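/- Trees are finite rooted ordered trees over ranked symbols (a node labelled with a symbol of rank $k$ has exactly $k$ children; there are countably infinitely many symbols of each rank), and $|T|$ is the number of nodes of $T$. An SLCF grammar is a straight-line linear context-free tree grammar; its size is the total number of nodes, not counting parameters, in the right-hand sides of its productions. A handle is a pattern $f(w_1(\gamma_1),\dots,w_{i-1}(\gamma_{i-1}),y,w_{i+1}(\gamma_{i+1}),\dots,w_\ell(\gamma_\ell))$, where $f$ is a letter of rank $\ell$, each $w_j$ is a (possibly empty) chain of unary letters and each $\gamma_j$ is a constant or a nonterminal of rank $0$. An SLCF grammar is a handle grammar if each nonterminal has rank $0$ or $1$, the rules for nonterminals of rank $1$ have the form $A\to u$, $A\to uBv$ or $A\to uBvCw$ with $B,C$ nonterminals of rank $1$, and the rules for nonterminals of rank $0$ have the form $A\to uc$, $A\to uC$, $A\to uBvc$ or $A\to uBvC$ with $B$ a nonterminal of rank $1$, $C$ a nonterminal of rank $0$ and $c$ a constant; here $u,v,w$ are (possibly empty) sequences of handles. The algorithm $\mathsf{TtoG}$ starts with the input tree $T$ and, as long as the current tree has more than one node, executes a phase that consists of three steps. (1) Chain compression: every maximal $a$-chain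 of length $\ell>1$, for every unary letter $a$, is replaced by a node with a fresh unary letter $a_\ell$. If $\ell_1<\dots<\ell_k$ are the lengths that occur for $a$ and $\ell_0=0$, these letters are represented by productions $a_{2^i}\to a_{2^{i-1}}a_{2^{i-1}}$ for $1\le i\le\lfloor\log_2\max_j(\ell_j-\ell_{j-1})\rfloor$, productions for letters representing $a^{\ell_j-\ell_{j-1}}$ given by the binary expansion of $\ell_j-\ell_{j-1}$, and productions $a_{\ell_j}\to a_{\ell_j-\ell_{j-1}}a_{\ell_{j-1}}$. (2) Unary pair compression: the set $F_1$ of unary letters of the current tree is partitioned into $F_1^{\mathrm{up}}$ and $F_1^{\mathrm{down}}$ by the greedy algorithm: it considers the letters in an arbitrary order and puts each letter $a$ into $F_1^{\mathrm{up}}$ if the number of occurrences of chain patterns $ab$ or $ba$ with $b$ already in $F_1^{\mathrm{down}}$ is at least the number of those with $b$ already in $F_1^{\mathrm{up}}$, and into $F_1^{\mathrm{down}}$ otherwise; at the end the two sets are exchanged if patterns in $F_1^{\mathrm{down}}F_1^{\mathrm{up}}$ occur more often than patterns in $F_1^{\mathrm{up}}F_1^{\mathrm{down}}$. Then every occurrence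 of $ab$ with $a\in F_1^{\mathrm{up}}$, $b\in F_1^{\mathrm{down}}$ is replaced by a fresh unary letter $c$ with the production $c\to ab$. (3) Leaf compression: every node that has leaf children absorbs all of them; its new label is a fresh letter $f'$ determined by the old label $f$ and by the positions and labels of the absorbed leaves, with the corresponding production. The productions of all letters introduced in this way form the grammar produced by $\mathsf{TtoG}$; its size is the total representation cost of the introduced letters. Let $T$ be a tree with $n=|T|\ge 2$, let $r$ be the maximal rank of a symbol in $T$, let $\mathbb G_{\mathrm{opt}}$ be a smallest SLCF grammar generating $T$, and let $g=|\mathbb G_{\mathrm{opt}}|$. For a constant $K$, a handle normal form of $\mathbb G_{\mathrm{opt}}$ (with constant $K$) is a handle grammar $\mathbb G$ that generates $T$ and has size at most $Kgr$, $n_1\le Kg$ occurrences of nonterminals of rank $1$ and $n_0\le Kgr$ occurrences of nonterminals of rank $0$ in its right-hand sides. (i) There is a universal constant $K$ such that for every such $T$ every smallest grammar $\mathbb G_{\mathrm{opt}}$ of $T$ has a handle normal form with constant $K$. (ii) $\mathsf{TtoG}$ returns a grammar on every such $T$. (iii) For every $K$ there is a constant $C>0$ such that for every such $T$, every smallest grammar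 $\mathbb G_{\mathrm{opt}}$ of $T$ and every handle normal form of $\mathbb G_{\mathrm{opt}}$ with constant $K$, every grammar that $\mathsf{TtoG}$ produces on input $T$ (for every choice of the fresh letters and of the order used by the greedy algorithm) has size at most $$C\,\bigl(gr+(n_0+n_1r)\log n\bigr),\qquad\text{and}\qquad gr+(n_0+n_1r)\log n\;\le\; C\,\bigl(gr+gr\log n\bigr).$$ -/

import Mathlib

namespace TreeGrammar

/-! ### Ranked symbols, trees and patterns -/

/-- Symbols: for every rank there are countably infinitely many of them. Letters and nonterminals
are both drawn from this supply; in a grammar, the nonterminals are the left-hand sides. -/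
structure Symb where
  rank : ℕ
  id : ℕ
deriving DecidableEq

/-- Ordered trees with node labels in `α` and parameters `y₁, y₂, …`
(`param i` stands for the parameter `y_{i+1}`). -/
inductive Pat (α : Type) : Type
  | param (i : ℕ) : Pat α
  | node (a : α) (ts : List (Pat α)) : Pat α

namespace Pat

variable {α β : Type}

mutual
/-- Bottom-up recursion on trees. -/
def fold (onParam : ℕ → β) (onNode : α → List β → β) : Pat α → β
  | param i => onParam i
  | node a ts => onNode a (foldList onParam onNode ts)
def foldList (onParam : ℕ → β) (onNode : α → List β → β) : List (Pat α) → List β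
  | [] => []
  | t :: ts => fold onParam onNode t :: foldList onParam onNode ts
end

theorem foldList_eq_map (p : ℕ → β) (h : α → List β → β) (ts : List (Pat α)) :
    foldList p h ts = ts.map (fold p h) := by
  induction ts with
  | nil => simp [foldList]
  | cons t ts ih => simp [foldList, ih]

theorem fold_param (p : ℕ → β) (h : α → List β → β) (i : ℕ) :
    fold p h (param i : Pat α) = p i := by
  simp [fold]

theorem fold_node (p : ℕ → β) (h : α → List β → β) (a : α) (ts : List (Pat α)) :
    fold p h (node a ts) = h a (ts.map (fold p h)) := by
  simp [fold, foldList_eq_map]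

/-- The number of nodes that are not parameters. -/
def size (t : Pat α) : ℕ := fold (fun _ => 0) (fun _ ns => ns.sum + 1) t

/-- The labels of all nodes that are not parameters, with multiplicity. -/
def labels (t : Pat α) : List α := fold (fun _ => []) (fun a ls => a :: ls.flatten) t

/-- The indices of all parameters, with multiplicity, from left to right. -/
def params (t : Pat α) : List ℕ := fold (fun i => [i]) (fun _ ls => ls.flatten) t

/-- Relabelling of the nodes. -/
def relabel (g : α → β) (t : Pat α) : Pat β := fold param (fun a ts => node (g a) ts) t

/-- Replace the `i`-th parameter by the `i`-th entry of `us`. -/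
def subst (us : List (Pat α)) (t : Pat α) : Pat α := fold (fun i => us.getD i (param i)) node t

mutual
/-- The list of all (full) subtrees, one for each node. -/
def subtrees : Pat α → List (Pat α)
  | param i => [param i]
  | node a ts => node a ts :: subtreesList ts
def subtreesList : List (Pat α) → List (Pat α)
  | [] => []
  | t :: ts => subtrees t ++ subtreesList ts
end

/-- Every node has as many children as the rank of its label says. -/
inductive WellRanked : Pat Symb → Prop
  | param (i : ℕ) : WellRanked (param i)
  | node (a : Symb) (ts : List (Pat Symb)) :
      ts.length = a.rank → (∀ t ∈ ts, WellRanked t) → WellRanked (node a ts)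

/-- A tree over a ranked alphabet: well-ranked and without parameters. -/
def IsTree (t : Pat Symb) : Prop := WellRanked t ∧ t.params = []

/-- The maximal rank of a symbol in the tree. -/
def maxRank (t : Pat Symb) : ℕ := (t.labels.map Symb.rank).foldr max 0

/-- The chain pattern `a₁(a₂(… a_k(y₁) …))`. -/
def chainPat (as : List Symb) : Pat Symb := as.foldr (fun a t => node a [t]) (param 0)

end Pat

open Pat

/-! ### Straight-line linear context-free tree grammars -/

/-- A grammar is given by its productions `A → t` and its start nonterminal. -/
structure Grammar where
  prods : List (Symb × Pat Symb)
  start : Symb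

namespace Grammar

/-- The nonterminals; all other symbols are terminals. -/
def nonterminals (G : Grammar) : List Symb := G.prods.map Prod.fst

/-- Straight-line linear context-free tree grammars. A linear order on the finite set of
nonterminals is given by an injective numbering. -/
structure IsSLCF (G : Grammar) : Prop where
  unique_prod : G.nonterminals.Nodup
  start_mem : G.start ∈ G.nonterminals
  start_rank : G.start.rank = 0
  wellRanked : ∀ p ∈ G.prods, WellRanked p.2
  linear : ∀ p ∈ G.prods, (params p.2).Perm (List.range p.1.rank)
  straight_line : ∃ ord : Symb → ℕ,
    Set.InjOn ord {A | A ∈ G.nonterminals} ∧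
    (∀ p ∈ G.prods, ∀ B ∈ G.nonterminals, B ∈ labels p.2 → ord B < ord p.1) ∧
    ∀ A ∈ G.nonterminals, A ≠ G.start → ord A < ord G.start

/-- One derivation step: some subtree `A(t₁, …, t_k)` is replaced by the right-hand side of `A`,
with `y_i` replaced by `t_i`. -/
inductive Step (G : Grammar) : Pat Symb → Pat Symb → Prop
  | root (A : Symb) (t : Pat Symb) (us : List (Pat Symb)) :
      (A, t) ∈ G.prods → us.length = A.rank → Step G (node A us) (t.subst us)
  | child (a : Symb) (pre post : List (Pat Symb)) (s s' : Pat Symb) :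
      Step G s s' → Step G (node a (pre ++ s :: post)) (node a (pre ++ s' :: post))

/-- The tree `T` contains terminals only and is derived from the start nonterminal. -/
def Generates (G : Grammar) (T : Pat Symb) : Prop :=
  T.IsTree ∧ (∀ a ∈ T.labels, a ∉ G.nonterminals) ∧
    Relation.ReflTransGen G.Step (node G.start []) T

/-- The total number of nodes in the right-hand sides, parameters not counted. -/
def size (G : Grammar) : ℕ := (G.prods.map (fun p => Pat.size p.2)).sum

/-- `G` is a smallest SLCF grammar for `T`. -/
def IsSmallest (G : Grammar) (T : Pat Symb) : Prop :=
  G.IsSLCF ∧ G.Generates T ∧ ∀ G' : Grammar, G'.IsSLCF → G'.Generates T → G.size ≤ G'.size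

/-- The number of occurrences of nonterminals of rank `i` in the right-hand sides. -/
def ntOcc (G : Grammar) (i : ℕ) : ℕ :=
  (G.prods.map (fun p =>
    (labels p.2).countP (fun B => decide (B ∈ G.nonterminals ∧ B.rank = i)))).sum

/-! ### Handle grammars -/

/-- A chain of unary letters that ends in a constant or a nonterminal of rank `0`. -/
inductive IsTwig (G : Grammar) : Pat Symb → Prop
  | last (c : Symb) : c.rank = 0 → IsTwig G (node c [])
  | cons (a : Symb) (t : Pat Symb) :
      a.rank = 1 → a ∉ G.nonterminals → IsTwig G t → IsTwig G (node a [t])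

/-- `HandlesThen G P t`: `t` is `h₁(h₂(… h_k(s) …))` for handles `h₁, …, h_k` (`k ≥ 0`) and
some `s` with `P s`. A handle is `f(t₁, …, t_{i-1}, y, t_{i+1}, …, t_ℓ)` for a letter `f` of
rank `ℓ` where every `t_j` is a chain of unary letters followed by a constant or a nonterminal
of rank `0`. -/
inductive HandlesThen (G : Grammar) (P : Pat Symb → Prop) : Pat Symb → Prop
  | nil (s : Pat Symb) : P s → HandlesThen G P s
  | cons (f : Symb) (pre post : List (Pat Symb)) (s : Pat Symb) :
      f ∉ G.nonterminals → f.rank = pre.length + 1 + post.length →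
      (∀ t ∈ pre, IsTwig G t) → (∀ t ∈ post, IsTwig G t) →
      HandlesThen G P s → HandlesThen G P (node f (pre ++ s :: post))

/-- `s = B(s')` for a nonterminal `B` of rank `1` and some `s'` with `P s'`. -/
def NtThen (G : Grammar) (P : Pat Symb → Prop) (s : Pat Symb) : Prop :=
  ∃ B ∈ G.nonterminals, B.rank = 1 ∧ ∃ s', s = node B [s'] ∧ P s'

/-- Right-hand sides `u`, `u B v` and `u B v C w` for nonterminals of rank `1`. -/
def IsHandleRhs1 (G : Grammar) : Pat Symb → Prop :=
  HandlesThen G fun s => s = param 0 ∨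
    NtThen G (HandlesThen G fun s' => s' = param 0 ∨
      NtThen G (HandlesThen G fun s'' => s'' = param 0) s') s

/-- Right-hand sides `u c`, `u C`, `u B v c` and `u B v C` for nonterminals of rank `0`, with `c` a
constant, `C` a nonterminal of rank `0` and `B` a nonterminal of rank `1`. -/
def IsHandleRhs0 (G : Grammar) : Pat Symb → Prop :=
  HandlesThen G fun s => (∃ c : Symb, c.rank = 0 ∧ s = node c []) ∨
    NtThen G (HandlesThen G fun s' => ∃ c : Symb, c.rank = 0 ∧ s' = node c []) s

/-- Handle grammars. -/
def IsHandle (G : Grammar) : Prop :=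
  ∀ p ∈ G.prods,
    (p.1.rank = 0 ∧ IsHandleRhs0 G p.2) ∨ (p.1.rank = 1 ∧ IsHandleRhs1 G p.2)

/-- `H` is a handle normal form, with constant `K`, of the grammar `G` for the tree `T`: an
equivalent handle grammar of size at most `K r g` with at most `K g` occurrences of nonterminals
of rank `1` and at most `K r g` occurrences of nonterminals of rank `0`. -/
structure IsHandleNormalForm (K : ℕ) (T : Pat Symb) (G H : Grammar) : Prop where
  slcf : H.IsSLCF
  handle : H.IsHandle
  generates : H.Generates T
  size_le : H.size ≤ K * (G.size * T.maxRank)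
  occ_one_le : H.ntOcc 1 ≤ K * G.size
  occ_zero_le : H.ntOcc 0 ≤ K * (G.size * T.maxRank)

end Grammar

/-! ### The algorithm TtoG -/

namespace TtoG

/-- What a letter introduced in a compression step stands for: `chain a ℓ` for a maximal chain
`a^ℓ`; the auxiliary `pow a i` for `a^(2^i)` and `diff a d` for `a^d`; `pair a b` for `ab`;
`leaf f pat` for `f` with its constant children absorbed, where the `i`-th entry of `pat` is
`some c` if the `i`-th child is the constant `c` and `none` if it is not a constant. -/
inductive Key
  | chain (a : Symb) (l : ℕ)
  | pow (a : Symb) (i : ℕ)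
  | diff (a : Symb) (d : ℕ)
  | pair (a b : Symb)
  | leaf (f : Symb) (pat : List (Option Symb))

/-- The rank of the letter to be introduced. -/
def Key.rank : Key → ℕ
  | .leaf _ pat => pat.countP Option.isNone
  | _ => 1

/-- The current tree and the productions of the letters introduced so far. -/
structure State where
  tree : Pat Symb
  prods : List (Symb × Pat Symb)

/-- All symbols used so far. -/
def State.used (s : State) : List Symb :=
  s.tree.labels ++ s.prods.flatMap (fun p => p.1 :: p.2.labels)

/-- A choice of pairwise different fresh letters. -/
structure Fresh (s : State) (ν : Key → Symb) : Prop where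
  injective : Function.Injective ν
  rank_eq : ∀ k, (ν k).rank = k.rank
  not_used : ∀ k, ν k ∉ s.used

/-! #### Chain compression -/

/-- Contract every maximal `a`-chain of length `ℓ` to one node labelled `(a, ℓ)`;
all nodes with a label `f` that is not unary become `(f, 1)`. -/
def group (t : Pat Symb) : Pat (Symb × ℕ) :=
  fold param (fun a ts =>
    match ts with
    | [node (b, l) us] => if a = b then node (a, l + 1) us else node (a, 1) [node (b, l) us]
    | ts => node (a, 1) ts) t

/-- Replace every maximal `a`-chain of length `ℓ > 1` by the letter for `a^ℓ`. -/
def chainComp (ν : Key → Symb) (t : Pat Symb) : Pat Symb :=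
  (group t).relabel (fun p => if p.2 ≤ 1 then p.1 else ν (.chain p.1 p.2))

/-- The lengths `ℓ₁ < ℓ₂ < … < ℓ_k` greater than `1` of the maximal `a`-chains. -/
def chainLengths (t : Pat Symb) (a : Symb) : List ℕ :=
  ((((group t).labels.filter (fun p => p.1 = a ∧ 1 < p.2)).map Prod.snd).dedup).insertionSort
    (· ≤ ·)

/-- The letter for `a^(2^i)`; it is `a` for `i = 0`. -/
def powSym (ν : Key → Symb) (a : Symb) (i : ℕ) : Symb := if i = 0 then a else ν (.pow a i)

/-- The productions that represent the letters for `a^ℓ`, where `ℓ` runs through the increasing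
list `ls` (and `ℓ₀ = 0`): `a_{2^i} → a_{2^(i-1)} a_{2^(i-1)}` for
`1 ≤ i ≤ ⌊log₂ max_j (ℓ_j - ℓ_{j-1})⌋`, then the letters for `a^(ℓ_j - ℓ_{j-1})` by binary
expansion, and then `a_{ℓ_j} → a_{ℓ_j - ℓ_{j-1}} a_{ℓ_{j-1}}`. -/
def chainRulesFor (ν : Key → Symb) (a : Symb) (ls : List ℕ) : List (Symb × Pat Symb) :=
  let ds := List.zipWith (fun l l' => l - l') ls (0 :: ls)
  (List.range (Nat.log 2 (ds.foldr max 0))).map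
      (fun i => (ν (.pow a (i + 1)), chainPat [powSym ν a i, powSym ν a i])) ++
    ds.dedup.map (fun d => (ν (.diff a d), chainPat (d.bitIndices.map (powSym ν a)))) ++
    List.zipWith (fun l l' => (ν (.chain a l),
      chainPat (ν (.diff a (l - l')) :: if l' = 0 then [] else [ν (.chain a l')]))) ls (0 :: ls)

/-- The unary letters of a tree. -/
def unaryLetters (t : Pat Symb) : List Symb := (t.labels.filter (fun a => a.rank = 1)).dedup

def chainStep (ν : Key → Symb) (s : State) : State where
  tree := chainComp ν s.tree
  prods := s.prods ++
    (unaryLetters s.tree).flatMap (fun a => chainRulesFor ν a (chainLengths s.tree a))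

/-! #### Unary pair compression -/

/-- All occurrences of chain patterns `ab` for unary `a`, `b`, as a list of label pairs. -/
def unaryPairs (t : Pat Symb) : List (Symb × Symb) :=
  t.subtrees.filterMap (fun s =>
    match s with
    | node a [node b [_]] => some (a, b)
    | _ => none)

/-- The number of occurrences in `ps` of pairs from `X × Y`. -/
def countPairs (ps : List (Symb × Symb)) (X Y : Finset Symb) : ℕ :=
  ps.countP (fun p => decide (p.1 ∈ X ∧ p.2 ∈ Y))

/-- The greedy choice for the letter `a`, given the current sets `(up, down)`. -/
def greedyStep (ps : List (Symb × Symb)) (st : Finset Symb × Finset Symb) (a : Symb) :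
    Finset Symb × Finset Symb :=
  let count (X : Finset Symb) := countPairs ps {a} X + countPairs ps X {a}
  if count st.1 ≤ count st.2 then (insert a st.1, st.2) else (st.1, insert a st.2)

/-- The greedy partition `(up, down)`, when the unary letters are considered in the order
given by `order`. -/
def greedyPartition (ps : List (Symb × Symb)) (order : List Symb) : Finset Symb × Finset Symb :=
  let st := order.foldl (greedyStep ps) (∅, ∅)
  if countPairs ps st.1 st.2 < countPairs ps st.2 st.1 then (st.2, st.1) else st

/-- Replace every occurrence of `ab` with `a ∈ up`, `b ∈ down` by the letter for `ab`. -/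
def unaryComp (ν : Key → Symb) (up down : Finset Symb) (t : Pat Symb) : Pat Symb :=
  fold param (fun a ts =>
    match ts with
    | [node b [u]] => if a ∈ up ∧ b ∈ down then node (ν (.pair a b)) [u] else node a [node b [u]]
    | ts => node a ts) t

def unaryStep (ν : Key → Symb) (up down : Finset Symb) (s : State) : State where
  tree := unaryComp ν up down s.tree
  prods := s.prods ++
    (((unaryPairs s.tree).filter (fun p => p.1 ∈ up ∧ p.2 ∈ down)).dedup).map
      (fun p => (ν (.pair p.1 p.2), chainPat [p.1, p.2]))

/-! #### Leaf compression -/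

/-- The label of a tree that consists of a constant only. -/
def constLabel : Pat Symb → Option Symb
  | node c [] => some c
  | _ => none

mutual
/-- Every node with at least one leaf child absorbs all its leaf children (those of the given
tree; leaves that arise during the process are not absorbed). -/
def leafComp (ν : Key → Symb) : Pat Symb → Pat Symb
  | param i => param i
  | node f ts =>
      node (if (ts.map constLabel).any Option.isSome then ν (.leaf f (ts.map constLabel)) else f)
        (leafCompList ν ts)
/-- Drop the leaves from a list of children and compress the others. -/
def leafCompList (ν : Key → Symb) : List (Pat Symb) → List (Pat Symb)
  | [] => []
  | t :: ts =>
      if (constLabel t).isSome then leafCompList ν ts else leafComp ν t :: leafCompList ν ts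
end

/-- The pairs of a parent label and the pattern of its leaf children, one for each node that has
leaf children. -/
def leafRecords (t : Pat Symb) : List (Symb × List (Option Symb)) :=
  t.subtrees.filterMap (fun s =>
    match s with
    | node f ts =>
        if (ts.map constLabel).any Option.isSome then some (f, ts.map constLabel) else none
    | param _ => none)

/-- The children on the right-hand side for a leaf pattern: the given constants and, from left to
right, the parameters number `i`, `i + 1`, …. -/
def fillPat : ℕ → List (Option Symb) → List (Pat Symb)
  | _, [] => []
  | i, none :: pat => param i :: fillPat (i + 1) pat
  | i, some c :: pat => node c [] :: fillPat i pat

def leafStep (ν : Key → Symb) (s : State) : State where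
  tree := leafComp ν s.tree
  prods := s.prods ++
    (leafRecords s.tree).dedup.map (fun p => (ν (.leaf p.1 p.2), node p.1 (fillPat 0 p.2)))

/-! #### Main loop -/

/-- One phase: chain compression, unary pair compression for a greedy partition, leaf compression.
The choice of the fresh letters and the order in which the greedy algorithm considers the unary
letters are arbitrary. -/
inductive Phase : State → State → Prop
  | mk (s s₁ s₂ s₃ : State) (ν₁ ν₂ ν₃ : Key → Symb) (order : List Symb)
      (up down : Finset Symb) :
      Fresh s ν₁ → s₁ = chainStep ν₁ s →
      order.Perm (unaryLetters s₁.tree) →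
      (up, down) = greedyPartition (unaryPairs s₁.tree) order →
      Fresh s₁ ν₂ → s₂ = unaryStep ν₂ up down s₁ →
      Fresh s₂ ν₃ → s₃ = leafStep ν₃ s₂ →
      Phase s s₃

/-- Phases are executed as long as the current tree has more than one node. -/
inductive Loop : State → State → Prop
  | done (s : State) : s.tree.size ≤ 1 → Loop s s
  | step (s s' s'' : State) : 1 < s.tree.size → Phase s s' → Loop s' s'' → Loop s s''

/-- `G` is a grammar that TtoG may return on input `T`: it consists of the productions of all
letters that were introduced, and its start nonterminal is the label of the one-node tree
that is left at the end. -/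
def Produces (T : Pat Symb) (G : Grammar) : Prop :=
  ∃ s : State, Loop ⟨T, []⟩ s ∧ s.tree = node G.start [] ∧ G.prods = s.prods

end TtoG

end TreeGrammar

open TreeGrammar

namespace TreeGrammar

open Pat List

/-! ### Basic facts on trees -/

namespace Pat

variable {α β γ : Type}

-- The size bound comes from simulating `TtoG` on a compressed representation of the tree. Start
-- from a handle grammar `H` and keep, phase after phase, a grammar whose value is the current tree
-- (`Rel`, `Gram.Inv`). A compression step can be performed on right-hand sides alone once nothing
-- that has to be compressed crosses the border of a nonterminal.
--
-- Chain and pair compression are both contractions of maximal runs of unary letters for a link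
-- relation (`chainComp_eq`, `unaryComp_eq`). Runs are kept from crossing borders by popping, from
-- every nonterminal except the start, the maximal run at the top and, for rank 1, the one at the
-- bottom; these are written next to each occurrence (`Gram.runStep_holds`). For leaf compression
-- the last frame of a nonterminal of rank 1 is popped, so that a constant ending a right-hand side
-- has an explicit parent. Children of the popped frame that are not constants are named by
-- nonterminals of rank 0, at most `r` for each nonterminal of rank 1. These names are reused: the
-- next frame is popped only when all of them stand for constants. Until then one of them still
-- occurs below the nonterminal, hence no leaf can be absorbed into it (`Gram.Inv.expanded_last`).
--
-- The costs are amortized. Let the weight of a letter be the number of original nodes it stands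
-- for, and let `F` be the bit length of `n`. The potential is twice the number of explicit letters
-- plus, for each occurrence of a nonterminal of rank 1, `2F` minus the bit length of the weight on
-- the path down to the next nonterminal or to the closing constant (just `F` if a rule of rank 1
-- has no further nonterminal). New letters are paid for by the explicit letters that vanish, by
-- `O(1)` for each popped piece, and by this potential. For a chain of length `ℓ` there are four
-- cases. Without popped pieces, its explicit letters pay. With one piece, that piece is itself a
-- run of a smaller nonterminal, and only the explicit rest has to be represented on top of it. If a
-- whole nonterminal vanished into the run, its share of at least `F` is released. If pieces from
-- two nonterminals meet, the gap between these grows from the explicit weight to at least the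
-- weight of the whole run, and the resulting drop of the potential covers the logarithm
-- (`payOk_chain`, `Acct.push_lf_two`). The algorithm represents differences of consecutive lengths
-- instead of following these predecessors, but this is not more expensive, since bit length is
-- subadditive (`sum_gaps_le`). Pair letters cost `O(1)` each, and leaf letters are paid for by the
-- absorbed constants.
--
-- Altogether, productions plus five times the potential grow by `O(n₀ + n₁ r)` in a phase
-- (`Rel.phase`). The greedy partition captures a quarter of the unary pairs and every leaf is
-- absorbed, so a phase shrinks the tree by the factor `3/4` (`Phase.isTree_and_size`). This gives
-- termination and `O(log n)` phases, and with the initial potential `O(gr + n₁ log n)` the bound in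
-- (iii).
--
-- For (i), the value of every reachable nonterminal is cut into pieces with at most one parameter,
-- separated by nodes that have at least two children with parameters (`Good`). Substituting
-- arguments only creates pieces near the places where something closes, and an amortized count
-- gives at most four new pieces for each node of the given grammar (`exists_good_expand`). Each
-- piece becomes a nonterminal whose right-hand side is a handle followed by at most one nonterminal
-- or constant, or a concatenation of two smaller pieces.

lemma induct {P : Pat α → Prop} (hp : ∀ i, P (param i))
    (hn : ∀ a ts, (∀ t ∈ ts, P t) → P (node a ts)) (t : Pat α) : P t :=
  Pat.rec (motive_1 := P) (motive_2 := fun ts => ∀ t ∈ ts, P t) hp (fun a ts h => hn a ts h)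
    (by simp) (fun t ts h1 h2 => by simpa using ⟨h1, h2⟩) t

@[simp] lemma size_param (i : ℕ) : (param i : Pat α).size = 0 := by simp [size, fold]
@[simp] lemma size_node (a : α) (ts : List (Pat α)) : (node a ts).size = (ts.map size).sum + 1 := by
  simp only [size, fold_node]; rfl
@[simp] lemma labels_param (i : ℕ) : (param i : Pat α).labels = [] := by simp [labels, fold]
@[simp] lemma labels_node (a : α) (ts : List (Pat α)) :
    (node a ts).labels = a :: ts.flatMap labels := by
  simp only [labels, fold_node, flatMap_def]; rfl
@[simp] lemma params_param (i : ℕ) : (param i : Pat α).params = [i] := by simp [params, fold]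
@[simp] lemma params_node (a : α) (ts : List (Pat α)) : (node a ts).params = ts.flatMap params := by
  simp only [params, fold_node, flatMap_def]; rfl
@[simp] lemma relabel_param (g : α → β) (i : ℕ) : (param i : Pat α).relabel g = param i := by
  simp [relabel, fold]
@[simp] lemma relabel_node (g : α → β) (a : α) (ts : List (Pat α)) :
    (node a ts).relabel g = node (g a) (ts.map (relabel g)) := by
  simp only [relabel, fold_node]; rfl
@[simp] lemma subst_param (us : List (Pat α)) (i : ℕ) :
    (param i : Pat α).subst us = us.getD i (param i) := by simp [subst, fold]
@[simp] lemma subst_node (us : List (Pat α)) (a : α) (ts : List (Pat α)) :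
    (node a ts).subst us = node a (ts.map (subst us)) := by
  simp only [subst, fold_node]; rfl

lemma subtreesList_eq (ts : List (Pat α)) : subtreesList ts = ts.flatMap subtrees := by
  induction ts with
  | nil => simp [subtreesList]
  | cons t ts ih => simp [subtreesList, ih]

@[simp] lemma subtrees_param (i : ℕ) : (param i : Pat α).subtrees = [param i] := by simp [subtrees]
@[simp] lemma subtrees_node (a : α) (ts : List (Pat α)) :
    (node a ts).subtrees = node a ts :: ts.flatMap subtrees := by
  simp [subtrees, subtreesList_eq]

lemma wellRanked_node {a : Symb} {ts : List (Pat Symb)} :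
    WellRanked (node a ts) ↔ ts.length = a.rank ∧ ∀ t ∈ ts, WellRanked t :=
  ⟨fun h => by cases h with | node _ _ h1 h2 => exact ⟨h1, h2⟩, fun h => .node _ _ h.1 h.2⟩

lemma size_eq_length_labels (t : Pat α) : t.size = t.labels.length := by
  induction t using induct with
  | hp i => simp
  | hn a ts ih =>
    simp only [size_node, labels_node, length_cons, length_flatMap]; congr 2
    exact map_congr_left ih

lemma labels_relabel (g : α → β) (t : Pat α) : (t.relabel g).labels = t.labels.map g := by
  induction t using induct with
  | hp i => simp
  | hn a ts ih =>
    simp only [relabel_node, labels_node, map_cons, flatMap_map, map_flatMap]; congr 1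
    exact flatMap_congr ih

lemma params_subst (us : List (Pat α)) (t : Pat α) :
    (t.subst us).params = t.params.flatMap fun i => (us.getD i (param i)).params := by
  induction t using induct with
  | hp i => simp
  | hn a ts ih =>
    simp only [subst_node, params_node, flatMap_map, flatMap_assoc]; exact flatMap_congr ih

/-- The bound on the parameters matters: a parameter beyond the end of `as` stays in place, where
the second substitution would act on it. -/
lemma subst_subst (as bs : List (Pat α)) (t : Pat α) (h : ∀ i ∈ t.params, i < as.length) :
    (t.subst as).subst bs = t.subst (as.map (subst bs)) := by
  induction t using induct with
  | hp i =>
    have : i < as.length := by simpa using h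
    simp [getD, this]
  | hn a ts ih =>
    simp only [params_node, mem_flatMap] at h; simp only [subst_node, map_map, node.injEq, true_and]
    exact map_congr_left fun t ht => ih t ht fun i hi => h i ⟨t, ht, hi⟩

lemma subst_eq_self {us : List (Pat α)} (t : Pat α)
    (h : ∀ i ∈ t.params, us.getD i (param i) = param i) : t.subst us = t := by
  induction t using induct with
  | hp i => simpa using h
  | hn a ts ih =>
    simp only [params_node, mem_flatMap] at h
    rw [subst_node, map_congr_left fun t ht => ih t ht fun i hi => h i ⟨t, ht, hi⟩, map_id']

lemma subst_of_params_nil (us : List (Pat α)) (t : Pat α) (h : t.params = []) :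
    t.subst us = t := subst_eq_self t (by simp [h])

lemma wellRanked_subst {us : List (Pat Symb)} {t : Pat Symb} (ht : WellRanked t)
    (hu : ∀ u ∈ us, WellRanked u) : WellRanked (t.subst us) := by
  induction t using induct with
  | hp i =>
    simp only [subst_param, getD]; rcases h : us[i]? with _ | u
    · exact .param i
    · exact hu u (mem_of_getElem? h)
  | hn a ts ih =>
    rw [wellRanked_node] at ht; rw [subst_node, wellRanked_node]; refine ⟨by simpa using ht.1, ?_⟩
    simp only [mem_map]
    rintro _ ⟨t, h, rfl⟩
    exact ih t h (ht.2 t h)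

lemma flatMap_range_getD (us : List (Pat α)) (f : Pat α → List β) :
    ((range us.length).flatMap fun i => f (us.getD i (param i))) = us.flatMap f := by
  rw [flatMap_def, flatMap_def]; congr 1
  apply ext_getElem <;> simp
  intro i h; simp [h]

/-! ### Values of patterns -/

/-- Replace all labels that have a value by their value. -/
def expand (v : Symb → Option (Pat Symb)) (t : Pat Symb) : Pat Symb :=
  fold param (fun a ts => match v a with | some p => p.subst ts | none => node a ts) t

variable {v w : Symb → Option (Pat Symb)}

@[simp] lemma expand_param (i : ℕ) : expand v (param i) = param i := by simp [expand, fold]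

lemma expand_node (a : Symb) (ts : List (Pat Symb)) : expand v (node a ts) = match v a with
      | some p => p.subst (ts.map (expand v))
      | none => node a (ts.map (expand v)) := by
  simp only [expand, fold_node]; rfl

lemma expand_node_some {a : Symb} {p : Pat Symb} (h : v a = some p) (ts : List (Pat Symb)) :
    expand v (node a ts) = p.subst (ts.map (expand v)) := by rw [expand_node, h]

lemma expand_node_none {a : Symb} (h : v a = none) (ts : List (Pat Symb)) :
    expand v (node a ts) = node a (ts.map (expand v)) := by rw [expand_node, h]

lemma expand_congr (t : Pat Symb) (h : ∀ a ∈ t.labels, v a = w a) : expand v t = expand w t := by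
  induction t using induct with
  | hp i => simp
  | hn a ts ih =>
    simp only [labels_node, mem_cons, mem_flatMap] at h
    have : ts.map (expand v) = ts.map (expand w) :=
      map_congr_left fun t ht => ih t ht fun b hb => h b (.inr ⟨t, ht, hb⟩)
    rw [expand_node, expand_node, this, h a (.inl rfl)]

lemma expand_of_none (t : Pat Symb) (h : ∀ a ∈ t.labels, v a = none) : expand v t = t := by
  induction t using induct with
  | hp i => simp
  | hn a ts ih =>
    simp only [labels_node, mem_cons, mem_flatMap] at h
    rw [expand_node_none (h a (.inl rfl)),
      map_congr_left fun t ht => ih t ht fun b hb => h b (.inr ⟨t, ht, hb⟩), map_id']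

/-- Both operations replace nodes independently. Well-rankedness ensures that the value of a label
mentions only parameters for which the node has a child, so that `subst_subst` applies. -/
lemma expand_subst (hv : ∀ a p, v a = some p → ∀ i ∈ p.params, i < a.rank) (us : List (Pat Symb))
    (t : Pat Symb) (ht : WellRanked t) :
    expand v (t.subst us) = (expand v t).subst (us.map (expand v)) := by
  induction t using induct with
  | hp i =>
    simp only [subst_param, expand_param, getD, getElem?_map]
    cases us[i]? <;> simp
  | hn a ts ih =>
    rw [wellRanked_node] at ht
    have e : (ts.map (subst us)).map (expand v) =
        (ts.map (expand v)).map (subst (us.map (expand v))) := by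
      simpa using fun t h => ih t h (ht.2 t h)
    rw [subst_node]; rcases h : v a with _ | p
    · rw [expand_node_none h, expand_node_none h, e, subst_node]
    · rw [expand_node_some h, expand_node_some h, e, subst_subst]; intro i hi
      simpa [ht.1] using hv a p h i hi

/-- Only a permutation results, because a linear value may use its parameters in any order. -/
lemma params_expand (hv : ∀ a p, v a = some p → p.params.Perm (range a.rank))
    (t : Pat Symb) (ht : WellRanked t) : (expand v t).params.Perm t.params := by
  induction t using induct with
  | hp i => simp
  | hn a ts ih =>
    rw [wellRanked_node] at ht
    have e : ((ts.map (expand v)).flatMap params).Perm (ts.flatMap params) := by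
      rw [flatMap_map]; exact Perm.flatMap_left _ fun t h => ih t h (ht.2 t h)
    rcases h : v a with _ | p
    · rw [expand_node_none h, params_node, params_node]; exact e
    · rw [expand_node_some h, params_subst, params_node]
      refine ((hv a p h).flatMap_right _).trans ?_
      have hl : a.rank = (ts.map (expand v)).length := by simp [ht.1]
      rw [hl, flatMap_range_getD]; exact e

lemma wellRanked_expand (hv : ∀ a p, v a = some p → WellRanked p)
    (t : Pat Symb) (ht : WellRanked t) : WellRanked (expand v t) := by
  induction t using induct with
  | hp i => simpa using ht
  | hn a ts ih =>
    rw [wellRanked_node] at ht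
    have e : ∀ t ∈ ts.map (expand v), WellRanked t := by
      simp only [mem_map]
      rintro _ ⟨t, h, rfl⟩
      exact ih t h (ht.2 t h)
    rcases h : v a with _ | p
    · rw [expand_node_none h]; exact .node _ _ (by simpa using ht.1) e
    · rw [expand_node_some h]; exact wellRanked_subst (hv a p h) e

lemma labels_sublist_subst (us : List (Pat Symb)) (t : Pat Symb) :
    t.labels.Sublist (t.subst us).labels := by
  induction t using induct with
  | hp i => simp
  | hn b ts ih =>
    rw [subst_node, labels_node, labels_node, flatMap_map]
    exact (Sublist.flatMap_right _ ih).cons_cons _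

lemma labels_arg_sublist_subst {us : List (Pat Symb)} {t : Pat Symb} {i : ℕ}
    (hi : i ∈ t.params) : (us.getD i (param i)).labels.Sublist (t.subst us).labels := by
  induction t using induct with
  | hp j =>
    obtain rfl : i = j := by simpa using hi
    simp
  | hn b ts ih =>
    obtain ⟨t, ht, hi⟩ := mem_flatMap.1 (params_node b ts ▸ hi)
    rw [subst_node, labels_node, flatMap_map]
    exact (ih t ht hi).trans ((sublist_flatten_of_mem
      (mem_map_of_mem (f := fun t => (t.subst us).labels) ht)).cons _)

/-- The letters of the value of a symbol. -/
def symLabels (v : Symb → Option (Pat Symb)) (b : Symb) : List Symb := (v b).elim [b] labels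

/-- Linearity is the point: a value uses each of its parameters, so no argument is erased, and
whatever a label produces survives in the expansion. -/
lemma symLabels_sublist_expand (hv : ∀ a p, v a = some p → p.params.Perm (range a.rank))
    (t : Pat Symb) (ht : WellRanked t) {b : Symb} (hb : b ∈ t.labels) :
    (symLabels v b).Sublist (expand v t).labels := by
  induction t using induct with
  | hp i => simp at hb
  | hn a ts ih =>
    rw [wellRanked_node] at ht; simp only [labels_node, mem_cons, mem_flatMap] at hb
    rcases h : v a with _ | p
    · rw [expand_node_none h, labels_node, flatMap_map]; rcases hb with rfl | ⟨t, htt, hb⟩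
      · simp [symLabels, h]
      · exact (ih t htt (ht.2 t htt) hb).trans ((sublist_flatten_of_mem
          (mem_map_of_mem (f := fun t => (expand v t).labels) htt)).cons _)
    · rw [expand_node_some h]; rcases hb with rfl | ⟨t, htt, hb⟩
      · simpa [symLabels, h] using labels_sublist_subst _ p
      · obtain ⟨i, hi, rfl⟩ := getElem_of_mem htt
        refine .trans ?_ (labels_arg_sublist_subst (i := i) ?_)
        · simpa [getD, hi] using ih _ htt (ht.2 _ htt) hb
        · rw [(hv a p h).mem_iff]; simpa [← ht.1] using hi

end Pat

/-! ### Values of nonterminals -/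

namespace Grammar

/-- `v` assigns to every nonterminal its value. -/
structure IsVal (G : Grammar) (v : Symb → Option (Pat Symb)) : Prop where
  none_iff : ∀ a, v a = none ↔ a ∉ G.nonterminals
  eq : ∀ p ∈ G.prods, v p.1 = some (expand v p.2)
  perm : ∀ a p, v a = some p → p.params.Perm (range a.rank)
  wellRanked : ∀ a p, v a = some p → WellRanked p

variable {G : Grammar} {v : Symb → Option (Pat Symb)} {T : Pat Symb}

lemma mem_nonterminals {p : Symb × Pat Symb} (h : p ∈ G.prods) :
    p.1 ∈ G.nonterminals := mem_map_of_mem h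

lemma IsSLCF.unique (h : G.IsSLCF) {p q : Symb × Pat Symb} (hp : p ∈ G.prods)
    (hq : q ∈ G.prods) (e : p.1 = q.1) : p = q :=
  inj_on_of_nodup_map h.unique_prod hp hq e

/-- Values are defined by well-founded recursion along the order of the grammar. -/
lemma IsSLCF.exists_val (h : G.IsSLCF) : ∃ v, G.IsVal v := by
  classical
  obtain ⟨ord, -, hord, -⟩ := h.straight_line
  have hr : ∀ A, ∃ t, ∀ p ∈ G.prods, p.1 = A → p.2 = t := fun A => by
    by_cases hA : ∃ p ∈ G.prods, p.1 = A
    · obtain ⟨p, hp, rfl⟩ := hA; exact ⟨p.2, fun q hq e => by rw [h.unique hq hp e]⟩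
    · exact ⟨param 0, fun p hp e => absurd ⟨p, hp, e⟩ hA⟩
  choose rhs hrhs using hr
  let v : Symb → Option (Pat Symb) := (measure ord).wf.fix fun A w => if A ∈ G.nonterminals then
      some (expand (fun B => if hB : ord B < ord A then w B hB else none) (rhs A)) else none
  have hv : ∀ A, v A = if A ∈ G.nonterminals then
      some (expand (fun B => if _ : ord B < ord A then v B else none) (rhs A)) else none :=
    WellFounded.fix_eq _ _
  have hnone : ∀ A, A ∉ G.nonterminals → v A = none := fun A hA => by rw [hv, if_neg hA]
  -- The recursion sees only values of smaller nonterminals. By straight-linearity no other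
  -- nonterminal occurs in a right-hand side, so the cut-off has no effect.
  have hcut : ∀ p ∈ G.prods,
      expand (fun B => if _ : ord B < ord p.1 then v B else none) p.2 = expand v p.2 := fun p hp =>
    expand_congr _ fun B hB => by
      by_cases hBn : B ∈ G.nonterminals
      · exact dif_pos (hord p hp B hBn hB)
      · simp [hnone _ hBn]
  have heq : ∀ p ∈ G.prods, v p.1 = some (expand v p.2) := fun p hp => by
    rw [hv, if_pos (mem_nonterminals hp), ← hrhs _ p hp rfl, hcut p hp]
  have key : ∀ k a p, ord a < k → v a = some p → p.params.Perm (range a.rank) ∧ WellRanked p := by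
    intro k
    induction k with
    | zero => intro a p h; omega
    | succ k ih =>
      intro a p hk hp
      by_cases ha : a ∈ G.nonterminals
      · obtain ⟨q, hq, rfl⟩ := mem_map.1 ha; rw [heq q hq, ← hcut q hq] at hp
        obtain rfl := Option.some.inj hp
        have hb : ∀ b p, (if _ : ord b < ord q.1 then v b else none) = some p →
            p.params.Perm (range b.rank) ∧ WellRanked p := fun b p hb => by
          split_ifs at hb with h1; exact ih b p (by omega) hb
        exact ⟨(params_expand (fun b p h => (hb b p h).1) _ (h.wellRanked q hq)).trans (h.linear q hq),
          wellRanked_expand (fun b p h => (hb b p h).2) _ (h.wellRanked q hq)⟩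
      · simp [hnone a ha] at hp
  exact ⟨v, fun a => ⟨fun hn ha => by simp [hv a, ha] at hn, hnone a⟩, heq,
    fun a p hp => (key _ a p (Nat.lt_succ_self _) hp).1,
    fun a p hp => (key _ a p (Nat.lt_succ_self _) hp).2⟩

lemma IsVal.lt (hv : G.IsVal v) :
    ∀ a p, v a = some p → ∀ i ∈ p.params, i < a.rank := fun a p h i hi => by
  simpa using (hv.perm a p h).mem_iff.1 hi

-- Derivations compute values

lemma Step.expand_eq (h : G.IsSLCF)
    (hv : G.IsVal v) {t t' : Pat Symb} (hs : G.Step t t') (ht : WellRanked t) :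
    WellRanked t' ∧ expand v t' = expand v t := by
  induction hs with
  | root A t us hA hl =>
    rw [wellRanked_node] at ht; have hw := h.wellRanked _ hA
    exact ⟨wellRanked_subst hw ht.2,
      by rw [expand_subst hv.lt us t hw, expand_node_some (hv.eq _ hA)]⟩
  | child a pre post s s' _ ih =>
    rw [wellRanked_node] at ht; obtain ⟨h1, h2⟩ := ih (ht.2 s (by simp))
    refine ⟨.node _ _ (by simpa using ht.1) ?_, by rw [expand_node, expand_node]; simp [h2]⟩
    intro t hh; simp only [mem_append, mem_cons] at hh; rcases hh with hh | rfl | hh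
    · exact ht.2 t (by simp [hh])
    · exact h1
    · exact ht.2 t (by simp [hh])

lemma Generates.val_start (h : G.IsSLCF)
    (hv : G.IsVal v) (hT : G.Generates T) : v G.start = some T := by
  have key : ∀ t, Relation.ReflTransGen G.Step (node G.start []) t →
      WellRanked t ∧ expand v t = expand v (node G.start []) := by
    intro t ht
    induction ht with
    | refl => exact ⟨.node _ _ (by simp [h.start_rank]) (by simp), rfl⟩
    | tail _ hs ih => obtain ⟨h1, h2⟩ := hs.expand_eq h hv ih.1; exact ⟨h1, h2.trans ih.2⟩
  have e := (key T hT.2.2).2; rw [expand_of_none T fun a ha => (hv.none_iff a).2 (hT.2.1 a ha)] at e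
  rcases hs : v G.start with _ | p
  · exact absurd h.start_mem ((hv.none_iff _).1 hs)
  · rw [expand_node_some hs] at e
    have hp : p.params = [] := by
      have := hv.perm _ _ hs; rw [h.start_rank] at this; simpa using this
    rw [e, map_nil, subst_of_params_nil _ _ hp]

lemma Step.node_of {a : Symb} {pre post : List (Pat Symb)} {s s' : Pat Symb}
    (h : Relation.ReflTransGen G.Step s s') :
    Relation.ReflTransGen G.Step (node a (pre ++ s :: post)) (node a (pre ++ s' :: post)) := by
  induction h with
  | refl => exact .refl
  | tail _ hs ih => exact ih.tail (.child a pre post _ _ hs)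

/-- The induction is on a bound for the order of the nonterminals and, inside, on the tree. An
arbitrary substitution is carried along because a right-hand side is entered with the already
expanded arguments in place of its parameters. -/
lemma IsSLCF.derives_expand (h : G.IsSLCF)
    (hv : G.IsVal v) (t : Pat Symb) (ht : WellRanked t) :
    Relation.ReflTransGen G.Step t (expand v t) := by
  obtain ⟨ord, -, hord, -⟩ := h.straight_line
  have aux : ∀ (k : ℕ) (t : Pat Symb), WellRanked t →
      (∀ B ∈ t.labels, B ∈ G.nonterminals → ord B < k) →
      ∀ us : List (Pat Symb), Relation.ReflTransGen G.Step (t.subst us) ((expand v t).subst us) := by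
    intro k
    induction k with
    | zero =>
      intro t _ hb us
      rw [expand_of_none t fun a ha => (hv.none_iff a).2 fun hn => by simpa using hb a ha hn]
    | succ k ihk =>
      intro t ht hb us
      induction t using induct generalizing us with
      | hp i => simpa using .refl
      | hn a ts ih =>
        rw [wellRanked_node] at ht; simp only [labels_node, mem_cons, mem_flatMap] at hb
        have gen : ∀ (l pre : List (Pat Symb)), (∀ t ∈ l, t ∈ ts) →
            Relation.ReflTransGen G.Step (node a (pre ++ l.map (subst us)))
              (node a (pre ++ l.map (fun t => (expand v t).subst us))) := by
          intro l
          induction l with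
          | nil => intro pre _; exact .refl
          | cons t l ihl =>
            intro pre hl; have htt := hl t (by simp)
            refine (Step.node_of (ih t htt (ht.2 t htt)
              (fun B hB => hb B (.inr ⟨t, htt, hB⟩)) us)).trans ?_
            simpa using ihl (pre ++ [(expand v t).subst us]) fun t h => hl t (by simp [h])
        have h1 : Relation.ReflTransGen G.Step ((node a ts).subst us)
            (node a (ts.map (fun t => (expand v t).subst us))) := by
          simpa using gen ts [] fun _ h => h
        rcases hva : v a with _ | p
        · rw [expand_node_none hva, subst_node (ts := ts.map _), map_map]; exact h1
        · have han : a ∈ G.nonterminals := by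
            by_contra hc
            rw [(hv.none_iff a).2 hc] at hva; cases hva
          obtain ⟨q, hq, rfl⟩ := mem_map.1 han
          have hp : p = expand v q.2 := by
            have := hv.eq q hq; rw [hva] at this; exact Option.some.inj this
          rw [expand_node_some hva]
          refine h1.trans (.head (.root q.1 q.2 _ hq (by simpa using ht.1)) ?_)
          have h2 := ihk q.2 (h.wellRanked q hq) (fun B hB hn => by
            have := hord q hq B hn hB; have := hb q.1 (.inl rfl) han
            omega) (ts.map (fun t => (expand v t).subst us))
          refine h2.trans ?_; rw [← hp, subst_subst, map_map]
          · exact .refl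
          · intro i hi; simpa [ht.1] using hv.lt _ _ hva i hi
  simpa [subst_eq_self] using aux ((t.labels.map ord).sum + 1) t ht
    (fun B hB _ => Nat.lt_succ_of_le (le_sum_of_mem (mem_map_of_mem hB))) []

lemma IsSLCF.generates_of_val (h : G.IsSLCF)
    (hv : G.IsVal v) (hT : T.IsTree) (hn : ∀ a ∈ T.labels, a ∉ G.nonterminals)
    (hs : v G.start = some T) : G.Generates T := by
  refine ⟨hT, hn, ?_⟩
  have := h.derives_expand hv (node G.start []) (.node _ _ (by simp [h.start_rank]) (by simp))
  rwa [expand_node_some hs, map_nil, subst_of_params_nil _ _ hT.2] at this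

/-- `A` occurs in some pattern that can be derived from the start nonterminal. -/
def Reach (G : Grammar) : Symb → Prop :=
  Relation.ReflTransGen (fun A B => ∃ t, (A, t) ∈ G.prods ∧ B ∈ t.labels) G.start

/-- Nothing that a reachable nonterminal derives is ever erased. This bounds the size of its value
by the size of the tree, and is the reason for discarding unreachable nonterminals later. -/
lemma Reach.symLabels_sublist (h : G.IsSLCF)
    (hv : G.IsVal v) (hs : v G.start = some T) {A : Symb} (hA : G.Reach A) :
    (symLabels v A).Sublist T.labels := by
  induction hA with
  | refl => simp [symLabels, hs]
  | tail _ hB ih =>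
    obtain ⟨t, ht, hB⟩ := hB
    refine (symLabels_sublist_expand hv.perm t (h.wellRanked _ ht) hB).trans ?_
    simpa [symLabels, hv.eq _ ht] using ih

end Grammar

/-! ### Compression of maximal linked runs of unary letters -/

namespace Pat

variable {α β γ : Type}

/-- Turn the pending run on top of a compressed tree into a node. -/
def finish (φ : α → List α → β) : List α × Pat β → Pat β
  | ([], t) => t
  | (a :: w, t) => node (φ a w) [t]

/-- Add a unary letter on top of a pending run. -/
def pushRun (R : α → α → Bool) (φ : α → List α → β) (a : α) : List α × Pat β → List α × Pat β
  | ([], t) => ([a], t)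
  | (b :: w, t) => if R a b then (a :: b :: w, t) else ([a], node (φ b w) [t])

/-- The maximal linked run of unary letters at the root, and the compressed rest of the tree. -/
def splitRun (R : α → α → Bool) (φ : α → List α → β) (g : α → β) : Pat α → List α × Pat β :=
  fold (fun i => ([], param i)) fun a rs => match rs with
    | [s] => pushRun R φ a s
    | rs => ([], node (g a) (rs.map (finish φ)))

/-- Replace every maximal linked run `a w` of unary letters by the letter `φ a w`, and all other
letters `f` by `g f`. -/
def runComp (R : α → α → Bool) (φ : α → List α → β) (g : α → β) (t : Pat α) : Pat β :=
  finish φ (splitRun R φ g t)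

variable {R : α → α → Bool} {φ : α → List α → β} {g : α → β} {t : Pat α} {a : α} {w V : List α} {ts : List (Pat α)}

@[simp] lemma splitRun_param (i : ℕ) : splitRun R φ g (param i) = ([], param i) := by
  simp [splitRun, fold_param]

lemma splitRun_unary (a : α) (t : Pat α) :
    splitRun R φ g (node a [t]) = pushRun R φ a (splitRun R φ g t) := by
  simp [splitRun, fold_node]

lemma splitRun_node (a : α) (ts : List (Pat α)) (h : ts.length ≠ 1) :
    splitRun R φ g (node a ts) = ([], node (g a) (ts.map (runComp R φ g))) := by
  match ts, h with
  | [], _ => simp [splitRun, fold_node]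
  | t :: t' :: ts, _ => simp [splitRun, fold_node, runComp]

lemma exists_unary_or (ts : List (Pat α)) : (∃ t, ts = [t]) ∨ ts.length ≠ 1 := by
  match ts with
  | [] => simp
  | [t] => exact .inl ⟨t, rfl⟩
  | t :: t' :: ts => exact .inr (by simp)

lemma induct_unary {P : Pat α → Prop} (hp : ∀ i, P (param i))
    (h1 : ∀ a t, P t → P (node a [t]))
    (hn : ∀ a ts, ts.length ≠ 1 → (∀ t ∈ ts, P t) → P (node a ts)) (t : Pat α) : P t := by
  induction t using induct with
  | hp i => exact hp i
  | hn a ts ih =>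
    rcases exists_unary_or ts with ⟨t, rfl⟩ | h
    · exact h1 a t (ih t (by simp))
    · exact hn a ts h ih

lemma relabel_finish (h : β → γ) (s : List α × Pat β) :
    (finish φ s).relabel h = finish (fun a w => h (φ a w)) (s.1, s.2.relabel h) := by
  obtain ⟨_ | ⟨a, w⟩, t⟩ := s <;> simp [finish]

lemma splitRun_relabel_right (h : β → γ) (t : Pat α) :
    splitRun R (fun a w => h (φ a w)) (fun a => h (g a)) t =
      ((splitRun R φ g t).1, (splitRun R φ g t).2.relabel h) := by
  induction t using induct_unary with
  | hp i => simp
  | h1 a t ih =>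
    rw [splitRun_unary, splitRun_unary, ih]; obtain ⟨_ | ⟨b, w⟩, u⟩ := splitRun R φ g t
    · rfl
    · by_cases hr : R a b <;> simp [pushRun, hr]
  | hn a ts hl ih =>
    rw [splitRun_node _ _ hl, splitRun_node _ _ hl]
    simp only [relabel_node, map_map, Prod.mk.injEq, node.injEq, true_and]
    refine map_congr_left fun t ht => ?_
    simp [runComp, ih t ht, relabel_finish]

lemma runComp_relabel_right (h : β → γ) (t : Pat α) :
    (runComp R φ g t).relabel h = runComp R (fun a w => h (φ a w)) (fun a => h (g a)) t := by
  rw [runComp, runComp, relabel_finish, splitRun_relabel_right]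

lemma splitRun_relabel_left {δ : Type} (i : δ → α) (t : Pat δ) : splitRun R φ g (t.relabel i) =
      ((splitRun (fun a b => R (i a) (i b)) (fun a w => φ (i a) (w.map i)) (fun a => g (i a)) t).1.map
        i, (splitRun (fun a b => R (i a) (i b)) (fun a w => φ (i a) (w.map i))
          (fun a => g (i a)) t).2) := by
  induction t using induct_unary with
  | hp i => simp
  | h1 a t ih =>
    rw [relabel_node, map_singleton, splitRun_unary, splitRun_unary, ih]
    obtain ⟨_ | ⟨b, w⟩, u⟩ := splitRun (fun a b => R (i a) (i b)) (fun a w => φ (i a) (w.map i))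
        (fun a => g (i a)) t
    · rfl
    · by_cases hr : R (i a) (i b) <;> simp [pushRun, hr]
  | hn a ts hl ih =>
    rw [relabel_node, splitRun_node _ _ (by simpa using hl), splitRun_node _ _ hl]
    simp only [map_map, Prod.mk.injEq, node.injEq, true_and, map_nil]
    refine map_congr_left fun t ht => ?_
    simp [runComp, ih t ht]
    obtain ⟨_ | ⟨b, w⟩, u⟩ := splitRun (fun a b => R (i a) (i b)) (fun a w => φ (i a) (w.map i))
        (fun a => g (i a)) t <;> rfl

lemma runComp_relabel_left {δ : Type} (i : δ → α) (t : Pat δ) : runComp R φ g (t.relabel i) =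
      runComp (fun a b => R (i a) (i b)) (fun a w => φ (i a) (w.map i)) (fun a => g (i a)) t := by
  rw [runComp, splitRun_relabel_left, runComp]
  obtain ⟨_ | ⟨b, w⟩, u⟩ := splitRun (fun a b => R (i a) (i b)) (fun a w => φ (i a) (w.map i))
        (fun a => g (i a)) t <;> rfl

lemma splitRun_subset (t : Pat α) : (splitRun R φ g t).1 ⊆ t.labels := by
  induction t using induct_unary with
  | hp i => simp
  | h1 a t ih =>
    rw [splitRun_unary]; generalize splitRun R φ g t = s at ih ⊢; obtain ⟨_ | ⟨b, w⟩, u⟩ := s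
    · simp [pushRun]
    · by_cases hr : R a b
      · simp only [pushRun, hr, if_true, labels_node, flatMap_cons, flatMap_nil, append_nil]
        exact cons_subset_cons a ih
      · simp [pushRun, hr]
  | hn a ts hl ih => rw [splitRun_node _ _ hl]; simp

lemma splitRun_congr {R' : α → α → Bool} {φ' : α → List α → β} {g' : α → β} (t : Pat α)
    (hR : ∀ a ∈ t.labels, ∀ b ∈ t.labels, R a b = R' a b)
    (hφ : ∀ a ∈ t.labels, ∀ w ⊆ t.labels, φ a w = φ' a w)
    (hg : ∀ a ∈ t.labels, g a = g' a) : splitRun R φ g t = splitRun R' φ' g' t := by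
  induction t using induct_unary with
  | hp i => simp
  | h1 a t ih =>
    have hsub : t.labels ⊆ (node a [t]).labels := by simp
    rw [splitRun_unary, splitRun_unary, ← ih (fun a ha b hb => hR a (hsub ha) b (hsub hb))
      (fun a ha w hw => hφ a (hsub ha) w (Subset.trans hw hsub)) fun a ha => hg a (hsub ha)]
    have hs := splitRun_subset (R := R) (φ := φ) (g := g) t; generalize splitRun R φ g t = s at hs ⊢
    obtain ⟨_ | ⟨b, w⟩, u⟩ := s
    · rfl
    · have hb : b ∈ (node a [t]).labels := hsub (hs (by simp))
      have hw : w ⊆ (node a [t]).labels := fun x hx => hsub (hs (by simp [hx]))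
      simp only [pushRun, hR a (by simp) b hb, hφ b hb w hw]
  | hn a ts hl ih =>
    have hsub : ∀ t ∈ ts, t.labels ⊆ (node a ts).labels := by
      intro t ht x hx; simp; exact .inr ⟨t, ht, hx⟩
    rw [splitRun_node _ _ hl, splitRun_node _ _ hl, hg a (by simp)]
    simp only [Prod.mk.injEq, node.injEq, true_and]; refine map_congr_left fun t ht => ?_
    rw [runComp, runComp, ← ih t ht (fun a ha b hb => hR a (hsub t ht ha) b (hsub t ht hb))
      (fun a ha w hw => hφ a (hsub t ht ha) w (Subset.trans hw (hsub t ht)))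
      fun a ha => hg a (hsub t ht ha)]
    have hs := splitRun_subset (R := R) (φ := φ) (g := g) t; generalize splitRun R φ g t = s at hs ⊢
    obtain ⟨_ | ⟨b, w⟩, u⟩ := s
    · rfl
    · simp only [finish]
      rw [hφ b (hsub t ht (hs (by simp))) w fun x hx => hsub t ht (hs (by simp [hx]))]

lemma runComp_congr {R' : α → α → Bool} {φ' : α → List α → β} {g' : α → β} (t : Pat α)
    (hR : ∀ a ∈ t.labels, ∀ b ∈ t.labels, R a b = R' a b)
    (hφ : ∀ a ∈ t.labels, ∀ w ⊆ t.labels, φ a w = φ' a w)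
    (hg : ∀ a ∈ t.labels, g a = g' a) : runComp R φ g t = runComp R' φ' g' t := by
  rw [runComp, runComp, ← splitRun_congr t hR hφ hg]
  have hs := splitRun_subset (R := R) (φ := φ) (g := g) t; generalize splitRun R φ g t = s at hs ⊢
  obtain ⟨_ | ⟨b, w⟩, u⟩ := s
  · rfl
  · simp only [finish]; rw [hφ b (hs (by simp)) w fun x hx => hs (by simp [hx])]

lemma params_finish (s : List α × Pat β) : (finish φ s).params = s.2.params := by
  obtain ⟨_ | ⟨b, w⟩, u⟩ := s <;> simp [finish]

lemma params_splitRun (t : Pat α) : (splitRun R φ g t).2.params = t.params := by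
  induction t using induct_unary with
  | hp i => simp
  | h1 a t ih =>
    rw [splitRun_unary]; generalize splitRun R φ g t = s at ih ⊢; obtain ⟨_ | ⟨b, w⟩, u⟩ := s
    · simpa [pushRun] using ih
    · by_cases hr : R a b <;> simpa [pushRun, hr] using ih
  | hn a ts hl ih =>
    rw [splitRun_node _ _ hl]; simp only [params_node, flatMap_map]
    exact flatMap_congr fun t ht => by rw [runComp, params_finish, ih t ht]

lemma params_runComp (t : Pat α) : (runComp R φ g t).params = t.params := by
  rw [runComp, params_finish, params_splitRun]

lemma wellRanked_splitRun {R : Symb → Symb → Bool} {φ : Symb → List Symb → Symb} {g : Symb → Symb}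
    (hφ : ∀ a w, a.rank = 1 → (φ a w).rank = 1) (hg : ∀ a, (g a).rank = a.rank) (t : Pat Symb)
    (ht : WellRanked t) :
    WellRanked (splitRun R φ g t).2 ∧ ∀ a ∈ (splitRun R φ g t).1, a.rank = 1 := by
  induction t using induct_unary with
  | hp i => simpa using ht
  | h1 a t ih =>
    rw [wellRanked_node] at ht; rw [splitRun_unary]
    have ha : a.rank = 1 := by simpa using ht.1.symm
    have ih := ih (ht.2 t (by simp))
    generalize splitRun R φ g t = s at ih ⊢; obtain ⟨_ | ⟨b, w⟩, u⟩ := s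
    · simpa [pushRun, ha] using ih
    · have hb := ih.2 b (by simp)
      by_cases hr : R a b
      · simpa [pushRun, hr, ha] using ih
      · simp [pushRun, hr, ha]
        exact .node _ _ (by simp [hφ b w hb]) (by simpa using ih.1)
  | hn a ts hl ih =>
    rw [wellRanked_node] at ht; rw [splitRun_node _ _ hl]
    refine ⟨.node _ _ (by simp [hg, ht.1]) ?_, by simp⟩
    simp only [mem_map]
    rintro _ ⟨t, h, rfl⟩
    have ih := ih t h (ht.2 t h); rw [runComp]; generalize splitRun R φ g t = s at ih ⊢
    obtain ⟨_ | ⟨b, w⟩, u⟩ := s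
    · exact ih.1
    · exact .node _ _ (by simp [hφ b w (ih.2 b (by simp))]) (by simpa using ih.1)

lemma wellRanked_runComp {R : Symb → Symb → Bool} {φ : Symb → List Symb → Symb} {g : Symb → Symb}
    (hφ : ∀ a w, a.rank = 1 → (φ a w).rank = 1) (hg : ∀ a, (g a).rank = a.rank) (t : Pat Symb)
    (ht : WellRanked t) : WellRanked (runComp R φ g t) := by
  have ih := wellRanked_splitRun (R := R) hφ hg t ht; rw [runComp]
  generalize splitRun R φ g t = s at ih ⊢; obtain ⟨_ | ⟨b, w⟩, u⟩ := s
  · exact ih.1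
  · exact .node _ _ (by simp [hφ b w (ih.2 b (by simp))]) (by simpa using ih.1)

/-! ### Leaf compression -/

/-- Leaf compression with labels `g f pat`, together with the label of a tree that is a constant. -/
def leafFold (g : α → List (Option α) → β) : Pat α → Pat β × Option α :=
  fold (fun i => (param i, none)) fun f rs =>
    (node (g f (rs.map Prod.snd)) ((rs.filter (fun r => r.2.isNone)).map Prod.fst),
      if rs.isEmpty then some f else none)

/-- The label of a tree that consists of a constant only. -/
def constOf : Pat α → Option α
  | node c [] => some c
  | _ => none

/-- Every node absorbs its leaf children; a node with label `f` and leaf children `pat` gets the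
label `g f pat`. -/
def absorb (g : α → List (Option α) → β) (t : Pat α) : Pat β := (leafFold g t).1

variable {g : α → List (Option α) → β} {c : α}

lemma leafFold_snd (t : Pat α) : (leafFold g t).2 = constOf t := by
  cases t with
  | param i => simp [leafFold, fold_param, constOf]
  | node a ts => cases ts <;> simp [leafFold, fold_node, constOf]

@[simp] lemma absorb_param (i : ℕ) : absorb g (param i) = param i := by
  simp [absorb, leafFold, fold_param]

lemma absorb_node (f : α) (ts : List (Pat α)) : absorb g (node f ts) = node (g f (ts.map constOf))
      ((ts.filter (fun t => (constOf t).isNone)).map (absorb g)) := by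
  simp only [absorb, leafFold, fold_node, node.injEq]; constructor
  · congr 1; rw [map_map]; exact map_congr_left fun t _ => leafFold_snd (g := g) t
  · rw [filter_map, map_map]
    have : ((fun r : Pat β × Option α => r.2.isNone) ∘ fold (fun i => (param i, none)) fun f rs =>
        (node (g f (rs.map Prod.snd)) ((rs.filter (fun r => r.2.isNone)).map Prod.fst),
          if rs.isEmpty then some f else none)) = fun t => (constOf t).isNone :=
      funext fun t => by simp only [Function.comp_apply, ← leafFold_snd (g := g) t]; rfl
    rw [this]; rfl

lemma constOf_eq_some : constOf t = some c ↔ t = node c [] := by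
  rcases t with i | ⟨a, _ | ⟨t, ts⟩⟩ <;> simp [constOf]

@[simp] lemma constOf_node_cons (a : α) (t : Pat α) (ts : List (Pat α)) :
    constOf (node a (t :: ts)) = none := rfl

@[simp] lemma constOf_node_nil (a : α) : constOf (node a []) = some a := rfl

lemma params_absorb (t : Pat α) : (absorb g t).params = t.params := by
  induction t using induct with
  | hp i => simp
  | hn a ts ih =>
    rw [absorb_node, params_node, params_node]; clear * - ih
    induction ts with
    | nil => rfl
    | cons t ts ih2 =>
      have ih2 := ih2 fun t ht => ih t (by simp [ht])
      rcases h : constOf t with _ | c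
      · rw [filter_cons_of_pos (by simp [h]), map_cons, flatMap_cons,
          flatMap_cons, ih2, ih t (by simp)]
      · rw [filter_cons_of_neg (by simp [h]), flatMap_cons, ih2, constOf_eq_some.1 h]
        simp

lemma constOf_relabel (h : α → β) (t : Pat α) : constOf (t.relabel h) = (constOf t).map h := by
  rcases t with i | ⟨a, _ | ⟨t, ts⟩⟩ <;> simp [constOf]

lemma absorb_relabel_right (h : β → γ) (t : Pat α) :
    (absorb g t).relabel h = absorb (fun f p => h (g f p)) t := by
  induction t using induct with
  | hp i => simp
  | hn a ts ih =>
    rw [absorb_node, absorb_node, relabel_node, map_map]; simp only [node.injEq, true_and]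
    exact map_congr_left fun t ht => ih t (mem_of_mem_filter ht)

lemma absorb_relabel_left {δ : Type} (i : δ → α) (t : Pat δ) :
    absorb g (t.relabel i) = absorb (fun f p => g (i f) (p.map (Option.map i))) t := by
  induction t using induct with
  | hp i => simp
  | hn a ts ih =>
    rw [relabel_node, absorb_node, absorb_node, filter_map, map_map, map_map, map_map]; simp
    constructor
    · congr 1; exact map_congr_left fun t _ => constOf_relabel i t
    · have : ((fun t : Pat α => (constOf t).isNone) ∘ relabel i) = fun t => (constOf t).isNone :=
        funext fun t => by simp [constOf_relabel]
      rw [this]; exact map_congr_left fun t ht => ih t (mem_of_mem_filter ht)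

lemma wellRanked_absorb {g : Symb → List (Option Symb) → Symb}
    (hg : ∀ f p, f.rank = p.length → (g f p).rank = p.countP Option.isNone) (t : Pat Symb)
    (ht : WellRanked t) : WellRanked (absorb g t) := by
  induction t using induct with
  | hp i => simpa using ht
  | hn a ts ih =>
    rw [wellRanked_node] at ht; rw [absorb_node, wellRanked_node]; constructor
    · rw [hg _ _ (by simp [ht.1]), length_map, countP_map, countP_eq_length_filter]
      rfl
    · simp only [mem_map]
      rintro _ ⟨t, h, rfl⟩
      have h := mem_of_mem_filter h; exact ih t h (ht.2 t h)

end Pat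

namespace TtoG

/-! ### The compression steps as instances of the general ones -/

variable {ν : Key → Symb} {φ : Symb → List Symb → Symb} {R : Symb → Symb → Bool} {t : Pat Symb} {a : Symb}

lemma group_node (a : Symb) (ts : List (Pat Symb)) : group (node a ts) = match ts.map group with
    | [node (b, l) us] => if a = b then node (a, l + 1) us else node (a, 1) [node (b, l) us]
    | ts => node (a, 1) ts := by
  simp only [group, fold_node]; rfl

@[simp] lemma group_param (i : ℕ) : group (param i) = param i := by simp [group, fold_param]

/-- Identifies chain grouping with run compression for the link relation of equality, so that chains
and pairs share one theory. -/
lemma group_eq (t : Pat Symb) (ht : WellRanked t) :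
    group t = runComp (fun a b => decide (a = b)) (fun a w => (a, w.length + 1)) (fun f => (f, 1)) t := by
  -- `group` inspects only the label of the compressed child, whereas `splitRun` remembers the open
  -- run. The condition on the rank says that a root outside an open run cannot be mistaken for the
  -- top of a chain.
  have key : ∀ t : Pat Symb, WellRanked t →
      match splitRun (fun a b => decide (a = b)) (fun (a : Symb) w => (a, w.length + 1))
        (fun f => (f, 1)) t with
      | ([], u) => group t = u ∧ ∀ b l us, u = node (b, l) us → b.rank ≠ 1
      | (a :: w, u) => group t = node (a, w.length + 1) [u] ∧ a.rank = 1 := by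
    intro t
    induction t using induct_unary with
    | hp i => intro _; simp
    | h1 a t ih =>
      intro ht; rw [wellRanked_node] at ht; have ih := ih (ht.2 t (by simp))
      have ha : a.rank = 1 := by simpa using ht.1.symm
      rw [splitRun_unary, group_node, map_singleton]
      generalize splitRun (fun a b => decide (a = b)) (fun (a : Symb) w => (a, w.length + 1))
        (fun f => (f, 1)) t = s at ih
      obtain ⟨_ | ⟨b, w⟩, u⟩ := s
      · obtain ⟨h1, h2⟩ := ih; rw [h1]; refine ⟨?_, ha⟩; rcases u with i | ⟨⟨b, l⟩, us⟩
        · rfl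
        · have : a ≠ b := fun h => h2 b l us rfl (h ▸ ha)
          simp [this]
      · obtain ⟨h1, h2⟩ := ih; rw [h1]
        by_cases hab : a = b <;> simp [pushRun, hab, ha]
        exact hab ▸ ha
    | hn a ts hl ih =>
      intro ht; rw [wellRanked_node] at ht; rw [splitRun_node _ _ hl]; constructor
      · have e : ts.map group = ts.map (runComp (fun a b => decide (a = b))
            (fun (a : Symb) w => (a, w.length + 1)) (fun f => (f, 1))) := by
          refine map_congr_left fun t h => ?_
          have ih := ih t h (ht.2 t h); rw [runComp]
          generalize splitRun (fun a b => decide (a = b)) (fun (a : Symb) w => (a, w.length + 1))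
            (fun f => (f, 1)) t = s at ih
          obtain ⟨_ | ⟨b, w⟩, u⟩ := s
          · exact ih.1
          · exact ih.1
        rw [group_node, e]
        match ts, hl with
        | [], _ => rfl
        | t :: t' :: ts, _ => grind
      grind
  have := key t ht; rw [runComp]
  generalize splitRun (fun a b => decide (a = b)) (fun (a : Symb) w => (a, w.length + 1))
    (fun f => (f, 1)) t = s at this
  obtain ⟨_ | ⟨b, w⟩, u⟩ := s
  · exact this.1
  · exact this.1

/-- The letter for a maximal chain. -/
def chainLetter (ν : Key → Symb) (a : Symb) (w : List Symb) : Symb :=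
  if w.length + 1 ≤ 1 then a else ν (.chain a (w.length + 1))

lemma chainComp_eq (ν : Key → Symb) (t : Pat Symb) (ht : WellRanked t) :
    chainComp ν t = runComp (fun a b => decide (a = b)) (chainLetter ν) id t := by
  rw [chainComp, group_eq t ht, runComp_relabel_right]; rfl

lemma unaryComp_node (ν : Key → Symb) (up down : Finset Symb) (a : Symb) (ts : List (Pat Symb)) :
    unaryComp ν up down (node a ts) =
    match ts.map (unaryComp ν up down) with
    | [node b [u]] => if a ∈ up ∧ b ∈ down then node (ν (.pair a b)) [u] else node a [node b [u]]
    | ts => node a ts := by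
  simp only [unaryComp, fold_node]; rfl

@[simp] lemma unaryComp_param (ν : Key → Symb) (up down : Finset Symb) (i : ℕ) :
    unaryComp ν up down (param i) = param i := by simp [unaryComp, fold_param]

/-- The letter for a pair. -/
def pairLetter (ν : Key → Symb) (a : Symb) : List Symb → Symb
  | [] => a
  | b :: _ => ν (.pair a b)

/-- Disjointness limits linked runs to two letters, and a pair letter is never in `down`, so the
bottom-up rewriting cannot react again with a letter it has just created. -/
lemma unaryComp_eq (ν : Key → Symb) (up down : Finset Symb) (hd : Disjoint up down)
    (hν : ∀ a b, ν (.pair a b) ∉ down) (t : Pat Symb) :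
    unaryComp ν up down t =
      runComp (fun a b => decide (a ∈ up ∧ b ∈ down)) (pairLetter ν) id t := by
  have key : ∀ t : Pat Symb,
      match splitRun (fun a b => decide (a ∈ up ∧ b ∈ down)) (pairLetter ν) id t with
      | ([], u) => unaryComp ν up down t = u ∧ ∀ b v, u ≠ node b [v]
      | (a :: w, u) => unaryComp ν up down t = node (pairLetter ν a w) [u] ∧
          (w = [] ∨ a ∈ up) := by
    intro t
    induction t using induct_unary with
    | hp i => simp
    | h1 a t ih =>
      rw [splitRun_unary, unaryComp_node, map_singleton]
      generalize splitRun (fun a b => decide (a ∈ up ∧ b ∈ down)) (pairLetter ν) id t = s at ih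
      obtain ⟨_ | ⟨b, w⟩, u⟩ := s
      · obtain ⟨h1, h2⟩ := ih; rw [h1]; refine ⟨?_, .inl rfl⟩; rcases u with i | ⟨b, us⟩
        · rfl
        · rcases us with _ | ⟨v, _ | ⟨v', us⟩⟩
          · rfl
          · exact absurd rfl (h2 b v)
          · rfl
      · obtain ⟨h1, h2⟩ := ih; rw [h1]
        by_cases hab : a ∈ up ∧ b ∈ down
        · have hw : w = [] := h2.resolve_right fun hb => Finset.disjoint_left.1 hd hb hab.2
          subst hw; simp [pushRun, hab, pairLetter]
        · have : ¬ (a ∈ up ∧ pairLetter ν b w ∈ down) := by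
            rintro ⟨h3, h4⟩
            cases w with
            | nil => exact hab ⟨h3, h4⟩
            | cons c w => exact hν _ _ h4
          simp only [pushRun, hab, decide_false, Bool.false_eq_true, if_false, this]
          exact ⟨rfl, .inl trivial⟩
    | hn a ts hl ih =>
      rw [splitRun_node _ _ hl]
      have e : ts.map (unaryComp ν up down) =
          ts.map (runComp (fun a b => decide (a ∈ up ∧ b ∈ down)) (pairLetter ν) id) := by
        refine map_congr_left fun t h => ?_
        have ih := ih t h; rw [runComp]
        generalize splitRun (fun a b => decide (a ∈ up ∧ b ∈ down)) (pairLetter ν) id t = s at ih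
        obtain ⟨_ | ⟨b, w⟩, u⟩ := s
        · exact ih.1
        · exact ih.1
      constructor
      · rw [unaryComp_node, e]
        match ts, hl with
        | [], _ => rfl
        | t :: t' :: ts, _ => grind
      · intro b v h; simp only [node.injEq] at h; have := congrArg length h.2; simp [hl] at this
  have := key t; rw [runComp]
  generalize splitRun (fun a b => decide (a ∈ up ∧ b ∈ down)) (pairLetter ν) id t = s at this
  obtain ⟨_ | ⟨b, w⟩, u⟩ := s
  · exact this.1
  · exact this.1

/-- The letter for a symbol with its absorbed leaves. -/
def leafLetter (ν : Key → Symb) (f : Symb) (pat : List (Option Symb)) : Symb :=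
  if pat.any Option.isSome then ν (.leaf f pat) else f

lemma constLabel_eq : constLabel = constOf := by
  funext t
  rcases t with i | ⟨a, _ | ⟨t, ts⟩⟩ <;> rfl

lemma leafCompList_eq (ν : Key → Symb) (ts : List (Pat Symb)) : leafCompList ν ts =
    (ts.filter (fun t => (constOf t).isNone)).map (leafComp ν) := by
  induction ts with
  | nil => simp [leafCompList]
  | cons t ts ih =>
    rw [leafCompList, constLabel_eq, ih]
    rcases h : constOf t with _ | c <;> simp [h]

lemma leafComp_eq (ν : Key → Symb) (t : Pat Symb) : leafComp ν t = absorb (leafLetter ν) t := by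
  induction t using induct with
  | hp i => simp [leafComp]
  | hn a ts ih =>
    rw [leafComp, absorb_node, leafCompList_eq, constLabel_eq, node.injEq]
    exact ⟨rfl, map_congr_left fun t ht => ih t (mem_of_mem_filter ht)⟩

/-! ### Sizes -/

end TtoG

namespace Pat

variable {α β : Type}

/-- The label of the root if it has exactly one child. -/
def topUnary : Pat α → Option α
  | node a [_] => some a
  | _ => none

lemma topUnary_node {a : α} {ts : List (Pat α)} (h : ts.length ≠ 1) :
    topUnary (node a ts) = none := by
  match ts, h with
  | [], _ => rfl
  | _ :: _ :: _, _ => rfl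

lemma head?_splitRun {R : α → α → Bool} {φ : α → List α → β} {g : α → β} (t : Pat α) :
    (splitRun R φ g t).1.head? = topUnary t := by
  induction t using induct_unary with
  | hp i => simp [topUnary]
  | h1 a t ih =>
    rw [splitRun_unary]; generalize splitRun R φ g t = s; obtain ⟨_ | ⟨b, w⟩, u⟩ := s
    · rfl
    · by_cases hr : R a b <;> simp [pushRun, hr, topUnary]
  | hn a ts hl ih => rw [splitRun_node _ _ hl, topUnary_node hl]; rfl

/-- The number of leaves. -/
def numLeaves (t : Pat α) : ℕ := fold (fun _ => 0) (fun _ ns => if ns.isEmpty then 1 else ns.sum) t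

@[simp] lemma numLeaves_param (i : ℕ) : (param i : Pat α).numLeaves = 0 := by
  simp [numLeaves, fold_param]

@[simp] lemma numLeaves_nil (a : α) : (node a []).numLeaves = 1 := by simp [numLeaves, fold_node]

lemma numLeaves_node (a : α) {ts : List (Pat α)} (h : ts ≠ []) :
    (node a ts).numLeaves = (ts.map numLeaves).sum := by
  simp only [numLeaves, fold_node]; rw [if_neg (by simpa using h)]; rfl

lemma numLeaves_finish {φ : α → List α → β} (s : List α × Pat β) :
    (finish φ s).numLeaves = s.2.numLeaves := by
  obtain ⟨_ | ⟨b, w⟩, u⟩ := s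
  · rfl
  · simp [finish, numLeaves_node]

lemma numLeaves_runComp {R : α → α → Bool} {φ : α → List α → β} {g : α → β} (t : Pat α) :
    (runComp R φ g t).numLeaves = t.numLeaves := by
  rw [runComp, numLeaves_finish]
  induction t using induct_unary with
  | hp i => simp
  | h1 a t ih =>
    rw [splitRun_unary, numLeaves_node _ (by simp)]
    generalize splitRun R φ g t = s at ih ⊢; obtain ⟨_ | ⟨b, w⟩, u⟩ := s
    · simpa [pushRun] using ih
    · by_cases hr : R a b <;> simpa [pushRun, hr, numLeaves_node] using ih
  | hn a ts hl ih =>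
    rw [splitRun_node _ _ hl]; rcases ts with _ | ⟨t, ts⟩
    · simp
    · rw [numLeaves_node _ (by simp), numLeaves_node _ (by simp), map_map]
      congr 1
      exact map_congr_left fun t ht => by
        rw [Function.comp_apply, runComp, numLeaves_finish, ih t ht]

lemma constOf_runComp {R : α → α → Bool} {φ : α → List α → β} {g : α → β} (t : Pat α)
    (h : constOf t = none) : constOf (runComp R φ g t) = none := by
  rcases t with i | ⟨a, ts⟩
  · simp [runComp, finish, constOf]
  · rcases exists_unary_or ts with ⟨t, rfl⟩ | hl
    · have := head?_splitRun (R := R) (φ := φ) (g := g) (node a [t]); rw [runComp]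
      generalize splitRun R φ g (node a [t]) = s at this; obtain ⟨_ | ⟨b, w⟩, u⟩ := s
      · simp [topUnary] at this
      · rfl
    · rw [runComp, splitRun_node _ _ hl]; rcases ts with _ | ⟨t, ts⟩
      · simp at h
      · rfl

/-- Exactly the leaves that have a parent disappear. The correction term is for a tree that is
itself a single leaf. -/
lemma size_absorb {g : α → List (Option α) → β} (t : Pat α) :
    (absorb g t).size + t.numLeaves = t.size + if (constOf t).isSome then 1 else 0 := by
  induction t using induct with
  | hp i => simp [constOf]
  | hn a ts ih =>
    rcases eq_or_ne ts [] with rfl | hts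
    · simp [absorb_node]
    · have hc : constOf (node a ts) = none := by cases ts <;> simp at hts ⊢
      rw [absorb_node, numLeaves_node _ hts, hc]
      simp only [size_node, Option.isSome_none, Bool.false_eq_true, if_false, add_zero]
      suffices ((ts.filter fun t => (constOf t).isNone).map (fun t => (absorb g t).size)).sum +
          (ts.map numLeaves).sum = (ts.map size).sum by
        rw [map_map]; have e : (size ∘ absorb g) = fun t : Pat α => (absorb g t).size := rfl
        rw [e]; omega
      clear hts hc
      induction ts with
      | nil => rfl
      | cons t ts ih2 =>
        have ih2 := ih2 fun t ht => ih t (by simp [ht])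
        have ih := ih t (by simp)
        rcases h : constOf t with _ | c
        · rw [filter_cons_of_pos (by simp [h])]
          simp; rw [h] at ih; simp at ih; omega
        · rw [filter_cons_of_neg (by simp [h])]
          simp; rw [constOf_eq_some.1 h]; simp; omega

lemma size_pos {t : Pat α} (h : t.params = []) : 1 ≤ t.size := by cases t <;> simp at h ⊢

lemma eq_const_of_size_le_one {t : Pat α} (h : t.params = []) (hs : t.size ≤ 1) :
    ∃ c, t = node c [] := by
  rcases t with i | ⟨a, _ | ⟨t, ts⟩⟩
  · simp at h
  · exact ⟨a, rfl⟩
  · simp at h; have := size_pos h.1; simp at hs; omega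

end Pat

namespace TtoG

lemma unaryPairs_unary (a : Symb) (t : Pat Symb) : unaryPairs (node a [t]) =
    ((topUnary t).map (fun b => (a, b))).toList ++ unaryPairs t := by
  rcases t with i | ⟨b, _ | ⟨u, _ | ⟨u', us⟩⟩⟩ <;> simp [unaryPairs, topUnary]

lemma unaryPairs_node (a : Symb) (ts : List (Pat Symb)) (h : ts.length ≠ 1) :
    unaryPairs (node a ts) = ts.flatMap unaryPairs := by
  have e : unaryPairs = fun t : Pat Symb => t.subtrees.filterMap (fun s => match s with
    | node a [node b [_]] => some (a, b)
    | _ => none) := rfl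
  match ts, h with
  | [], _ => simp [unaryPairs]
  | t :: t' :: ts, _ =>
    simp [unaryPairs]; rw [flatMap_def, filterMap_flatten, flatMap_def, map_map, e]; rfl

@[simp] lemma unaryPairs_param (i : ℕ) : unaryPairs (param i) = [] := by simp [unaryPairs]

/-- A run of `k` letters contains `k - 1` linked pairs and loses `k - 1` nodes. -/
lemma size_runComp {β : Type} {R : Symb → Symb → Bool} {φ : Symb → List Symb → β} {g : Symb → β}
    (t : Pat Symb) :
    (runComp R φ g t).size + (unaryPairs t).countP (fun p => R p.1 p.2) = t.size := by
  have hf : ∀ s : List Symb × Pat β, (finish φ s).size = s.2.size + if s.1.isEmpty then 0 else 1 := by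
    rintro ⟨_ | ⟨b, w⟩, u⟩ <;> simp [finish]
  induction t using induct_unary with
  | hp i => simp [runComp, finish]
  | h1 a t ih =>
    rw [runComp, hf] at ih ⊢; rw [splitRun_unary, unaryPairs_unary, countP_append]
    have hh := head?_splitRun (R := R) (φ := φ) (g := g) t; generalize splitRun R φ g t = s at ih hh
    obtain ⟨_ | ⟨b, w⟩, u⟩ := s
    · rw [← hh]; simp [pushRun] at ih ⊢; omega
    · rw [← hh]
      by_cases hr : R a b <;> simp [pushRun, hr] at ih ⊢ <;> omega
  | hn a ts hl ih =>
    rw [runComp, splitRun_node _ _ hl, unaryPairs_node _ _ hl]; simp [finish]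
    suffices (ts.map (fun t => (runComp R φ g t).size)).sum +
        (ts.flatMap unaryPairs).countP (fun p => R p.1 p.2) = (ts.map size).sum by
      have e : (size ∘ runComp R φ g) = fun t => (runComp R φ g t).size := rfl
      rw [e]; omega
    clear hl
    induction ts with
    | nil => rfl
    | cons t ts ih2 =>
      have ih2 := ih2 fun t ht => ih t (by simp [ht])
      have ih := ih t (by simp)
      simp; omega

/-- Branching nodes are fewer than leaves, hence so many nodes can fail to be the upper letter of a
unary pair only up to a constant factor of the leaves. The sharper bound for a root that is not
unary drives the induction: a unary node on top of it adds a node but no pair. -/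
lemma size_le_pairs_leaves (t : Pat Symb) (h : t.params = []) :
    t.size + 2 ≤ (unaryPairs t).length + 4 * t.numLeaves ∧
      (topUnary t = none → t.size + 3 ≤ (unaryPairs t).length + 4 * t.numLeaves) := by
  induction t using induct_unary with
  | hp i => simp at h
  | h1 a t ih =>
    have ih := ih (by simpa using h)
    rw [unaryPairs_unary, numLeaves_node _ (by simp)]
    refine ⟨?_, by simp [topUnary]⟩
    rcases hu : topUnary t with _ | b
    · have := ih.2 hu; simp at this ⊢; omega
    · have := ih.1
      simp at this ⊢; omega
  | hn a ts hl ih =>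
    suffices (node a ts).size + 3 ≤ (unaryPairs (node a ts)).length + 4 * (node a ts).numLeaves from
      ⟨by omega, fun _ => this⟩
    rw [unaryPairs_node _ _ hl]; rcases eq_or_ne ts [] with rfl | hts
    · simp
    · rw [numLeaves_node _ hts, size_node]; simp at h
      have : (ts.map size).sum + 2 * ts.length ≤
          (ts.flatMap unaryPairs).length + 4 * (ts.map numLeaves).sum := by
        clear hl hts
        induction ts with
        | nil => simp
        | cons t ts ih2 =>
          have ih2 := ih2 (fun t ht => ih t (by simp [ht])) fun t ht => h t (by simp [ht])
          grind
      have h2 : 2 ≤ ts.length := by have := length_pos_iff.2 hts; omega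
      omega

/-! ### The greedy partition -/

variable {up down X : Finset Symb} {a : Symb} {b : Bool}

lemma countPairs_insert_left (ps : List (Symb × Symb)) (ha : a ∉ X)
    (Z : Finset Symb) :
    countPairs ps (insert a X) Z = countPairs ps {a} Z + countPairs ps X Z := by
  induction ps with
  | nil => rfl
  | cons p ps ih =>
    simp only [countPairs, countP_cons, Finset.mem_insert, Finset.mem_singleton] at ih ⊢; grind

lemma countPairs_insert_right (ps : List (Symb × Symb)) (ha : a ∉ X)
    (Z : Finset Symb) :
    countPairs ps Z (insert a X) = countPairs ps Z {a} + countPairs ps Z X := by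
  induction ps with
  | nil => rfl
  | cons p ps ih =>
    simp only [countPairs, countP_cons, Finset.mem_insert, Finset.mem_singleton] at ih ⊢; grind

/-- The invariant is that pairs inside a class are at most as many as pairs across. The class chosen
for a letter gets it at least as many new cross pairs as inner ones, and pairs `aa`, which could
spoil this, do not occur after chain compression. -/
lemma greedy_foldl (ps : List (Symb × Symb)) (hps : ∀ p ∈ ps, p.1 ≠ p.2) (order : List Symb)
    (hnd : order.Nodup) (st : Finset Symb × Finset Symb) (hd : Disjoint st.1 st.2)
    (ho : ∀ a ∈ order, a ∉ st.1 ∧ a ∉ st.2)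
    (hc : countPairs ps st.1 st.1 + countPairs ps st.2 st.2 ≤
      countPairs ps st.1 st.2 + countPairs ps st.2 st.1) :
    let r := order.foldl (greedyStep ps) st
    Disjoint r.1 r.2 ∧ (∀ a, a ∈ r.1 ∨ a ∈ r.2 ↔ a ∈ order ∨ a ∈ st.1 ∨ a ∈ st.2) ∧
      countPairs ps r.1 r.1 + countPairs ps r.2 r.2 ≤
        countPairs ps r.1 r.2 + countPairs ps r.2 r.1 := by
  induction order generalizing st with
  | nil => simpa using ⟨hd, hc⟩
  | cons a order ih =>
    rw [nodup_cons] at hnd; obtain ⟨ha1, ha2⟩ := ho a (by simp)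
    have haa : countPairs ps {a} {a} = 0 := by
      simp only [countPairs, countP_eq_zero, Finset.mem_singleton, decide_eq_true_eq, not_and]
      grind
    rw [foldl_cons]
    by_cases hle : countPairs ps {a} st.1 + countPairs ps st.1 {a} ≤
        countPairs ps {a} st.2 + countPairs ps st.2 {a}
    · have e : greedyStep ps st a = (insert a st.1, st.2) := by simp [greedyStep, hle]
      rw [e]
      have := ih hnd.2 (insert a st.1, st.2) (by simp [ha2, hd])
        (fun b hb => ⟨by
          have := ho b (by simp [hb])
          simp
          exact ⟨fun h => hnd.1 (h ▸ hb), this.1⟩, (ho b (by simp [hb])).2⟩) (by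
          simp only [countPairs_insert_left ps ha1, countPairs_insert_right ps ha1, haa]; omega)
      grind
    · have e : greedyStep ps st a = (st.1, insert a st.2) := by simp [greedyStep, hle]
      rw [e]
      have := ih hnd.2 (st.1, insert a st.2) (by simp [ha1, hd])
        (fun b hb => ⟨(ho b (by simp [hb])).1, by
          have := ho b (by simp [hb])
          simp
          exact ⟨fun h => hnd.1 (h ▸ hb), this.2⟩⟩) (by
          simp only [countPairs_insert_left ps ha2, countPairs_insert_right ps ha2, haa]; omega)
      grind

lemma countPairs_total (ps : List (Symb × Symb)) {Y : Finset Symb} (hd : Disjoint X Y)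
    (h : ∀ p ∈ ps, (p.1 ∈ X ∨ p.1 ∈ Y) ∧ (p.2 ∈ X ∨ p.2 ∈ Y)) :
    ps.length = countPairs ps X X + countPairs ps Y Y + countPairs ps X Y + countPairs ps Y X := by
  induction ps with
  | nil => rfl
  | cons p ps ih =>
    have ih := ih fun p hp => h p (by simp [hp])
    simp [countPairs] at ih ⊢; have d1 : p.1 ∈ X → p.1 ∉ Y := fun h => Finset.disjoint_left.1 hd h
    have d2 : p.2 ∈ X → p.2 ∉ Y := fun h => Finset.disjoint_left.1 hd h
    obtain ⟨h1 | h1, h2 | h2⟩ := h p (by simp) <;>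
    by_cases h3 : p.1 ∈ X <;> by_cases h4 : p.2 ∈ X <;>
      simp_all <;> omega

/-- One factor 2 because at least half of the pairs are across, another because the final exchange
selects the better of the two directions. -/
lemma greedyPartition_spec (ps : List (Symb × Symb)) (hps : ∀ p ∈ ps, p.1 ≠ p.2)
    (order : List Symb) (hnd : order.Nodup) (ho : ∀ p ∈ ps, p.1 ∈ order ∧ p.2 ∈ order) (h : (up, down) = greedyPartition ps order) :
    Disjoint up down ∧ (∀ a ∈ down, a ∈ order) ∧ (∀ a ∈ up, a ∈ order) ∧
      ps.length ≤ 4 * countPairs ps up down := by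
  obtain ⟨h1, h2, h3⟩ := greedy_foldl ps hps order hnd (∅, ∅) (by simp) (by simp)
    (by simp)
  simp at h2
  have h4 := countPairs_total ps h1 fun p hp => ⟨(h2 _).2 (ho p hp).1, (h2 _).2 (ho p hp).2⟩
  rw [greedyPartition] at h; grind

lemma mem_unaryPairs {t : Pat Symb} (ht : WellRanked t) {p : Symb × Symb}
    (hp : p ∈ unaryPairs t) :
    p.1 ∈ t.labels ∧ p.1.rank = 1 ∧ p.2 ∈ t.labels ∧ p.2.rank = 1 := by
  induction t using induct_unary with
  | hp i => simp at hp
  | h1 a t ih =>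
    rw [wellRanked_node] at ht; have htt := ht.2 t (by simp)
    rw [unaryPairs_unary, mem_append] at hp; have hsub : t.labels ⊆ (node a [t]).labels := by simp
    rcases hp with hp | hp
    · rcases t with i | ⟨b, _ | ⟨u, _ | ⟨u', us⟩⟩⟩ <;> simp [topUnary] at hp
      subst hp; rw [wellRanked_node] at htt; simpa using ⟨ht.1.symm, htt.1.symm⟩
    · obtain ⟨h1, h2, h3, h4⟩ := ih htt hp
      exact ⟨hsub h1, h2, hsub h3, h4⟩
  | hn a ts hl ih =>
    rw [wellRanked_node] at ht; rw [unaryPairs_node _ _ hl, mem_flatMap] at hp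
    obtain ⟨t, htt, hp⟩ := hp; obtain ⟨h1, h2, h3, h4⟩ := ih t htt (ht.2 t htt) hp
    have hsub : t.labels ⊆ (node a ts).labels := by intro x hx; simp; exact .inr ⟨t, htt, hx⟩
    exact ⟨hsub h1, h2, hsub h3, h4⟩

lemma mem_unaryLetters {t : Pat Symb} : a ∈ unaryLetters t ↔ a ∈ t.labels ∧ a.rank = 1 := by
  simp [unaryLetters]

end TtoG

-- Linked runs, and unary pairs of a compressed tree

namespace Pat

variable {α β : Type} {R : α → α → Bool}

/-- Consecutive letters are linked. -/
def Linked (R : α → α → Bool) (w : List α) : Prop := w.IsChain (fun a b => R a b = true)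

lemma linked_splitRun {φ : α → List α → β} {g : α → β} (t : Pat α) :
    Linked R (splitRun R φ g t).1 := by
  induction t using induct_unary with
  | hp i => simp [Linked]
  | h1 a t ih =>
    rw [splitRun_unary]; generalize splitRun R φ g t = s at ih ⊢; obtain ⟨_ | ⟨b, w⟩, u⟩ := s
    · simp [pushRun, Linked]
    · by_cases hr : R a b
      · simp [pushRun, hr, Linked]; exact ih
      · simp [pushRun, hr, Linked]
  | hn a ts hl ih => rw [splitRun_node _ _ hl]; simp [Linked]

/-- A linked run of the given letters. -/
def IsRunIn (R : α → α → Bool) (V : List α) (a : α) (w : List α) : Prop :=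
  a :: w ⊆ V ∧ Linked R (a :: w)

lemma isRunIn_of_splitRun {φ : α → List α → β} {g : α → β} {t : Pat α} {V : List α}
    (hV : t.labels ⊆ V) {a : α} {w : List α} {u : Pat β} (h : splitRun R φ g t = (a :: w, u)) :
    IsRunIn R V a w := by
  have h1 := linked_splitRun (R := R) (φ := φ) (g := g) t
  have h2 := splitRun_subset (R := R) (φ := φ) (g := g) t; rw [h] at h1 h2
  exact ⟨Subset.trans h2 hV, h1⟩

lemma labels_subset_of_mem {a : α} {ts : List (Pat α)} {V : List α}
    (h : (node a ts).labels ⊆ V) {t : Pat α} (ht : t ∈ ts) : t.labels ⊆ V := fun x hx => h (by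
  simp; exact .inr ⟨t, ht, hx⟩)

lemma linked_eq_replicate [DecidableEq α] {w : List α} {a : α}
    (h : Linked (fun a b => decide (a = b)) (a :: w)) : w = replicate w.length a := by
  induction w generalizing a with
  | nil => rfl
  | cons b w ih =>
    simp [Linked] at h; obtain ⟨rfl, h⟩ := h; rw [length_cons, replicate_succ]; congr 1
    exact ih (by simpa [Linked] using h)

end Pat

namespace TtoG

/-- Neighbouring unary letters of the compressed tree come from two runs that touch but are not
linked. For chains this shows that equal letters are no longer adjacent. -/
lemma unaryPairs_runComp {R : Symb → Symb → Bool} {φ : Symb → List Symb → Symb} {g : Symb → Symb}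
    {V : List Symb} (t : Pat Symb) (hV : t.labels ⊆ V) : ∀ p ∈ unaryPairs (runComp R φ g t),
      ∃ a w b w', p = (φ a w, φ b w') ∧
      IsRunIn R V a w ∧ IsRunIn R V b w' ∧ R ((a :: w).getLast (by simp)) b = false := by
  let Good (p : Symb × Symb) : Prop := ∃ a w b w', p = (φ a w, φ b w') ∧
      IsRunIn R V a w ∧ IsRunIn R V b w' ∧ R ((a :: w).getLast (by simp)) b = false
  -- A unary root of the compressed rest lies directly below the last letter of the open run; in
  -- particular the open run is then not empty.
  let Q (s : List Symb × Pat Symb) : Prop :=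
    (∀ p ∈ unaryPairs s.2, Good p) ∧ ∀ y, topUnary s.2 = some y → ∃ h : s.1 ≠ [], ∃ b w',
      y = φ b w' ∧ IsRunIn R V b w' ∧ R (s.1.getLast h) b = false
  have fin : ∀ t s, t.labels ⊆ V → splitRun R φ g t = s → Q s →
      ∀ p ∈ unaryPairs (finish φ s), Good p := by
    rintro t ⟨_ | ⟨a, w⟩, u⟩ hV hs ⟨h1, h2⟩ p hp
    · exact h1 p hp
    · rw [finish, unaryPairs_unary, mem_append] at hp; rcases hp with hp | hp
      · rcases hu : topUnary u with _ | y
        · simp [hu] at hp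
        · obtain ⟨h, b, w', rfl, h3, h4⟩ := h2 y hu; rw [hu] at hp; simp at hp
          exact ⟨a, w, b, w', hp, isRunIn_of_splitRun hV hs, h3, h4⟩
      · exact h1 p hp
  have key : ∀ t : Pat Symb, t.labels ⊆ V → Q (splitRun R φ g t) := by
    intro t hV
    induction t using induct_unary with
    | hp i => simp [Q, topUnary]
    | h1 a t ih =>
      have hV := labels_subset_of_mem hV (mem_singleton.2 rfl); have ih := ih hV
      have fin := fin t _ hV rfl ih; rw [splitRun_unary]
      rcases hsp : splitRun R φ g t with ⟨_ | ⟨b, w⟩, u⟩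
      · rw [hsp] at ih; exact ⟨ih.1, fun y hy => absurd rfl (ih.2 y hy).1⟩
      · rw [hsp] at ih fin
        by_cases hr : R a b
        · simp [pushRun, hr]; grind
        · simp only [pushRun, hr]; refine ⟨fin, fun y hy => ?_⟩
          simp [topUnary] at hy
          exact ⟨by simp, b, w, hy.symm, isRunIn_of_splitRun hV hsp, by simpa using hr⟩
    | hn a ts hl ih =>
      rw [splitRun_node _ _ hl]; refine ⟨fun p hp => ?_, fun y hy => ?_⟩
      · rw [unaryPairs_node _ _ (by simpa using hl), flatMap_map, mem_flatMap] at hp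
        obtain ⟨t, ht, hp⟩ := hp; have hV := labels_subset_of_mem hV ht
        exact fin t _ hV rfl (ih t ht hV) p hp
      · rw [topUnary_node (by simpa using hl)] at hy
        cases hy
  exact fin t _ hV rfl (key t hV)

-- The trees within a phase and the decrease of their size

lemma Fresh.not_mem_tree {s : State} {ν : Key → Symb} (h : Fresh s ν) (k : Key) :
    ν k ∉ s.tree.labels := fun hk => h.not_used k (mem_append_left _ hk)

/-- Adjacent maximal chains have different base letters, and fresh letters are distinct from each
other and from the old ones. -/
lemma isTree_chainComp {s : State} {ν : Key → Symb} (h : Fresh s ν) (hT : s.tree.IsTree) :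
    (chainComp ν s.tree).IsTree ∧ ∀ p ∈ unaryPairs (chainComp ν s.tree), p.1 ≠ p.2 := by
  rw [chainComp_eq ν _ hT.1]
  refine ⟨⟨wellRanked_runComp ?_ (fun _ => rfl) _ hT.1, by rw [params_runComp, hT.2]⟩, ?_⟩
  · intro a w ha; rw [chainLetter]; split_ifs
    · exact ha
    · exact h.rank_eq _
  · intro p hp; obtain ⟨a, w, b, w', rfl, h1, h2, h3⟩ := unaryPairs_runComp _ (fun _ h => h) p hp
    have hw := linked_eq_replicate h1.2; have hab : a ≠ b := by grind
    have ha : a ∈ s.tree.labels := h1.1 (by simp)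
    have hb : b ∈ s.tree.labels := h2.1 (by simp)
    dsimp only; rw [chainLetter, chainLetter]; split_ifs with h4 h5 h5
    · exact hab
    · exact fun e => h.not_mem_tree _ (e ▸ ha)
    · exact fun e => h.not_mem_tree _ (e ▸ hb)
    · intro e; have := h.injective e; simp at this; exact hab this.1

/-- The properties of the partition that is used in unary pair compression. -/
structure IsGoodPartition (t : Pat Symb) (up down : Finset Symb) : Prop where
  disjoint : Disjoint up down
  down_mem : ∀ a ∈ down, a ∈ t.labels
  le : (unaryPairs t).length ≤ 4 * countPairs (unaryPairs t) up down

lemma isGoodPartition {t : Pat Symb} (ht : WellRanked t)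
    (hd : ∀ p ∈ unaryPairs t, p.1 ≠ p.2) {order : List Symb} (ho : order.Perm (unaryLetters t))
    {up down : Finset Symb} (h : (up, down) = greedyPartition (unaryPairs t) order) :
    IsGoodPartition t up down := by
  obtain ⟨h1, h2, -, h4⟩ := greedyPartition_spec _ hd order
    (ho.nodup_iff.2 (nodup_dedup _)) (fun p hp => by
      obtain ⟨h1, h2, h3, h4⟩ := mem_unaryPairs ht hp
      exact ⟨ho.mem_iff.2 (mem_unaryLetters.2 ⟨h1, h2⟩),
        ho.mem_iff.2 (mem_unaryLetters.2 ⟨h3, h4⟩)⟩) h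
  exact ⟨h1, fun a ha => (mem_unaryLetters.1 (ho.mem_iff.1 (h2 a ha))).1, h4⟩

lemma unaryComp_eq_of_fresh {s : State} {ν : Key → Symb} (h : Fresh s ν) {up down : Finset Symb}
    (hp : IsGoodPartition s.tree up down) : unaryComp ν up down s.tree =
      runComp (fun a b => decide (a ∈ up ∧ b ∈ down)) (pairLetter ν) id s.tree :=
  unaryComp_eq ν up down hp.disjoint (fun _ _ hm => h.not_mem_tree _ (hp.down_mem _ hm)) _

lemma isTree_unaryComp {s : State} {ν : Key → Symb} (h : Fresh s ν) (hT : s.tree.IsTree)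
    {up down : Finset Symb} (hp : IsGoodPartition s.tree up down) :
    (unaryComp ν up down s.tree).IsTree := by
  rw [unaryComp_eq_of_fresh h hp]
  refine ⟨wellRanked_runComp ?_ (fun _ => rfl) _ hT.1, by rw [params_runComp, hT.2]⟩
  intro a w ha
  cases w with
  | nil => exact ha
  | cons b w => exact h.rank_eq _

lemma isTree_leafComp {s : State} {ν : Key → Symb} (h : Fresh s ν) (hT : s.tree.IsTree) :
    (leafComp ν s.tree).IsTree := by
  rw [leafComp_eq]; refine ⟨wellRanked_absorb ?_ _ hT.1, by rw [params_absorb, hT.2]⟩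
  intro f p hf; rw [leafLetter]; split_ifs with hp
  · exact h.rank_eq _
  · rw [hf, eq_comm, countP_eq_length]; intro a ha; simp at hp; simpa using hp a ha

/-- With `N` nodes, `P` unary pairs and `L` leaves after chain compression, pair compression removes
at least `P / 4` nodes and leaf compression removes `L`. Since `N + 2 ≤ P + 4 L`, at least a quarter
of the nodes disappears. -/
lemma Phase.isTree_and_size {s s' : State} (h : Phase s s') (hT : s.tree.IsTree)
    (hs : 1 < s.tree.size) : s'.tree.IsTree ∧ 4 * s'.tree.size ≤ 3 * s.tree.size := by
  obtain ⟨s₁, s₂, _, ν₁, ν₂, ν₃, order, up, down, f₁, rfl, ho, hg, f₂, rfl, f₃, rfl⟩ := h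
  obtain ⟨t₁, d₁⟩ := isTree_chainComp f₁ hT; have hp := isGoodPartition t₁.1 d₁ ho hg
  have t₂ := isTree_unaryComp f₂ t₁ hp; refine ⟨isTree_leafComp f₃ t₂, ?_⟩
  have e₁ := chainComp_eq ν₁ _ hT.1; have e₂ := unaryComp_eq_of_fresh f₂ hp
  have z₁ := size_runComp (R := fun a b => decide (a = b)) (φ := chainLetter ν₁) (g := id) s.tree
  have z₂ := size_runComp (R := fun a b => decide (a ∈ up ∧ b ∈ down)) (φ := pairLetter ν₂) (g := id)
    (chainStep ν₁ s).tree
  have z₃ := size_absorb (g := leafLetter ν₃) (unaryStep ν₂ up down (chainStep ν₁ s)).tree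
  have hc : constOf s.tree = none := by
    rcases hc : constOf s.tree with _ | c
    · rfl
    · rw [constOf_eq_some.1 hc] at hs; simp at hs
  have hl : numLeaves (unaryStep ν₂ up down (chainStep ν₁ s)).tree =
      numLeaves (chainStep ν₁ s).tree := by
    change numLeaves (unaryComp ν₂ up down (chainStep ν₁ s).tree) = _; rw [e₂, numLeaves_runComp]
  have hc₂ : constOf (unaryStep ν₂ up down (chainStep ν₁ s)).tree = none := by
    change constOf (unaryComp ν₂ up down (chainStep ν₁ s).tree) = _; rw [e₂]
    refine constOf_runComp _ ?_; change constOf (chainComp ν₁ s.tree) = _; rw [e₁]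
    exact constOf_runComp _ hc
  have hle := (size_le_pairs_leaves _ t₁.2).1; have hq := hp.le; rw [← e₁] at z₁; rw [← e₂] at z₂
  rw [hl, hc₂, ← leafComp_eq] at z₃; simp at z₃; simp only [countPairs] at hq
  simp only [leafStep, unaryStep, chainStep] at *; omega

/-! ### Termination -/

variable {ν : Key → Symb} {s s' : State}

lemma countable_symb : Countable Symb :=
  Function.Injective.countable (f := fun a : Symb => (a.rank, a.id)) (by
    rintro ⟨a, b⟩ ⟨c, d⟩ h
    simpa using h)

lemma countable_key : Countable Key := by
  have := countable_symb
  refine Function.Injective.countable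
    (f := fun k : Key => (match k with
      | .chain a l => (0, a, l, a, [])
      | .pow a i => (1, a, i, a, [])
      | .diff a d => (2, a, d, a, [])
      | .pair a b => (3, a, 0, b, [])
      | .leaf f pat => (4, f, 0, f, pat) : ℕ × Symb × ℕ × Symb × List (Option Symb))) ?_
  intro k k' h
  cases k <;> cases k' <;> simp_all

lemma exists_fresh (s : State) : ∃ ν, Fresh s ν := by
  have := countable_key; obtain ⟨e, he⟩ := exists_injective_nat Key
  have hb : ∀ l : List Symb, ∀ a ∈ l, a.id ≤ (l.map Symb.id).sum := by
    intro l a ha; exact le_sum_of_mem (mem_map_of_mem ha)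
  refine ⟨fun k => ⟨k.rank, (s.used.map Symb.id).sum + 1 + e k⟩, ⟨?_, fun _ => rfl, ?_⟩⟩
  · intro k k' h; simp at h; exact he (by omega)
  · intro k hk; have := hb _ _ hk; simp only at this; omega

lemma exists_phase (s : State) : ∃ s', Phase s s' := by
  obtain ⟨ν₁, h₁⟩ := exists_fresh s; obtain ⟨ν₂, h₂⟩ := exists_fresh (chainStep ν₁ s)
  let p := greedyPartition (unaryPairs (chainStep ν₁ s).tree) (unaryLetters (chainStep ν₁ s).tree)
  obtain ⟨ν₃, h₃⟩ := exists_fresh (unaryStep ν₂ p.1 p.2 (chainStep ν₁ s))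
  exact ⟨_, .mk s _ _ _ ν₁ ν₂ ν₃ _ p.1 p.2 h₁ rfl (.refl _) rfl h₂ rfl h₃ rfl⟩

lemma exists_loop (n : ℕ) (s : State) (hs : s.tree.size ≤ n) (hT : s.tree.IsTree) :
    ∃ s', Loop s s' ∧ s'.tree.IsTree ∧ s'.tree.size ≤ 1 := by
  induction n generalizing s with
  | zero => exact ⟨s, .done s (by omega), hT, by omega⟩
  | succ n ih =>
    by_cases h : s.tree.size ≤ 1
    · exact ⟨s, .done s h, hT, h⟩
    · obtain ⟨s', hp⟩ := exists_phase s; obtain ⟨h1, h2⟩ := hp.isTree_and_size hT (by omega)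
      obtain ⟨s'', h3, h4⟩ := ih s' (by omega) h1
      exact ⟨s'', .step s s' s'' (by omega) hp h3, h4⟩

lemma exists_produces (T : Pat Symb) (hT : T.IsTree) : ∃ R : Grammar, Produces T R := by
  obtain ⟨s, h1, h2, h3⟩ := exists_loop T.size ⟨T, []⟩ le_rfl hT
  obtain ⟨c, hc⟩ := eq_const_of_size_le_one h2.2 h3; exact ⟨⟨s.prods, c⟩, s, h1, hc, rfl⟩

end TtoG

/-! ### Contexts -/

open TtoG

namespace Sim

/-- A node with a hole among its children. -/
@[ext] structure Frame (α τ : Type) where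
  label : α
  pre : List τ
  post : List τ

variable {α β τ σ X : Type}

/-- A unary letter above the hole. -/
def Frame.letter (a : α) : Frame α τ := ⟨a, [], []⟩

/-- Apply a function to all children. -/
def Frame.map (f : τ → σ) (x : Frame α τ) : Frame α σ := ⟨x.label, x.pre.map f, x.post.map f⟩

/-- Put a tree into the hole. -/
def Frame.fill (x : Frame α (Pat α)) (t : Pat α) : Pat α := node x.label (x.pre ++ t :: x.post)

/-- Put a tree below a sequence of frames. -/
def plug (L : List (Frame α (Pat α))) (t : Pat α) : Pat α := L.foldr Frame.fill t

@[simp] lemma plug_nil (t : Pat α) : plug [] t = t := rfl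
@[simp] lemma plug_cons (x : Frame α (Pat α)) (L : List (Frame α (Pat α))) (t : Pat α) :
    plug (x :: L) t = x.fill (plug L t) := rfl
lemma plug_append (L L' : List (Frame α (Pat α))) (t : Pat α) :
    plug (L ++ L') t = plug L (plug L' t) := by simp [plug]

/-- Distinguish unary letters from other frames. -/
def Frame.token (x : Frame α τ) : α ⊕ Frame α τ := match x with
  | ⟨a, [], []⟩ => .inl a
  | x => .inr x

lemma Frame.token_letter (a : α) : (Frame.letter a : Frame α τ).token = .inl a := rfl

lemma Frame.eq_letter_or (x : Frame α τ) :
    (∃ a, x = Frame.letter a) ∨ (x.pre.length + x.post.length ≠ 0 ∧ x.token = .inr x) := by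
  rcases x with ⟨a, _ | ⟨p, pre⟩, _ | ⟨q, post⟩⟩
  · exact .inl ⟨a, rfl⟩
  all_goals exact .inr ⟨by simp, rfl⟩

/-! ### Runs in sequences of letters and other items -/

/-- The state of the right-to-left decomposition into maximal linked runs: the run on top that is
still open, the finished runs and other items, and the bottommost run (`none` if it is the open
one). -/
structure RunState (α X : Type) where
  top : List α
  mid : List (List α ⊕ X)
  bot : Option (List α)

variable {L : List (Frame α τ)} {s : RunState α X} {a : α} {w b : List α}

/-- A finished run, if it is nonempty. -/
def runItem : List α → List (List α ⊕ X)
  | [] => []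
  | a :: w => [.inl (a :: w)]

/-- Close the open run. -/
def RunState.close (s : RunState α X) : RunState α X := match s.bot with
  | none => ⟨[], s.mid, some s.top⟩
  | some b => ⟨[], runItem s.top ++ s.mid, some b⟩

/-- Add a letter or another item on top. -/
def RunState.push (R : α → α → Bool) (x : α ⊕ X) (s : RunState α X) : RunState α X := match x with
  | .inl a => match s.top with
    | [] => ⟨[a], s.mid, s.bot⟩
    | b :: w => if R a b then ⟨a :: b :: w, s.mid, s.bot⟩ else ⟨[a], s.close.mid, s.close.bot⟩
  | .inr x => ⟨[], .inr x :: s.close.mid, s.close.bot⟩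

/-- The decomposition of a sequence, continuing from a given state. -/
def pushAll (R : α → α → Bool) (l : List (α ⊕ X)) (s : RunState α X) : RunState α X :=
  l.foldr (RunState.push R) s

variable {R : α → α → Bool}

@[simp] lemma pushAll_nil (s : RunState α X) : pushAll R [] s = s := rfl
@[simp] lemma pushAll_cons (x : α ⊕ X) (l : List (α ⊕ X)) (s : RunState α X) :
    pushAll R (x :: l) s = (pushAll R l s).push R x := rfl
lemma pushAll_append (l l' : List (α ⊕ X)) (s : RunState α X) :
    pushAll R (l ++ l') s = pushAll R l (pushAll R l' s) := by simp [pushAll]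

lemma RunState.close_bot (s : RunState α X) : ∃ b, s.close.bot = some b := by
  obtain ⟨t, m, _ | b⟩ := s
  · exact ⟨_, rfl⟩
  · exact ⟨_, rfl⟩

lemma RunState.push_bot (h : s.bot = some b) (x : α ⊕ X) : (s.push R x).bot = some b := by
  obtain ⟨t, m, b'⟩ := s; obtain rfl : b' = some b := h; rcases x with a | x
  · rcases t with _ | ⟨c, t⟩
    · rfl
    · by_cases hr : R a c <;> simp [RunState.push, hr, RunState.close]
  · rfl

lemma pushAll_bot (h : s.bot = some b) (l : List (α ⊕ X)) : (pushAll R l s).bot = some b := by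
  induction l with
  | nil => exact h
  | cons x l ih => exact RunState.push_bot ih x

lemma pushAll_letters_top (s : RunState α X) (c : α) (w : List α) :
    ∃ w', (pushAll R ((c :: w).map .inl) s).top = c :: w' := by
  rw [map_cons, pushAll_cons]; generalize pushAll R (w.map .inl) s = s
  obtain ⟨_ | ⟨d, t⟩, m, b⟩ := s
  · exact ⟨_, rfl⟩
  · by_cases hr : R c d
    · exact ⟨d :: t, by simp [RunState.push, hr]⟩
    · exact ⟨[], by simp [RunState.push, hr]⟩

/-- Add a nonempty linked run on top. -/
def RunState.pushWord (R : α → α → Bool) (a : α) (w : List α) (s : RunState α X) : RunState α X :=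
  match s.top with
  | [] => ⟨a :: w, s.mid, s.bot⟩
  | b :: v => if R ((a :: w).getLast (by simp)) b then ⟨a :: w ++ b :: v, s.mid, s.bot⟩
    else ⟨a :: w, s.close.mid, s.close.bot⟩

/-- A linked word enters the decomposition as a whole; only its last letter meets what is already
there. -/
lemma pushAll_linked (a : α) (w : List α) (h : Linked R (a :: w)) (s : RunState α X) :
    pushAll R ((a :: w).map .inl) s = s.pushWord R a w := by
  induction w generalizing a with
  | nil =>
    simp
    obtain ⟨_ | ⟨d, t⟩, m, b⟩ := s <;> rfl
  | cons b w ih =>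
    simp [Linked] at h; rw [map_cons, pushAll_cons, ih b h.2]; obtain ⟨_ | ⟨d, t⟩, m, bt⟩ := s
    · simp [RunState.push, RunState.pushWord, h.1]
    · by_cases hr : R ((b :: w).getLast (by simp)) d
      · simp [RunState.push, RunState.pushWord, hr, h.1]
      · simp [RunState.push, RunState.pushWord, hr, h.1]

/-- The decomposition of a context. -/
def ctxRuns (R : α → α → Bool) (L : List (Frame α τ)) : RunState α (Frame α τ) :=
  pushAll R (L.map Frame.token) ⟨[], [], none⟩

lemma ctxRuns_cons (x : Frame α τ) (L : List (Frame α τ)) :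
    ctxRuns R (x :: L) = (ctxRuns R L).push R x.token := rfl

/-- The bottom run stays open as long as nothing has been closed, that is, as long as the whole
context is a single run of unary letters. Such a nonterminal disappears when its runs are popped. -/
lemma ctxRuns_of_none (h : (ctxRuns R L).bot = none) :
    L = (ctxRuns R L).top.map Frame.letter ∧ (ctxRuns R L).mid = [] ∧
      Linked R (ctxRuns R L).top := by
  induction L with
  | nil => simp [ctxRuns, Linked]
  | cons x L ih =>
    rw [ctxRuns_cons] at h ⊢
    have hn : (ctxRuns R L).bot = none := by
      rcases hb : (ctxRuns R L).bot with _ | b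
      · rfl
      · rw [RunState.push_bot hb] at h; cases h
    obtain ⟨h1, h2, h3⟩ := ih hn; generalize ctxRuns R L = s at *; obtain ⟨t, m, b⟩ := s
    dsimp only at *; subst h1 h2 hn; rcases x.eq_letter_or with ⟨a, rfl⟩ | ⟨-, e⟩
    · rw [Frame.token_letter] at h ⊢; rcases t with _ | ⟨c, t⟩
      · simp [RunState.push, Linked]
      · by_cases hr : R a c
        · simp only [RunState.push, hr, if_true]
          exact ⟨by simp, trivial, by simpa [Linked, hr] using h3⟩
        · simp [RunState.push, hr, RunState.close] at h
    · rw [e] at h; simp [RunState.push, RunState.close] at h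

lemma linked_ctxRuns (L : List (Frame α τ)) : Linked R (ctxRuns R L).top ∧
    ∀ b, (ctxRuns R L).bot = some b → Linked R b := by
  induction L with
  | nil => simp [ctxRuns, Linked]
  | cons x L ih =>
    rw [ctxRuns_cons]; generalize ctxRuns R L = s at *; obtain ⟨t, m, b⟩ := s; dsimp only at *
    have hc : ∀ b', (RunState.close ⟨t, m, b⟩ : RunState α (Frame α τ)).bot = some b' →
        Linked R b' := by
      intro b' hb'; rcases b with _ | b
      · simp [RunState.close] at hb'; subst hb'; exact ih.1
      · simp [RunState.close] at hb'; subst hb'; exact ih.2 _ rfl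
    rcases x.token with a | x
    · rcases t with _ | ⟨c, t⟩
      · exact ⟨by simp [RunState.push, Linked], ih.2⟩
      · by_cases hr : R a c
        · simp [RunState.push, hr]; exact ⟨by simpa [Linked, hr] using ih.1, ih.2⟩
        · simp only [RunState.push, hr]; exact ⟨by simp [Linked], by simpa using hc⟩
    · exact ⟨by simp [RunState.push, Linked], by simpa [RunState.push] using hc⟩

/-- Only the bottom run of a context can interact with what lies below, and only the top run with
what lies above; the middle is the same in every environment. This is what makes compression inside
a nonterminal possible after popping both ends. -/
lemma pushAll_ctx (h : (ctxRuns R L).bot = some b)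
    (s : RunState α (Frame α τ)) : pushAll R (L.map Frame.token) s =
      ⟨(ctxRuns R L).top, (ctxRuns R L).mid ++ (pushAll R (b.map .inl) s).close.mid,
        (pushAll R (b.map .inl) s).close.bot⟩ := by
  induction L generalizing b with
  | nil => simp [ctxRuns] at h
  | cons x L ih =>
    rw [map_cons, pushAll_cons]; rcases hb : (ctxRuns R L).bot with _ | b'
    · obtain ⟨h1, h2, h3⟩ := ctxRuns_of_none hb
      have e : L.map Frame.token = (ctxRuns R L).top.map .inl := by
        conv_lhs => rw [h1]
        simp [Frame.token_letter, Function.comp_def]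
      rw [ctxRuns_cons] at h ⊢; rw [e]; generalize ctxRuns R L = s' at *; obtain ⟨t, m, b''⟩ := s'
      dsimp only at hb h1 h2 h3 e; subst hb h2; generalize x.token = y at h ⊢; rcases y with a | x
      · rcases t with _ | ⟨c, t⟩
        · simp [RunState.push] at h
        · by_cases hr : R a c
          · simp [RunState.push, hr] at h
          · simp only [RunState.push, hr, RunState.close, Bool.false_eq_true, if_false,
              Option.some.injEq] at h ⊢
            subst h; obtain ⟨w', hw'⟩ := pushAll_letters_top (R := R) s c t; rw [hw']
            simp [hr]
      · simp [RunState.push, RunState.close] at h ⊢; subst h; simp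
    · rw [ih hb]; rw [ctxRuns_cons, RunState.push_bot hb] at h; obtain rfl := Option.some.inj h
      rw [ctxRuns_cons]; obtain ⟨b'', hb''⟩ := (pushAll R (b'.map .inl) s).close_bot; rw [hb'']
      generalize ctxRuns R L = s' at *; obtain ⟨t, m, b3⟩ := s'; dsimp only at *; subst hb
      rcases x.token with a | x
      · rcases t with _ | ⟨c, t⟩
        · rfl
        · by_cases hr : R a c <;> simp [RunState.push, hr, RunState.close]
      · simp [RunState.push, RunState.close]

open RunState (push close pushWord push_bot)
open Frame (letter fill token_letter token)

/-! ### Run compression of contexts -/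

variable {φ : α → List α → β} {g : α → β}

/-- The compressed form of a finished run or of another frame. -/
def compressItem (R : α → α → Bool) (φ : α → List α → β) (g : α → β) :
    List α ⊕ Frame α (Pat α) → List (Frame β (Pat β))
  | .inl [] => []
  | .inl (a :: w) => [letter (φ a w)]
  | .inr x => [⟨g x.label, x.pre.map (runComp R φ g), x.post.map (runComp R φ g)⟩]

lemma finish_eq_plug (w : List α) (t : Pat β) :
    finish φ (w, t) = plug ((runItem w).flatMap (compressItem R φ g)) t := by
  cases w <;> simp [finish, runItem, compressItem, fill, letter]

/-- Reduces compression of a tree to a computation along a path: below the path only the open run of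
the lower tree is visible. -/
lemma splitRun_plug (L : List (Frame α (Pat α))) (t : Pat α) : splitRun R φ g (plug L t) =
      ((pushAll R (L.map token) ⟨(splitRun R φ g t).1, [], some []⟩).top,
        plug ((pushAll R (L.map token) ⟨(splitRun R φ g t).1, [], some []⟩).mid.flatMap
          (compressItem R φ g)) (splitRun R φ g t).2) := by
  induction L with
  | nil => simp
  | cons x L ih =>
    rw [map_cons, pushAll_cons, plug_cons]
    have hb := pushAll_bot (R := R) (s := ⟨(splitRun R φ g t).1, [], some []⟩) rfl
      (L.map token)
    generalize pushAll R (L.map token) ⟨(splitRun R φ g t).1, [], some []⟩ = s at *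
    obtain ⟨tp, m, b⟩ := s; dsimp only at *; subst hb; rcases x.eq_letter_or with ⟨a, rfl⟩ | ⟨hl, e⟩
    · have e : (letter a : Frame α (Pat α)).fill (plug L t) = node a [plug L t] := rfl
      rw [e, splitRun_unary, ih, token_letter]; rcases tp with _ | ⟨c, tp⟩
      · rfl
      · by_cases hr : R a c
        · simp [pushRun, push, hr]
        · simp [pushRun, push, hr, close, runItem, compressItem, fill, letter]
    · rw [fill, splitRun_node _ _ (by simp; omega), e]
      simp [push, close]
      have : runComp R φ g (plug L t) = plug ((runItem tp ++ m).flatMap (compressItem R φ g))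
          (splitRun R φ g t).2 := by
        rw [runComp, ih, flatMap_append, plug_append, finish_eq_plug (R := R) (g := g)]
      rw [this]; simp [compressItem, fill]

/-! ### Internal grammars -/

/-- Nonterminals of rank `0`: original ones and those for the children of popped frames. -/
inductive Name0
  | orig (C : Symb)
  | child (D : Symb) (j : ℕ)
deriving DecidableEq

/-- Nonterminals. -/
inductive Name
  | one (A : Symb)
  | zero (C : Name0)
deriving DecidableEq

/-- A constant or a nonterminal of rank `0`. -/
inductive End (α : Type)
  | con (c : α)
  | nt (C : Name0)

/-- A chain of unary letters above a constant or a nonterminal of rank `0`. -/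
structure Twig (α : Type) where
  chain : List α
  last : End α

/-- A frame with twigs as children, or a nonterminal of rank `1`. -/
inductive Item (α : Type)
  | frame (x : Frame α (Twig α))
  | nt (B : Symb)

/-- A right-hand side; for nonterminals of rank `1`, the last entry is `none`. -/
structure Rule (α : Type) where
  items : List (Item α)
  last : Option (End α)

/-- A grammar in which also the values of the nonterminals are given. -/
structure Gram (α : Type) where
  rule : Name → Rule α
  ctx : Symb → List (Frame α (Pat α))
  val : Name0 → Pat α

def End.names : End α → List Name
  | .con _ => []
  | .nt C => [.zero C]

def Twig.names (t : Twig α) : List Name := t.last.names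

def Item.names : Item α → List Name
  | .frame x => (x.pre ++ x.post).flatMap Twig.names
  | .nt B => [.one B]

def Rule.lastNames (r : Rule α) : List Name := r.last.elim [] End.names

/-- The nonterminals in a right-hand side, from left to right. -/
def Rule.names (r : Rule α) : List Name := r.items.flatMap Item.names ++ r.lastNames

variable (G : Gram α) {t : Pat α} {x : Frame α (Pat α)}

def Gram.endVal : End α → Pat α
  | .con c => node c []
  | .nt C => G.val C

def Gram.twigVal (t : Twig α) : Pat α := plug (t.chain.map letter) (G.endVal t.last)

def Gram.itemVal : Item α → List (Frame α (Pat α))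
  | .frame x => [x.map G.twigVal]
  | .nt B => G.ctx B

def Gram.itemsVal (l : List (Item α)) : List (Frame α (Pat α)) := l.flatMap G.itemVal

/-- The local equations: the value of a nonterminal is the value of its right-hand side. -/
def Gram.Holds : Name → Prop
  | .one A => (G.rule (.one A)).last = none ∧ G.ctx A = G.itemsVal (G.rule (.one A)).items
  | .zero C => ∃ e, (G.rule (.zero C)).last = some e ∧
      G.val C = plug (G.itemsVal (G.rule (.zero C)).items) (G.endVal e)

@[simp] lemma Gram.itemsVal_nil : G.itemsVal [] = [] := rfl
@[simp] lemma Gram.itemsVal_cons (i : Item α) (l : List (Item α)) :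
    G.itemsVal (i :: l) = G.itemVal i ++ G.itemsVal l := rfl
lemma Gram.itemsVal_append (l l' : List (Item α)) :
    G.itemsVal (l ++ l') = G.itemsVal l ++ G.itemsVal l' := by simp [itemsVal]

lemma Frame.map_letter (f : τ → σ) (a : α) : (letter a : Frame α τ).map f = letter a := rfl

lemma Gram.itemsVal_letters (w : List α) :
    G.itemsVal (w.map fun a => .frame (letter a)) = w.map letter := by
  induction w with
  | nil => rfl
  | cons a w ih => simp [ih, itemVal, Frame.map_letter]

lemma Frame.token_map (f : τ → σ) (x : Frame α τ) :
    (x.map f).token = x.token.map id (Frame.map f) := by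
  rcases x with ⟨a, _ | ⟨p, pre⟩, _ | ⟨q, post⟩⟩ <;> rfl

/-! ### Runs in right-hand sides -/

/-- Explicit letters; runs popped from the top or from the bottom of a nonterminal; the value of a
removed nonterminal. -/
inductive Tag
  | ex | rt | lf | rm
deriving DecidableEq

/-- A piece of a run. -/
structure Part (α : Type) where
  tag : Tag
  word : List α

variable {ps : List (Part α)} {p : Part α} {ru : Rule α} {l : List (Item α)} {e : End α}

/-- The piece with the given letters, if there are any. -/
def parts (tag : Tag) : List α → List (Part α)
  | [] => []
  | a :: w => [⟨tag, a :: w⟩]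

variable (R)

def partLink (p q : Part α) : Bool := match p.word.getLast?, q.word.head? with
  | some a, some b => R a b
  | _, _ => false

/-- A new label: a compressed run, or the label of a node that is not in a run. -/
inductive Blk (α : Type)
  | run (a : α) (w : List α)
  | other (a : α)

/-- The maximal run at the root and the compressed rest. -/
abbrev cut (t : Pat α) : List α × Pat (Blk α) := splitRun R Blk.run Blk.other t

abbrev comp (t : Pat α) : Pat (Blk α) := runComp R Blk.run Blk.other t

/-- The contribution of an item to the runs of the rule around it. A nonterminal stands between the
runs popped from its top and from its bottom; if its context is one single run, it is replaced by
that run. -/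
def Gram.itemToks : Item α → List (Part α ⊕ Item α)
  | .frame x => match x.token with
    | .inl a => [.inl ⟨.ex, [a]⟩]
    | .inr x => [.inr (.frame x)]
  | .nt B => match (ctxRuns R (G.ctx B)).bot with
    | none => (parts .rm (ctxRuns R (G.ctx B)).top).map .inl
    | some b => (parts .rt (ctxRuns R (G.ctx B)).top).map .inl ++ .inr (.nt B) ::
        (parts .lf b).map .inl

/-- For rules of rank 1 the bottom run is still open and will itself be popped. For rank 0 it is set
to `some []`, so that all finished runs stay in the rule, and an end nonterminal contributes the run
popped from its top. -/
def Gram.startState : Option (End α) → RunState (Part α) (Item α)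
  | none => ⟨[], [], none⟩
  | some (.con _) => ⟨[], [], some []⟩
  | some (.nt C) => ⟨parts .rt (cut R (G.val C)).1, [], some []⟩

def Gram.runs (r : Rule α) : RunState (Part α) (Item α) :=
  pushAll (partLink R) (r.items.flatMap (G.itemToks R)) (G.startState R r.last)

/-- The letters of a run. -/
def flat (ps : List (Part α)) : List α := ps.flatMap Part.word

def Gram.evMid : List (Part α) ⊕ Item α → List (List α ⊕ Frame α (Pat α))
  | .inl ps => [.inl (flat ps)]
  | .inr (.frame x) => [.inr (x.map G.twigVal)]
  | .inr (.nt B) => (ctxRuns R (G.ctx B)).mid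

/-- Reads a decomposition of a right-hand side as a decomposition of its value: pieces are
concatenated, and a surviving nonterminal is replaced by the middle part of its own decomposition.
-/
def Gram.ev (s : RunState (Part α) (Item α)) : RunState α (Frame α (Pat α)) :=
  ⟨flat s.top, s.mid.flatMap (G.evMid R), s.bot.map flat⟩

variable {R}

section

variable {S : Name0}

lemma flat_eq_nil (h : ∀ p ∈ ps, p.word ≠ []) : flat ps = [] ↔ ps = [] := by
  cases ps with
  | nil => simp [flat]
  | cons p ps => simp [flat, h p (by simp)]

lemma Gram.ev_close (s : RunState (Part α) (Item α)) (h : ∀ p ∈ s.top, p.word ≠ []) :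
    G.ev R s.close = (G.ev R s).close := by
  obtain ⟨t, m, _ | b⟩ := s
  · simp [close, ev, flat]
  · rcases t with _ | ⟨p, t⟩
    · simp [close, ev, flat, runItem]
    · have hp : flat (p :: t) ≠ [] := by
        rw [Ne, flat_eq_nil h]; simp
      obtain ⟨a, w, hw⟩ := exists_cons_of_ne_nil hp; simp [close, ev, hw, runItem, evMid]; rfl

lemma flat_cons (p : Part α) (ps : List (Part α)) : flat (p :: ps) = p.word ++ flat ps := rfl

lemma Gram.ev_push_part (s : RunState (Part α) (Item α)) (h : ∀ p ∈ s.top, p.word ≠ [])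
    (tag : Tag) (a : α) (w : List α) :
    G.ev R (s.push (partLink R) (.inl ⟨tag, a :: w⟩)) = (G.ev R s).pushWord R a w ∧
      ∀ p ∈ (s.push (partLink R) (.inl ⟨tag, a :: w⟩)).top, p.word ≠ [] := by
  have hc := G.ev_close (R := R) s h; obtain ⟨_ | ⟨⟨tg, v⟩, t⟩, m, b⟩ := s
  · exact ⟨by simp [push, pushWord, ev, flat], by simp [push]⟩
  · obtain ⟨c, v, rfl⟩ := exists_cons_of_ne_nil (h ⟨tg, v⟩ (by simp))
    have hl : partLink R ⟨tag, a :: w⟩ ⟨tg, c :: v⟩ = R ((a :: w).getLast (by simp)) c := by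
      simp [partLink, getLast?_eq_some_getLast]
    have ht : (G.ev R ⟨⟨tg, c :: v⟩ :: t, m, b⟩).top = c :: (v ++ flat t) := rfl; rw [pushWord, ht]
    by_cases hr : R ((a :: w).getLast (by simp)) c
    · simp only [push, hl, hr, if_true]; refine ⟨?_, ?_⟩
      · simp [ev, flat]
      · intro p hp; rcases mem_cons.1 hp with rfl | hp
        · simp
        · exact h p hp
    · simp only [push, hl, hr]; refine ⟨?_, by simp⟩
      simp; rw [← hc]; simp [ev, flat]

lemma Gram.ev_push_parts (s : RunState (Part α) (Item α)) (h : ∀ p ∈ s.top, p.word ≠ [])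
    (tag : Tag) (w : List α) (hw : Linked R w) :
    G.ev R (pushAll (partLink R) ((parts tag w).map .inl) s) = pushAll R (w.map .inl) (G.ev R s) ∧
      ∀ p ∈ (pushAll (partLink R) ((parts tag w).map .inl) s).top, p.word ≠ [] := by
  rcases w with _ | ⟨a, w⟩
  · exact ⟨rfl, h⟩
  · rw [pushAll_linked a w hw]; exact G.ev_push_part s h tag a w

/-- The runs of a value can be computed from the right-hand side once the top and bottom runs of the
nonterminals in it are known. The case of a nonterminal is `pushAll_ctx`. -/
lemma Gram.ev_pushAll (l : List (Item α)) (s : RunState (Part α) (Item α))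
    (h : ∀ p ∈ s.top, p.word ≠ []) :
    G.ev R (pushAll (partLink R) (l.flatMap (G.itemToks R)) s) =
        pushAll R ((G.itemsVal l).map token) (G.ev R s) ∧
      ∀ p ∈ (pushAll (partLink R) (l.flatMap (G.itemToks R)) s).top, p.word ≠ [] := by
  induction l with
  | nil => exact ⟨rfl, h⟩
  | cons i l ih =>
    rw [flatMap_cons, pushAll_append, itemsVal_cons, map_append, pushAll_append, ← ih.1]
    generalize pushAll (partLink R) (l.flatMap (G.itemToks R)) s = s at ih ⊢
    replace ih := ih.2
    rcases i with x | B
    · simp [itemVal, Frame.token_map, itemToks]; rcases x.token with a | x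
      · exact G.ev_push_parts s ih .ex [a] (by simp [Linked])
      · simp only [pushAll_cons, pushAll_nil, Sum.map_inr, push, ← G.ev_close s ih]
        refine ⟨by simp [ev, evMid, flat], by simp⟩
    · obtain ⟨h1, h2⟩ := linked_ctxRuns (R := R) (G.ctx B); simp only [itemVal, itemToks]
      rcases hb : (ctxRuns R (G.ctx B)).bot with _ | b
      · have hc := (ctxRuns_of_none hb).1
        have e : (G.ctx B).map token = (ctxRuns R (G.ctx B)).top.map .inl := by
          conv_lhs => rw [hc]
          simp [token_letter, Function.comp_def]
        rw [e]; exact G.ev_push_parts s ih _ _ h1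
      · simp only; rw [pushAll_append, pushAll_cons, pushAll_ctx hb]
        obtain ⟨e1, e2⟩ := G.ev_push_parts s ih .lf b (h2 b hb); rw [← e1]
        generalize pushAll (partLink R) ((parts .lf b).map .inl) s = s at e2 ⊢
        rw [← G.ev_close s e2]
        have hw : ∀ p ∈ (s.push (partLink R) (.inr (Item.nt B))).top, p.word ≠ [] := by simp [push]
        obtain ⟨e3, e4⟩ := G.ev_push_parts _ hw .rt _ h1; refine ⟨?_, e4⟩; rw [e3]
        generalize (ctxRuns R (G.ctx B)).top = t at h1 ⊢; rcases t with _ | ⟨a, w⟩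
        · simp [ev, evMid, push, flat]
        · rw [pushAll_linked a w h1]; simp [ev, evMid, push, flat, pushWord]

lemma Gram.startState_ne (e : Option (End α)) : ∀ p ∈ (G.startState R e).top, p.word ≠ [] := by
  rcases e with _ | c | C
  · simp [startState]
  · simp [startState]
  · simp only [startState]
    rcases (cut R (G.val C)).1 with _ | ⟨a, w⟩ <;> simp [parts]

lemma Gram.ev_startState (e : End α) :
    G.ev R (G.startState R (some e)) = ⟨(cut R (G.endVal e)).1, [], some []⟩ := by
  rcases e with c | C
  · simp [startState, ev, endVal, flat, splitRun_node]
  · simp only [startState, ev, endVal]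
    rcases (cut R (G.val C)).1 with _ | ⟨a, w⟩ <;> simp [parts, flat]

lemma Gram.ev_runs_none (r : Rule α) (h : r.last = none) :
    G.ev R (G.runs R r) = ctxRuns R (G.itemsVal r.items) := by
  rw [runs, (G.ev_pushAll _ _ (G.startState_ne _)).1, h]; rfl

lemma Gram.ev_runs_some (r : Rule α) (h : r.last = some e) :
    G.ev R (G.runs R r) = pushAll R ((G.itemsVal r.items).map token)
      ⟨(cut R (G.endVal e)).1, [], some []⟩ := by
  rw [runs, (G.ev_pushAll _ _ (G.startState_ne _)).1, h, ev_startState]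

lemma Gram.runs_ne (r : Rule α) : ∀ p ∈ (G.runs R r).top, p.word ≠ [] :=
  (G.ev_pushAll _ _ (G.startState_ne _)).2

/-! ### Run compression of grammars -/

/-- The letter for a run. -/
def blkOf : List (Part α) → List (Blk α) := fun ps => match flat ps with
  | [] => []
  | a :: w => [.run a w]

def newEnd : End α → End (Blk α)
  | .con c => .con (.other c)
  | .nt C => .nt C

variable (R)

/-- The items of a rule after run compression, where the run on top is kept. -/
def Gram.keptRuns (r : Rule α) : List (List (Part α) ⊕ Item α) :=
  runItem (G.runs R r).top ++ (G.runs R r).mid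

def twigRule (t : Twig α) : Rule α := ⟨t.chain.map fun a => .frame (letter a), some t.last⟩

def Gram.newTwig (t : Twig α) : Twig (Blk α) where
  chain := (G.keptRuns R (twigRule t)).flatMap (Sum.elim blkOf fun _ => [])
  last := newEnd t.last

def Gram.newItem : List (Part α) ⊕ Item α → List (Item (Blk α))
  | .inl ps => (blkOf ps).map (fun a => .frame (letter a))
  | .inr (.frame x) => [.frame ⟨.other x.label, x.pre.map (G.newTwig R), x.post.map (G.newTwig R)⟩]
  | .inr (.nt B) => [.nt B]

/-- The grammar after run compression: from every nonterminal except `S`, the run on top and (for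
rank `1`) the run at the bottom are popped. -/
def Gram.runStep (S : Name0) : Gram (Blk α) where
  rule X := ⟨(if X = .zero S then G.keptRuns R (G.rule X) else (G.runs R (G.rule X)).mid).flatMap
    (G.newItem R), (G.rule X).last.map newEnd⟩
  ctx A := (ctxRuns R (G.ctx A)).mid.flatMap (compressItem R Blk.run Blk.other)
  val C := if C = S then comp R (G.val C) else (cut R (G.val C)).2

variable {R}

def Gram.FrameOk (x : Frame α (Twig α)) (S : Name0) : Prop :=
  ∀ t ∈ x.pre ++ x.post, (G.runStep R S).twigVal (G.newTwig R t) = comp R (G.twigVal t)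

lemma mem_push {y : α ⊕ X} {x : X}
    (h : .inr x ∈ (s.push R y).mid) : .inr x ∈ s.mid ∨ y = .inr x := by
  have hc : (.inr x : List α ⊕ X) ∈ s.close.mid → .inr x ∈ s.mid := by
    obtain ⟨t, m, _ | b⟩ := s
    · exact id
    · rcases t with _ | ⟨c, t⟩ <;> simp [close, runItem]
  rcases y with a | y
  · obtain ⟨_ | ⟨c, t⟩, m, b⟩ := s
    · exact .inl h
    · by_cases hr : R a c
      · simp [push, hr] at h; exact .inl h
      · simp only [push, hr] at h; exact .inl (hc h)
  · simp [push] at h; grind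

lemma mem_pushAll {l : List (α ⊕ X)} {x : X}
    (h : .inr x ∈ (pushAll R l s).mid) : .inr x ∈ s.mid ∨ .inr x ∈ l := by
  induction l with
  | nil => exact .inl h
  | cons y l ih =>
    rcases mem_push h with h | rfl
    · rcases ih h with h | h
      · exact .inl h
      · exact .inr (by simp [h])
    · exact .inr (by simp)

lemma Gram.startState_mid (e : Option (End α)) : (G.startState R e).mid = [] := by
  rcases e with _ | c | C <;> rfl

lemma Gram.frame_mem_runs {r : Rule α} {x : Frame α (Twig α)}
    (h : .inr (.frame x) ∈ (G.runs R r).mid) :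
    .frame x ∈ r.items ∧ x.pre.length + x.post.length ≠ 0 := by
  rcases mem_pushAll h with h | h
  · simp [startState_mid] at h
  · obtain ⟨i, hi, hx⟩ := mem_flatMap.1 h; rcases i with y | B
    · rcases y.eq_letter_or with ⟨a, rfl⟩ | ⟨hl, e⟩
      · simp [itemToks, token_letter] at hx
      · simp [itemToks, e] at hx; cases hx; exact ⟨hi, hl⟩
    · simp only [itemToks] at hx
      rcases hb : (ctxRuns R (G.ctx B)).bot with _ | b <;> simp [hb] at hx

lemma Gram.newItem_val (m : List (List (Part α) ⊕ Item α))
    (h : ∀ x, .inr (.frame x) ∈ m → G.FrameOk (R := R) x S) :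
    (G.runStep R S).itemsVal (m.flatMap (G.newItem R)) =
      (m.flatMap (G.evMid R)).flatMap (compressItem R Blk.run Blk.other) := by
  induction m with
  | nil => rfl
  | cons y m ih =>
    rw [flatMap_cons, itemsVal_append, ih (fun x hx => h x (by simp [hx])), flatMap_cons,
      flatMap_append]
    congr 1; rcases y with ps | x | B
    · simp [newItem, evMid, blkOf]; rcases flat ps with _ | ⟨a, w⟩
      · simp [compressItem]
      · simp [compressItem, itemVal, Frame.map_letter]
    · have hx := h x (by simp)
      simp only [newItem, evMid, flatMap_cons, flatMap_nil, append_nil,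
        itemsVal_cons, itemsVal_nil, itemVal, compressItem, Frame.map, map_map]
      congr 2
      · exact map_congr_left fun t ht => hx t (by simp [ht])
      · exact map_congr_left fun t ht => hx t (by simp [ht])
    · simp [newItem, itemVal, evMid, runStep]

lemma Gram.newEnd_val (e : End α) (h : ∀ C, e = .nt C → C ≠ S) :
    (G.runStep R S).endVal (newEnd e) = (cut R (G.endVal e)).2 := by
  rcases e with c | C
  · simp [newEnd, endVal, splitRun_node]
  · simp [newEnd, endVal, runStep, h C rfl]

/-- Both versions are needed: without the top run for nonterminals from which it is popped, with the
top run for the start nonterminal and for twigs. -/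
lemma Gram.runs_val (r : Rule α) (he : r.last = some e) (h : ∀ C, e = .nt C → C ≠ S)
    (hf : ∀ x, .frame x ∈ r.items → G.FrameOk (R := R) x S) :
    plug ((G.runStep R S).itemsVal ((G.runs R r).mid.flatMap (G.newItem R)))
        ((G.runStep R S).endVal (newEnd e)) = (cut R (plug (G.itemsVal r.items) (G.endVal e))).2 ∧
      plug ((G.runStep R S).itemsVal ((G.keptRuns R r).flatMap (G.newItem R)))
        ((G.runStep R S).endVal (newEnd e)) = comp R (plug (G.itemsVal r.items) (G.endVal e)) := by
  have hm : ∀ x, .inr (.frame x) ∈ (G.runs R r).mid → G.FrameOk (R := R) x S :=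
    fun x hx => hf x (G.frame_mem_runs hx).1
  have hk : ∀ x, .inr (.frame x) ∈ G.keptRuns R r → G.FrameOk (R := R) x S := by
    intro x hx; rcases mem_append.1 hx with hx | hx
    · rcases ht : (G.runs R r).top with _ | ⟨c, t⟩ <;> simp [ht, runItem] at hx
    · exact hm x hx
  have hev := G.ev_runs_some (R := R) r he
  have hp : cut R (plug (G.itemsVal r.items) (G.endVal e)) = _ :=
    splitRun_plug (R := R) (φ := Blk.run) (g := Blk.other) (G.itemsVal r.items) (G.endVal e)
  have htop : flat (G.runs R r).top = (G.ev R (G.runs R r)).top := rfl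
  have hmid : (G.runs R r).mid.flatMap (G.evMid R) = (G.ev R (G.runs R r)).mid := rfl
  have h1 : plug ((G.runStep R S).itemsVal ((G.runs R r).mid.flatMap (G.newItem R)))
      ((G.runStep R S).endVal (newEnd e)) = (cut R (plug (G.itemsVal r.items) (G.endVal e))).2 := by
    rw [G.newItem_val _ hm, G.newEnd_val e h, hmid, hev, hp]
  refine ⟨h1, ?_⟩
  rw [keptRuns, flatMap_append, itemsVal_append, plug_append, h1,
    show ∀ t : Pat α, comp R t = finish Blk.run (cut R t) from fun _ => rfl]
  have h2 : (cut R (plug (G.itemsVal r.items) (G.endVal e))).1 = flat (G.runs R r).top := by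
    rw [htop, hev, hp]
  generalize cut R (plug (G.itemsVal r.items) (G.endVal e)) = q at h2; obtain ⟨q1, q2⟩ := q
  dsimp only at h2 ⊢; subst h2; have hne := G.runs_ne (R := R) r
  rcases ht : (G.runs R r).top with _ | ⟨c, t⟩
  · rfl
  · rw [ht] at hne; have : flat (c :: t) ≠ [] := by rw [Ne, flat_eq_nil hne]; simp
    obtain ⟨a, w, hw⟩ := exists_cons_of_ne_nil this
    simp [runItem, newItem, blkOf, hw, finish, itemVal, Frame.map, fill, letter]

lemma Gram.keptRuns_twigRule (t : Twig α) :
    ∃ m : List (List (Part α)), G.keptRuns R (twigRule t) = m.map .inl := by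
  have hfr : ∀ x, .inr x ∉ G.keptRuns R (twigRule t) := by
    intro x hx; rcases mem_append.1 hx with hx | hx
    · rcases ht : (G.runs R (twigRule t)).top with _ | ⟨c, t⟩ <;> simp [ht, runItem] at hx
    · rcases mem_pushAll hx with h | h
      · simp [startState_mid] at h
      · simp [twigRule, itemToks, token_letter] at h
  generalize G.keptRuns R (twigRule t) = m at hfr
  induction m with
  | nil => exact ⟨[], rfl⟩
  | cons y m ih =>
    obtain ⟨l, rfl⟩ := ih fun x hx => hfr x (by simp [hx])
    rcases y with ps | x
    · exact ⟨ps :: l, rfl⟩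
    · exact absurd (by simp) (hfr x)

lemma Gram.newTwig_val (t : Twig α) (h : ∀ C, t.last = .nt C → C ≠ S) :
    (G.runStep R S).twigVal (G.newTwig R t) = comp R (G.twigVal t) := by
  have key := (G.runs_val (R := R) (S := S) (twigRule t) rfl h (by
      rintro x hx
      obtain ⟨a, -, ⟨⟩⟩ := mem_map.1 hx; simp [FrameOk, letter])).2
  obtain ⟨m, e⟩ := G.keptRuns_twigRule (R := R) t
  have e1 : G.itemsVal (twigRule t).items = t.chain.map letter := G.itemsVal_letters _
  rw [e1, e] at key; rw [twigVal, newTwig, twigVal, ← key, e]; congr 1; clear key e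
  induction m <;> simp_all [itemsVal_append, newItem, itemsVal_letters]

lemma Gram.frameOk {x : Frame α (Twig α)} (h : .zero S ∉ (Item.frame x).names) :
    G.FrameOk (R := R) x S := by
  intro t ht; refine G.newTwig_val t ?_
  rintro C hC rfl
  exact h (mem_flatMap.2 ⟨t, ht, by simp [Twig.names, End.names, hC]⟩)

/-- What is popped from a nonterminal is reinserted at each of its occurrences, so the local
equations remain true. Nothing is popped from `S`, which therefore must not occur in a right-hand
side. -/
lemma Gram.runStep_holds {X : Name} (h : G.Holds X) (hS : .zero S ∉ (G.rule X).names) :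
    (G.runStep R S).Holds X := by
  have hf : ∀ x, .frame x ∈ (G.rule X).items → G.FrameOk (R := R) x S := by
    intro x hx; refine G.frameOk fun hm => hS (mem_append_left _ (mem_flatMap.2 ⟨_, hx, hm⟩))
  rcases X with A | C
  · obtain ⟨h1, h2⟩ := h; refine ⟨by simp [runStep, h1], ?_⟩
    have hev := G.ev_runs_none (R := R) _ h1
    have hm : ∀ x, .inr (.frame x) ∈ (G.runs R (G.rule (.one A))).mid → G.FrameOk (R := R) x S :=
      fun x hx => hf x (G.frame_mem_runs hx).1
    have e := G.newItem_val (R := R) (S := S) _ hm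
    have hmid : (G.runs R (G.rule (.one A))).mid.flatMap (G.evMid R) =
      (G.ev R (G.runs R (G.rule (.one A)))).mid := rfl
    rw [hmid, hev, ← h2] at e
    rw [show (G.runStep R S).ctx A =
      (ctxRuns R (G.ctx A)).mid.flatMap (compressItem R Blk.run Blk.other) from rfl, ← e]
    simp [runStep]
  · obtain ⟨e, h1, h2⟩ := h; refine ⟨newEnd e, by simp [runStep, h1], ?_⟩
    have hC : ∀ C, e = .nt C → C ≠ S := by
      rintro C rfl rfl
      exact hS (mem_append_right _ (by simp [Rule.lastNames, h1, End.names]))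
    obtain ⟨k1, k2⟩ := G.runs_val (R := R) (S := S) _ h1 hC hf; rw [← h2] at k1 k2
    by_cases hCS : C = S
    · subst hCS; rw [show (G.runStep R C).val C = comp R (G.val C) by simp [runStep], ← k2]
      simp [runStep]
    · rw [show (G.runStep R S).val C = (cut R (G.val C)).2 by simp [runStep, hCS], ← k1]
      simp [runStep, hCS]

end

/-! ### Sizes and potentials -/

def End.size : End α → ℕ
  | .con _ => 1
  | .nt _ => 0

def Twig.size (t : Twig α) : ℕ := t.chain.length + t.last.size

def Frame.twigSize (x : Frame α (Twig α)) : ℕ := ((x.pre ++ x.post).map Twig.size).sum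

def Item.size : Item α → ℕ
  | .frame x => 1 + x.twigSize
  | .nt _ => 0

/-- The number of letters, nonterminals not counted. -/
def Rule.size (r : Rule α) : ℕ := (r.items.map Item.size).sum + r.last.elim 0 End.size

/-- The weight of a word. -/
def wtSum (wt : α → ℕ) (w : List α) : ℕ := (w.map wt).sum

@[simp] lemma wtSum_nil (wt : α → ℕ) : wtSum wt [] = 0 := rfl
@[simp] lemma wtSum_cons (wt : α → ℕ) (a : α) (w : List α) :
    wtSum wt (a :: w) = wt a + wtSum wt w := by simp [wtSum]
lemma wtSum_append (wt : α → ℕ) (v w : List α) :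
    wtSum wt (v ++ w) = wtSum wt v + wtSum wt w := by simp [wtSum]

/-- One step of the computation of the potential of a right-hand side: a letter of weight `w`, or a
nonterminal of rank `1`. The second component is the weight between here and the next nonterminal
(`none` if there is no further one in a rule of rank `1`). -/
def gapStep (F : ℕ) : ℕ ⊕ Unit → ℕ × Option ℕ → ℕ × Option ℕ
  | .inl w, (u, g) => (u, g.map (· + w))
  | .inr _, (u, g) => (u + g.elim F (fun x => 2 * F - x.size), some 0)

def gapPot (F : ℕ) (g : Option ℕ) (l : List (ℕ ⊕ Unit)) : ℕ × Option ℕ := l.foldr (gapStep F) (0, g)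

def Item.mark (wt : α → ℕ) : Item α → ℕ ⊕ Unit
  | .frame x => .inl (wt x.label)
  | .nt _ => .inr ()

def endGap (wt : α → ℕ) : Option (End α) → Option ℕ
  | none => none
  | some (.con c) => some (wt c)
  | some (.nt _) => some 0

/-- The potential of a right-hand side. -/
def Rule.pot (wt : α → ℕ) (F : ℕ) (r : Rule α) : ℕ :=
  (gapPot F (endGap wt r.last) (r.items.map (Item.mark wt))).1

/-- Every nonterminal of rank 1 contributes at most `2 * F`. This bounds the initial potential, and
makes the potential of twigs vanish. -/
lemma gapPot_le (F : ℕ) (g : Option ℕ) (l : List (ℕ ⊕ Unit)) :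
    (gapPot F g l).1 ≤ 2 * F * l.countP Sum.isRight := by
  induction l with
  | nil => simp [gapPot]
  | cons x l ih =>
    have : gapPot F g (x :: l) = gapStep F x (gapPot F g l) := rfl; rw [this]
    generalize gapPot F g l = q at ih ⊢
    obtain ⟨u, _ | y⟩ := q <;> rcases x with w | x <;> simp [gapStep, countP_cons, mul_add] at * <;> omega

/-! ### The letters of a run by origin -/

def exLen (ps : List (Part α)) : ℕ := (ps.map fun p => if p.tag = .ex then p.word.length else 0).sum

def exWt (wt : α → ℕ) (ps : List (Part α)) : ℕ :=
  (ps.map fun p => if p.tag = .ex then wtSum wt p.word else 0).sum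

/-- The number of pieces that are not explicit letters. -/
def numPop (ps : List (Part α)) : ℕ := ps.countP fun p => decide (p.tag ≠ .ex)

/-- The number of removed nonterminals. -/
def numRem (ps : List (Part α)) : ℕ := ps.countP fun p => decide (p.tag = .rm)

/-- What a cost function for the runs has to satisfy. -/
structure PayOk (R : α → α → Bool) (wt : α → ℕ) (F n : ℕ) (pay : List (Part α) → ℕ) : Prop where
  nil : pay [] = 0
  le : ∀ ps, ps ≠ [] → Linked R (flat ps) → (∀ p ∈ ps, p.word ≠ []) → wtSum wt (flat ps) ≤ n →
    (numRem ps ≠ 0 ∨ numPop ps ≤ 1) → pay ps + 2 ≤ 2 * exLen ps + 4 * numPop ps + F * numRem ps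
  le_two : ∀ ps, Linked R (flat ps) → (∀ p ∈ ps, p.word ≠ []) → wtSum wt (flat ps) ≤ n →
    numRem ps = 0 → numPop ps = 2 →
    pay ps + 2 + (exWt wt ps).size ≤ 2 * exLen ps + 4 * numPop ps + (wtSum wt (flat ps)).size

section Accounting

variable {wt : α → ℕ} {F n : ℕ} {pay : List (Part α) → ℕ}
  (fc : Frame α (Twig α) → ℕ)

/-- The `+ 2` for a run covers the new letter, since explicit letters count twice in the potential.
-/
def midCost (pay : List (Part α) → ℕ) (fc : Frame α (Twig α) → ℕ) :
    List (List (Part α) ⊕ Item α) → ℕ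
  | [] => 0
  | .inl ps :: m => pay ps + 2 + midCost pay fc m
  | .inr (.frame x) :: m => fc x + midCost pay fc m
  | .inr (.nt _) :: m => midCost pay fc m

def midMark (wt : α → ℕ) : List (Part α) ⊕ Item α → ℕ ⊕ Unit
  | .inl ps => .inl (wtSum wt (flat ps))
  | .inr i => i.mark wt

/-- The invariant of the amortized analysis: `C` bounds the cost so far, `g` is the gap in the old
right-hand side, and `W` is the weight so far. -/
structure Acct (R : α → α → Bool) (wt : α → ℕ) (F : ℕ) (pay : List (Part α) → ℕ)
    (fc : Frame α (Twig α) → ℕ) (g₀ : Option ℕ)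
    (s : RunState (Part α) (Item α)) (g : Option ℕ) (C W : ℕ) : Prop where
  cost : midCost pay fc s.mid + s.bot.elim 0 pay + (gapPot F g₀ (s.mid.map (midMark wt))).1 +
    (2 * exLen s.top + 4 * numPop s.top + F * numRem s.top) ≤ C
  gap_none : g = none → (gapPot F g₀ (s.mid.map (midMark wt))).2 = none
  gap_some : ∀ x, g = some x → x ≤ W ∧ ((gapPot F g₀ (s.mid.map (midMark wt))).2 = none ∨
    ∃ y, (gapPot F g₀ (s.mid.map (midMark wt))).2 = some y ∧ x ≤ y + wtSum wt (flat s.top))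
  pop : numRem s.top = 0 → numPop s.top ≤ 1
  bot : s.bot = .none → (gapPot F g₀ (s.mid.map (midMark wt))).2 = .none
  linked : Linked R (flat s.top)
  ne : ∀ p ∈ s.top, p.word ≠ []
  wt_le : ∀ y, (gapPot F g₀ (s.mid.map (midMark wt))).2 = .some y → y + wtSum wt (flat s.top) ≤ W
  wt_top : wtSum wt (flat s.top) ≤ W

/-- If the open run ends with a run popped from a nonterminal, then the gap consists of its explicit
letters. -/
def PopGap (wt : α → ℕ) (F : ℕ) (g₀ : Option ℕ) (s : RunState (Part α) (Item α)) (g : Option ℕ) :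
    Prop :=
  numRem s.top = 0 → numPop s.top = 1 → g = some (exWt wt s.top) ∧
    (gapPot F g₀ (s.mid.map (midMark wt))).2 ≠ none

variable {fc} {g₀ g : Option ℕ} {s : RunState (Part α) (Item α)} {C W : ℕ}

lemma Acct.of_top_nil {m : List (List (Part α) ⊕ Item α)} {b : List (Part α)} {u : ℕ}
    {q : Option ℕ} (hq : gapPot F g₀ (m.map (midMark wt)) = (u, q))
    (cost : midCost pay fc m + pay b + u ≤ C) (gap_none : g = none → q = none)
    (gap_some : ∀ x, g = some x → x ≤ W ∧ ∀ y, q = some y → x ≤ y)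
    (wt_le : ∀ y, q = some y → y ≤ W) : Acct R wt F pay fc g₀ ⟨[], m, some b⟩ g C W := by
  constructor <;> simp only [hq]
  · simpa [exLen, numPop, numRem] using cost
  · exact gap_none
  · intro x hx
    cases q <;> simpa [flat] using gap_some x hx
  · simp [numPop]
  · simp
  · simp [flat, Linked]
  · simp
  · simpa [flat] using wt_le
  · simp [flat]

/-- The credit stored with the open run (2 for an explicit letter, 4 for a popped piece, `F` for a
removed nonterminal) is converted into the payment for that run and, if it stays in the rule, for
its new letter. -/
lemma Acct.close (hp : PayOk R wt F n pay) (hW : W ≤ n) (h : Acct R wt F pay fc g₀ s g C W) :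
    Acct R wt F pay fc g₀ s.close g C W := by
  by_cases ht : s.top = []
  · obtain ⟨t, m, b⟩ := s; dsimp only at ht; subst ht; rcases b with _ | b
    · obtain ⟨h1, h2, h3, h4, h5, h6, h7, h8, h9⟩ := h
      refine ⟨?_, h2, h3, h4, fun h => by simp [RunState.close] at h, h6, h7, h8, h9⟩
      simpa [RunState.close, hp.nil] using h1
    · simpa [RunState.close, runItem] using h
  · have hle := hp.le s.top ht h.linked h.ne (h.wt_top.trans hW) (by
      by_cases hr : numRem s.top = 0
      · exact .inr (h.pop hr)
      · exact .inl hr)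
    obtain ⟨t, m, b⟩ := s; obtain ⟨h1, h2, h3, h4, h5, h6, h7, h8, h9⟩ := h; dsimp only at *
    rcases b with _ | b
    · have h5' := h5 rfl
      refine ⟨?_, h2, ?_, ?_, fun h => by simp [RunState.close] at h, by simp [RunState.close, flat,
        Linked], by simp [RunState.close], ?_, by simp [RunState.close, flat]⟩
      · simp [RunState.close, exLen, numPop, numRem] at h1 ⊢; simp [exLen, numPop, numRem] at hle
        omega
      · intro x hx; exact ⟨(h3 x hx).1, .inl h5'⟩
      · simp [RunState.close, numPop]
      · intro y hy; simp only [RunState.close] at hy; rw [h5'] at hy; cases hy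
    · obtain ⟨p, t, rfl⟩ := exists_cons_of_ne_nil ht; simp [RunState.close, runItem]
      generalize hq : gapPot F g₀ (m.map (midMark wt)) = q at *; obtain ⟨u, q⟩ := q; dsimp only at *
      refine .of_top_nil (congrArg (gapStep F (.inl _)) hq) ?_ (by simpa using h2) ?_ (by simpa using h8)
      · simp only [midCost, exLen, numPop, numRem, Option.elim_some] at h1 hle ⊢; omega
      · grind

lemma Acct.mono (h : Acct R wt F pay fc g₀ s g C W) {C' W' : ℕ} (hC : C ≤ C') (hW : W ≤ W') :
    Acct R wt F pay fc g₀ s g C' W' := by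
  obtain ⟨h1, h2, h3, h4, h5, h6, h7, h8, h9⟩ := h
  exact ⟨h1.trans hC, h2, fun x hx => ⟨(h3 x hx).1.trans hW, (h3 x hx).2⟩, h4, h5, h6, h7,
    fun y hy => (h8 y hy).trans hW, h9.trans hW⟩

lemma RunState.close_top {s : RunState α X} : s.close.top = [] := by
  obtain ⟨t, m, _ | b⟩ := s <;> rfl

lemma RunState.push_inr (R : α → α → Bool) (s : RunState α X) (x : X) :
    s.push R (.inr x) = ⟨[], .inr x :: s.close.mid, s.close.bot⟩ := rfl

lemma Acct.push_frame (hp : PayOk R wt F n pay) (x : Frame α (Twig α)) (hW : W ≤ n)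
    (h : Acct R wt F pay fc g₀ s g C W) :
    Acct R wt F pay fc g₀ (s.push (partLink R) (.inr (.frame x))) (g.map (· + wt x.label))
      (C + fc x) (W + wt x.label) := by
  have hc := h.close hp hW; have ht : s.close.top = [] := RunState.close_top
  obtain ⟨b, hb⟩ := s.close_bot; rw [RunState.push_inr]; generalize s.close = s at *
  obtain ⟨t, m, b'⟩ := s; obtain ⟨h1, h2, h3, h4, h5, h6, h7, h8, h9⟩ := hc; dsimp only at *
  subst ht hb; generalize hq : gapPot F g₀ (m.map (midMark wt)) = q at *; obtain ⟨u, q⟩ := q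
  dsimp only [Option.elim_some] at *
  refine .of_top_nil (congrArg (gapStep F (.inl _)) hq) ?_ (by simpa using h2) ?_ ?_
  · simp only [midCost]; omega
  all_goals cases g <;> cases q <;> simp [flat] at * <;> omega

lemma Acct.push_part (h : Acct R wt F pay fc g₀ s g C W) (hp : p.word ≠ [])
    (hl : Linked R (flat (p :: s.top))) {g' : Option ℕ} {C' : ℕ}
    (hC : C + (2 * exLen [p] + 4 * numPop [p] + F * numRem [p]) ≤ C')
    (hpop : numRem (p :: s.top) = 0 → numPop (p :: s.top) ≤ 1) (hg : g' = none → g = none)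
    (hg' : ∀ x, g' = some x → x ≤ wtSum wt p.word ∨ ∃ y, g = some y ∧ x ≤ y + wtSum wt p.word) :
    Acct R wt F pay fc g₀ ⟨p :: s.top, s.mid, s.bot⟩ g' C' (W + wtSum wt p.word) := by
  obtain ⟨t, m, b⟩ := s; obtain ⟨h1, h2, h3, h4, h5, h6, h7, h8, h9⟩ := h
  have e1 : exLen (p :: t) = exLen [p] + exLen t := by simp [exLen]
  have e2 : numPop (p :: t) = numPop [p] + numPop t := countP_append (l₁ := [p])
  have e3 : numRem (p :: t) = numRem [p] + numRem t := countP_append (l₁ := [p])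
  have e4 : wtSum wt (flat (p :: t)) = wtSum wt p.word + wtSum wt (flat t) := by
    simp [flat_cons, wtSum_append]
  dsimp only at *
  refine ⟨?_, h2 ∘ hg, fun x hx => ?_, hpop, h5, hl, by simpa using ⟨hp, h7⟩, fun y hy => ?_, ?_⟩
  · dsimp only; rw [e1, e2, e3, mul_add F]; omega
  · rcases hg' x hx with h | ⟨y, rfl, h⟩
    · cases hq : (gapPot F g₀ (m.map (midMark wt))).2 <;> simp <;> omega
    · have := h3 y rfl; grind
  · have := h8 y hy; dsimp only; omega
  · dsimp only; omega

/-- Either the new piece is linked to the open run or that run is closed first. Both cases become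
"put the piece on top of a state with the same bounds". -/
lemma Acct.push_cases (hp : PayOk R wt F n pay) (hW : W ≤ n)
    (h : Acct R wt F pay fc g₀ s g C W) (p : Part α) :
    ∃ s', Acct R wt F pay fc g₀ s' g C W ∧ (PopGap wt F g₀ s g → PopGap wt F g₀ s' g) ∧
      s.push (partLink R) (.inl p) = ⟨p :: s'.top, s'.mid, s'.bot⟩ ∧
        (Linked R p.word → Linked R (flat (p :: s'.top))) := by
  have hc := h.close hp hW; have hl := h.linked; have hn := h.ne
  obtain ⟨_ | ⟨⟨tg, v⟩, t⟩, m, b⟩ := s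
  · exact ⟨_, h, id, rfl, by simp [flat]⟩
  · obtain ⟨c, v, rfl⟩ := exists_cons_of_ne_nil (hn ⟨tg, v⟩ (by simp))
    by_cases hr : partLink R p ⟨tg, c :: v⟩
    · refine ⟨_, h, id, by simp [push, hr], fun hpl => ?_⟩
      rw [flat_cons, Linked, isChain_append]; refine ⟨hpl, hl, ?_⟩; intro x hx y hy
      simp [flat_cons] at hy; subst hy; simpa [partLink, Option.mem_def.1 hx] using hr
    · exact ⟨_, hc, by simp [PopGap, RunState.close_top, numPop],
        by simp [push, hr, RunState.close_top], by simp [RunState.close_top, flat]⟩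

lemma Acct.push_ex (hp : PayOk R wt F n pay) (a : α) (hW : W ≤ n)
    (h : Acct R wt F pay fc g₀ s g C W) (hg : PopGap wt F g₀ s g) :
    Acct R wt F pay fc g₀ (s.push (partLink R) (.inl ⟨.ex, [a]⟩)) (g.map (· + wt a))
      (C + 2) (W + wt a) ∧
      PopGap wt F g₀ (s.push (partLink R) (.inl ⟨.ex, [a]⟩)) (g.map (· + wt a)) := by
  obtain ⟨s, h, hg', e, hl⟩ := h.push_cases hp hW ⟨.ex, [a]⟩; rw [e]; constructor
  · simpa using h.push_part (p := ⟨.ex, [a]⟩) (by simp) (hl (by simp [Linked]))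
      (by simp [exLen, numPop, numRem]) (by simpa [numRem, numPop] using h.pop) (by simp)
      (by simp +contextual)
  · simp only [PopGap, numRem, numPop, exWt] at hg' ⊢; simp +contextual [hg' hg, add_comm]

/-- A gap has bit length at most `F`, so the share of the vanishing nonterminal in the potential is
at least `F`. It is stored with the piece. -/
lemma Acct.push_rm (hp : PayOk R wt F n pay) (hw : w ≠ []) (hl : Linked R w)
    (hF : ∀ x ≤ n, x.size ≤ F) (hW : W ≤ n) (h : Acct R wt F pay fc g₀ s g C W) :
    Acct R wt F pay fc g₀ (s.push (partLink R) (.inl ⟨.rm, w⟩)) (some 0)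
      (C + 4 + g.elim F (fun x => 2 * F - x.size)) (W + wtSum wt w) ∧
      PopGap wt F g₀ (s.push (partLink R) (.inl ⟨.rm, w⟩)) (some 0) := by
  have hU : F ≤ g.elim F (fun x => 2 * F - x.size) := by
    rcases g with _ | x
    · simp
    · have := hF x ((h.gap_some x rfl).1.trans hW); simp; omega
  obtain ⟨s, h, -, e, hl'⟩ := h.push_cases hp hW ⟨.rm, w⟩; rw [e]
  exact ⟨h.push_part hw (hl' hl) (by simp [exLen, numPop, numRem]; omega) (by simp [numRem])
    (by simp) (by simp), by simp [PopGap, numRem]⟩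

/-- The gap below `B` has not become smaller, so its share in the new potential is at most its share
in the old one. A new gap `none` is harmless, because its share `F` is the minimal one. -/
lemma Acct.push_nt_closed (hF : ∀ x ≤ n, x.size ≤ F) (hW : W ≤ n) (B : Symb)
    (h : Acct R wt F pay fc g₀ s g C W) (ht : s.top = []) {b : List (Part α)}
    (hb : s.bot = some b) :
    Acct R wt F pay fc g₀ ⟨[], .inr (.nt B) :: s.mid, s.bot⟩ (some 0)
      (C + g.elim F (fun x => 2 * F - x.size)) W := by
  obtain ⟨t, m, b⟩ := s; obtain ⟨h1, h2, h3, h4, h5, h6, h7, h8, h9⟩ := h; dsimp only at *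
  subst ht hb; generalize hq : gapPot F g₀ (m.map (midMark wt)) = q at *; obtain ⟨u, q⟩ := q
  dsimp only [Option.elim_some] at *
  refine .of_top_nil (congrArg (gapStep F (.inr ())) hq) ?_ (by simp) (by simp) (by simp)
  simp only [midCost]; rcases g with _ | x
  · rw [h2 rfl]; simp; omega
  · obtain ⟨h3, h3'⟩ := h3 x rfl; have := hF x (h3.trans hW); rcases h3' with rfl | ⟨y, rfl, hy⟩
    · simp; omega
    · have := hF y (by have := h8 y rfl; omega)
      have : x.size ≤ y.size := Nat.size_le_size (by simpa [flat] using hy)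
      simp; omega

/-- The critical case: one run lies between two nonterminals and receives a piece from each. Its
cost may be logarithmic in `n` while the stored credit is not. The old gap consisted of the explicit
letters of the run only, the new one contains the whole run, and the lower share of `B` in the
potential pays the difference by `PayOk.le_two`. -/
lemma Acct.push_lf_two (hp : PayOk R wt F n pay)
    (hF : ∀ x ≤ n, x.size ≤ F) (hW : W + wtSum wt w ≤ n) (B : Symb)
    (h : Acct R wt F pay fc g₀ s g C W) (hg : PopGap wt F g₀ s g)
    (hr : numRem s.top = 0) (hn : numPop s.top = 1)
    (hw : w ≠ []) (hl : Linked R (flat (⟨.lf, w⟩ :: s.top))) :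
    Acct R wt F pay fc g₀
      (push (partLink R) (.inr (.nt B)) ⟨⟨.lf, w⟩ :: s.top, s.mid, s.bot⟩) (some 0)
      (C + 4 + g.elim F (fun x => 2 * F - x.size)) (W + wtSum wt w) := by
  obtain ⟨rfl, hy⟩ := hg hr hn; obtain ⟨t, m, b⟩ := s
  obtain ⟨h1, h2, h3, h4, h5, h6, h7, h8, h9⟩ := h; dsimp only at *
  obtain ⟨b, rfl⟩ : ∃ b', b = some b' := Option.ne_none_iff_exists'.1 fun hb => hy (h5 hb)
  obtain ⟨y, hy⟩ := Option.ne_none_iff_exists'.1 hy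
  have e1 : exLen (⟨.lf, w⟩ :: t) = exLen t := by simp [exLen]
  have e2 : numPop (⟨.lf, w⟩ :: t) = numPop t + 1 := by simp [numPop]
  have e3 : numRem (⟨.lf, w⟩ :: t) = numRem t := by simp [numRem]
  have e4 : wtSum wt (flat (⟨.lf, w⟩ :: t)) = wtSum wt w + wtSum wt (flat t) := by
    simp [flat_cons, wtSum_append]
  have e5 : exWt wt (⟨.lf, w⟩ :: t) = exWt wt t := by simp [exWt]
  have hle := hp.le_two (⟨.lf, w⟩ :: t) hl (by
    intro p hp; rcases mem_cons.1 hp with rfl | hp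
    · exact hw
    · exact h7 p hp) (by omega) (by omega) (by omega)
  simp [push, RunState.close, runItem]; generalize hq : gapPot F g₀ (m.map (midMark wt)) = q at *
  obtain ⟨u, q⟩ := q; dsimp only [Option.elim_some] at *; subst hy; have h8 := h8 y rfl
  refine .of_top_nil (congrArg (gapStep F (.inr ()) ∘ gapStep F (.inl _)) hq) ?_ (by simp) (by simp)
    (by simp)
  simp only [midCost]; rw [e1, e2, e5] at hle
  have f3 := hF _ ((h3 _ rfl).1.trans (show W ≤ n by omega))
  have f1 := hF (y + wtSum wt (flat (⟨.lf, w⟩ :: t))) (by omega)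
  have f2 : (wtSum wt (flat (⟨.lf, w⟩ :: t))).size ≤
    (y + wtSum wt (flat (⟨.lf, w⟩ :: t))).size := Nat.size_le_size (by omega)
  simp [exLen, numPop, numRem] at h1 hle hr ⊢; omega

lemma Acct.push_nt_bot (hp : PayOk R wt F n pay) (hl : Linked R w)
    (hF : ∀ x ≤ n, x.size ≤ F) (hW : W + wtSum wt w ≤ n) (B : Symb)
    (h : Acct R wt F pay fc g₀ s g C W) (hg : PopGap wt F g₀ s g) :
    Acct R wt F pay fc g₀ ((pushAll (partLink R) ((parts .lf w).map .inl) s).push (partLink R)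
      (.inr (.nt B))) (some 0)
      (C + 4 + g.elim F (fun x => 2 * F - x.size)) (W + wtSum wt w) := by
  rcases w with _ | ⟨a, w⟩
  · have hc := h.close hp (by simpa using hW)
    obtain ⟨b, hb⟩ := s.close_bot
    have := hc.push_nt_closed hF (by simpa using hW) B RunState.close_top hb
    exact this.mono (by omega) (by simp)
  · rw [parts, map_cons, map_nil, pushAll_cons, pushAll_nil]
    obtain ⟨s, h1, h2, e, hl'⟩ := h.push_cases hp (by omega) ⟨.lf, a :: w⟩
    have hl := hl' hl; rw [e]
    -- If a removed nonterminal is part of the run or no other piece was popped into it, the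
    -- ordinary payment rule suffices. Otherwise exactly one piece is already there.
    by_cases hpop : numRem s.top ≠ 0 ∨ numPop s.top = 0
    · have hc := (h1.push_part (p := ⟨.lf, a :: w⟩) (g' := g) (C' := C + 4) (by simp) hl
        (by simp [exLen, numPop, numRem]) (by simp [numRem, numPop] at hpop ⊢; tauto) id
        (by simp +contextual)).close hp hW
      obtain ⟨b, hb⟩ := (⟨⟨.lf, a :: w⟩ :: s.top, s.mid, s.bot⟩ :
        RunState (Part α) (Item α)).close_bot
      exact hc.push_nt_closed hF hW B RunState.close_top hb
    · have hr : numRem s.top = 0 := by omega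
      have := h1.pop hr; exact h1.push_lf_two hp hF hW B (h2 hg) hr (by omega) (by simp) hl

lemma Acct.push_nt (hp : PayOk R wt F n pay) {v : List α} (hv : Linked R v) (hl : Linked R w)
    (hF : ∀ x ≤ n, x.size ≤ F) (hW : W + wtSum wt w ≤ n) (B : Symb)
    (h : Acct R wt F pay fc g₀ s g C W) (hg : PopGap wt F g₀ s g) :
    Acct R wt F pay fc g₀ (pushAll (partLink R) ((parts .rt v).map .inl ++ .inr (.nt B) ::
      (parts .lf w).map .inl) s) (some 0)
      (C + 8 + g.elim F (fun x => 2 * F - x.size)) (W + wtSum wt v + wtSum wt w) ∧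
      PopGap wt F g₀ (pushAll (partLink R) ((parts .rt v).map .inl ++ .inr (.nt B) ::
      (parts .lf w).map .inl) s) (some 0) := by
  have key := h.push_nt_bot hp hl hF hW B hg; rw [pushAll_append, pushAll_cons]
  rw [RunState.push_inr] at key ⊢; rcases v with _ | ⟨a, v⟩
  · exact ⟨key.mono (by omega) (by simp), by simp [PopGap, parts, numPop]⟩
  · exact ⟨(key.push_part (p := ⟨.rt, a :: v⟩) (g' := some 0)
      (C' := C + 8 + g.elim F fun x => 2 * F - x.size) (by simp) (by simpa [flat] using hv)
      (by simp [exLen, numPop, numRem]; omega) (by simp [numRem, numPop]) (by simp)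
      (by simp)).mono le_rfl (by dsimp only; omega),
      fun _ _ => ⟨by simp [parts, push, exWt],
        by simp [parts, push, gapPot, gapStep, midMark, Item.mark]⟩⟩

/-- The cost of an item of an old right-hand side. -/
def itemCost (fc : Frame α (Twig α) → ℕ) : Item α → ℕ
  | .frame x => match x.token with
    | .inl _ => 2
    | .inr x => fc x
  | .nt _ => 8

def ctxWt (wt : α → ℕ) (L : List (Frame α τ)) : ℕ := (L.map fun x => wt x.label).sum

def treeWt (wt : α → ℕ) (t : Pat α) : ℕ := wtSum wt t.labels

def Gram.itemWt (wt : α → ℕ) : Item α → ℕ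
  | .frame x => wt x.label
  | .nt B => ctxWt wt (G.ctx B)

lemma RunState.wt_push (wt : α → ℕ) (s : RunState α (Frame α τ)) (x : Frame α τ) :
    wtSum wt (s.push R x.token).top + ((s.push R x.token).mid.map
      (Sum.elim (wtSum wt) (fun _ => 0))).sum + (s.push R x.token).bot.elim 0 (wtSum wt) ≤
    wt x.label + (wtSum wt s.top + (s.mid.map (Sum.elim (wtSum wt) (fun _ => 0))).sum +
        s.bot.elim 0 (wtSum wt)) := by
  obtain ⟨t, m, b⟩ := s; rcases x.eq_letter_or with ⟨a, rfl⟩ | ⟨-, e⟩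
  · rw [token_letter]; rcases t with _ | ⟨c, t⟩
    · simp [push, letter]; omega
    · by_cases hr : R a c
      · simp [push, hr, letter]; omega
      · rcases b with _ | b <;> simp [push, hr, letter, close, runItem] <;>
          omega
  · rw [e]; rcases b with _ | b
    · simp [push, close]; omega
    · rcases t with _ | ⟨c, t⟩ <;> simp [push, close, runItem]

lemma wt_ctxRuns (wt : α → ℕ) (L : List (Frame α τ)) :
    wtSum wt (ctxRuns R L).top + (ctxRuns R L).bot.elim 0 (wtSum wt) ≤ ctxWt wt L := by
  have : wtSum wt (ctxRuns R L).top + ((ctxRuns R L).mid.map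
      (Sum.elim (wtSum wt) (fun _ => 0))).sum + (ctxRuns R L).bot.elim 0 (wtSum wt) ≤
      ctxWt wt L := by
    induction L with
    | nil => simp [ctxRuns]
    | cons x L ih =>
      rw [ctxRuns_cons]; have := RunState.wt_push (R := R) wt (ctxRuns R L) x; simp [ctxWt] at ih ⊢
      omega
  omega

lemma wt_splitRun (wt : α → ℕ) {g : α → β} (t : Pat α) :
    wtSum wt (splitRun R φ g t).1 ≤ treeWt wt t := by
  induction t using induct_unary with
  | hp i => simp
  | h1 a t ih =>
    rw [splitRun_unary]; have e : treeWt wt (node a [t]) = wt a + treeWt wt t := by simp [treeWt]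
    rw [e]; generalize splitRun R φ g t = q at ih ⊢; obtain ⟨_ | ⟨b, w⟩, u⟩ := q
    · simp [pushRun]
    · by_cases hr : R a b <;> simp [pushRun, hr] at ih ⊢; omega
  | hn a ts h ih => simp [splitRun_node _ _ h]

/-- The right-hand side is traversed from right to left, with the old gap and potential computed
alongside. Contexts have to be nonempty, as an empty one would vanish without leaving a piece to
store its credit with. -/
lemma Acct.items (hp : PayOk R wt F n pay) (hF : ∀ x ≤ n, x.size ≤ F) (l : List (Item α))
    (hB : ∀ B, .nt B ∈ l → G.ctx B ≠ []) (hW : (l.map (G.itemWt wt)).sum + W ≤ n)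
    (h : Acct R wt F pay fc g₀ s g C W) (hg : PopGap wt F g₀ s g) :
    Acct R wt F pay fc g₀ (pushAll (partLink R) (l.flatMap (G.itemToks R)) s)
        (gapPot F g (l.map (Item.mark wt))).2
        ((l.map (itemCost fc)).sum + (gapPot F g (l.map (Item.mark wt))).1 + C)
        ((l.map (G.itemWt wt)).sum + W) ∧
      PopGap wt F g₀ (pushAll (partLink R) (l.flatMap (G.itemToks R)) s)
        (gapPot F g (l.map (Item.mark wt))).2 := by
  induction l with
  | nil => simpa [gapPot] using ⟨h, hg⟩
  | cons i l ih =>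
    rw [flatMap_cons, pushAll_append]; simp at hW ⊢
    obtain ⟨ih1, ih2⟩ := ih (fun B hBl => hB B (by simp [hBl])) (by omega)
    generalize pushAll (partLink R) (l.flatMap (G.itemToks R)) s = s at *
    have e : gapPot F g (i.mark wt :: l.map (Item.mark wt)) =
      gapStep F (i.mark wt) (gapPot F g (l.map (Item.mark wt))) := rfl
    rw [e]; generalize gapPot F g (l.map (Item.mark wt)) = q at *; obtain ⟨u, q⟩ := q
    rcases i with x | B
    · rcases x.eq_letter_or with ⟨a, rfl⟩ | ⟨-, hx⟩
      · obtain ⟨k1, k2⟩ := ih1.push_ex hp a (by omega) ih2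
        exact ⟨k1.mono (by simp only [itemCost, token_letter, Item.mark, gapStep]; omega)
          (by simp only [Gram.itemWt, letter]; omega), k2⟩
      · have k1 := ih1.push_frame hp x (by omega)
        simp only [Gram.itemToks, hx]
        refine ⟨k1.mono (by simp only [itemCost, hx, Item.mark, gapStep]; omega)
          (by simp only [Gram.itemWt]; omega), ?_⟩
        simp [RunState.push_inr, PopGap, numPop]
    · have hw := wt_ctxRuns (R := R) wt (G.ctx B)
      obtain ⟨l1, l2⟩ := linked_ctxRuns (R := R) (G.ctx B); simp only [Gram.itemWt] at hW ⊢
      simp only [Gram.itemToks]; rcases hb : (ctxRuns R (G.ctx B)).bot with _ | b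
      · obtain ⟨h1, -, -⟩ := ctxRuns_of_none hb
        have hne : (ctxRuns R (G.ctx B)).top ≠ [] := by grind
        obtain ⟨k1, k2⟩ := ih1.push_rm hp hne l1 hF (by omega)
        obtain ⟨a, w, ew⟩ := exists_cons_of_ne_nil hne; simp [ew, parts] at k1 k2 hw ⊢
        exact ⟨k1.mono (by simp only [itemCost, Item.mark, gapStep]; omega) (by omega), k2⟩
      · simp [hb] at hw ⊢; obtain ⟨k1, k2⟩ := ih1.push_nt hp l1 (l2 b hb) hF (by omega) B ih2
        exact ⟨k1.mono (by simp only [itemCost, Item.mark, gapStep]; omega) (by omega), k2⟩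

/-- The costs of a right-hand side in a run compression step. -/
def Gram.ruleCost (R : α → α → Bool) (pay : List (Part α) → ℕ) (fc : Frame α (Twig α) → ℕ)
    (r : Rule α) : ℕ :=
  midCost pay fc (G.runs R r).mid + (G.runs R r).bot.elim 0 pay + pay (G.runs R r).top +
    if (G.runs R r).top = [] then 0 else 2

def Gram.endWt (wt : α → ℕ) : Option (End α) → ℕ := fun e => e.elim 0 fun e => treeWt wt (G.endVal e)

lemma Gram.acct_start (hp : PayOk R wt F n pay) (fc : Frame α (Twig α) → ℕ) (r : Rule α) :
    Acct R wt F pay fc (endGap wt r.last) (G.startState R r.last) (endGap wt r.last)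
        (4 * r.lastNames.length) (G.endWt wt r.last) ∧
      PopGap wt F (endGap wt r.last) (G.startState R r.last) (endGap wt r.last) := by
  rw [Rule.lastNames]; rcases r.last with _ | c | C
  · refine ⟨?_, by simp [PopGap, startState, numPop]⟩
    constructor <;> simp [startState, midCost, gapPot, endGap, exLen, numPop, numRem, flat, Linked]
  · refine ⟨?_, by simp [PopGap, startState, numPop]⟩
    constructor <;> simp [startState, midCost, gapPot, endGap, exLen, numPop, numRem, flat, Linked,
      hp.nil, endWt, treeWt, endVal]
  · have hl : Linked R (cut R (G.val C)).1 := linked_splitRun _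
    have hw : wtSum wt (cut R (G.val C)).1 ≤ _ := wt_splitRun wt (G.val C)
    simp only [startState, PopGap]; generalize (cut R (G.val C)).1 = v at hl hw ⊢
    rcases v with _ | ⟨a, w⟩
    · refine ⟨?_, by simp [numPop, parts]⟩
      constructor <;> simp [parts, midCost, gapPot, endGap, exLen, numPop, numRem, flat, Linked,
        hp.nil]
    · refine ⟨?_, by simp [numPop, parts, endGap, exWt, gapPot]⟩
      constructor <;> simp [parts, midCost, gapPot, endGap, exLen, numPop, numRem, flat, hp.nil,
        End.names, endWt, endVal]
      · exact hl
      · simpa using hw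
      · simpa using hw

/-- After the traversal one run is still open at the top. Its stored credit pays for it and for a
letter, which is needed where the top run is kept. -/
lemma Gram.ruleCost_le (hp : PayOk R wt F n pay) (hF : ∀ x ≤ n, x.size ≤ F)
    (fc : Frame α (Twig α) → ℕ) (r : Rule α)
    (hB : ∀ B, .nt B ∈ r.items → G.ctx B ≠ [])
    (hW : (r.items.map (G.itemWt wt)).sum + G.endWt wt r.last ≤ n) :
    G.ruleCost R pay fc r + (gapPot F (endGap wt r.last) ((G.runs R r).mid.map (midMark wt))).1 ≤
      (r.items.map (itemCost fc)).sum + r.pot wt F + 4 * r.lastNames.length := by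
  obtain ⟨h1, h2⟩ := G.acct_start hp (R := R) fc r
  obtain ⟨h, -⟩ := h1.items G hp hF r.items hB hW h2; rw [← Rule.pot] at h
  change Acct _ _ _ _ _ _ (G.runs R r) _ _ _ at h; have h1 := h.cost; rw [ruleCost]
  by_cases ht : (G.runs R r).top = []
  · rw [ht, hp.nil]; simp; omega
  · have hle := hp.le _ ht h.linked h.ne (h.wt_top.trans hW) (by
      by_cases hr : numRem (G.runs R r).top = 0
      · exact .inr (h.pop hr)
      · exact .inl hr)
    rw [if_neg ht]; omega

end Accounting

/-! ### Weights of values -/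

lemma treeWt_node (wt : α → ℕ) (a : α) (ts : List (Pat α)) :
    treeWt wt (node a ts) = wt a + (ts.map (treeWt wt)).sum := by
  have : ∀ ts : List (Pat α), wtSum wt (ts.map labels).flatten = (ts.map (treeWt wt)).sum := by
    intro ts
    induction ts with
    | nil => rfl
    | cons t ts ih => simp [wtSum_append, ih, treeWt]
  rw [treeWt, labels_node, wtSum_cons]; grind

/-- The weight of a frame together with its children. -/
def frameWt (wt : α → ℕ) (x : Frame α (Pat α)) : ℕ :=
  wt x.label + ((x.pre ++ x.post).map (treeWt wt)).sum

def ctxTot (wt : α → ℕ) (L : List (Frame α (Pat α))) : ℕ := (L.map (frameWt wt)).sum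

@[simp] lemma ctxTot_nil (wt : α → ℕ) : ctxTot wt [] = 0 := rfl
@[simp] lemma ctxTot_cons (wt : α → ℕ) (x : Frame α (Pat α)) (L : List (Frame α (Pat α))) :
    ctxTot wt (x :: L) = frameWt wt x + ctxTot wt L := by simp [ctxTot]
lemma ctxTot_append (wt : α → ℕ) (L L' : List (Frame α (Pat α))) :
    ctxTot wt (L ++ L') = ctxTot wt L + ctxTot wt L' := by simp [ctxTot]

lemma treeWt_fill (wt : α → ℕ) (x : Frame α (Pat α)) (t : Pat α) :
    treeWt wt (x.fill t) = frameWt wt x + treeWt wt t := by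
  simp [fill, treeWt_node, frameWt]; omega

lemma treeWt_plug (wt : α → ℕ) (L : List (Frame α (Pat α))) (t : Pat α) :
    treeWt wt (plug L t) = ctxTot wt L + treeWt wt t := by
  induction L with
  | nil => simp
  | cons x L ih => rw [plug_cons, treeWt_fill, ih, ctxTot_cons, add_assoc]

lemma ctxWt_le (wt : α → ℕ) (L : List (Frame α (Pat α))) : ctxWt wt L ≤ ctxTot wt L := by
  induction L with
  | nil => rfl
  | cons x L ih => rw [ctxTot_cons]; simp [ctxWt, frameWt] at ih ⊢; omega

lemma Gram.itemsWt_le (wt : α → ℕ) (l : List (Item α)) :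
    (l.map (G.itemWt wt)).sum ≤ ctxTot wt (G.itemsVal l) := by
  induction l with
  | nil => simp
  | cons i l ih =>
    rw [itemsVal_cons, ctxTot_append, map_cons, sum_cons]; refine Nat.add_le_add ?_ ih
    rcases i with x | B
    · simp [itemWt, itemVal, frameWt, Frame.map]
    · exact ctxWt_le _ _

lemma Gram.twigWt_le (wt : α → ℕ) {x : Frame α (Twig α)} (hx : .frame x ∈ l)
    {t : Twig α} (ht : t ∈ x.pre ++ x.post) :
    treeWt wt (G.twigVal t) ≤ ctxTot wt (G.itemsVal l) := by
  obtain ⟨l1, l2, rfl⟩ := append_of_mem hx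
  rw [itemsVal_append, itemsVal_cons, ctxTot_append, ctxTot_append]
  have h1 : ctxTot wt (G.itemVal (.frame x)) = frameWt wt (x.map G.twigVal) := by simp [itemVal]
  have h2 : treeWt wt (G.twigVal t) ≤ frameWt wt (x.map G.twigVal) := by
    have : treeWt wt (G.twigVal t) ∈ ((x.pre ++ x.post).map G.twigVal).map (treeWt wt) :=
      mem_map_of_mem (mem_map_of_mem ht)
    have := le_sum_of_mem this; simp only [frameWt, Frame.map, ← map_append]; omega
  omega

/-! ### The costs of a run compression step -/

def blkWt (wt : α → ℕ) : Blk α → ℕ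
  | .run a w => wtSum wt (a :: w)
  | .other a => wt a

variable (R)

def Gram.twigRuns (t : Twig α) : List (List (Part α)) :=
  (G.keptRuns R (twigRule t)).flatMap (Sum.elim (fun ps => [ps]) (fun _ => []))

def Gram.midRuns : List (Part α) ⊕ Item α → List (List (Part α))
  | .inl ps => [ps]
  | .inr (.frame x) => (x.pre ++ x.post).flatMap (G.twigRuns R)
  | .inr (.nt _) => []

/-- All runs in a right-hand side, including those in twigs. -/
def Gram.allRuns (r : Rule α) : List (List (Part α)) :=
  (G.runs R r).top :: ((G.runs R r).bot.toList ++ (G.runs R r).mid.flatMap (G.midRuns R))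

/-- Twigs contain no nonterminals of rank 1, so they carry no potential, and all their costs can be
charged to the frame they hang from. -/
def Gram.newFrameCost (pay : List (Part α) → ℕ) (x : Frame α (Twig α)) : ℕ :=
  (((x.pre ++ x.post).flatMap (G.twigRuns R)).map pay).sum +
    2 * (1 + ((x.pre ++ x.post).map fun t => (G.newTwig R t).size).sum)

variable {R} {wt : α → ℕ} {F n : ℕ} {pay : List (Part α) → ℕ}

section

variable {S : Name0}

lemma length_blkOf (ps : List (Part α)) : (blkOf ps).length ≤ 1 := by unfold blkOf; split <;> simp

lemma size_letters (w : List α) :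
    ((w.map fun a => Item.frame (letter a)).map Item.size).sum = w.length := by
  induction w with
  | nil => rfl
  | cons a w ih =>
    rw [map_cons, map_cons, sum_cons, ih]; simp [Item.size, letter, Frame.twigSize]; omega

lemma Gram.midCost_eq (m : List (List (Part α) ⊕ Item α)) :
    ((m.flatMap (G.midRuns R)).map pay).sum + 2 * ((m.flatMap (G.newItem R)).map Item.size).sum ≤
      midCost pay (G.newFrameCost R pay) m := by
  induction m with
  | nil => simp
  | cons y m ih =>
    simp; rcases y with ps | x | B
    · have := length_blkOf ps
      simp only [midRuns, newItem, size_letters, midCost, map_cons, map_nil, sum_cons, sum_nil]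
      omega
    · have e : (((x.pre ++ x.post).map (G.newTwig R)).map Twig.size).sum =
        ((x.pre ++ x.post).map fun t => (G.newTwig R t).size).sum := by rw [map_map]; rfl
      rw [map_append] at e
      simp only [midRuns, newItem, midCost, map_cons, map_nil, sum_cons,
        sum_nil, newFrameCost, Item.size, Frame.twigSize, e]
      omega
    · simp [midRuns, newItem, midCost, Item.size]; omega

lemma gapPot_cons_zero (F : ℕ) (g : Option ℕ) (l : List (ℕ ⊕ Unit)) :
    gapPot F g (.inl 0 :: l) = gapPot F g l := by
  have : gapPot F g (.inl 0 :: l) = gapStep F (.inl 0) (gapPot F g l) := rfl; rw [this]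
  rcases gapPot F g l with ⟨u, _ | y⟩ <;> rfl

lemma gapPot_cons_inl (F : ℕ) (g : Option ℕ) (w : ℕ) (l : List (ℕ ⊕ Unit)) :
    (gapPot F g (.inl w :: l)).1 = (gapPot F g l).1 := by
  have : gapPot F g (.inl w :: l) = gapStep F (.inl w) (gapPot F g l) := rfl; rw [this]; rfl

lemma gapPot_append (F : ℕ) (g : Option ℕ) (l l' : List (ℕ ⊕ Unit)) :
    gapPot F g (l ++ l') = l.foldr (gapStep F) (gapPot F g l') := by simp [gapPot]

/-- The new letter carries the total weight of its run, so gaps do not notice the contraction. -/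
lemma Gram.gapPot_newItem (F : ℕ) (g : Option ℕ) (m : List (List (Part α) ⊕ Item α)) :
    gapPot F g ((m.flatMap (G.newItem R)).map (Item.mark (blkWt wt))) =
      gapPot F g (m.map (midMark wt)) := by
  induction m with
  | nil => rfl
  | cons y m ih =>
    rw [flatMap_cons, map_append, gapPot_append, ih]; rcases y with ps | x | B
    · have hb : blkOf ps = match flat ps with
        | [] => []
        | a :: w => [.run a w] := rfl
      simp [newItem, midMark, hb]; rcases flat ps with _ | ⟨a, w⟩
      · rw [wtSum_nil, gapPot_cons_zero]; rfl
      · rfl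
    · rfl
    · rfl

lemma endGap_newEnd (e : Option (End α)) : endGap (blkWt wt) (e.map newEnd) = endGap wt e := by
  rcases e with _ | c | C <;> rfl

lemma size_newEnd (e : Option (End α)) : (e.map newEnd).elim 0 End.size = e.elim 0 End.size := by
  rcases e with _ | c | C <;> rfl

lemma Gram.gapPot_kept (F : ℕ) (g : Option ℕ) (r : Rule α) :
    (gapPot F g ((G.keptRuns R r).map (midMark wt))).1 =
      (gapPot F g ((G.runs R r).mid.map (midMark wt))).1 := by
  rw [keptRuns]; rcases (G.runs R r).top with _ | ⟨p, t⟩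
  · rfl
  · exact gapPot_cons_inl _ _ _ _

/-- A twig is a right-hand side without nonterminals of rank 1, so the bound for rules applies with
potential zero. -/
lemma Gram.twig_le (hp : PayOk R wt F n pay) (hF : ∀ x ≤ n, x.size ≤ F) (t : Twig α)
    (hW : treeWt wt (G.twigVal t) ≤ n) :
    ((G.twigRuns R t).map pay).sum + 2 * (G.newTwig R t).size ≤ 2 * t.size + 4 * t.names.length := by
  have h := G.ruleCost_le hp hF (G.newFrameCost R pay) (twigRule t) (by simp [twigRule]) (by
    rw [twigVal, treeWt_plug] at hW; have := G.itemsWt_le wt (twigRule t).items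
    have e : G.itemsVal (twigRule t).items = t.chain.map letter := G.itemsVal_letters _
    have e' : G.endWt wt (twigRule t).last = treeWt wt (G.endVal t.last) := rfl; rw [e] at this
    omega)
  have hpot : (twigRule t).pot wt F = 0 := by
    have := gapPot_le F (endGap wt (twigRule t).last) ((twigRule t).items.map (Item.mark wt))
    have e : ((twigRule t).items.map (Item.mark wt)).countP Sum.isRight = 0 := by
      rw [countP_eq_zero]; simp [twigRule, Item.mark]
    rw [e] at this; simpa [Rule.pot] using this
  have hc : ((twigRule t).items.map (itemCost (G.newFrameCost R pay))).sum = 2 * t.chain.length := by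
    simp [twigRule]
    induction t.chain with
    | nil => rfl
    | cons a w ih => simp [ih, itemCost, token_letter]; omega
  obtain ⟨m, e⟩ := G.keptRuns_twigRule (R := R) t
  have k : ((G.twigRuns R t).map pay).sum + 2 * ((G.keptRuns R (twigRule t)).flatMap
      (Sum.elim blkOf fun _ => [])).length ≤
      midCost pay (G.newFrameCost R pay) (G.keptRuns R (twigRule t)) := by
    rw [twigRuns, e]; clear e
    induction m with
    | nil => simp
    | cons ps m ih => have := length_blkOf ps; simp [midCost] at ih ⊢; omega
  have e2 : midCost pay (G.newFrameCost R pay) (G.keptRuns R (twigRule t)) ≤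
      G.ruleCost R pay (G.newFrameCost R pay) (twigRule t) := by
    rw [keptRuns, ruleCost]; rcases (G.runs R (twigRule t)).top with _ | ⟨p, ps⟩
    · simp [runItem]; omega
    · simp [runItem, midCost]; omega
  have e3 : (newEnd t.last).size = t.last.size := size_newEnd (some t.last)
  have e4 : (twigRule t).lastNames = t.names := rfl
  have e5 : (G.newTwig R t).size = ((G.keptRuns R (twigRule t)).flatMap
    (Sum.elim blkOf (fun _ => []))).length + (newEnd t.last).size := rfl
  rw [hpot, hc, e4] at h; rw [e5, e3, Twig.size]; omega

lemma Gram.newFrameCost_le (hp : PayOk R wt F n pay) (hF : ∀ x ≤ n, x.size ≤ F)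
    (x : Frame α (Twig α)) (hW : ∀ t ∈ x.pre ++ x.post, treeWt wt (G.twigVal t) ≤ n) :
    G.newFrameCost R pay x ≤ 2 * (Item.frame x).size + 4 * (Item.frame x).names.length := by
  simp only [newFrameCost, Item.size, Item.names, Frame.twigSize]
  generalize x.pre ++ x.post = l at hW ⊢
  induction l with
  | nil => simp
  | cons t l ih =>
    have ih := ih fun t ht => hW t (by simp [ht])
    have h := G.twig_le hp hF t (hW t (by simp))
    simp at ih ⊢; omega

/-- Payments, new size and new potential together are covered by the old rule plus 8 for each name,
namely 4 for each of at most two pieces popped from it. -/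
lemma Gram.runStep_cost (hp : PayOk R wt F n pay) (hF : ∀ x ≤ n, x.size ≤ F) (X : Name)
    (hB : ∀ B, .nt B ∈ (G.rule X).items → G.ctx B ≠ [])
    (hW : ctxTot wt (G.itemsVal (G.rule X).items) + G.endWt wt (G.rule X).last ≤ n) :
    ((G.allRuns R (G.rule X)).map pay).sum + 2 * ((G.runStep R S).rule X).size +
        ((G.runStep R S).rule X).pot (blkWt wt) F ≤
      2 * (G.rule X).size + (G.rule X).pot wt F + 8 * (G.rule X).names.length := by
  have h1 := G.ruleCost_le hp hF (G.newFrameCost R pay) (G.rule X) hB (by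
    have := G.itemsWt_le wt (G.rule X).items; omega)
  have h2 : ((G.rule X).items.map (itemCost (G.newFrameCost R pay))).sum ≤
      2 * ((G.rule X).items.map Item.size).sum +
        8 * ((G.rule X).items.flatMap Item.names).length := by
    have hW' : ∀ x, .frame x ∈ (G.rule X).items → ∀ t ∈ x.pre ++ x.post,
        treeWt wt (G.twigVal t) ≤ n := by
      intro x hx t ht; have := G.twigWt_le wt hx ht; omega
    generalize (G.rule X).items = l at hW'
    induction l with
    | nil => simp
    | cons i l ih =>
      have ih := ih fun x hx => hW' x (by simp [hx])
      have hi : itemCost (G.newFrameCost R pay) i ≤ 2 * i.size + 8 * i.names.length := by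
        rcases i with x | B
        · have := G.newFrameCost_le hp hF x (hW' x (by simp))
          rcases x.eq_letter_or with ⟨a, rfl⟩ | ⟨-, hx⟩
          · simp [itemCost, token_letter, Item.size]; omega
          · simp only [itemCost, hx]; omega
        · simp [itemCost, Item.names, Item.size]
      grind
  have h3 : ((G.runStep R S).rule X).pot (blkWt wt) F =
      (gapPot F (endGap wt (G.rule X).last) ((G.runs R (G.rule X)).mid.map (midMark wt))).1 := by
    simp only [Rule.pot, runStep, gapPot_newItem, endGap_newEnd]
    split
    · exact G.gapPot_kept _ _ _
    · rfl
  have h4 : ((G.allRuns R (G.rule X)).map pay).sum + 2 * ((G.runStep R S).rule X).size ≤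
      G.ruleCost R pay (G.newFrameCost R pay) (G.rule X) + 2 * (G.rule X).last.elim 0 End.size := by
    have k1 := G.midCost_eq (R := R) (pay := pay) (G.runs R (G.rule X)).mid
    have k2 : (((if X = .zero S then G.keptRuns R (G.rule X) else (G.runs R (G.rule X)).mid).flatMap
        (G.newItem R)).map Item.size).sum ≤
        (((G.runs R (G.rule X)).mid.flatMap (G.newItem R)).map Item.size).sum +
          if (G.runs R (G.rule X)).top = [] then 0 else 1 := by
      split
      · rw [keptRuns]; rcases (G.runs R (G.rule X)).top with _ | ⟨p, t⟩
        · simp [runItem]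
        · have := length_blkOf (p :: t)
          simp only [runItem, cons_append, nil_append, flatMap_cons, map_append,
            sum_append, newItem, size_letters]
          simp; omega
      · omega
    have k3 : (((G.runs R (G.rule X)).bot.toList).map pay).sum =
        (G.runs R (G.rule X)).bot.elim 0 pay := by
      rcases (G.runs R (G.rule X)).bot with _ | b <;> simp
    have k4 : ((G.runStep R S).rule X).size = (((if X = .zero S then G.keptRuns R (G.rule X) else
        (G.runs R (G.rule X)).mid).flatMap (G.newItem R)).map Item.size).sum +
        (G.rule X).last.elim 0 End.size := by
      simp only [Rule.size, runStep, size_newEnd]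
    rw [k4, allRuns, ruleCost]; grind
  have h5 : (G.rule X).names.length = ((G.rule X).items.flatMap Item.names).length +
    (G.rule X).lastNames.length := by simp [Rule.names]
  rw [h3, h5]; simp only [Rule.size] at h4 ⊢; omega

end

/-! ### Domains of nonterminals and the invariant -/

/-- The nonterminals in use: nonterminals of rank `1` and `0`, and `r` nonterminals for the children
of popped frames for each nonterminal of rank `1`. -/
structure Dom where
  one : Finset Symb
  zero : Finset Symb
  r : ℕ
  start : Symb

def Dom.Mem (D : Dom) : Name → Prop
  | .one A => A ∈ D.one
  | .zero (.orig C) => C ∈ D.zero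
  | .zero (.child E j) => E ∈ D.one ∧ j < D.r

/-- The sum over all nonterminals in use. -/
def Dom.sum (D : Dom) (f : Name → ℕ) : ℕ :=
  ∑ E ∈ D.one, (f (.one E) + ∑ j ∈ Finset.range D.r, f (.zero (.child E j))) +
    ∑ C ∈ D.zero, f (.zero (.orig C))

abbrev Dom.S (D : Dom) : Name0 := .orig D.start

lemma Dom.sum_le (D : Dom) {f g : Name → ℕ} (h : ∀ X, D.Mem X → f X ≤ g X) : D.sum f ≤ D.sum g := by
  refine Nat.add_le_add (Finset.sum_le_sum fun E hE => Nat.add_le_add (h _ hE)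
    (Finset.sum_le_sum fun j hj => h _ ⟨hE, Finset.mem_range.1 hj⟩))
    (Finset.sum_le_sum fun C hC => h _ hC)

lemma Dom.sum_add (D : Dom) (f g : Name → ℕ) : D.sum (fun X => f X + g X) = D.sum f + D.sum g := by
  simp only [Dom.sum, Finset.sum_add_distrib]; ring

lemma Dom.sum_mul (D : Dom) (c : ℕ) (f : Name → ℕ) : D.sum (fun X => c * f X) = c * D.sum f := by
  simp only [Dom.sum, ← Finset.mul_sum, ← mul_add]

lemma Dom.le_sum (D : Dom) (f : Name → ℕ) {X : Name} (h : D.Mem X) : f X ≤ D.sum f := by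
  rcases X with A | C | ⟨E, j⟩
  · have := Finset.single_le_sum (f := fun E => f (.one E) + ∑ j ∈ Finset.range D.r,
      f (.zero (.child E j))) (fun _ _ => Nat.zero_le _) h
    simp only [Dom.sum] at this ⊢; omega
  · have := Finset.single_le_sum (f := fun C => f (.zero (.orig C))) (fun _ _ => Nat.zero_le _) h
    simp only [Dom.sum] at this ⊢; omega
  · have := Finset.single_le_sum (f := fun E => f (.one E) + ∑ j ∈ Finset.range D.r,
      f (.zero (.child E j))) (fun _ _ => Nat.zero_le _) h.1
    have h2 := Finset.single_le_sum (f := fun j => f (.zero (.child E j)))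
      (fun _ _ => Nat.zero_le _) (Finset.mem_range.2 h.2)
    simp only [Dom.sum] at this ⊢; omega

lemma Dom.sum_comm (D : Dom) {ι : Type} (s : Finset ι) (f : ι → Name → ℕ) :
    D.sum (fun X => ∑ i ∈ s, f i X) = ∑ i ∈ s, D.sum (f i) := by
  classical
  induction s using Finset.induction with
  | empty => simp [Dom.sum]
  | insert i s hi ih => simp only [Finset.sum_insert hi, Dom.sum_add, ih]

lemma Dom.sum_sum_comm (D : Dom) (f : Name → Name → ℕ) :
    D.sum (fun X => D.sum (f X)) = D.sum fun Y => D.sum fun X => f X Y := by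
  have e : (fun X => D.sum (f X)) = fun X =>
    ((∑ E ∈ D.one, (f X (.one E) + ∑ j ∈ Finset.range D.r, f X (.zero (.child E j)))) +
    ∑ C ∈ D.zero, f X (.zero (.orig C))) := rfl
  rw [e, Dom.sum_add, Dom.sum_comm, Dom.sum_comm]; simp only [Dom.sum_add, Dom.sum_comm]; rfl

lemma Dom.length_le (D : Dom) (l : List Name) (h : ∀ Y ∈ l, D.Mem Y) :
    l.length ≤ D.sum fun Y => l.count Y := by
  induction l with
  | nil => simp
  | cons Y l ih =>
    have ih := ih fun Z hZ => h Z (by simp [hZ])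
    have h1 := D.le_sum (fun Z => if Y = Z then 1 else 0) (h Y (by simp))
    have e : (fun Z => (Y :: l).count Z) = fun Z => l.count Z + if Y = Z then 1 else 0 := by
      funext Z; simp [count_cons]
    rw [e, Dom.sum_add]; simp at h1; simp; omega

def ctxWidth (r : ℕ) (L : List (Frame α τ)) : Prop := ∀ x ∈ L, x.pre.length + x.post.length < r

/-- The nonterminals for the children of the frame popped from `E` that do not yet stand for
constants still occur below every occurrence of `E`. -/
def Gram.Pending (r : ℕ) (X : Name) : Prop :=
  ∀ E l₁ l₂, (G.rule X).names = l₁ ++ .one E :: l₂ → ∀ j < r,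
    constOf (G.val (.child E j)) = none → .zero (.child E j) ∈ l₂ ∨ ∃ A, X = .one A ∧ ∃ i < r,
      .zero (.child E j) ∈ (G.rule (.zero (.child A i))).names

/-- The invariant. -/
structure Gram.Inv (D : Dom) (ord m : Name → ℕ) (wt : α → ℕ) (n : ℕ) : Prop where
  start_mem : D.start ∈ D.zero
  holds : ∀ X, D.Mem X → G.Holds X
  closed : ∀ X, D.Mem X → ∀ Y ∈ (G.rule X).names, D.Mem Y ∧ ord Y < ord X ∧ Y ≠ .zero D.S
  closed_one : ∀ X, D.Mem X → ∀ B, .one B ∈ (G.rule X).names → ord (.one B) + 1 < ord X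
  count : ∀ Y, D.sum (fun X => (G.rule X).names.count Y) ≤ m Y
  weight_one : ∀ A ∈ D.one, ctxTot wt (G.ctx A) ≤ n
  weight_zero : ∀ C, D.Mem (.zero C) → treeWt wt (G.val C) ≤ n
  width : ∀ A ∈ D.one, ctxWidth D.r (G.ctx A)
  pending : ∀ X, D.Mem X → G.Pending D.r X

variable {G} {D : Dom} {ord m : Name → ℕ}

lemma Gram.Inv.weight (h : G.Inv D ord m wt n) {X : Name} (hX : D.Mem X) :
    ctxTot wt (G.itemsVal (G.rule X).items) + G.endWt wt (G.rule X).last ≤ n := by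
  have hh := h.holds X hX; rcases X with A | C
  · obtain ⟨h1, h2⟩ := hh; have := h.weight_one A hX; rw [h1, ← h2]; simpa [endWt] using this
  · obtain ⟨e, h1, h2⟩ := hh; have := h.weight_zero C hX; rw [h2, treeWt_plug] at this; rw [h1]
    simpa [endWt] using this

lemma Gram.Inv.sum_names (h : G.Inv D ord m wt n) :
    D.sum (fun X => (G.rule X).names.length) ≤ D.sum m := by
  refine (D.sum_le fun X hX => D.length_le _ fun Y hY => (h.closed X hX Y hY).1).trans ?_
  rw [Dom.sum_sum_comm]; exact D.sum_le fun Y _ => h.count Y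

/-- Run compression, cleaning and leaf compression only delete names from right-hand sides, and they
never delete a child name whose value remains different from a constant. Hence order, occurrence
counts and pending names are treated once and for all. -/
lemma Gram.Inv.of_filter {G' : Gram β} {wt' : β → ℕ} (h : G.Inv D ord m wt n)
    (p : Name → Bool)
    (hn : ∀ X, D.Mem X → (G'.rule X).names = (G.rule X).names.filter p)
    (hp : ∀ E j, constOf (G'.val (.child E j)) = none → constOf (G.val (.child E j)) = none ∧
      p (.zero (.child E j)) = true)
    (holds : ∀ X, D.Mem X → G'.Holds X)
    (weight_one : ∀ A ∈ D.one, ctxTot wt' (G'.ctx A) ≤ n)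
    (weight_zero : ∀ C, D.Mem (.zero C) → treeWt wt' (G'.val C) ≤ n)
    (width : ∀ A ∈ D.one, ctxWidth D.r (G'.ctx A)) : G'.Inv D ord m wt' n where
  start_mem := h.start_mem
  holds := holds
  closed X hX Y hY := h.closed X hX Y (mem_of_mem_filter (hn X hX ▸ hY))
  closed_one X hX B hB := h.closed_one X hX B (mem_of_mem_filter (hn X hX ▸ hB))
  count Y := (D.sum_le fun X hX => by
    rw [hn X hX]; exact filter_sublist.count_le Y).trans (h.count Y)
  weight_one := weight_one
  weight_zero := weight_zero
  width := width
  pending X hX E l₁ l₂ e j hj hc := by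
    rw [hn X hX] at e; obtain ⟨k₁, k₂, e1, -, e2⟩ := filter_eq_append_iff.1 e
    obtain ⟨k₃, k₄, rfl, -, -, e4⟩ := filter_eq_cons_iff.1 e2; obtain ⟨c1, c2⟩ := hp E j hc
    rcases h.pending X hX E (k₁ ++ k₃) k₄ (by rw [e1]; simp) j hj c1 with hm | ⟨A, rfl, i, hi, hm⟩
    · left; rw [← e4]; exact mem_filter.2 ⟨hm, c2⟩
    · right
      exact ⟨A, rfl, i, hi, by rw [hn (.zero (.child A i)) ⟨hX, hi⟩]; exact mem_filter.2 ⟨hm, c2⟩⟩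

/-! ### Run compression preserves the invariant -/

variable (R) in
def Gram.survives (G : Gram α) : Name → Bool
  | .one B => (ctxRuns R (G.ctx B)).bot.isSome
  | .zero _ => true

def tokNames : X ⊕ Item α → List Name
  | .inl _ => []
  | .inr i => i.names

lemma midNames_push {R : X → X → Bool} (s : RunState X (Item α)) (x : X ⊕ Item α) :
    (s.push R x).mid.flatMap tokNames = tokNames x ++ s.mid.flatMap tokNames := by
  have hc : ∀ s : RunState X (Item α), s.close.mid.flatMap tokNames = s.mid.flatMap tokNames := by
    rintro ⟨t, m, _ | b⟩
    · rfl
    · cases t <;> simp [close, runItem, tokNames]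
  rcases x with a | i
  · obtain ⟨_ | ⟨c, t⟩, m, b⟩ := s
    · rfl
    · by_cases hr : R a c
      · simp [push, hr, tokNames]
      · simp only [push, hr]; simpa [tokNames] using hc ⟨c :: t, m, b⟩
  · simp [push, hc]; rfl

lemma midNames_pushAll {R : X → X → Bool} (s : RunState X (Item α)) (l : List (X ⊕ Item α)) :
    (pushAll R l s).mid.flatMap tokNames = l.flatMap tokNames ++ s.mid.flatMap tokNames := by
  induction l with
  | nil => rfl
  | cons x l ih => rw [pushAll_cons, midNames_push, ih]; simp

lemma Gram.itemToks_names (i : Item α) :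
    (G.itemToks R i).flatMap tokNames = i.names.filter (G.survives R) := by
  rcases i with x | B
  · have e : (Item.frame x).names.filter (G.survives R) = (Item.frame x).names := by
      rw [filter_eq_self]; intro Y hY; obtain ⟨t, -, ht⟩ := mem_flatMap.1 hY
      rcases hl : t.last with c | C
      · simp [Twig.names, End.names, hl] at ht
      · simp [Twig.names, End.names, hl] at ht; subst ht; rfl
    rw [e]; rcases x.eq_letter_or with ⟨a, rfl⟩ | ⟨-, hx⟩
    · rfl
    · simp [itemToks, hx, tokNames]
  · rcases hb : (ctxRuns R (G.ctx B)).bot with _ | b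
    · simp only [itemToks, hb]; simp [Item.names, survives, hb, tokNames, flatMap_map]
    · simp only [itemToks, hb]
      have e : ∀ l : List (Part α), l.flatMap (fun _ => ([] : List Name)) = [] := by simp
      simp [Item.names, survives, hb, tokNames, flatMap_map, e]

lemma Gram.runs_names (r : Rule α) : (G.runs R r).mid.flatMap tokNames =
    (r.items.flatMap Item.names).filter (G.survives R) := by
  rw [runs, midNames_pushAll, startState_mid, flatMap_nil, append_nil, flatMap_assoc,
    filter_flatMap]
  simp only [itemToks_names]

lemma names_newEnd (e : End α) : (newEnd e).names = e.names := by cases e <;> rfl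

lemma Gram.newItem_names (y : List (Part α) ⊕ Item α) :
    (G.newItem R y).flatMap Item.names = tokNames y := by
  rcases y with ps | x | B
  · simp only [newItem, tokNames]
    induction blkOf ps with
    | nil => rfl
    | cons a w ih => simp [Item.names, letter]
  · have e : ∀ l : List (Twig α), (l.map (G.newTwig R)).flatMap Twig.names = l.flatMap Twig.names := by
      intro l; rw [flatMap_map]; congr 1
      funext t
      exact names_newEnd t.last
    simp only [newItem, tokNames, flatMap_cons, flatMap_nil, append_nil, Item.names]
    rw [← map_append, e]
  · simp [newItem, tokNames]; rfl

lemma Gram.runStep_names (S : Name0) (Y : Name) :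
    ((G.runStep R S).rule Y).names = (G.rule Y).names.filter (G.survives R) := by
  have h1 : (((G.rule Y).last.map newEnd).elim [] End.names) = (G.rule Y).lastNames := by
    rw [Rule.lastNames]; rcases (G.rule Y).last with _ | e
    · rfl
    · exact names_newEnd e
  have h2 : (G.rule Y).lastNames.filter (G.survives R) = (G.rule Y).lastNames := by
    rw [filter_eq_self]; intro Z hZ; rw [Rule.lastNames] at hZ
    rcases hl : (G.rule Y).last with _ | c | C
    · simp [hl] at hZ
    · simp [hl, End.names] at hZ
    · simp [hl, End.names] at hZ; subst hZ; rfl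
  have h3 : ∀ m : List (List (Part α) ⊕ Item α),
      (m.flatMap (G.newItem R)).flatMap Item.names = m.flatMap tokNames := by
    intro m; rw [flatMap_assoc]; simp only [newItem_names]
  have h4 : (G.keptRuns R (G.rule Y)).flatMap tokNames =
      (G.runs R (G.rule Y)).mid.flatMap tokNames := by
    rw [keptRuns]
    cases (G.runs R (G.rule Y)).top <;> simp [runItem, tokNames]
  rw [Rule.names, Rule.names, filter_append, h2]; congr 1; simp only [runStep]
  rw [h3, ← G.runs_names]
  split
  · exact h4
  · rfl

lemma treeWt_splitRun (wt : α → ℕ) (t : Pat α) :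
    treeWt (blkWt wt) (cut R t).2 + wtSum wt (cut R t).1 = treeWt wt t ∧
      treeWt (blkWt wt) (comp R t) = treeWt wt t := by
  have hfin : ∀ s : List α × Pat (Blk α), treeWt (blkWt wt) (finish Blk.run s) =
      treeWt (blkWt wt) s.2 + wtSum wt s.1 := by
    rintro ⟨_ | ⟨a, w⟩, t⟩
    · rfl
    · simp [finish, treeWt_node, blkWt]; omega
  suffices h : treeWt (blkWt wt) (cut R t).2 + wtSum wt (cut R t).1 = treeWt wt t from
    ⟨h, by rw [comp, runComp, hfin]; exact h⟩
  induction t using induct_unary with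
  | hp i => simp [treeWt]
  | h1 a t ih =>
    rw [cut, splitRun_unary, treeWt_node, ← cut]; simp; rw [← ih]
    rcases cut R t with ⟨_ | ⟨b, w⟩, u⟩
    · simp [pushRun]; omega
    · by_cases hr : R a b <;> simp [pushRun, hr, treeWt_node, blkWt] <;> omega
  | hn a ts h ih =>
    have e : (ts.map (comp R)).map (treeWt (blkWt wt)) = ts.map (treeWt wt) := by
      rw [map_map]; refine map_congr_left fun t ht => ?_
      rw [Function.comp, comp, runComp, hfin]; exact ih t ht
    rw [cut, splitRun_node _ _ h, treeWt_node, treeWt_node, e]; rfl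

lemma ctxTot_ctxRuns (wt : α → ℕ) (L : List (Frame α (Pat α))) :
    ctxTot (blkWt wt) ((ctxRuns R L).mid.flatMap (compressItem R Blk.run Blk.other)) ≤
      ctxTot wt L := by
  have hrun : ∀ w : List α, ctxTot (blkWt wt) ((runItem w).flatMap
      (compressItem R Blk.run Blk.other)) = wtSum wt w := by
    rintro (_ | ⟨a, w⟩)
    · rfl
    · simp [runItem, compressItem, frameWt, letter, blkWt]
  have hclose : ∀ s : RunState α (Frame α (Pat α)), ctxTot (blkWt wt) (s.close.mid.flatMap
      (compressItem R Blk.run Blk.other)) ≤ ctxTot (blkWt wt) (s.mid.flatMap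
      (compressItem R Blk.run Blk.other)) + wtSum wt s.top := by
    rintro ⟨t, m, _ | b⟩
    · simp [close]
    · simp [close, ctxTot_append, hrun]; omega
  suffices h : ctxTot (blkWt wt) ((ctxRuns R L).mid.flatMap (compressItem R Blk.run Blk.other)) +
      wtSum wt (ctxRuns R L).top ≤ ctxTot wt L by omega
  induction L with
  | nil => simp [ctxRuns]
  | cons x L ih =>
    rw [ctxRuns_cons, ctxTot_cons]; have hc := hclose (ctxRuns R L); generalize ctxRuns R L = s at *
    rcases x.eq_letter_or with ⟨a, rfl⟩ | ⟨-, e⟩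
    · rw [token_letter]; have ew : frameWt wt (letter a) = wt a := by simp [frameWt, letter]
      rw [ew]; obtain ⟨_ | ⟨c, t⟩, m, b⟩ := s
      · simp [push] at ih ⊢; omega
      · by_cases hr : R a c
        · simp [push, hr] at ih ⊢; omega
        · simp only [push, hr]; simp at hc ih ⊢; omega
    · rw [e]
      have ew : ctxTot (blkWt wt) (compressItem R Blk.run Blk.other (.inr x)) = frameWt wt x := by
        simp only [compressItem, ctxTot_cons, ctxTot_nil, frameWt, blkWt, ← map_append,
          map_map, add_zero]
        congr 2; exact map_congr_left fun t _ => (treeWt_splitRun wt t).2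
      simp [push, ctxTot_append, ew]; omega

lemma constOf_cut {c : α} (h : constOf t = some c) : constOf (cut R t).2 = some (.other c) := by
  rw [constOf_eq_some.1 h]; simp [splitRun_node]

lemma Gram.Inv.runStep (h : G.Inv D ord m wt n) : (G.runStep R D.S).Inv D ord m (blkWt wt) n := by
  refine h.of_filter (G.survives R) (fun X _ => G.runStep_names _ _) ?_ ?_ ?_ ?_ ?_
  · intro E j hc; refine ⟨?_, rfl⟩; rcases hv : constOf (G.val (.child E j)) with _ | c
    · rfl
    · have : (G.runStep R D.S).val (.child E j) = (cut R (G.val (.child E j))).2 := by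
        simp [Gram.runStep]
      rw [this, constOf_cut hv] at hc; cases hc
  · exact fun X hX => G.runStep_holds (h.holds X hX) fun hm => (h.closed X hX _ hm).2.2 rfl
  · exact fun A hA => (ctxTot_ctxRuns wt _).trans (h.weight_one A hA)
  · intro C hC; refine le_trans ?_ (h.weight_zero C hC)
    obtain ⟨h1, h2⟩ := treeWt_splitRun (R := R) wt (G.val C); simp only [Gram.runStep]
    split <;> omega
  · intro A hA y hy; obtain ⟨x, hx, hy⟩ := mem_flatMap.1 hy; rcases x with w | x
    · have := h.width A hA; rcases w with _ | ⟨a, w⟩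
      · simp [compressItem] at hy
      · simp [compressItem] at hy; subst hy
        have hL : G.ctx A ≠ [] := by intro hL; rw [hL] at hx; simp [ctxRuns] at hx
        obtain ⟨z, L, hz⟩ := exists_cons_of_ne_nil hL; have := this z (by simp [hz])
        simp [letter]; omega
    · rcases mem_pushAll hx with hx | hx
      · simp at hx
      · obtain ⟨z, hz, hzx⟩ := mem_map.1 hx; have hw := h.width A hA z hz
        rcases z.eq_letter_or with ⟨a, rfl⟩ | ⟨-, e⟩
        · simp [token_letter] at hzx
        · rw [e] at hzx; cases hzx; simp [compressItem] at hy; subst hy; simpa using hw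

/-! ### Comparison of potentials -/

/-- The second potential is at most the first one, and its gap is at least the first one. -/
def GapLe (p p' : ℕ × Option ℕ) : Prop := p'.1 ≤ p.1 ∧ ∀ y, p'.2 = some y → ∃ x ≤ y, p.2 = some x

lemma GapLe.refl (p : ℕ × Option ℕ) : GapLe p p := ⟨le_rfl, fun y hy => ⟨y, le_rfl, hy⟩⟩

variable {p p' : ℕ × Option ℕ} {Y : Name} {B E C : Symb} {x : Frame α (Twig α)} {j : ℕ}

lemma gapLe_letter (h : GapLe p p') {w w' : ℕ} (hw : w ≤ w') :
    GapLe (gapStep F (.inl w) p) (gapStep F (.inl w') p') := by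
  rcases p with ⟨u, _ | g⟩ <;> rcases p' with ⟨u', _ | g'⟩ <;> simp_all [GapLe, gapStep]; omega

lemma gapLe_insert (h : GapLe p p') (w : ℕ) : GapLe p (gapStep F (.inl w) p') := by
  rcases p with ⟨u, _ | g⟩ <;> rcases p' with ⟨u', _ | g'⟩ <;> simp_all [GapLe, gapStep]; omega

/-- A wider gap means a smaller share. The bounds by `F` ensure that any share is at least `F`, so
that replacing a gap by `none` is also allowed. -/
lemma gapLe_nt (h : GapLe p p') (hF : ∀ x, p.2 = some x → x.size ≤ F)
    (hF' : ∀ y, p'.2 = some y → y.size ≤ F) :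
    GapLe (gapStep F (.inr ()) p) (gapStep F (.inr ()) p') := by
  have := @Nat.size_le_size
  rcases p with ⟨u, _ | g⟩ <;> rcases p' with ⟨u', _ | g'⟩ <;> simp_all [GapLe, gapStep] <;> grind

/-- Removing a nonterminal deletes a summand, and the gap above it, which started at zero, can only
become wider. -/
lemma gapLe_drop (h : GapLe p p') : GapLe (gapStep F (.inr ()) p) p' := by
  rcases p with ⟨u, _ | g⟩ <;> rcases p' with ⟨u', _ | g'⟩ <;> simp_all [GapLe, gapStep] <;> omega

lemma gap_le (g : Option ℕ) (l : List (ℕ ⊕ Unit)) (x : ℕ)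
    (hx : (gapPot F g l).2 = some x) : x ≤ (l.map (Sum.elim id fun _ => 0)).sum + g.getD 0 := by
  induction l generalizing x with
  | nil => simp [gapPot] at hx; simp [hx]
  | cons y l ih =>
    have e : gapPot F g (y :: l) = gapStep F y (gapPot F g l) := rfl; rw [e] at hx
    generalize gapPot F g l = q at ih hx; obtain ⟨u, q⟩ := q; rcases y with w | w
    · simp [gapStep] at hx; obtain ⟨y, rfl, rfl⟩ := hx; have := ih y rfl; simp; omega
    · simp [gapStep] at hx; omega

lemma Gram.gap_le {e : Option (End α)} {x : ℕ}
    (hx : (gapPot F (endGap wt e) (l.map (Item.mark wt))).2 = some x) :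
    x ≤ ctxTot wt (G.itemsVal l) + G.endWt wt e := by
  have h1 := Sim.gap_le _ _ _ hx; have h2 := G.itemsWt_le wt l
  have h3 : ((l.map (Item.mark wt)).map (Sum.elim id fun _ => 0)).sum ≤
      (l.map (G.itemWt wt)).sum := by
    rw [map_map]; refine sum_le_sum fun i _ => ?_
    rcases i with x | B
    exacts [le_rfl, Nat.zero_le _]
  have h4 : (endGap wt e).getD 0 ≤ G.endWt wt e := by
    rcases e with _ | c | C
    · exact le_rfl
    · simp [endGap, endWt, endVal, treeWt_node]
    · exact Nat.zero_le _
  omega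

/-! ### Removing empty nonterminals -/

variable (G)

def Gram.cleanEnd : End α → End α
  | .con c => .con c
  | .nt C => match constOf (G.val C) with
    | some c => .con c
    | none => .nt C

def Gram.cleanTwig (t : Twig α) : Twig α := ⟨t.chain, G.cleanEnd t.last⟩

def Gram.cleanItem : Item α → List (Item α)
  | .frame x => [.frame (x.map G.cleanTwig)]
  | .nt B => match G.ctx B with
    | [] => []
    | _ :: _ => [.nt B]

/-- Remove nonterminals with empty values and replace those that stand for constants. -/
def Gram.clean : Gram α where
  rule X := ⟨(G.rule X).items.flatMap G.cleanItem, (G.rule X).last.map G.cleanEnd⟩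
  ctx := G.ctx
  val := G.val

/-- The nonterminals that are not removed. -/
def Gram.solid : Name → Bool
  | .one B => !(G.ctx B).isEmpty
  | .zero C => (constOf (G.val C)).isNone

lemma Gram.cleanEnd_val (e : End α) : G.clean.endVal (G.cleanEnd e) = G.endVal e := by
  rcases e with c | C
  · rfl
  · simp only [cleanEnd]; rcases h : constOf (G.val C) with _ | c
    · rfl
    · exact (constOf_eq_some.1 h).symm

lemma Gram.cleanTwig_val (t : Twig α) : G.clean.twigVal (G.cleanTwig t) = G.twigVal t := by
  rw [twigVal, twigVal, cleanTwig, G.cleanEnd_val]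

lemma Gram.clean_val (l : List (Item α)) :
    G.clean.itemsVal (l.flatMap G.cleanItem) = G.itemsVal l := by
  induction l with
  | nil => rfl
  | cons i l ih =>
    rw [flatMap_cons, itemsVal_append, ih, itemsVal_cons]; congr 1; rcases i with x | B
    · simp [cleanItem, itemVal, itemsVal_cons, Frame.map, cleanTwig_val]
    · simp only [cleanItem, itemVal]; rcases h : G.ctx B with _ | ⟨x, L⟩
      · rfl
      · simp [itemVal, clean, h]

lemma Gram.cleanEnd_names (e : End α) : (G.cleanEnd e).names = e.names.filter G.solid := by
  rcases e with c | C
  · rfl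
  · simp only [cleanEnd]
    rcases h : constOf (G.val C) with _ | c <;> simp [End.names, solid, h]

lemma Gram.cleanTwigs_names (l : List (Twig α)) :
    (l.map G.cleanTwig).flatMap Twig.names = (l.flatMap Twig.names).filter G.solid := by
  rw [flatMap_map, filter_flatMap]; congr 1
  funext t
  exact G.cleanEnd_names _

lemma Gram.clean_names (Y : Name) : (G.clean.rule Y).names = (G.rule Y).names.filter G.solid := by
  rw [Rule.names, Rule.names, filter_append]; congr 1
  · simp only [clean]; rw [flatMap_assoc, filter_flatMap]; congr 1
    funext i
    rcases i with x | B
    · simp [cleanItem, Item.names, Frame.map, ← map_append, cleanTwigs_names]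
    · rcases h : G.ctx B with _ | ⟨x, L⟩ <;> simp [cleanItem, Item.names, solid, h]
  · simp only [Rule.lastNames, clean]; rcases (G.rule Y).last with _ | e
    · rfl
    · exact G.cleanEnd_names e

lemma Gram.cleanEnd_size (e : End α) : (G.cleanEnd e).size ≤ e.size + e.names.length := by
  rcases e with c | C
  · simp [cleanEnd]
  · simp only [cleanEnd]
    rcases constOf (G.val C) with _ | c <;> simp [End.size, End.names]

lemma Gram.clean_size (Y : Name) :
    (G.clean.rule Y).size ≤ (G.rule Y).size + (G.rule Y).names.length := by
  have ht : ∀ l : List (Twig α), ((l.map G.cleanTwig).map Twig.size).sum ≤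
      (l.map Twig.size).sum + (l.flatMap Twig.names).length := by
    intro l
    induction l with
    | nil => simp
    | cons t l ih =>
      have := G.cleanEnd_size t.last; simp only [map_cons, sum_cons, flatMap_cons, length_append]
      have e : (G.cleanTwig t).size ≤ t.size + t.names.length := by
        simp only [Twig.size, cleanTwig, Twig.names]; omega
      omega
  have hi : (((G.rule Y).items.flatMap G.cleanItem).map Item.size).sum ≤
      ((G.rule Y).items.map Item.size).sum + ((G.rule Y).items.flatMap Item.names).length := by
    induction (G.rule Y).items with
    | nil => simp
    | cons i l ih =>
      simp only [flatMap_cons, map_append, sum_append, map_cons, sum_cons, length_append]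
      have e : ((G.cleanItem i).map Item.size).sum ≤ i.size + i.names.length := by
        rcases i with x | B
        · have := ht (x.pre ++ x.post); rw [map_append] at this
          simp [cleanItem, Item.size, Frame.twigSize, Frame.map, Item.names] at this ⊢; omega
        · rcases h : G.ctx B with _ | ⟨x, L⟩ <;> simp [cleanItem, Item.names, Item.size, h]
      omega
  have he : ((G.rule Y).last.map G.cleanEnd).elim 0 End.size ≤
      (G.rule Y).last.elim 0 End.size + (G.rule Y).lastNames.length := by
    rw [Rule.lastNames]; rcases (G.rule Y).last with _ | e
    · simp
    · exact G.cleanEnd_size e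
  simp only [Rule.size, Rule.names, length_append, clean]; omega

variable {G}

/-- Cleaning removes nonterminals of rank 1 or puts constants at the end, and neither narrows a gap.
-/
lemma Gram.clean_pot (hF : ∀ x ≤ n, x.size ≤ F)
    (hW : ctxTot wt (G.itemsVal (G.rule Y).items) + G.endWt wt (G.rule Y).last ≤ n) :
    (G.clean.rule Y).pot wt F ≤ (G.rule Y).pot wt F := by
  have he : ∀ e : Option (End α), G.clean.endWt wt (e.map G.cleanEnd) = G.endWt wt e := by
    rintro (_ | e)
    · rfl
    · simp [endWt, cleanEnd_val]
  suffices h : ∀ l, ctxTot wt (G.itemsVal l) + G.endWt wt (G.rule Y).last ≤ n →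
      GapLe (gapPot F (endGap wt (G.rule Y).last) (l.map (Item.mark wt)))
        (gapPot F (endGap wt ((G.rule Y).last.map G.cleanEnd))
          ((l.flatMap G.cleanItem).map (Item.mark wt))) from (h _ hW).1
  intro l hl
  induction l with
  | nil =>
    rcases (G.rule Y).last with _ | c | C
    iterate 2 exact GapLe.refl _
    · simp [cleanEnd]; rcases constOf (G.val C) with _ | c
      · exact GapLe.refl _
      · exact ⟨le_rfl, fun y _ => ⟨0, y.zero_le, rfl⟩⟩
  | cons i l ih =>
    rw [itemsVal_cons, ctxTot_append] at hl; have ih := ih (by omega)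
    rw [map_cons, flatMap_cons, map_append, gapPot_append]; rcases i with x | B
    · exact gapLe_letter ih le_rfl
    · rcases h : G.ctx B with _ | ⟨x, L⟩
      · simp only [cleanItem, h]; exact gapLe_drop ih
      · simp only [cleanItem, h]; refine gapLe_nt ih (fun x hx => hF x ?_) (fun x hx => hF x ?_)
        · have := G.gap_le hx; omega
        · have := G.clean.gap_le hx; rw [G.clean_val, he] at this; omega

lemma Gram.Inv.clean (h : G.Inv D ord m wt n) : G.clean.Inv D ord m wt n := by
  refine h.of_filter G.solid (fun X _ => G.clean_names X) ?_ ?_ h.weight_one h.weight_zero h.width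
  · intro E j hc; have hc' : constOf (G.val (.child E j)) = none := hc
    exact ⟨hc, by simp [solid, hc']⟩
  · intro X hX; have hh := h.holds X hX; rcases X with A | C
    · obtain ⟨h1, h2⟩ := hh; exact ⟨by simp [Gram.clean, h1], h2.trans (G.clean_val _).symm⟩
    · obtain ⟨e, h1, h2⟩ := hh; refine ⟨G.cleanEnd e, by simp [Gram.clean, h1], ?_⟩
      have := G.clean_val (G.rule (.zero C)).items
      change G.val C = plug (G.clean.itemsVal ((G.rule (.zero C)).items.flatMap G.cleanItem)) _
      rw [this, G.cleanEnd_val, ← h2]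

/-- No nonterminal in a right-hand side is empty or stands for a constant. -/
def Gram.IsClean (G : Gram α) (D : Dom) : Prop :=
  ∀ X, D.Mem X → ∀ Y ∈ (G.rule X).names, G.solid Y = true

lemma Gram.isClean_clean (D : Dom) : G.clean.IsClean D := by
  intro X _ Y hY; rw [clean_names] at hY; have := (mem_filter.1 hY).2
  rcases Y with B | C <;> exact this

/-! ### Popping the last frames of nonterminals -/

variable (G)

/-- The last frame is popped from `B` if none of the nonterminals for the children of a frame popped
earlier is needed any more. -/
def Gram.pops (r : ℕ) (B : Symb) : Bool :=
  !(G.ctx B).isEmpty && (range r).all fun j => (constOf (G.val (.child B j))).isSome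

def nameTwig (B : Symb) (i : ℕ) (t : Pat α) : Twig α := ⟨[], match constOf t with
    | some c => .con c
    | none => .nt (.child B i)⟩

/-- The popped frame, with names for its children that are not constants. -/
def nameFrame (B : Symb) (x : Frame α (Pat α)) : Frame α (Twig α) :=
  ⟨x.label, x.pre.mapIdx (nameTwig B), x.post.mapIdx fun i => nameTwig B (i + x.pre.length)⟩

def Gram.popFrames (r : ℕ) (B : Symb) : List (Item α) :=
  if G.pops r B then ((G.ctx B).getLast?.map fun x => .frame (nameFrame B x)).toList else []

def Gram.expandItem (r : ℕ) : Item α → List (Item α)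
  | .frame x => [.frame x]
  | .nt B => .nt B :: G.popFrames r B

def Gram.expanded (r : ℕ) (X : Name) : List (Item α) := (G.rule X).items.flatMap (G.expandItem r)

/-- The rule for the child number `j` of a popped frame. -/
def childRule (j : ℕ) : Option (Item α) → Rule α
  | some (.frame x) => match (x.pre ++ x.post)[j]? with
    | some t => twigRule t
    | none => ⟨[], some (.con x.label)⟩
  | _ => ⟨[], none⟩

/-- Pop the last frames from nonterminals of rank `1`. -/
def Gram.pop (r : ℕ) : Gram α where
  rule
    | .one E => ⟨if G.pops r E then (G.expanded r (.one E)).dropLast else G.expanded r (.one E),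
        (G.rule (.one E)).last⟩
    | .zero (.child E j) =>
      if G.pops r E then childRule j (G.expanded r (.one E)).getLast?
      else ⟨G.expanded r (.zero (.child E j)), (G.rule (.zero (.child E j))).last⟩
    | .zero (.orig C) => ⟨G.expanded r (.zero (.orig C)), (G.rule (.zero (.orig C))).last⟩
  ctx A := if G.pops r A then (G.ctx A).dropLast else G.ctx A
  val
    | .child E j => if G.pops r E then
        (G.ctx E).getLast?.elim (G.val (.child E j)) fun x => (x.pre ++ x.post).getD j (node x.label [])
      else G.val (.child E j)
    | .orig C => G.val (.orig C)

variable {G} {r : ℕ}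

lemma Gram.pops_iff : G.pops r B = true ↔
    G.ctx B ≠ [] ∧ ∀ j < r, constOf (G.val (.child B j)) ≠ none := by
  simp [pops, Option.isSome_iff_ne_none]

lemma Gram.pops_last (h : G.pops r B = true) :
    ∃ L x, G.ctx B = L ++ [x] ∧ G.popFrames r B = [.frame (nameFrame B x)] ∧ (G.pop r).ctx B = L ∧
      ∀ j, (G.pop r).val (.child B j) = (x.pre ++ x.post).getD j (node x.label []) := by
  obtain ⟨L, x, e⟩ := eq_nil_or_concat' (G.ctx B) |>.resolve_left (pops_iff.1 h).1
  exact ⟨L, x, e, by simp [popFrames, h, e], by simp [pop, h, e], by simp [pop, h, e]⟩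

lemma nameFrame_children (B : Symb) (x : Frame α (Pat α)) :
    (nameFrame B x).pre ++ (nameFrame B x).post = (x.pre ++ x.post).mapIdx (nameTwig B) :=
  mapIdx_append.symm

lemma nameTwig_names (B : Symb) (i : ℕ) (t : Pat α) :
    (nameTwig B i t).names = if constOf t = none then [.zero (.child B i)] else [] := by
  rcases h : constOf t with _ | c <;> simp [nameTwig, h, Twig.names, End.names]

lemma nameFrame_names (B : Symb) (x : Frame α (Pat α)) : (Item.frame (nameFrame B x)).names.Sublist
      ((range (x.pre.length + x.post.length)).map fun i => .zero (.child B i)) := by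
  rw [Item.names, nameFrame_children, ← length_append, mapIdx_eq_zipIdx_map, range_eq_range']
  generalize x.pre ++ x.post = l, 0 = k
  induction l generalizing k with
  | nil => simp
  | cons t l ih =>
    have := ih (k + 1); rcases h : constOf t with _ | c
    · simpa [nameTwig_names, h, range'_succ] using this
    · simpa [nameTwig_names, h, range'_succ] using this.cons _

lemma mem_nameFrame_names {x : Frame α (Pat α)} {C : Name0} :
    .zero C ∈ (Item.frame (nameFrame B x)).names ↔
      ∃ j, C = .child B j ∧ constOf ((x.pre ++ x.post).getD j (node a [])) = none := by
  simp only [Item.names, nameFrame_children, mem_flatMap, mem_mapIdx]; constructor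
  · rintro ⟨_, ⟨j, hj, rfl⟩, hm⟩
    rw [nameTwig_names] at hm; grind
  · rintro ⟨j, rfl, h⟩
    by_cases hj : j < (x.pre ++ x.post).length
    · rw [getD_eq_getElem _ _ hj] at h; exact ⟨_, ⟨j, hj, rfl⟩, by simp [nameTwig_names, h]⟩
    · rw [getD_eq_default _ _ (by omega)] at h
      simp at h

lemma Gram.nameFrame_val {x : Frame α (Pat α)}
    (h : ∀ j, G.val (.child B j) = (x.pre ++ x.post).getD j (node a [])) :
    (nameFrame B x).map G.twigVal = x := by
  have key : ((x.pre ++ x.post).mapIdx (nameTwig B)).map G.twigVal = x.pre ++ x.post := by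
    refine ext_getElem (by simp) fun i h1 h2 => ?_
    simp [twigVal, nameTwig]; rcases hc : constOf (x.pre ++ x.post)[i] with _ | c
    · exact (h i).trans (getD_eq_getElem _ _ h2)
    · exact (constOf_eq_some.1 hc).symm
  rw [← nameFrame_children, map_append] at key
  obtain ⟨h1, h2⟩ := append_inj key (by simp [nameFrame])
  exact Frame.ext rfl h1 h2

/-- Popping redefines only the child names of nonterminals that are popped from, and these all stood
for constants. -/
lemma Gram.pop_val {C : Name0} (h : G.solid (.zero C) = true)
    (hr : ∀ E j, C = .child E j → j < r) : (G.pop r).val C = G.val C := by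
  rcases C with C | ⟨E, j⟩
  · rfl
  · have : G.pops r E = false := by
      by_contra hp
      have := (pops_iff.1 (by simpa using hp)).2 j (hr E j rfl)
      exact this (by simpa [solid] using h)
    simp [pop, this]

lemma Gram.pop_endVal (h : ∀ Y ∈ e.names, G.solid Y = true)
    (hr : ∀ E j, .zero (.child E j) ∈ e.names → j < r) : (G.pop r).endVal e = G.endVal e := by
  rcases e with c | C
  · rfl
  · exact G.pop_val (h _ (by simp [End.names])) fun E j e => hr E j (by simp [End.names, e])

lemma Gram.expand_val (l : List (Item α))
    (h : ∀ Y ∈ l.flatMap Item.names, G.solid Y = true)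
    (hr : ∀ E j, .zero (.child E j) ∈ l.flatMap Item.names → j < r) :
    (G.pop r).itemsVal (l.flatMap (G.expandItem r)) = G.itemsVal l := by
  induction l with
  | nil => rfl
  | cons i l ih =>
    rw [flatMap_cons] at h hr
    rw [flatMap_cons, itemsVal_append, itemsVal_cons, ih (fun Y hY => h Y (mem_append_right _ hY))
        fun E j hj => hr E j (mem_append_right _ hj)]
    congr 1; rcases i with x | B
    · have ht : ∀ t ∈ x.pre ++ x.post, (G.pop r).twigVal t = G.twigVal t := by
        intro t ht; rw [twigVal, twigVal, pop_endVal]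
        · exact fun Y hY => h Y (mem_append_left _ (mem_flatMap.2 ⟨t, ht, hY⟩))
        · exact fun E j hj => hr E j (mem_append_left _ (mem_flatMap.2 ⟨t, ht, hj⟩))
      simp only [expandItem, itemsVal_cons, itemsVal_nil, append_nil, itemVal, Frame.map]
      congr 2 <;> exact map_congr_left fun t hx => ht t (by simp [hx])
    · rcases hp : G.pops r B with _ | _
      · simp [expandItem, itemVal, popFrames, hp, pop]
      · obtain ⟨L, x, e1, e2, e3, e4⟩ := G.pops_last hp
        simp [expandItem, itemVal, e2, e3, nameFrame_val e4, e1]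

/-- Any frame, nonempty context or nonconstant end would make the value larger than a constant. So
the child names of a nonterminal that is popped from have trivial rules, which can be overwritten
without losing anything. -/
lemma Gram.names_eq_nil {C : Name0} (h : G.Holds (.zero C)) (hc : constOf (G.val C) ≠ none)
    (hs : ∀ Y ∈ (G.rule (.zero C)).names, G.solid Y = true) : (G.rule (.zero C)).names = [] := by
  obtain ⟨e, h1, h2⟩ := h; obtain ⟨c, hc⟩ := Option.ne_none_iff_exists'.1 hc
  rw [constOf_eq_some, h2] at hc
  have hi : ∀ L : List (Frame α (Pat α)), ∀ t, plug L t = node c [] → L = [] := by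
    rintro (_ | ⟨x, L⟩) t ht
    · rfl
    · simp [fill] at ht
  have hl := hi _ _ hc
  have hitems : (G.rule (.zero C)).items = [] := by
    rcases hL : (G.rule (.zero C)).items with _ | ⟨i, l⟩
    · rfl
    · rw [hL, itemsVal_cons] at hl; rcases i with x | B
      · simp [itemVal] at hl
      · have := hs (.one B) (by simp [Rule.names, hL, Item.names])
        simp [itemVal] at hl; simp [solid, hl.1] at this
  rw [hl, plug_nil] at hc; rcases e with c' | C'
  · simp [Rule.names, hitems, Rule.lastNames, h1, End.names]
  · have := hs (.zero C') (by simp [Rule.names, Rule.lastNames, h1, End.names])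
    simp only [endVal] at hc; simp [solid, hc] at this

/-- The names in a right-hand side after popping. -/
def Gram.expandNames (G : Gram α) (r : ℕ) (l : List Name) : List Name := l.flatMap fun
    | .one B => .one B :: (G.popFrames r B).flatMap Item.names
    | .zero C => [.zero C]

lemma Gram.expandItem_names (i : Item α) :
    (G.expandItem r i).flatMap Item.names = G.expandNames r i.names := by
  rcases i with x | B
  · rw [expandItem, flatMap_singleton, Item.names, expandNames, flatMap_assoc]; congr 1
    funext t
    rw [Twig.names]
    rcases t.last with c | C <;> rfl
  · simp [expandItem, Item.names, expandNames]

lemma Gram.expanded_names (l : List (Item α)) :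
    (l.flatMap (G.expandItem r)).flatMap Item.names = G.expandNames r (l.flatMap Item.names) := by
  rw [flatMap_assoc, expandNames, flatMap_assoc]; simp only [expandItem_names, expandNames]

lemma Gram.expandNames_last (ru : Rule α) : G.expandNames r ru.lastNames = ru.lastNames := by
  rw [Rule.lastNames]
  rcases ru.last with _ | c | C <;> rfl

lemma Gram.expandNames_one (A : Symb) (l : List Name) : G.expandNames r (.one A :: l) =
    .one A :: ((G.popFrames r A).flatMap Item.names ++ G.expandNames r l) := by simp [expandNames]

lemma Gram.expandNames_zero (C : Name0) (l : List Name) :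
    G.expandNames r (.zero C :: l) = .zero C :: G.expandNames r l := by simp [expandNames]

lemma Gram.expandNames_append (l l' : List Name) :
    G.expandNames r (l ++ l') = G.expandNames r l ++ G.expandNames r l' := by
  simp [expandNames]

lemma Gram.popFrames_names (B : Symb) (hw : ctxWidth r (G.ctx B)) :
    ((G.popFrames r B).flatMap Item.names).Sublist
      ((range r).map fun i => .zero (.child B i)) := by
  rcases hp : G.pops r B with _ | _
  · simp [popFrames, hp]
  · obtain ⟨L, x, e1, e2, -⟩ := G.pops_last hp; rw [e2]; simp
    refine (nameFrame_names B x).trans (Sublist.map _ (range_sublist.2 ?_))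
    exact (hw x (by simp [e1])).le

lemma Gram.expandNames_split {l l₁ l₂ : List Name}
    (hw : ∀ A, .one A ∈ l → ctxWidth r (G.ctx A))
    (h : G.expandNames r l = l₁ ++ .one B :: l₂) : ∃ k₁ k₂, l = k₁ ++ .one B :: k₂ ∧
      l₂ = (G.popFrames r B).flatMap Item.names ++ G.expandNames r k₂ := by
  induction l generalizing l₁ with
  | nil => simp [expandNames] at h
  | cons Y l ih =>
    have hw' : ∀ A, .one A ∈ l → ctxWidth r (G.ctx A) := fun A hA => hw A (by simp [hA])
    rcases Y with A | C
    · rw [expandNames_one] at h; rcases l₁ with _ | ⟨Z, l₁⟩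
      · simp at h; obtain ⟨rfl, h⟩ := h; exact ⟨[], l, rfl, h.symm⟩
      · simp at h; have h := h.2; rw [append_eq_append_iff] at h
        have hno : .one B ∉ (G.popFrames r A).flatMap Item.names := by
          intro hm; have := (G.popFrames_names A (hw A (by simp))).subset hm
          simp at this
        rcases h with ⟨a, ha, hb⟩ | ⟨c, hc, hd⟩
        · obtain ⟨k₁, k₂, rfl, hk⟩ := ih hw' hb; exact ⟨.one A :: k₁, k₂, rfl, hk⟩
        · rcases c with _ | ⟨Z, c⟩
          · grind
          grind
    · rw [expandNames_zero] at h; rcases l₁ with _ | ⟨Z, l₁⟩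
      · simp at h
      · simp at h; grind

/-- The names in a popped frame are distinct, so each appears at most once for every occurrence of
the nonterminal. -/
lemma Gram.count_expandNames_le {l : List Name} (hw : ∀ A, .one A ∈ l → ctxWidth r (G.ctx A))
    (Y : Name) : (G.expandNames r l).count Y ≤ l.count Y + l.countP fun Z => match Z, Y with
        | .one A, .zero (.child B _) => decide (A = B) && G.pops r A
        | _, _ => false := by
  induction l with
  | nil => simp [expandNames]
  | cons Z l ih =>
    have ih := ih fun A hA => hw A (by simp [hA])
    rw [countP_cons]; rcases Z with A | C
    · rw [expandNames_one, count_cons, count_cons, count_append]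
      have hs := (G.popFrames_names A (hw A (by simp))).count_le Y
      have hnd : ((range r).map fun i => Name.zero (.child A i)).Nodup :=
        nodup_range.map fun i i' h => by simpa using h
      by_cases h0 : Y ∈ (G.popFrames r A).flatMap Item.names
      · obtain ⟨j, -, rfl⟩ := mem_map.1 ((G.popFrames_names A (hw A (by simp))).subset h0)
        have hp : G.pops r A = true := by by_contra hp; simp [popFrames, hp] at h0
        have := nodup_iff_count_le_one.1 hnd (.zero (.child A j)); simp [hp]; omega
      grind
    · rw [expandNames_zero, count_cons, count_cons]; omega

lemma Gram.mem_expandNames {l : List Name} (hw : ∀ A, .one A ∈ l → ctxWidth r (G.ctx A))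
    (h : Y ∈ G.expandNames r l) :
    Y ∈ l ∨ ∃ B, .one B ∈ l ∧ ∃ j < r, Y = .zero (.child B j) := by
  obtain ⟨Z, hZ, hY⟩ := mem_flatMap.1 h; rcases Z with B | C
  · rcases mem_cons.1 hY with rfl | hY
    · exact .inl hZ
    · have := (G.popFrames_names B (hw B hZ)).subset hY; obtain ⟨j, hj, rfl⟩ := mem_map.1 this
      exact .inr ⟨B, hZ, j, mem_range.1 hj, rfl⟩
  grind

lemma Gram.mem_expandNames_of_mem {l : List Name} (h : Y ∈ l) : Y ∈ G.expandNames r l := by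
  refine mem_flatMap.2 ⟨Y, h, ?_⟩
  rcases Y with B | C <;> simp

lemma names_letters (w : List α) :
    (w.map fun a => Item.frame (letter a)).flatMap Item.names = [] := by
  induction w with
  | nil => rfl
  | cons a w ih => simp [Item.names, letter]

/-! ### Popping preserves the invariant -/

lemma Gram.Inv.child_lt (h : G.Inv D ord m wt n) {X : Name} (hX : D.Mem X)
    (hj : .zero (.child E j) ∈ (G.rule X).names) : j < D.r := (h.closed X hX _ hj).1.2

lemma Gram.Inv.width_of_mem (h : G.Inv D ord m wt n) {X : Name} (hX : D.Mem X) {A : Symb}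
    (hA : .one A ∈ (G.rule X).names) : ctxWidth D.r (G.ctx A) :=
  h.width A (h.closed X hX _ hA).1

lemma Gram.Inv.expanded_val (h : G.Inv D ord m wt n) (hc : G.IsClean D) {X : Name}
    (hX : D.Mem X) : (G.pop D.r).itemsVal (G.expanded D.r X) = G.itemsVal (G.rule X).items :=
  G.expand_val _ (fun Y hY => hc X hX Y (mem_append_left _ hY))
    fun _ _ hj => h.child_lt hX (mem_append_left _ hj)

lemma Gram.Inv.names_child (h : G.Inv D ord m wt n) (hc : G.IsClean D)
    (hE : E ∈ D.one) (hp : G.pops D.r E = true) (hj : j < D.r) :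
    (G.rule (.zero (.child E j))).names = [] :=
  G.names_eq_nil (h.holds _ ⟨hE, hj⟩) ((G.pops_iff.1 hp).2 j hj) (hc _ ⟨hE, hj⟩)

/-- If the items ended with a nonterminal that is not popped from, some child name of it would not
stand for a constant and, being pending, would have to occur to its right, where nothing is left. -/
lemma Gram.Inv.expanded_last (h : G.Inv D ord m wt n) (hc : G.IsClean D) {X : Name} (hX : D.Mem X)
    (hl : (G.rule X).lastNames = []) (hne : (G.rule X).items ≠ [])
    (hn : ∀ A, X = .one A → ∀ i < D.r, (G.rule (.zero (.child A i))).names = []) :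
    ∃ l x, G.expanded D.r X = l ++ [.frame x] := by
  obtain ⟨l, x | B, hi⟩ := (eq_nil_or_concat' _).resolve_left hne
  · exact ⟨l.flatMap (G.expandItem D.r), x, by simp [expanded, hi, expandItem]⟩
  · have hpB : G.pops D.r B = true := by
      refine G.pops_iff.2 ⟨?_, fun j hj hcB => ?_⟩
      · simpa [solid] using hc X hX (.one B) (by simp [Rule.names, hi, Item.names])
      · rcases h.pending X hX B (l.flatMap Item.names) [] (by simp [Rule.names, hi, Item.names, hl]) j
          hj hcB with hm | ⟨A, e, i, hi, hm⟩
        · simp at hm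
        · simp [hn A e i hi] at hm
    obtain ⟨L, x, e1, e2, -⟩ := G.pops_last hpB
    exact ⟨l.flatMap (G.expandItem D.r) ++ [.nt B], nameFrame B x, by
      simp [expanded, hi, expandItem, e2]⟩

/-- The frame to be handed out from `E` is explicit in the expanded rule of `E`: either it was there
before, or it has just been popped from the last nonterminal in that rule. -/
lemma Gram.Inv.last_frame (h : G.Inv D ord m wt n) (hc : G.IsClean D)
    (hE : E ∈ D.one) (hp : G.pops D.r E = true) :
    ∃ l x L, G.expanded D.r (.one E) = l ++ [.frame x] ∧
      G.ctx E = L ++ [x.map (G.pop D.r).twigVal] ∧ (G.pop D.r).itemsVal l = L := by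
  have hv := h.expanded_val hc (X := .one E) hE; obtain ⟨hl, hh⟩ := h.holds (.one E) hE
  obtain ⟨l, x, e⟩ := h.expanded_last hc (X := .one E) hE (by simp [Rule.lastNames, hl])
    (fun hn => (G.pops_iff.1 hp).1 (by rw [hh, hn]; rfl))
    (by rintro _ ⟨⟩ i hi; exact h.names_child hc hE hp hi)
  refine ⟨l, x, _, e, ?_, rfl⟩; rw [hh, ← hv, e, itemsVal_append]; rfl

lemma Gram.pop_childRule (hp : G.pops r E = true) (e : G.expanded r (.one E) = l ++ [.frame x]) (j : ℕ) :
    (G.pop r).rule (.zero (.child E j)) = Sim.childRule j (some (.frame x)) := by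
  simp [pop, hp, e]

lemma childRule_names (j : ℕ) (x : Frame α (Twig α)) :
    (childRule j (some (.frame x))).names = ((x.pre ++ x.post)[j]?.map Twig.names).getD [] := by
  simp only [childRule]; rcases (x.pre ++ x.post)[j]? with _ | t
  · rfl
  · simp [Rule.names, twigRule, names_letters, Rule.lastNames, Twig.names]

lemma Gram.pop_names_of_not {X : Name} (h : ∀ E, X = .one E → G.pops D.r E = false)
    (h' : ∀ E j, X = .zero (.child E j) → G.pops D.r E = false) :
    ((G.pop D.r).rule X) = ⟨G.expanded D.r X, (G.rule X).last⟩ := by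
  rcases X with E | C | ⟨E, j⟩
  · simp [pop, h E rfl]
  · rfl
  · simp [pop, h' E j rfl]

lemma Gram.names_expanded (X : Name) (la : Option (End α)) (hla : la = (G.rule X).last) :
    (Rule.mk (G.expanded D.r X) la).names = G.expandNames D.r (G.rule X).names := by
  subst hla
  rw [Rule.names, Rule.names, expandNames_append, expandNames_last, expanded, expanded_names]; rfl

lemma Gram.Inv.pop_rule_cases (h : G.Inv D ord m wt n) (hc : G.IsClean D) {X : Name}
    (hX : D.Mem X) : (G.pop D.r).rule X = ⟨G.expanded D.r X, (G.rule X).last⟩ ∨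
      ∃ E l x, E ∈ D.one ∧ l.flatMap Item.names ++ (Item.frame x).names =
          G.expandNames D.r (G.rule (.one E)).names ∧ x.pre.length + x.post.length < D.r ∧
        (∀ j, (G.pop D.r).rule (.zero (.child E j)) = Sim.childRule j (some (.frame x))) ∧
        (X = .one E ∧ (G.pop D.r).rule X = ⟨l, none⟩ ∨ ∃ j, X = .zero (.child E j)) := by
  have key : ∀ E, E ∈ D.one → G.pops D.r E = true → ∃ l x,
      l.flatMap Item.names ++ (Item.frame x).names = G.expandNames D.r (G.rule (.one E)).names ∧
      x.pre.length + x.post.length < D.r ∧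
      (∀ j, (G.pop D.r).rule (.zero (.child E j)) = Sim.childRule j (some (.frame x))) ∧
      (G.pop D.r).rule (.one E) = ⟨l, none⟩ := by
    intro E hE hp; obtain ⟨l, x, L, e1, e2, e3⟩ := h.last_frame hc hE hp
    have hl : (G.rule (.one E)).last = none := (h.holds (.one E) hE).1
    have hw := h.width E hE (x.map (G.pop D.r).twigVal) (by simp [e2])
    exact ⟨l, x, by
      rw [← G.names_expanded (.one E) _ hl.symm, e1]; simp [Rule.names, Rule.lastNames], by simpa [Frame.map] using hw,
      G.pop_childRule hp e1, by simp [pop, hp, e1, hl]⟩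
  rcases X with E | C | ⟨E, j⟩
  · rcases hp : G.pops D.r E with _ | _
    · exact .inl (by simp [pop, hp])
    · obtain ⟨l, x, h1, h2, h3, h4⟩ := key E hX hp
      exact .inr ⟨E, l, x, hX, h1, h2, h3, .inl ⟨rfl, h4⟩⟩
  · exact .inl rfl
  · rcases hp : G.pops D.r E with _ | _
    · exact .inl (by simp [pop, hp])
    · obtain ⟨l, x, h1, h2, h3, -⟩ := key E hX.1 hp
      exact .inr ⟨E, l, x, hX.1, h1, h2, h3, .inr ⟨j, rfl⟩⟩

lemma Gram.Inv.pop_mem (h : G.Inv D ord m wt n) (hc : G.IsClean D)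
    (hord : ∀ E j, ord (.zero (.child E j)) = ord (.one E) + 1) {X : Name}
    (hX : D.Mem X) (hY : Y ∈ ((G.pop D.r).rule X).names) :
    ∃ Z, D.Mem Z ∧ ord Z ≤ ord X ∧ Y ∈ G.expandNames D.r (G.rule Z).names := by
  rcases h.pop_rule_cases hc hX with e | ⟨E, l, x, hE, e1, -, e2, ⟨rfl, e⟩ | ⟨j, rfl⟩⟩
  · rw [e, G.names_expanded X _ rfl] at hY; exact ⟨X, hX, le_rfl, hY⟩
  · refine ⟨.one E, hE, le_rfl, ?_⟩; rw [e] at hY; rw [← e1]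
    exact mem_append_left _ (by simpa [Rule.names, Rule.lastNames] using hY)
  · refine ⟨.one E, hE, by rw [hord]; omega, ?_⟩
    rw [← e1]; rw [e2, childRule_names] at hY; rcases ht : (x.pre ++ x.post)[j]? with _ | t
    · simp [ht] at hY
    · simp only [ht, Option.map_some, Option.getD_some] at hY
      exact mem_append_right _ (mem_flatMap.2 ⟨t, mem_of_getElem? ht, hY⟩)

lemma Gram.Inv.pop_holds (h : G.Inv D ord m wt n) (hc : G.IsClean D) {X : Name}
    (hX : D.Mem X) : (G.pop D.r).Holds X := by
  have hv := h.expanded_val hc hX; have hh := h.holds X hX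
  have hend : ∀ e, (G.rule X).last = some e → (G.pop D.r).endVal e = G.endVal e := by
    intro e he; refine G.pop_endVal ?_ ?_
    · intro Y hY; exact hc X hX Y (mem_append_right _ (by simpa [Rule.lastNames, he] using hY))
    · intro E j hj
      exact h.child_lt hX (mem_append_right _ (by simpa [Rule.lastNames, he] using hj))
  rcases X with E | C | ⟨E, j⟩
  · obtain ⟨h1, h2⟩ := hh; refine ⟨by simp [pop, h1], ?_⟩
    rcases hp : G.pops D.r E with _ | _
    · simp only [pop, hp]; rw [h2, ← hv]; rfl
    · obtain ⟨l, x, L, e1, e2, e3⟩ := h.last_frame hc hX hp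
      have : ((G.pop D.r).rule (.one E)).items = l := by simp [pop, hp, e1]
      rw [this, e3]; simp [pop, hp, e2]
  · obtain ⟨e, h1, h2⟩ := hh; refine ⟨e, h1, ?_⟩; rw [hend e h1]; exact h2.trans (by rw [← hv]; rfl)
  · rcases hp : G.pops D.r E with _ | _
    · obtain ⟨e, h1, h2⟩ := hh; refine ⟨e, by simp [pop, hp, h1], ?_⟩
      rw [hend e h1]
      have e1 : (G.pop D.r).val (.child E j) = G.val (.child E j) := by simp [pop, hp]
      have e2 : ((G.pop D.r).rule (.zero (.child E j))).items = G.expanded D.r (.zero (.child E j)) := by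
        simp [pop, hp]
      rw [e1, e2, hv, h2]
    · obtain ⟨l, x, L, e1, e2, e3⟩ := h.last_frame hc hX.1 hp
      have ev : (G.pop D.r).val (.child E j) = ((x.pre ++ x.post).map (G.pop D.r).twigVal).getD j
          (node x.label []) := by
        obtain ⟨L', x', e4, -, -, e6⟩ := G.pops_last hp; rw [e2] at e4
        obtain rfl : x.map (G.pop D.r).twigVal = x' := by simpa using (append_inj' e4 rfl).2
        rw [e6]; simp [Frame.map]
      rw [Holds, G.pop_childRule hp e1, Sim.childRule, ev]
      rcases ht : (x.pre ++ x.post)[j]? with _ | t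
      · refine ⟨_, rfl, ?_⟩; rw [getD, getElem?_map, ht]; rfl
      · refine ⟨_, rfl, ?_⟩
        simp only [getD, getElem?_map, ht, Option.map_some, Option.getD_some, twigRule]
        rw [itemsVal_letters]; rfl

/-- A frame just popped from `B` puts its nonconstant children right behind `B`. For other
nonterminals the old witness survives the expansion, unless it sits in the frame that leaves the
rule of `E`. It then reappears in a rule of a child name of `E`, which is the second alternative of
`Gram.Pending`. -/
lemma Gram.Inv.pop_pending (h : G.Inv D ord m wt n) (hc : G.IsClean D) {X : Name}
    (hX : D.Mem X) : (G.pop D.r).Pending D.r X := by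
  have hw : ∀ A, .one A ∈ (G.rule X).names → ctxWidth D.r (G.ctx A) :=
    fun A hA => h.width_of_mem hX hA
  -- decompositions of the expanded names
  have key : ∀ B l₁ l₂, G.expandNames D.r (G.rule X).names = l₁ ++ .one B :: l₂ → ∀ j < D.r,
      constOf ((G.pop D.r).val (.child B j)) = none → .zero (.child B j) ∈ l₂ ∨
      ∃ A, X = .one A ∧ ∃ i < D.r, .zero (.child B j) ∈
        ((G.pop D.r).rule (.zero (.child A i))).names := by
    intro B l₁ l₂ e j hj hcB; obtain ⟨k₁, k₂, e1, rfl⟩ := G.expandNames_split hw e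
    rcases hp : G.pops D.r B with _ | _
    · have hcB' : constOf (G.val (.child B j)) = none := by simpa [pop, hp] using hcB
      rcases h.pending X hX B k₁ k₂ e1 j hj hcB' with hm | ⟨A, rfl, i, hi, hm⟩
      · exact .inl (mem_append_right _ (mem_expandNames_of_mem hm))
      · refine .inr ⟨A, rfl, i, hi, ?_⟩; rcases hpA : G.pops D.r A with _ | _
        · rw [G.pop_names_of_not (X := .zero (.child A i)) (by simp) (by
            rintro E j e; cases e; exact hpA), G.names_expanded _ _ rfl]
          exact mem_expandNames_of_mem hm
        · rw [h.names_child hc hX hpA hi] at hm; simp at hm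
    · obtain ⟨L, x, e3, e4, -, e6⟩ := G.pops_last hp; left; rw [e6] at hcB; rw [e4]
      refine mem_append_left _ ?_; simpa using mem_nameFrame_names.2 ⟨j, rfl, hcB⟩
  intro B l₁ l₂ e j hj hcB
  rcases h.pop_rule_cases hc hX with er | ⟨E, l, x, hE, e1, hw, e2, ⟨rfl, er⟩ | ⟨i, rfl⟩⟩
  · rw [er, G.names_expanded X _ rfl] at e; exact key B _ _ e j hj hcB
  · rw [er] at e
    have e' : G.expandNames D.r (G.rule (.one E)).names =
        l₁ ++ .one B :: (l₂ ++ (Item.frame x).names) := by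
      rw [← e1]; simpa [Rule.names, Rule.lastNames] using congrArg (· ++ (Item.frame x).names) e
    rcases key B _ _ e' j hj hcB with hm | hm
    · rcases mem_append.1 hm with hm | hm
      · exact .inl hm
      · right; refine ⟨E, rfl, ?_⟩; obtain ⟨t, ht, htj⟩ := mem_flatMap.1 hm
        obtain ⟨i, hi, rfl⟩ := mem_iff_getElem.1 ht; refine ⟨i, by simp at hi; omega, ?_⟩
        rw [e2, childRule_names, getElem?_eq_getElem hi]; exact htj
    · exact .inr hm
  · rw [e2, childRule_names] at e; rcases ht : (x.pre ++ x.post)[i]? with _ | t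
    · simp [ht] at e
    · simp [ht, Twig.names] at e; rcases hl : t.last with c | C
      · simp [hl, End.names] at e
      · rw [hl] at e
        rcases l₁ with _ | ⟨z, l₁⟩ <;> simp [End.names] at e

/-- Popping moves the last frame of a rule into the rules for its children. A quantity that grows by
at most `b` under this splitting grows by at most `b` for each nonterminal of rank 1, beyond the
expansion. -/
lemma Gram.Inv.pop_sum (h : G.Inv D ord m wt n) (hc : G.IsClean D) (f : Rule α → ℕ) (b : ℕ)
    (hf : ∀ l (x : Frame α (Twig α)), x.pre.length + x.post.length < D.r →
      f ⟨l, none⟩ + ∑ j ∈ Finset.range D.r, f (Sim.childRule j (some (.frame x))) ≤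
        f ⟨l ++ [.frame x], none⟩ + b) :
    D.sum (fun X => f ((G.pop D.r).rule X)) ≤
      D.sum (fun X => f ⟨G.expanded D.r X, (G.rule X).last⟩) + b * D.one.card := by
  have key : ∀ E ∈ D.one, f ((G.pop D.r).rule (.one E)) +
      ∑ j ∈ Finset.range D.r, f ((G.pop D.r).rule (.zero (.child E j))) ≤
      f ⟨G.expanded D.r (.one E), (G.rule (.one E)).last⟩ + ∑ j ∈ Finset.range D.r,
        f ⟨G.expanded D.r (.zero (.child E j)), (G.rule (.zero (.child E j))).last⟩ + b := by
    intro E hE; rcases hp : G.pops D.r E with _ | _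
    · rw [G.pop_names_of_not (X := .one E) (by rintro E' e; cases e; exact hp) (by simp)]
      have : ∀ j, (G.pop D.r).rule (.zero (.child E j)) = ⟨G.expanded D.r (.zero (.child E j)),
          (G.rule (.zero (.child E j))).last⟩ := fun j =>
        G.pop_names_of_not (X := .zero (.child E j)) (by simp) (by rintro E' j' e; cases e; exact hp)
      simp only [this]; omega
    · obtain ⟨l, x, L, e1, e2, e3⟩ := h.last_frame hc hE hp
      have hl : (G.rule (.one E)).last = none := (h.holds (.one E) hE).1
      have hw := h.width E hE (x.map (G.pop D.r).twigVal) (by simp [e2])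
      simp [Frame.map] at hw
      have er : (G.pop D.r).rule (.one E) = ⟨l, none⟩ := by simp [pop, hp, e1, hl]
      simp only [G.pop_childRule hp e1]; rw [er, e1, hl]; have := hf l x hw; omega
  have h2 := Finset.sum_le_sum key
  simp only [Finset.sum_add_distrib, Finset.sum_const, smul_eq_mul] at h2
  have h3 : ∀ C, (G.pop D.r).rule (.zero (.orig C)) = ⟨G.expanded D.r (.zero (.orig C)),
    (G.rule (.zero (.orig C))).last⟩ := fun _ => rfl
  simp only [Dom.sum, h3, Finset.sum_add_distrib]; rw [mul_comm b]; omega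

lemma childRule_sum_names (x : Frame α (Twig α)) (r : ℕ) (Y : Name) :
    ∑ j ∈ Finset.range r, (childRule j (some (.frame x))).names.count Y ≤
      (Item.frame x).names.count Y := by
  simp only [childRule_names, Item.names]; generalize x.pre ++ x.post = l
  induction l generalizing r with
  | nil => simp
  | cons t l ih =>
    rcases r with _ | r
    · simp
    · rw [Finset.sum_range_succ', flatMap_cons, count_append]; have := ih r; simp at this ⊢; omega

/-- Before a frame is popped from `B` none of its child names occurs, as they stand for constants
and the grammar is clean. Hence the new occurrences are bounded by those of `B` itself. -/
lemma Gram.Inv.pop_count (h : G.Inv D ord m wt n) (hc : G.IsClean D)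
    (hm : ∀ E j, m (.zero (.child E j)) = m (.one E)) (Y : Name) :
    D.sum (fun X => ((G.pop D.r).rule X).names.count Y) ≤ m Y := by
  refine (h.pop_sum hc (fun ru => ru.names.count Y) 0 ?_).trans ?_
  · intro l x _; have := childRule_sum_names x D.r Y; simp [Rule.names, Rule.lastNames] at this ⊢
    omega
  · rw [Nat.zero_mul, Nat.add_zero]
    have e : ∀ X, (Rule.mk (G.expanded D.r X) (G.rule X).last).names.count Y =
        (G.expandNames D.r (G.rule X).names).count Y := by
      intro X; rw [G.names_expanded X _ rfl]
    simp only [e]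
    have hle := fun X hX => G.count_expandNames_le (fun A hA => h.width_of_mem (X := X) hX hA) Y
    by_cases hY : ∃ B j, Y = .zero (.child B j) ∧ G.pops D.r B = true
    · obtain ⟨B, j, rfl, hp⟩ := hY; rw [hm]
      refine le_trans (D.sum_le fun X hX => (hle X hX).trans ?_) (h.count (.one B))
      rw [count_eq_zero.2 fun hmem => ?_, Nat.zero_add, count_eq_countP]
      · exact countP_mono_left fun Z _ h => by cases Z <;> simp_all
      · have h1 := hc X hX _ hmem
        exact (G.pops_iff.1 hp).2 j (h.child_lt hX hmem) (by simpa [solid] using h1)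
    · refine le_trans (D.sum_le fun X hX => (hle X hX).trans ?_) (h.count Y)
      rw [countP_eq_zero.2 fun Z _ h => hY ?_, Nat.add_zero]
      rcases Z with A | C <;> rcases Y with B | C | ⟨B, j⟩ <;> simp at h
      exact ⟨B, j, rfl, h.1 ▸ h.2⟩

/-- Child names come directly after their nonterminal in the order. The distance two demanded by
`closed_one` leaves room for them in every rule that contains it. -/
lemma Gram.Inv.pop (h : G.Inv D ord m wt n) (hc : G.IsClean D)
    (hord : ∀ E j, ord (.zero (.child E j)) = ord (.one E) + 1)
    (hm : ∀ E j, m (.zero (.child E j)) = m (.one E)) : (G.pop D.r).Inv D ord m wt n where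
  start_mem := h.start_mem
  holds X hX := h.pop_holds hc hX
  closed X hX Y hY := by
    obtain ⟨Z, hZ, ho, hY⟩ := h.pop_mem hc hord hX hY
    rcases mem_expandNames (fun A hA => h.width_of_mem hZ hA) hY with hY | ⟨B, hB, j, hj, rfl⟩
    · obtain ⟨h1, h2, h3⟩ := h.closed Z hZ Y hY; exact ⟨h1, by omega, h3⟩
    · refine ⟨⟨(h.closed Z hZ _ hB).1, hj⟩, ?_, by simp⟩
      have := h.closed_one Z hZ B hB; rw [hord]; omega
  closed_one X hX B hB := by
    obtain ⟨Z, hZ, ho, hY⟩ := h.pop_mem hc hord hX hB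
    rcases mem_expandNames (fun A hA => h.width_of_mem hZ hA) hY with hY | ⟨B, hB, j, hj, e⟩
    · have := h.closed_one Z hZ B hY; omega
    · cases e
  count := h.pop_count hc hm
  weight_one A hA := by
    have := h.weight_one A hA; simp only [Gram.pop]
    split
    · rename_i hp
      obtain ⟨L, x, e, -⟩ := G.pops_last hp; rw [e, ctxTot_append] at this; rw [e, dropLast_concat]
      omega
    · exact this
  weight_zero C hC := by
    rcases C with C | ⟨E, j⟩
    · exact h.weight_zero _ hC
    · rcases hp : G.pops D.r E with _ | _
      · have := h.weight_zero _ hC; simpa [Gram.pop, hp] using this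
      · obtain ⟨L, x, e, -, -, e6⟩ := G.pops_last hp; rw [e6]; have := h.weight_one E hC.1
        rw [e, ctxTot_append, ctxTot_cons, frameWt] at this
        by_cases hj : j < (x.pre ++ x.post).length
        · rw [getD_eq_getElem _ _ hj]
          have := le_sum_of_mem (mem_map_of_mem (f := treeWt wt) (getElem_mem hj)); omega
        · rw [getD_eq_default _ _ (by omega), treeWt_node]
          simp; omega
  width A hA := by
    have := h.width A hA; simp only [Gram.pop]
    split
    · exact fun x hx => this x (mem_of_mem_dropLast hx)
    · exact this
  pending X hX := h.pop_pending hc hX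

/-! ### The cost of popping -/

lemma size_nameFrame (B : Symb) (x : Frame α (Pat α)) :
    (Item.frame (nameFrame B x)).size ≤ 1 + (x.pre.length + x.post.length) := by
  have ht : ∀ i t, (nameTwig (α := α) B i t).size ≤ 1 := by
    intro i t; rw [nameTwig, Twig.size]
    rcases constOf t with _ | c <;> simp [End.size]
  have := sum_le_card_nsmul
    (((nameFrame B x).pre ++ (nameFrame B x).post).map Twig.size) 1 (by
      simp only [nameFrame_children, mem_map, mem_mapIdx]
      rintro _ ⟨t, ⟨i, hi, rfl⟩, rfl⟩; exact ht _ _)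
  simpa [Item.size, Frame.twigSize, nameFrame] using this

lemma size_popFrames (hw : ctxWidth r (G.ctx B)) : ((G.popFrames r B).map Item.size).sum ≤ r := by
  rcases hp : G.pops r B with _ | _
  · simp [Gram.popFrames, hp]
  · obtain ⟨L, x, e1, e2, -⟩ := G.pops_last hp; have h1 := size_nameFrame B x
    have h2 := hw x (by simp [e1])
    simp [e2]; omega

lemma Gram.Inv.expanded_size (h : G.Inv D ord m wt n) {X : Name} (hX : D.Mem X) :
    (Rule.mk (G.expanded D.r X) (G.rule X).last).size ≤
      (G.rule X).size + D.r * ∑ A ∈ D.one, (G.rule X).names.count (.one A) := by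
  have hm : ∀ A, .one A ∈ (G.rule X).items.flatMap Item.names → A ∈ D.one := fun A hA =>
    (h.closed X hX _ (mem_append_left _ hA)).1
  have key : ∀ l : List (Item α), (∀ A, .one A ∈ l.flatMap Item.names → A ∈ D.one) →
      ((l.flatMap (G.expandItem D.r)).map Item.size).sum ≤ (l.map Item.size).sum +
        D.r * ∑ A ∈ D.one, (l.flatMap Item.names).count (.one A) := by
    intro l hl
    induction l with
    | nil => simp
    | cons i l ih =>
      have ih := ih fun A hA => hl A (mem_append_right _ hA)
      simp only [flatMap_cons, map_append, sum_append, map_cons, sum_cons,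
        count_append, Finset.sum_add_distrib, mul_add]
      rcases i with x | B
      · simp [expandItem]; omega
      · have hB : B ∈ D.one := hl B (by simp [Item.names])
        have h1 := Finset.single_le_sum (f := fun A => (Item.nt (α := α) B).names.count (.one A))
          (fun _ _ => Nat.zero_le _) hB
        have h2 := size_popFrames (h.width B hB)
        have h3 : D.r * 1 ≤ D.r * ∑ A ∈ D.one, (Item.nt (α := α) B).names.count (.one A) := by
          refine Nat.mul_le_mul_left _ (le_trans ?_ h1); simp [Item.names]
        simp [expandItem]; simp only [Item.size]; omega
  have := key _ hm
  simp only [Rule.size, expanded, Rule.names, count_append, Finset.sum_add_distrib, mul_add]; omega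

lemma size_twigRule (t : Twig α) : (twigRule t).size = t.size := by
  rw [twigRule, Rule.size, Twig.size, size_letters]; rfl

lemma size_childRules (x : Frame α (Twig α)) (r : ℕ) :
    ∑ j ∈ Finset.range r, (childRule j (some (.frame x))).size ≤ x.twigSize + r := by
  simp only [childRule, Frame.twigSize]; generalize x.pre ++ x.post = l
  induction l generalizing r with
  | nil => simp [Rule.size, End.size]
  | cons t l ih =>
    rcases r with _ | r
    · simp
    · rw [Finset.sum_range_succ', map_cons, sum_cons]; have := ih r; simp [size_twigRule] at this ⊢
      omega

/-- Each occurrence of a nonterminal of rank 1 gains at most `r` letters. In addition, the unused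
ones among the `r` child names of a nonterminal receive a dummy constant as right-hand side. -/
lemma Gram.Inv.pop_size (h : G.Inv D ord m wt n) (hc : G.IsClean D) :
    D.sum (fun X => ((G.pop D.r).rule X).size) ≤
      D.sum (fun X => (G.rule X).size) + D.r * (∑ A ∈ D.one, m (.one A) + D.one.card) := by
  refine (h.pop_sum hc Rule.size D.r ?_).trans ?_
  · intro l x _; have := size_childRules x D.r; simp [Rule.size, Item.size] at this ⊢; omega
  · have h1 := D.sum_le (fun X hX => h.expanded_size hX)
    rw [Dom.sum_add, Dom.sum_mul, Dom.sum_comm] at h1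
    have h2 : ∑ A ∈ D.one, D.sum (fun X => (G.rule X).names.count (.one A)) ≤
        ∑ A ∈ D.one, m (.one A) := Finset.sum_le_sum fun A _ => h.count _
    have h3 := Nat.mul_le_mul_left D.r h2; rw [mul_add]; omega

lemma gapPot_letters (F : ℕ) (g : Option ℕ) (w : List α) :
    gapPot F g ((w.map fun a => Item.frame (letter a)).map (Item.mark wt)) =
      (0, g.map (· + wtSum wt w)) := by
  induction w with
  | nil => cases g <;> simp [gapPot]
  | cons a w ih =>
    rw [map_cons, map_cons]; change gapStep F (.inl (wt a)) (gapPot _ _ _) = _; rw [ih]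
    cases g <;> simp [gapStep]; omega

lemma pot_twigRule (F : ℕ) (t : Twig α) : (twigRule t).pot wt F = 0 :=
  congrArg Prod.fst (gapPot_letters F _ t.chain)

lemma pot_childRule (F j : ℕ) (x : Frame α (Twig α)) :
    (childRule j (some (.frame x))).pot wt F = 0 := by
  rw [childRule]; rcases (x.pre ++ x.post)[j]? with _ | t
  · rfl
  · exact pot_twigRule F t

/-- Popped frames only widen gaps, and the rules for children contain no nonterminals of rank 1. -/
lemma Gram.Inv.pop_pot (h : G.Inv D ord m wt n) (hc : G.IsClean D) (hF : ∀ x ≤ n, x.size ≤ F) :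
    D.sum (fun X => ((G.pop D.r).rule X).pot wt F) ≤ D.sum (fun X => (G.rule X).pot wt F) := by
  refine (h.pop_sum hc (Rule.pot wt F) 0 ?_).trans ?_
  · intro l x _; simp [pot_childRule]; simp only [Rule.pot, endGap]
    rw [map_append, gapPot, gapPot, foldr_append]; exact le_rfl
  · rw [Nat.zero_mul, Nat.add_zero]; refine D.sum_le fun X hX => ?_
    have hW := h.weight hX
    have he : (G.pop D.r).endWt wt (G.rule X).last = G.endWt wt (G.rule X).last := by
      rcases hl : (G.rule X).last with _ | e
      · rfl
      · simp [endWt]; rw [G.pop_endVal]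
        · intro Y hY; exact hc X hX Y (mem_append_right _ (by simpa [Rule.lastNames, hl] using hY))
        · intro E j hj
          exact h.child_lt hX (mem_append_right _ (by simpa [Rule.lastNames, hl] using hj))
    suffices key : ∀ l : List (Item α), (∀ Y ∈ l.flatMap Item.names, G.solid Y = true) →
        (∀ E j, .zero (.child E j) ∈ l.flatMap Item.names → j < D.r) →
        ctxTot wt (G.itemsVal l) + G.endWt wt (G.rule X).last ≤ n →
        GapLe (gapPot F (endGap wt (G.rule X).last) (l.map (Item.mark wt)))
          (gapPot F (endGap wt (G.rule X).last)
            ((l.flatMap (G.expandItem D.r)).map (Item.mark wt))) from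
      (key _ (fun Y hY => hc X hX Y (mem_append_left _ hY))
        (fun E j hm => h.child_lt hX (mem_append_left _ hm)) hW).1
    intro l hs hj hl
    induction l with
    | nil => exact GapLe.refl _
    | cons i l ih =>
      rw [itemsVal_cons, ctxTot_append] at hl
      have ih := ih (fun Y hY => hs Y (mem_append_right _ hY))
        (fun E j hm => hj E j (mem_append_right _ hm)) (by omega)
      rw [map_cons, flatMap_cons, map_append, gapPot_append]; rcases i with x | B
      · exact gapLe_letter ih le_rfl
      · have hv := G.expand_val (r := D.r) (.nt B :: l) hs hj
        rw [flatMap_cons, expandItem, itemsVal_append, itemsVal_cons, itemsVal_cons,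
          append_assoc] at hv
        have hgap : ∀ y, (gapPot F (endGap wt (G.rule X).last)
            (((G.popFrames D.r B) ++ l.flatMap (G.expandItem D.r)).map (Item.mark wt))).2 = some y →
            y.size ≤ F := by
          intro y hy; refine hF y ?_; have h1 := (G.pop D.r).gap_le hy
          rw [he, itemsVal_append] at h1; have h2 := congrArg (ctxTot wt) hv
          simp only [ctxTot_append] at h1 h2; omega
        rw [expandItem, map_cons]; change GapLe (gapStep F (.inr ()) _) (gapStep F (.inr ()) _)
        rw [map_append, gapPot_append] at hgap; refine gapLe_nt ?_ (fun x hx => hF x ?_) hgap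
        · rcases hp : G.pops D.r B with _ | _
          · simpa [popFrames, hp, gapPot] using ih
          · obtain ⟨L, x, e1, e2, -⟩ := G.pops_last hp; rw [e2]; exact gapLe_insert ih _
        · have := G.gap_le hx; omega

/-! ### Explicit labels -/

def End.labels : End α → List α
  | .con c => [c]
  | .nt _ => []

def Twig.labels (t : Twig α) : List α := t.chain ++ t.last.labels

def Item.labels : Item α → List α
  | .frame x => x.label :: (x.pre ++ x.post).flatMap Twig.labels
  | .nt _ => []

/-- The letters of a right-hand side. -/
def Rule.labels (r : Rule α) : List α := r.items.flatMap Item.labels ++ r.last.elim [] End.labels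

lemma End.length_labels (e : End α) : e.labels.length = e.size := by cases e <;> rfl

lemma Rule.length_labels (r : Rule α) : r.labels.length = r.size := by
  have ht : ∀ l : List (Twig α), (l.flatMap Twig.labels).length = (l.map Twig.size).sum := by
    intro l; rw [length_flatMap]; congr 2
    funext t
    simp [Twig.labels, Twig.size, End.length_labels]
  have hi : ∀ i : Item α, i.labels.length = i.size := by
    rintro (x | B)
    · simp [Item.labels, Item.size, ht, Frame.twigSize]; omega
    · rfl
  rw [Rule.labels, Rule.size, length_append, length_flatMap]; congr 1
  · congr 2
    funext i
    exact hi i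
  · rcases r.last with _ | e
    · rfl
    · exact e.length_labels

/-! ### Right-hand sides that end with explicit letters -/

/-- A constant at the end of a rule for a nonterminal of rank `0` is a child of an explicit frame or
the whole right-hand side. -/
def Rule.EndsOk (ru : Rule α) : Prop :=
  ∀ c, ru.last = some (.con c) → ru.items = [] ∨ ∃ l x, ru.items = l ++ [.frame x]

/-- Nonterminals of rank `0` in the list do not stand for constants. -/
abbrev Gram.NoConst (G : Gram α) (l : List Name) : Prop :=
  ∀ C, .zero C ∈ l → constOf (G.val C) = none

lemma Gram.noConst_append {l l' : List Name} :
    G.NoConst (l ++ l') ↔ G.NoConst l ∧ G.NoConst l' := by simp [NoConst, or_imp, forall_and]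

def Gram.ZeroSolid (G : Gram α) (D : Dom) : Prop := ∀ X, D.Mem X → G.NoConst (G.rule X).names

lemma Gram.Inv.pop_zeroSolid (h : G.Inv D ord m wt n) (hc : G.IsClean D)
    (hord : ∀ E j, ord (.zero (.child E j)) = ord (.one E) + 1) : (G.pop D.r).ZeroSolid D := by
  intro X hX C hC; obtain ⟨Z, hZ, -, hm⟩ := h.pop_mem hc hord hX hC
  obtain ⟨Y, hY, hm⟩ := mem_flatMap.1 hm; rcases Y with B | C'
  · rcases mem_cons.1 hm with hm | hm
    · cases hm
    · rcases hp : G.pops D.r B with _ | _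
      · simp [popFrames, hp] at hm
      · obtain ⟨L, x, e1, e2, -, e6⟩ := G.pops_last hp; simp [e2] at hm
        obtain ⟨j, rfl, hj⟩ := (mem_nameFrame_names (a := x.label)).1 hm; rw [e6, hj]
  · obtain rfl : C = C' := by simpa using hm
    have hs := hc Z hZ _ hY; rw [G.pop_val hs]
    · simpa [solid] using hs
    · rintro E j rfl
      exact h.child_lt hZ hY

/-- This is the purpose of popping frames: a constant at the end of a rule now has an explicit
parent that can absorb it, unless it is the whole rule. -/
lemma Gram.Inv.pop_endsOk (h : G.Inv D ord m wt n) (hc : G.IsClean D) {X : Name}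
    (hX : D.Mem X) : ((G.pop D.r).rule X).EndsOk := by
  rcases h.pop_rule_cases hc hX with e | ⟨E, l, x, hE, e1, -, e2, ⟨rfl, e⟩ | ⟨j, rfl⟩⟩
  · rw [e]; intro c hl; change (G.rule X).last = _ at hl
    by_cases hn : (G.rule X).items = []
    · exact .inl (by simp [expanded, hn])
    · exact .inr (h.expanded_last hc hX (by simp [Rule.lastNames, hl, End.names]) hn (by
        rintro A rfl; simp [(h.holds _ hX).1] at hl))
  · rw [e]; rintro c ⟨⟩
  · rw [e2, childRule]; intro c _; rcases (x.pre ++ x.post)[j]? with _ | t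
    · exact .inl rfl
    · rcases eq_nil_or_concat' t.chain with hn | ⟨w, a, hw⟩
      · exact .inl (by simp [twigRule, hn])
      · exact .inr ⟨w.map fun a => .frame (letter a), letter a, by simp [twigRule, hw]⟩

/-! ### Leaf compression of grammars -/

/-- The label of a node that has absorbed its constant children. -/
abbrev Leafed (α : Type) : Type := α × List (Option α)

abbrev leafed (t : Pat α) : Pat (Leafed α) := absorb Prod.mk t

def leafFrame (x : Frame α (Pat α)) : Frame (Leafed α) (Pat (Leafed α)) :=
  ⟨(x.label, x.pre.map constOf ++ none :: x.post.map constOf),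
    (x.pre.filter fun t => (constOf t).isNone).map leafed,
    (x.post.filter fun t => (constOf t).isNone).map leafed⟩

lemma leafed_fill (x : Frame α (Pat α)) (ht : constOf t = none) :
    leafed (x.fill t) = (leafFrame x).fill (leafed t) := by
  simp only [leafed, fill, absorb_node, leafFrame, map_append, map_cons, ht,
    filter_append, filter_cons]
  simp

lemma constOf_fill (x : Frame α (Pat α)) (t : Pat α) : constOf (x.fill t) = none := by
  rw [fill]
  rcases x.pre with _ | ⟨p, pre⟩ <;> rfl

lemma constOf_plug (L : List (Frame α (Pat α))) (ht : constOf t = none) :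
    constOf (plug L t) = none := by
  cases L with
  | nil => exact ht
  | cons x L => exact constOf_fill x _

lemma leafed_plug (L : List (Frame α (Pat α))) (ht : constOf t = none) :
    leafed (plug L t) = plug (L.map leafFrame) (leafed t) := by
  induction L with
  | nil => rfl
  | cons x L ih => rw [plug_cons, leafed_fill x (constOf_plug L ht), ih, map_cons, plug_cons]

def Twig.const (t : Twig α) : Option α := match t with
  | ⟨[], .con c⟩ => some c
  | _ => none

/-- A unary letter without absorbed children. -/
def plain (a : α) : Leafed α := (a, [none])

def leafTwig (t : Twig α) : Twig (Leafed α) := match t.last with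
  | .nt C => ⟨t.chain.map plain, .nt C⟩
  | .con c => match t.chain.getLast? with
    | none => ⟨[], .con (c, [])⟩
    | some a => ⟨t.chain.dropLast.map plain, .con (a, [some c])⟩

def leafTwigs (l : List (Twig α)) : List (Twig (Leafed α)) :=
  (l.filter fun t => t.const.isNone).map leafTwig

def leafItem : Item α → Item (Leafed α)
  | .frame x => .frame ⟨(x.label, x.pre.map Twig.const ++ none :: x.post.map Twig.const),
      leafTwigs x.pre, leafTwigs x.post⟩
  | .nt B => .nt B

/-- The end of a right-hand side in which the lowest node absorbs its constant children: the last of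
the remaining children takes over the role of the end. -/
def leafEnd (x : Frame α (Twig α)) (c : α) : Rule (Leafed α) :=
  let f : Leafed α := (x.label, x.pre.map Twig.const ++ some c :: x.post.map Twig.const)
  match (leafTwigs (x.pre ++ x.post)).getLast? with
  | none => ⟨[], some (.con f)⟩
  | some t => ⟨.frame ⟨f, (leafTwigs (x.pre ++ x.post)).dropLast, []⟩ ::
      t.chain.map fun a => .frame (letter a), some t.last⟩

def leafRule (ru : Rule α) : Rule (Leafed α) := match ru.last with
  | none => ⟨ru.items.map leafItem, none⟩
  | some (.nt C) => ⟨ru.items.map leafItem, some (.nt C)⟩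
  | some (.con c) => match ru.items.getLast? with
    | some (.frame x) => ⟨ru.items.dropLast.map leafItem ++ (leafEnd x c).items, (leafEnd x c).last⟩
    | _ => ⟨ru.items.map leafItem, some (.con (c, []))⟩

def Gram.leaf (G : Gram α) : Gram (Leafed α) where
  rule X := leafRule (G.rule X)
  ctx A := (G.ctx A).map leafFrame
  val C := leafed (G.val C)

/-! Names -/

lemma leafTwig_names (t : Twig α) : (leafTwig t).names = t.names := by
  obtain ⟨w, c | C⟩ := t
  · simp only [leafTwig]
    rcases w.getLast? with _ | a <;> rfl
  · rfl

lemma leafTwigs_names (l : List (Twig α)) :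
    (leafTwigs l).flatMap Twig.names = l.flatMap Twig.names := by
  induction l with
  | nil => rfl
  | cons t l ih =>
    rw [leafTwigs] at ih; rcases h : t.const with _ | c
    · rw [leafTwigs, filter_cons_of_pos (by simp [h]), map_cons, flatMap_cons, ih,
        leafTwig_names, flatMap_cons]
    · rw [leafTwigs, filter_cons_of_neg (by simp [h]), ih, flatMap_cons]
      obtain ⟨_ | ⟨a, w⟩, c | C⟩ := t <;> simp_all [Twig.const, Twig.names, End.names]

lemma leafItem_names (i : Item α) : (leafItem i).names = i.names := by
  rcases i with x | B
  · simp [leafItem, Item.names, leafTwigs_names]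
  · rfl

lemma leafItems_names (l : List (Item α)) :
    (l.map leafItem).flatMap Item.names = l.flatMap Item.names := by
  rw [flatMap_map]; congr 1
  funext i
  exact leafItem_names i

lemma leafEnd_names (x : Frame α (Twig α)) (c : α) :
    (leafEnd x c).names = (Item.frame x).names := by
  have h := leafTwigs_names (x.pre ++ x.post); rw [leafEnd, Item.names, ← h]
  rcases eq_nil_or_concat' (leafTwigs (x.pre ++ x.post)) with hn | ⟨l, t, hl⟩
  · simp [hn, Rule.names, Rule.lastNames, End.names]
  · simp [hl, Rule.names, names_letters, Item.names, Rule.lastNames]; rfl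

lemma leafRule_cases (h : ru.EndsOk) :
    (ru.last = none ∧ leafRule ru = ⟨ru.items.map leafItem, none⟩) ∨
    (∃ C, ru.last = some (.nt C) ∧ leafRule ru = ⟨ru.items.map leafItem, some (.nt C)⟩) ∨
    (∃ c, ru.last = some (.con c) ∧ ru.items = [] ∧ leafRule ru = ⟨[], some (.con (c, []))⟩) ∨
    ∃ c l x, ru.last = some (.con c) ∧ ru.items = l ++ [.frame x] ∧
      leafRule ru = ⟨l.map leafItem ++ (leafEnd x c).items, (leafEnd x c).last⟩ := by
  rcases hl : ru.last with _ | c | C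
  · exact .inl ⟨rfl, by simp [leafRule, hl]⟩
  · right; right; rcases h c hl with hi | ⟨l, x, hi⟩
    · exact .inl ⟨c, rfl, hi, by simp [leafRule, hl, hi]⟩
    · exact .inr ⟨c, l, x, rfl, hi, by simp [leafRule, hl, hi]⟩
  · exact .inr (.inl ⟨C, rfl, by simp [leafRule, hl]⟩)

lemma leafRule_names (h : ru.EndsOk) : (leafRule ru).names = ru.names := by
  rcases leafRule_cases h with ⟨h1, h2⟩ | ⟨C, h1, h2⟩ | ⟨c, h1, h3, h2⟩ | ⟨c, l, x, h1, h3, h2⟩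
  · rw [h2, Rule.names, Rule.names, leafItems_names, Rule.lastNames, Rule.lastNames, h1]; rfl
  · rw [h2, Rule.names, Rule.names, leafItems_names, Rule.lastNames, Rule.lastNames, h1]; rfl
  · rw [h2, Rule.names, Rule.names, Rule.lastNames, Rule.lastNames, h1, h3]; rfl
  · have e := leafEnd_names x c; rw [Rule.names, Rule.lastNames] at e
    rw [h2, Rule.names, Rule.names, Rule.lastNames, Rule.lastNames, h1, h3]
    simp [leafItems_names, e]; simp [End.names]

/-! Values -/

lemma constOf_twigVal {t : Twig α} (h : G.NoConst t.names) : constOf (G.twigVal t) = t.const := by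
  obtain ⟨_ | ⟨a, w⟩, c | C⟩ := t
  · rfl
  · exact h C (by simp [Twig.names, End.names])
  · exact constOf_fill _ _
  · exact constOf_fill _ _

lemma leafed_letters (w : List α) (ht : constOf t = none) :
    leafed (plug (w.map letter) t) = plug ((w.map plain).map letter) (leafed t) := by
  rw [leafed_plug _ ht, map_map, map_map]; rfl

lemma leafTwig_val {t : Twig α} (h : G.NoConst t.names) :
    G.leaf.twigVal (leafTwig t) = leafed (G.twigVal t) := by
  obtain ⟨w, c | C⟩ := t
  · simp only [leafTwig, Gram.twigVal]; rcases eq_nil_or_concat' w with rfl | ⟨w, a, rfl⟩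
    · rfl
    · rw [map_append, plug_append]; simp only [getLast?_concat, dropLast_concat, Gram.endVal]
      rw [leafed_letters w (t := plug ([a].map letter) (node c []))
        (by exact constOf_fill _ _)]
      rfl
  · exact (leafed_letters w (h C (by simp [Twig.names, End.names]))).symm

lemma leafTwigs_val {l : List (Twig α)}
    (h : G.NoConst (l.flatMap Twig.names)) :
    (leafTwigs l).map G.leaf.twigVal =
      ((l.map G.twigVal).filter fun t => (constOf t).isNone).map leafed := by
  have h' : ∀ t ∈ l, G.NoConst t.names := fun t ht C hC => h C (mem_flatMap.2 ⟨t, ht, hC⟩)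
  rw [leafTwigs, filter_map, map_map, map_map]
  have e : l.filter ((fun t : Pat α => (constOf t).isNone) ∘ G.twigVal) =
      l.filter fun t => t.const.isNone :=
    filter_congr fun t ht => by rw [Function.comp_apply, constOf_twigVal (h' t ht)]
  rw [e]; exact map_congr_left fun t ht => leafTwig_val (h' t (mem_of_mem_filter ht))

lemma consts_val {l : List (Twig α)}
    (h : G.NoConst (l.flatMap Twig.names)) :
    (l.map G.twigVal).map constOf = l.map Twig.const := by
  rw [map_map]
  exact map_congr_left fun t ht => constOf_twigVal fun C hC => h C (mem_flatMap.2 ⟨t, ht, hC⟩)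

lemma leafItems_val
    (h : G.NoConst (l.flatMap Item.names)) :
    G.leaf.itemsVal (l.map leafItem) = (G.itemsVal l).map leafFrame := by
  induction l with
  | nil => rfl
  | cons i l ih =>
    rw [flatMap_cons, Gram.noConst_append] at h
    rw [map_cons, Gram.itemsVal_cons, Gram.itemsVal_cons, map_append, ih h.2]; congr 1
    rcases i with x | B
    · obtain ⟨h, -⟩ := h; rw [Item.names, flatMap_append, Gram.noConst_append] at h
      simp [leafItem, Gram.itemVal, Frame.map, leafFrame, leafTwigs_val h.1, leafTwigs_val h.2,
        consts_val h.1, consts_val h.2]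
    · rfl

lemma leafEnd_val {c : α}
    (h : G.NoConst (Item.frame x).names) :
    ∃ e, (leafEnd x c).last = some e ∧ plug (G.leaf.itemsVal (leafEnd x c).items) (G.leaf.endVal e) =
      leafed ((x.map G.twigVal).fill (node c [])) := by
  have hx : G.NoConst ((x.pre ++ x.post).flatMap Twig.names) := h
  obtain ⟨h1, h2⟩ := Gram.noConst_append.1 (flatMap_append ▸ hx)
  have e : leafed ((x.map G.twigVal).fill (node c [])) =
      node (x.label, x.pre.map Twig.const ++ some c :: x.post.map Twig.const)
        ((leafTwigs (x.pre ++ x.post)).map G.leaf.twigVal) := by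
    rw [leafTwigs_val hx]
    simp only [leafed, fill, Frame.map, absorb_node, map_append, map_cons,
      consts_val h1, consts_val h2, filter_append, filter_cons, constOf_node_nil]
    simp
  rw [e, leafEnd]; rcases eq_nil_or_concat' (leafTwigs (x.pre ++ x.post)) with hn | ⟨l, t, hl⟩
  · exact ⟨.con (x.label, x.pre.map Twig.const ++ some c :: x.post.map Twig.const), by simp [hn],
      by simp [hn, Gram.endVal]⟩
  · refine ⟨t.last, by simp [hl], ?_⟩
    simp [hl, Gram.itemVal, Gram.itemsVal_letters]; simp [Frame.map, fill, Gram.twigVal]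

lemma Gram.leaf_holds {X : Name} (hh : G.Holds X) (hE : (G.rule X).EndsOk)
    (hs : G.NoConst ((G.rule X).names)) : G.leaf.Holds X := by
  have hi := (noConst_append.1 hs).1; have er : G.leaf.rule X = leafRule (G.rule X) := rfl
  rcases X with A | C
  · obtain ⟨h1, h2⟩ := hh
    rcases leafRule_cases hE with ⟨h3, h4⟩ | ⟨C, h3, h4⟩ | ⟨c, h3, h5, h4⟩ | ⟨c, l, x, h3, h5, h4⟩
    · refine ⟨by rw [er, h4], ?_⟩
      rw [er, h4, leafItems_val hi, ← h2]; rfl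
    all_goals simp [h1] at h3
  · obtain ⟨e, h1, h2⟩ := hh
    rcases leafRule_cases hE with ⟨h3, h4⟩ | ⟨C', h3, h4⟩ | ⟨c, h3, h5, h4⟩ | ⟨c, l, x, h3, h5, h4⟩
    · simp [h1] at h3
    · obtain rfl : e = .nt C' := by simpa [h1] using h3
      refine ⟨.nt C', by rw [er, h4], ?_⟩
      rw [er, h4, leafItems_val hi]; change leafed (G.val C) = _; rw [h2, leafed_plug]
      · rfl
      · exact hs C' (mem_append_right _ (by simp [Rule.lastNames, h3, End.names]))
    · obtain rfl : e = .con c := by simpa [h1] using h3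
      refine ⟨_, by rw [er, h4], ?_⟩
      rw [er, h4]; change leafed (G.val C) = _; rw [h2, h5]; rfl
    · obtain rfl : e = .con c := by simpa [h1] using h3
      rw [h5, flatMap_append, noConst_append] at hi; rw [h5] at h2
      obtain ⟨e', he, hv⟩ := leafEnd_val (G := G) (x := x) (c := c) (by simpa using hi.2)
      refine ⟨e', by rw [er, h4, he], ?_⟩
      rw [er, h4, itemsVal_append, plug_append, hv, leafItems_val hi.1]; change leafed (G.val C) = _
      rw [h2, itemsVal_append, plug_append]; exact leafed_plug _ (constOf_fill _ _)

/-! ### The cost of leaf compression -/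

/-- The weight of the absorbed constants. -/
def constWt (wt : α → ℕ) (p : List (Option α)) : ℕ := (p.map fun o => o.elim 0 wt).sum

@[simp] lemma constWt_nil : constWt wt [] = 0 := rfl
@[simp] lemma constWt_cons_none (p : List (Option α)) : constWt wt (none :: p) = constWt wt p := by
  simp [constWt]
@[simp] lemma constWt_cons_some (c : α) (p : List (Option α)) :
    constWt wt (some c :: p) = wt c + constWt wt p := by simp [constWt]
lemma constWt_append (p q : List (Option α)) : constWt wt (p ++ q) = constWt wt p + constWt wt q := by
  simp [constWt]

def leafWt (wt : α → ℕ) (a : Leafed α) : ℕ := wt a.1 + constWt wt a.2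

lemma treeWt_leafed (t : Pat α) : treeWt (leafWt wt) (leafed t) = treeWt wt t := by
  induction t using induct with
  | hp i => simp [leafed, treeWt]
  | hn a ts ih =>
    rw [leafed, absorb_node, treeWt_node, treeWt_node, leafWt]
    have : constWt wt (ts.map constOf) +
        (((ts.filter fun t => (constOf t).isNone).map leafed).map (treeWt (leafWt wt))).sum =
        (ts.map (treeWt wt)).sum := by
      induction ts with
      | nil => rfl
      | cons t ts ih2 =>
        have ih2 := ih2 fun t ht => ih t (by simp [ht])
        rcases h : constOf t with _ | c
        · simp [h, ih t] at ih2 ⊢; omega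
        · simp [constOf_eq_some.1 h, treeWt_node] at ih2 ⊢; omega
    grind

lemma frameWt_leafFrame (x : Frame α (Pat α)) :
    frameWt (leafWt wt) (leafFrame x) = frameWt wt x := by
  have h1 := treeWt_leafed (wt := wt) (x.fill (node x.label [node x.label []]))
  rw [leafed_fill x rfl, treeWt_fill, treeWt_leafed, treeWt_fill] at h1; omega

lemma ctxTot_leafFrame (L : List (Frame α (Pat α))) :
    ctxTot (leafWt wt) (L.map leafFrame) = ctxTot wt L := by
  simp [ctxTot, Function.comp_def, frameWt_leafFrame]

lemma wt_plain (a : α) : leafWt wt (plain a) = wt a := by simp [leafWt, plain]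

lemma wt_leafTwig {t : Twig α} (h : t.const = none) :
    wtSum (leafWt wt) (leafTwig t).labels = wtSum wt t.labels := by
  have hw : ∀ w : List α, wtSum (leafWt wt) (w.map plain) = wtSum wt w := fun w => by
    simp [wtSum, Function.comp_def, wt_plain]
  obtain ⟨w, c | C⟩ := t
  · rcases eq_nil_or_concat' w with rfl | ⟨w, a, rfl⟩
    · simp [Twig.const] at h
    · simp [leafTwig, Twig.labels, wtSum_append, hw, End.labels, leafWt]
  · simp [leafTwig, Twig.labels, hw, End.labels]

lemma wt_leafTwigs (l : List (Twig α)) :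
    wtSum (leafWt wt) ((leafTwigs l).flatMap Twig.labels) + constWt wt (l.map Twig.const) =
      wtSum wt (l.flatMap Twig.labels) := by
  induction l with
  | nil => rfl
  | cons t l ih =>
    rw [leafTwigs] at ih ⊢; rw [flatMap_cons, wtSum_append, map_cons]; rcases h : t.const with _ | c
    · simp [h, wtSum_append, wt_leafTwig h]; omega
    · have : wtSum wt t.labels = wt c := by
        obtain ⟨_ | ⟨a, w⟩, c | C⟩ := t <;> simp_all [Twig.const, Twig.labels, End.labels]
      simp [h]; omega

lemma wt_leafItem (i : Item α) : wtSum (leafWt wt) (leafItem i).labels = wtSum wt i.labels := by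
  rcases i with x | B
  · have h1 := wt_leafTwigs (wt := wt) x.pre; have h2 := wt_leafTwigs (wt := wt) x.post
    simp [leafItem, Item.labels, wtSum_append, leafWt, constWt_append, constWt_cons_none] at h1 h2 ⊢
    omega
  · rfl

lemma wt_leafItems (l : List (Item α)) :
    wtSum (leafWt wt) ((l.map leafItem).flatMap Item.labels) = wtSum wt (l.flatMap Item.labels) := by
  induction l with
  | nil => rfl
  | cons i l ih =>
    rw [map_cons, flatMap_cons, flatMap_cons, wtSum_append, wtSum_append, ih, wt_leafItem]

lemma labels_letters (w : List α) :
    (w.map fun a => Item.frame (letter a)).flatMap Item.labels = w := by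
  induction w with
  | nil => rfl
  | cons a w ih => rw [map_cons, flatMap_cons, ih]; rfl

lemma wt_leafEnd (x : Frame α (Twig α)) (c : α) :
    wtSum (leafWt wt) (leafEnd x c).labels = wtSum wt (Item.frame x).labels + wt c := by
  have h := wt_leafTwigs (wt := wt) (x.pre ++ x.post); rw [leafEnd, Item.labels, wtSum_cons]
  rcases eq_nil_or_concat' (leafTwigs (x.pre ++ x.post)) with hn | ⟨l, t, hl⟩
  · rw [hn, map_append, constWt_append] at h
    simp [hn, Rule.labels, End.labels, leafWt, constWt_append] at h ⊢; omega
  · rw [hl, map_append, constWt_append] at h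
    simp [hl, Rule.labels, labels_letters, Item.labels, wtSum_append, leafWt, constWt_append, constWt_cons_some, Twig.labels] at h ⊢
    omega

lemma wt_leafRule (h : ru.EndsOk) :
    wtSum (leafWt wt) (leafRule ru).labels = wtSum wt ru.labels := by
  rcases leafRule_cases h with ⟨h1, h2⟩ | ⟨C, h1, h2⟩ | ⟨c, h1, h3, h2⟩ | ⟨c, l, x, h1, h3, h2⟩
  iterate 2 rw [h2, Rule.labels, Rule.labels, wtSum_append, wtSum_append, wt_leafItems, h1]; rfl
  · simp [h2, Rule.labels, h1, h3, End.labels, leafWt]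
  · have e := wt_leafEnd (wt := wt) x c; rw [Rule.labels, wtSum_append] at e
    simp [h2, Rule.labels, h1, h3, wtSum_append, wt_leafItems, End.labels]; omega

/-- Counting with unit weights shows that the rule shrinks by the number of absorbed constants.
These vanishing letters pay for the productions of leaf compression. -/
lemma size_leafRule (h : ru.EndsOk) :
    (leafRule ru).size + wtSum (fun a => a.2.countP Option.isSome) (leafRule ru).labels = ru.size := by
  have h1 := wt_leafRule (wt := fun _ => 1) h
  have h2 : ∀ (γ : Type) (w : List γ), wtSum (fun _ => 1) w = w.length := by intro γ w; simp [wtSum]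
  have h3 : ∀ p : List (Option α), constWt (fun _ => 1) p = p.countP Option.isSome := fun p => by
    induction p with
    | nil => rfl
    | cons o p ih => cases o <;> simp [ih]; omega
  have h4 : ∀ w : List (Leafed α), wtSum (leafWt fun _ => 1) w =
      w.length + wtSum (fun a => a.2.countP Option.isSome) w := fun w => by
    induction w with
    | nil => rfl
    | cons a w ih => simp [ih, leafWt, h3]; omega
  rw [h2, h4, Rule.length_labels, Rule.length_labels] at h1; exact h1

lemma Gram.Inv.leaf (h : G.Inv D ord m wt n) (hs : G.ZeroSolid D)
    (hE : ∀ X, D.Mem X → (G.rule X).EndsOk) : G.leaf.Inv D ord m (leafWt wt) n := by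
  refine h.of_filter (fun _ => true) (fun X hX => ?_) ?_ (fun X hX =>
    Gram.leaf_holds (h.holds X hX) (hE X hX) (hs X hX)) ?_ ?_ ?_
  · rw [filter_true]; exact leafRule_names (hE X hX)
  · intro E j hc; refine ⟨?_, rfl⟩
    by_contra hne
    obtain ⟨c, hc'⟩ := Option.ne_none_iff_exists'.1 hne
    have e : G.leaf.val (.child E j) = leafed (G.val (.child E j)) := rfl
    rw [e, constOf_eq_some.1 hc', leafed, absorb_node] at hc; simp at hc
  · intro A hA; exact (ctxTot_leafFrame _).le.trans (h.weight_one A hA)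
  · intro C hC; exact (treeWt_leafed _).le.trans (h.weight_zero C hC)
  · intro A hA y hy; obtain ⟨x, hx, rfl⟩ := mem_map.1 hy; have := h.width A hA x hx
    have h1 := length_filter_le (fun t => (constOf t).isNone) x.pre
    have h2 := length_filter_le (fun t => (constOf t).isNone) x.post
    simp [leafFrame]; omega

lemma gapLe_leafEnd (x : Frame α (Twig α)) (c : α) :
    GapLe (gapPot F (some (wt c)) ([Item.frame x].map (Item.mark wt)))
      (gapPot F (endGap (leafWt wt) (leafEnd x c).last)
        ((leafEnd x c).items.map (Item.mark (leafWt wt)))) := by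
  have e1 : gapPot F (some (wt c)) ([Item.frame x].map (Item.mark wt)) =
    (0, some (wt c + wt x.label)) := rfl
  have hw : wt c + wt x.label ≤
      leafWt wt (x.label, x.pre.map Twig.const ++ some c :: x.post.map Twig.const) := by
    simp only [leafWt, constWt_append, constWt_cons_some]; omega
  rw [e1, leafEnd]; rcases eq_nil_or_concat' (leafTwigs (x.pre ++ x.post)) with hn | ⟨l, t, hl⟩
  · simp [hn]; exact ⟨le_rfl, fun y hy => ⟨_, by cases hy; exact hw, rfl⟩⟩
  · simp only [hl, getLast?_concat, map_cons]; change GapLe _ (gapStep F (.inl _) (gapPot _ _ _))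
    rw [gapPot_letters]
    obtain ⟨z, hz⟩ : ∃ z, endGap (leafWt wt) (some t.last) = some z := by
      rcases t.last with c | C <;> exact ⟨_, rfl⟩
    rw [hz]; exact ⟨le_rfl, fun y hy => ⟨_, by cases hy; dsimp only; omega, rfl⟩⟩

lemma Gram.Inv.leaf_pot (h : G.Inv D ord m wt n) (hs : G.ZeroSolid D)
    (hE : ∀ X, D.Mem X → (G.rule X).EndsOk) (hF : ∀ x ≤ n, x.size ≤ F) {X : Name}
    (hX : D.Mem X) : (G.leaf.rule X).pot (leafWt wt) F ≤ (G.rule X).pot wt F := by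
  have hW := h.weight hX; have hi := (Gram.noConst_append.1 (hs X hX)).1
  have key : ∀ (l k : List (Item α)) (k' : List (Item (Leafed α))) (e : Option (End α))
      (e' : Option (End (Leafed α))),
      G.NoConst (l.flatMap Item.names) →
      ctxTot wt (G.itemsVal (l ++ k)) + G.endWt wt e ≤ n →
      ctxTot (leafWt wt) (G.leaf.itemsVal k') + G.leaf.endWt (leafWt wt) e' ≤
        ctxTot wt (G.itemsVal k) + G.endWt wt e →
      GapLe (gapPot F (endGap wt e) (k.map (Item.mark wt)))
        (gapPot F (endGap (leafWt wt) e') (k'.map (Item.mark (leafWt wt)))) →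
      GapLe (gapPot F (endGap wt e) ((l ++ k).map (Item.mark wt)))
        (gapPot F (endGap (leafWt wt) e') ((l.map leafItem ++ k').map (Item.mark (leafWt wt)))) := by
    intro l k k' e e' hl hn hk hg
    induction l with
    | nil => exact hg
    | cons i l ih =>
      have hl' := (noConst_append.1 hl).2; rw [cons_append, itemsVal_cons, ctxTot_append] at hn
      have ih := ih hl' (by omega)
      rcases i with x | B
      · change GapLe (gapStep F (.inl (wt x.label)) _) (gapStep F (.inl (leafWt wt _)) _)
        refine gapLe_letter ih ?_; simp [leafWt]
      · change GapLe (gapStep F (.inr ()) (gapPot F _ ((l ++ k).map _)))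
          (gapStep F (.inr ()) (gapPot F _ ((l.map leafItem ++ k').map _)))
        refine gapLe_nt ih (fun y hy => hF y ?_) fun y hy => hF y ?_
        · have := G.gap_le hy; omega
        · have := G.leaf.gap_le hy
          rw [itemsVal_append, ctxTot_append, leafItems_val hl', ctxTot_leafFrame] at this
          rw [itemsVal_append, ctxTot_append] at hn; omega
  have er : G.leaf.rule X = leafRule (G.rule X) := rfl; rw [er, Rule.pot, Rule.pot]
  rcases leafRule_cases (hE X hX) with ⟨h1, h2⟩ | ⟨C, h1, h2⟩ | ⟨c, h1, h3, h2⟩ | ⟨c, l, x, h1, h3, h2⟩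
  · have := key (G.rule X).items [] [] none none hi (by simpa [h1] using hW) le_rfl (GapLe.refl _)
    rw [h2, h1]; simpa using this.1
  · have := key (G.rule X).items [] [] (some (.nt C)) (some (.nt C)) hi (by simpa [h1] using hW)
      (show 0 + treeWt (leafWt wt) (leafed (G.val C)) ≤ 0 + treeWt wt (G.val C) by
        rw [treeWt_leafed]) (GapLe.refl _)
    rw [h2, h1]; simpa using this.1
  · rw [h2, h1, h3]; exact le_rfl
  · rw [h3, flatMap_append, noConst_append] at hi; rw [h3] at hW
    obtain ⟨e', he, hv⟩ := leafEnd_val (G := G) (x := x) (c := c) (by simpa using hi.2)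
    have := key l [.frame x] (leafEnd x c).items (some (.con c)) (leafEnd x c).last hi.1
      (by simpa [h1] using hW) (by
        have h5 := congrArg (treeWt (leafWt wt)) hv
        rw [treeWt_plug, treeWt_leafed, treeWt_fill] at h5; rw [he]
        simp [endWt, itemVal, endVal, ctxTot] at h5 ⊢; omega) (gapLe_leafEnd x c)
    rw [h2, h1, h3]; exact this.1

/-! ### Where labels and runs occur -/

noncomputable def Dom.list (D : Dom) : List Name :=
  D.one.toList.flatMap (fun E => .one E :: (range D.r).map fun j => .zero (.child E j)) ++
    D.zero.toList.map fun C => .zero (.orig C)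

lemma Dom.mem_list {X : Name} : X ∈ D.list ↔ D.Mem X := by
  rcases X with A | C | ⟨E, j⟩ <;> simp [Dom.list, Dom.Mem]

lemma Dom.sum_list (f : Name → ℕ) : (D.list.map f).sum = D.sum f := by
  have : ∀ l : List Symb, ((l.flatMap fun E => Name.one E ::
      (range D.r).map fun j => .zero (.child E j)).map f).sum =
      (l.map fun E => f (.one E) + ∑ j ∈ Finset.range D.r, f (.zero (.child E j))).sum := by
    intro l
    induction l with
    | nil => rfl
    | cons E l ih =>
      rw [flatMap_cons, map_append, sum_append, ih, map_cons, sum_cons, map_cons, sum_cons, map_map]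
      rfl
  rw [Dom.list, map_append, sum_append, this, Finset.sum_map_toList, map_map, Dom.sum,
    Finset.sum_map_toList]
  rfl

lemma Dom.sum_flatMap {ι : Type} (f : Name → List ι) (w : ι → ℕ) :
    ((D.list.flatMap f).map w).sum = D.sum fun X => ((f X).map w).sum := by
  rw [← D.sum_list]
  induction D.list with
  | nil => rfl
  | cons X l ih => simp [ih]

def ctxLabels (L : List (Frame α (Pat α))) : List α :=
  L.flatMap fun x => x.label :: (x.pre ++ x.post).flatMap Pat.labels

lemma mem_labels_plug {L : List (Frame α (Pat α))} :
    a ∈ (plug L t).labels ↔ a ∈ ctxLabels L ∨ a ∈ t.labels := by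
  induction L with
  | nil => simp [ctxLabels]
  | cons x L ih =>
    simp only [plug_cons, fill, labels_node, flatMap_append, flatMap_cons, mem_cons, mem_append, ih]
    simp only [ctxLabels, flatMap_cons, mem_append, mem_cons, flatMap_append]; tauto

def Gram.nameLabels (G : Gram α) : Name → List α
  | .one A => ctxLabels (G.ctx A)
  | .zero C => (G.val C).labels

lemma Gram.mem_endVal (h : a ∈ (G.endVal e).labels) :
    a ∈ e.labels ∨ ∃ Y ∈ e.names, a ∈ G.nameLabels Y := by
  rcases e with c | C
  · exact .inl (by simpa [endVal, End.labels] using h)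
  · exact .inr ⟨.zero C, by simp [End.names], h⟩

lemma Gram.mem_itemsVal (h : a ∈ ctxLabels (G.itemsVal l)) :
    a ∈ l.flatMap Item.labels ∨ ∃ Y ∈ l.flatMap Item.names, a ∈ G.nameLabels Y := by
  induction l with
  | nil => simp [ctxLabels] at h
  | cons i l ih =>
    rw [itemsVal_cons, ctxLabels, flatMap_append, mem_append] at h
    simp only [flatMap_cons, mem_append]; rcases h with h | h
    · rcases i with x | B
      · rw [itemVal, flatMap_cons, flatMap_nil, append_nil, mem_cons, Frame.map,
          ← map_append, mem_flatMap] at h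
        rcases h with rfl | ⟨u, hu, h⟩
        · exact .inl (.inl (by simp [Item.labels]))
        · obtain ⟨t, ht, rfl⟩ := mem_map.1 hu
          have h' : a ∈ t.labels ∨ ∃ Y ∈ t.names, a ∈ G.nameLabels Y := by
            rcases mem_labels_plug.1 h with h | h
            · refine .inl (mem_append_left _ ?_); simpa [ctxLabels, mem_flatMap, letter] using h
            · exact (mem_endVal h).imp_left (mem_append_right _)
          rcases h' with h | ⟨Y, hY, h⟩
          · exact .inl (.inl (mem_cons_of_mem _ (mem_flatMap.2 ⟨t, ht, h⟩)))
          · exact .inr ⟨Y, .inl (mem_flatMap.2 ⟨t, ht, hY⟩), h⟩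
      · exact .inr ⟨.one B, .inl (by simp [Item.names]), h⟩
    · rcases ih h with h | ⟨Y, hY, h⟩
      · exact .inl (.inr h)
      · exact .inr ⟨Y, .inr hY, h⟩

/-- Descending through the nonterminals along the order, a label of a value is traced back to an
explicit occurrence. -/
lemma Gram.Inv.label_mem (h : G.Inv D ord m wt n) {X : Name} (hX : D.Mem X)
    (ha : a ∈ G.nameLabels X) : ∃ Y, D.Mem Y ∧ a ∈ (G.rule Y).labels := by
  induction hk : ord X using Nat.strong_induction_on generalizing X with
  | _ k ih =>
    subst hk
    have key : a ∈ (G.rule X).labels ∨ ∃ Y ∈ (G.rule X).names, a ∈ G.nameLabels Y := by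
      have hh := h.holds X hX
      have h1 : ∀ h' : a ∈ ctxLabels (G.itemsVal (G.rule X).items),
          a ∈ (G.rule X).labels ∨ ∃ Y ∈ (G.rule X).names, a ∈ G.nameLabels Y := by
        intro h'; rcases mem_itemsVal h' with h' | ⟨Y, hY, h'⟩
        · exact .inl (mem_append_left _ h')
        · exact .inr ⟨Y, mem_append_left _ hY, h'⟩
      rcases X with A | C
      · exact h1 (by rw [← hh.2]; exact ha)
      · obtain ⟨e, h2, h3⟩ := hh; rw [nameLabels, h3] at ha
        rcases mem_labels_plug.1 ha with h' | h'
        · exact h1 h'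
        · rcases mem_endVal h' with h' | ⟨Y, hY, h'⟩
          · exact .inl (mem_append_right _ (by simpa [h2] using h'))
          · exact .inr ⟨Y, mem_append_right _ (by simpa [Rule.lastNames, h2] using hY), h'⟩
    rcases key with h' | ⟨Y, hY, h'⟩
    · exact ⟨X, hX, h'⟩
    · obtain ⟨h1, h2, -⟩ := h.closed X hX Y hY; exact ih _ h2 h1 h' rfl

/-- All runs of a decomposition. -/
def RunState.all (s : RunState α X) : List (List α) :=
  s.top :: (s.bot.toList ++ s.mid.flatMap (Sum.elim (fun w => [w]) fun _ => []))

lemma RunState.all_close (h : w ∈ s.close.all) : w = [] ∨ w ∈ s.all := by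
  obtain ⟨_ | ⟨c, t⟩, m, _ | b⟩ := s <;> simp [all, close, runItem] at h ⊢ <;> tauto

lemma RunState.all_push {x : α ⊕ X}
    (h : w ∈ (s.push R x).all) : w = [] ∨ w ∈ s.all ∨ ∃ a, x = .inl a ∧
      (w = [a] ∨ ∃ b v, s.top = b :: v ∧ R a b = true ∧ w = a :: b :: v) := by
  have hc := fun w => RunState.all_close (s := s) (w := w)
  rcases x with a | x
  · rcases ht : s.top with _ | ⟨b, t⟩
    · simp only [push, ht, all, mem_cons] at h ⊢; grind
    · by_cases hr : R a b
      · simp only [push, ht, hr, if_true, all, mem_cons] at h ⊢; rcases h with rfl | h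
        · exact .inr (.inr ⟨a, rfl, .inr ⟨b, t, rfl, hr, rfl⟩⟩)
        · exact .inr (.inl (.inr h))
      · simp only [push, ht, hr] at h; rcases mem_cons.1 h with rfl | h
        · exact .inr (.inr ⟨a, rfl, .inl rfl⟩)
        · rcases hc w (mem_cons_of_mem _ h) with h | h
          · exact .inl h
          · exact .inr (.inl h)
  · rcases mem_cons.1 h with rfl | h
    · exact .inl rfl
    · rcases hc w (mem_cons_of_mem _ (by simpa [push] using h)) with h | h
      · exact .inl h
      · exact .inr (.inl h)

lemma linked_all (hs : ∀ w ∈ s.all, Linked R w)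
    (l : List (α ⊕ X)) : ∀ w ∈ (pushAll R l s).all, Linked R w := by
  induction l with
  | nil => exact hs
  | cons x l ih =>
    intro w hw; rcases RunState.all_push hw with rfl | h | ⟨a, rfl, rfl | ⟨b, v, ht, hr, rfl⟩⟩
    · simp [Linked]
    · exact ih w h
    · simp [Linked]
    · rw [Linked, isChain_cons_cons]
      exact ⟨hr, ih _ (by rw [RunState.all, show (pushAll R l s).top = _ from ht]; simp)⟩

lemma mem_all (l : List (α ⊕ X)) :
    ∀ w ∈ (pushAll R l s).all, ∀ a ∈ w, .inl a ∈ l ∨ ∃ v ∈ s.all, a ∈ v := by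
  induction l with
  | nil => exact fun w hw a ha => .inr ⟨w, hw, ha⟩
  | cons x l ih =>
    intro w hw a ha
    have ih' : ∀ w ∈ (pushAll R l s).all, a ∈ w → .inl a ∈ x :: l ∨ ∃ v ∈ s.all, a ∈ v :=
      fun w hw ha => (ih w hw a ha).imp_left (mem_cons_of_mem _)
    rcases RunState.all_push hw with rfl | h | ⟨b, rfl, rfl | ⟨c, v, ht, hr, rfl⟩⟩
    · simp at ha
    · exact ih' w h ha
    · simp at ha; simp [ha]
    · rcases mem_cons.1 ha with rfl | ha
      · simp
      · exact ih' (c :: v) (by rw [RunState.all, show (pushAll R l s).top = _ from ht]; simp) ha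

lemma Gram.flat_mem_ev {s : RunState (Part α) (Item α)} (h : ps ∈ s.all) :
    flat ps ∈ (G.ev R s).all := by
  simp only [RunState.all, ev, mem_cons, mem_append, Option.mem_toList,
    mem_flatMap, Option.map_eq_some_iff] at h ⊢
  rcases h with rfl | h | ⟨y, hy, h⟩
  · exact .inl rfl
  · exact .inr (.inl ⟨ps, h, rfl⟩)
  · rcases y with v | i
    · obtain rfl : ps = v := by simpa using h
      exact .inr (.inr ⟨.inl (flat ps), ⟨_, hy, by simp [evMid]⟩, by simp⟩)
    · simp at h

lemma Gram.linked_runs (ru : Rule α) (h : ps ∈ (G.runs R ru).all) : Linked R (flat ps) := by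
  have := flat_mem_ev (G := G) (R := R) h; rcases hl : ru.last with _ | e
  · rw [G.ev_runs_none _ hl, ctxRuns] at this
    exact linked_all (by simp [RunState.all, Linked]) _ _ this
  · rw [G.ev_runs_some _ hl] at this; refine linked_all ?_ _ _ this
    have h2 : Linked R (cut R (G.endVal e)).1 := linked_splitRun _
    simpa [RunState.all, Linked] using h2

lemma Gram.mem_allRuns : ps ∈ G.allRuns R ru → ps ∈ (G.runs R ru).all ∨
      ∃ x, .frame x ∈ ru.items ∧ ∃ t ∈ x.pre ++ x.post, ps ∈ (G.runs R (twigRule t)).all := by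
  intro h; simp only [allRuns, RunState.all, mem_cons, mem_append, mem_flatMap] at h ⊢
  rcases h with h | h | ⟨y, hy, h⟩
  · exact .inl (.inl h)
  · exact .inl (.inr (.inl h))
  · rcases y with v | x | B
    · exact .inl (.inr (.inr ⟨_, hy, h⟩))
    · right; obtain ⟨t, ht, h⟩ := mem_flatMap.1 h
      refine ⟨x, (G.frame_mem_runs hy).1, t, by simpa using ht, ?_⟩
      obtain ⟨y, hy, h⟩ := mem_flatMap.1 h; rcases y with v | i
      · obtain rfl : ps = v := by simpa using h
        rcases mem_append.1 hy with hy | hy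
        · left
          rcases hT : (G.runs R (twigRule t)).top with _ | ⟨c, w⟩ <;> simp [hT, runItem] at hy
          exact hy
        · exact .inr (.inr ⟨_, hy, h⟩)
      · simp at h
    · simp [midRuns] at h

lemma Gram.linked_allRuns (h : ps ∈ G.allRuns R ru) : Linked R (flat ps) := by
  rcases mem_allRuns h with h | ⟨x, -, t, -, h⟩ <;> exact G.linked_runs _ h

/-- The popped run is the top or bottom run of a smaller nonterminal, so it occurs as a complete run
in the right-hand side of that one. Its letter is paid for there. -/
lemma Gram.Inv.popped_mem (h : G.Inv D ord m wt n) {X : Name} (hX : D.Mem X) (hps : ps ∈ G.allRuns R (G.rule X)) {p : Part α} (hp : p ∈ ps)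
    (ht : p.tag = .rt ∨ p.tag = .lf) :
    ∃ Y, D.Mem Y ∧ ord Y < ord X ∧ p.word ≠ [] ∧ ∃ qs ∈ G.allRuns R (G.rule Y), flat qs = p.word := by
  have hc : ∀ Y ∈ (G.rule X).names, D.Mem Y ∧ ord Y < ord X := fun Y hY =>
    ⟨(h.closed X hX Y hY).1, (h.closed X hX Y hY).2.1⟩
  have hparts : ∀ (tag : Tag) (w : List α), p ∈ parts tag w → p.word = w ∧ w ≠ [] := by
    rintro tag (_ | ⟨a, w⟩) hm
    · simp [parts] at hm
    · simp [parts] at hm; simp [hm]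
  have key : ∀ ru : Rule α, (∀ Y ∈ ru.names, D.Mem Y ∧ ord Y < ord X) → ps ∈ (G.runs R ru).all →
      ∃ Y, D.Mem Y ∧ ord Y < ord X ∧ p.word ≠ [] ∧ ∃ qs ∈ G.allRuns R (G.rule Y), flat qs = p.word := by
    intro ru hru hps
    have hone : ∀ B, .one B ∈ ru.names → G.ev R (G.runs R (G.rule (.one B))) = ctxRuns R (G.ctx B) := by
      intro B hB; obtain ⟨h1, h2⟩ := h.holds (.one B) (hru _ hB).1; rw [G.ev_runs_none _ h1, ← h2]
    rcases mem_all _ ps hps p hp with hm | ⟨v, hv, hm⟩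
    · obtain ⟨i, hi, hm⟩ := mem_flatMap.1 hm; rcases i with x | B
      · rcases x.eq_letter_or with ⟨a, rfl⟩ | ⟨-, hx⟩
        · simp [itemToks, token_letter] at hm; cases hm; simp at ht
        · simp [itemToks, hx] at hm
      · have hB : .one B ∈ ru.names :=
          mem_append_left _ (mem_flatMap.2 ⟨_, hi, by simp [Item.names]⟩)
        have e := hone B hB; refine ⟨.one B, (hru _ hB).1, (hru _ hB).2, ?_⟩
        rcases hb : (ctxRuns R (G.ctx B)).bot with _ | b
        · simp only [itemToks, hb, mem_map] at hm; obtain ⟨q, hq, e⟩ := hm; cases e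
          rcases hw : (ctxRuns R (G.ctx B)).top with _ | ⟨a, w⟩ <;> simp [hw, parts] at hq
          simp [hq] at ht
        · simp only [itemToks, hb, mem_append, mem_cons, mem_map] at hm
          rcases hm with ⟨q, hq, e'⟩ | hm | ⟨q, hq, e'⟩
          · cases e'; obtain ⟨h1, h2⟩ := hparts _ _ hq
            exact ⟨h1 ▸ h2, _, mem_cons_self, by rw [h1, ← e]; rfl⟩
          · cases hm
          · cases e'; obtain ⟨h1, h2⟩ := hparts _ _ hq; refine ⟨h1 ▸ h2, ?_⟩
            have e3 := congrArg RunState.bot e; rw [hb] at e3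
            obtain ⟨qs, e4, e5⟩ := Option.map_eq_some_iff.1 e3
            exact ⟨qs, by simp [allRuns, e4], by rw [h1, e5]⟩
    · rcases hl : ru.last with _ | c | C
      · simp [hl, startState, RunState.all] at hv; simp [hv] at hm
      · simp [hl, startState, RunState.all] at hv; simp [hv] at hm
      · simp [hl, startState, RunState.all] at hv; rcases hv with rfl | rfl
        · obtain ⟨h1, h2⟩ := hparts _ _ hm
          have hC : .zero C ∈ ru.names :=
            mem_append_right _ (by simp [Rule.lastNames, hl, End.names])
          refine ⟨.zero C, (hru _ hC).1, (hru _ hC).2, h1 ▸ h2, _, mem_cons_self, ?_⟩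
          obtain ⟨e, k1, k2⟩ := h.holds (.zero C) (hru _ hC).1
          have e3 := congrArg RunState.top (G.ev_runs_some (R := R) _ k1)
          have e4 := splitRun_plug (R := R) (φ := Blk.run) (g := Blk.other)
            (G.itemsVal (G.rule (.zero C)).items) (G.endVal e)
          rw [h1, k2, show cut R _ = _ from e4, ← e3]; rfl
        · simp at hm
  rcases mem_allRuns hps with hps | ⟨x, hx, t, htx, hps⟩
  · exact key _ hc hps
  · refine key _ (fun Y hY => hc Y ?_) hps
    refine mem_append_left _ (mem_flatMap.2 ⟨_, hx, mem_flatMap.2 ⟨t, htx, ?_⟩⟩)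
    rw [Rule.names, twigRule, names_letters] at hY; simpa [Rule.lastNames, Twig.names] using hY

lemma mem_blkOf {b : Blk α} (h : b ∈ blkOf ps) : ∃ a w, b = .run a w ∧ flat ps = a :: w := by
  rw [blkOf] at h; grind

lemma Gram.run_mem {S : Name0}
    (h : .run a w ∈ ((G.runStep R S).rule Y).labels) :
    ∃ ps ∈ G.allRuns R (G.rule Y), flat ps = a :: w := by
  have hend : ∀ e : End α, Blk.run a w ∉ (newEnd e).labels := by
    rintro (c | C) <;> simp [newEnd, End.labels]
  rcases mem_append.1 h with h | h
  · obtain ⟨i, hi, h⟩ := mem_flatMap.1 h; obtain ⟨y, hy, hi⟩ := mem_flatMap.1 hi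
    have hblk : ∀ ps, Blk.run a w ∈ blkOf ps → flat ps = a :: w := by
      intro ps hm; obtain ⟨a', w', e, hf⟩ := mem_blkOf hm; cases e; exact hf
    have hy' : (∃ ps, y = .inl ps ∧ ps = (G.runs R (G.rule Y)).top) ∨ y ∈ (G.runs R (G.rule Y)).mid := by
      split at hy
      · rcases mem_append.1 hy with hy | hy
        · left
          rcases hT : (G.runs R (G.rule Y)).top with _ | ⟨c, w⟩ <;> simp [hT, runItem] at hy
          exact ⟨_, hy, rfl⟩
        · exact .inr hy
      · exact .inr hy
    rcases y with ps | x | B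
    · obtain ⟨b, hb, rfl⟩ := mem_map.1 hi
      obtain rfl : Blk.run a w = b := by simpa [Item.labels, letter] using h
      refine ⟨ps, ?_, hblk ps hb⟩; rcases hy' with ⟨_, e, rfl⟩ | hy'
      · cases e; exact mem_cons_self
      · exact mem_cons_of_mem _ (mem_append_right _
          (mem_flatMap.2 ⟨_, hy', by simp [midRuns]⟩))
    · obtain rfl : i = _ := by simpa [newItem] using hi
      have hy' : .inr (.frame x) ∈ (G.runs R (G.rule Y)).mid := by grind
      simp only [Item.labels, ← map_append, mem_cons, reduceCtorEq, false_or] at h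
      obtain ⟨t', hs, h⟩ := mem_flatMap.1 h; obtain ⟨t, ht, rfl⟩ := mem_map.1 hs
      rcases mem_append.1 h with h | h
      · obtain ⟨y, hy, h⟩ := mem_flatMap.1 h; rcases y with ps | i
        · refine ⟨ps, ?_, hblk ps h⟩
          exact mem_cons_of_mem _ (mem_append_right _ (mem_flatMap.2 ⟨_, hy',
            mem_flatMap.2 ⟨t, ht, mem_flatMap.2 ⟨_, hy, by simp⟩⟩⟩))
        · simp at h
      · exact absurd h (hend _)
    · obtain rfl : i = _ := by simpa [newItem] using hi
      simp [Item.labels] at h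
  · rcases hl : (G.rule Y).last with _ | e
    · simp [runStep, hl] at h
    · exact absurd (by simpa [runStep, hl] using h) (hend e)

/-! ### Sums over lists -/

lemma sum_ite_le {κ : Type} [DecidableEq κ] (o : Option κ) (x : ℕ) {ks : List κ} (hk : ks.Nodup) :
    (ks.map fun k => if o = some k then x else 0).sum ≤ x := by
  induction ks with
  | nil => simp
  | cons k ks ih =>
    rw [nodup_cons] at hk; have ih := ih hk.2; rw [map_cons, sum_cons]; split_ifs with h
    · subst h
      have : ks.map (fun k' => if some k = some k' then x else 0) = ks.map fun _ => 0 :=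
        map_congr_left fun k' hk' => if_neg fun e => hk.1 (by cases e; exact hk')
      rw [this]; simp
    · omega

/-- Different keys select disjoint parts of the list, so costs charged to entries with their own key
add up to at most the total weight. -/
lemma sum_filter_le {ι κ : Type} [DecidableEq κ] (l : List ι) (key : ι → Option κ) (w : ι → ℕ)
    {ks : List κ} (hk : ks.Nodup) {cost : κ → ℕ}
    (hc : ∀ k ∈ ks, cost k ≤ ((l.filter fun i => decide (key i = some k)).map w).sum) :
    (ks.map cost).sum ≤ (l.map w).sum := by
  refine (sum_le_sum hc).trans ?_; clear hc
  induction l with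
  | nil => simp
  | cons i l ih =>
    have e : ∀ k, (((i :: l).filter fun i => decide (key i = some k)).map w).sum =
        (if key i = some k then w i else 0) +
          ((l.filter fun i => decide (key i = some k)).map w).sum := by grind
    simp [e]; have := sum_ite_le (key i) (w i) hk; omega

lemma size_add_le (x y : ℕ) : (x + y).size ≤ x.size + y.size := by
  rcases Nat.eq_zero_or_pos x with rfl | hx
  · simp
  rcases Nat.eq_zero_or_pos y with rfl | hy
  · simp
  have h1 := Nat.size_pos.2 hx; have h2 := Nat.size_pos.2 hy; rw [Nat.size_le, pow_add]
  have h3 := Nat.lt_size_self x; have h4 := Nat.lt_size_self y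
  have h5 : 2 ≤ 2 ^ x.size := Nat.le_self_pow h1.ne' 2
  have h6 : 2 ≤ 2 ^ y.size := Nat.le_self_pow h2.ne' 2; nlinarith

lemma size_mul_le (x y : ℕ) : (x * y).size ≤ x.size + y.size := by
  rcases Nat.eq_zero_or_pos (x * y) with h | h
  · simp [h]
  · rw [Nat.size_le, pow_add]; exact Nat.mul_lt_mul'' (Nat.lt_size_self x) (Nat.lt_size_self y)

lemma size_add_size_le {x y : ℕ} (hx : 0 < x) (hy : 0 < y) : x.size + y.size ≤ (x * y).size + 1 := by
  have h1 : 2 ^ (x.size - 1) ≤ x := Nat.lt_size.1 (by have := Nat.size_pos.2 hx; omega)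
  have h2 : 2 ^ (y.size - 1) ≤ y := Nat.lt_size.1 (by have := Nat.size_pos.2 hy; omega)
  have h3 := Nat.mul_le_mul h1 h2; rw [← pow_add] at h3; have := Nat.lt_size.2 h3; omega

lemma size_le_self (x : ℕ) : x.size ≤ x := Nat.size_le.2 Nat.lt_two_pow_self

/-! ### The cost of the productions for chains -/

/-- The weight of the edges from lengths in an interval. -/
def edgeSum (E : List (ℕ × ℕ)) (lo hi : ℕ) : ℕ :=
  (E.map fun e => if lo < e.1 ∧ e.1 ≤ hi then e.2 else 0).sum

lemma edgeSum_add (E : List (ℕ × ℕ)) {lo p hi : ℕ} (h1 : lo ≤ p) (h2 : p ≤ hi) :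
    edgeSum E lo hi = edgeSum E lo p + edgeSum E p hi := by
  simp only [edgeSum, ← sum_map_add]; grind

lemma le_edgeSum {E : List (ℕ × ℕ)} {l w lo hi : ℕ} (h : (l, w) ∈ E) (h1 : lo < l) (h2 : l ≤ hi) :
    w ≤ edgeSum E lo hi := by
  have := le_sum_of_mem (mem_map_of_mem
    (f := fun e : ℕ × ℕ => if lo < e.1 ∧ e.1 ≤ hi then e.2 else 0) h)
  simpa [h1, h2, edgeSum] using this

lemma edgeSum_le (E : List (ℕ × ℕ)) (lo hi : ℕ) : edgeSum E lo hi ≤ (E.map Prod.snd).sum :=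
  sum_le_sum fun e _ => by split_ifs <;> simp

variable {E : List (ℕ × ℕ)} {L : ℕ → Prop}

/-- Follow the predecessors from `hi` down until `lo` is reached or passed. Every length on this
path lies in the interval, and bit length is subadditive. -/
lemma size_le_edgeSum (hL : ∀ l, L l → ∃ p < l, (p = 0 ∨ L p) ∧ (l, (l - p).size) ∈ E)
    {lo hi : ℕ} (h : L hi) (hlt : lo < hi) : (hi - lo).size ≤ edgeSum E lo hi := by
  induction hi using Nat.strong_induction_on with
  | _ hi ih =>
    obtain ⟨p, hp, h0, hE⟩ := hL hi h
    by_cases hpl : p ≤ lo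
    · exact (Nat.size_le_size (by omega)).trans (le_edgeSum hE hlt le_rfl)
    · have h1 := ih p hp (h0.resolve_left (by omega)) (by omega)
      have h2 := le_edgeSum hE hp le_rfl; have h3 := size_add_le (hi - p) (p - lo)
      rw [show hi - p + (p - lo) = hi - lo by omega] at h3
      rw [edgeSum_add E (p := p) (by omega) hp.le]
      omega

/-- The intervals between consecutive lengths are disjoint, so each edge pays for only one of the
differences that `TtoG` represents. -/
lemma sum_gaps_le (hL : ∀ l, L l → ∃ p < l, (p = 0 ∨ L p) ∧ (l, (l - p).size) ∈ E) {M : ℕ}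
    (ls : List ℕ) (lo : ℕ) (hs : (lo :: ls).Pairwise (· < ·)) (h : ∀ l ∈ ls, L l ∧ l ≤ M) :
    ((zipWith (fun l l' => l - l') ls (lo :: ls)).map Nat.size).sum ≤ edgeSum E lo M := by
  induction ls generalizing lo with
  | nil => simp
  | cons l ls ih =>
    rw [pairwise_cons] at hs; have h1 := ih l hs.2 fun l hl => h l (by simp [hl])
    have h2 := size_le_edgeSum hL (h l (by simp)).1 (hs.1 l (by simp))
    rw [edgeSum_add E (hs.1 l (by simp)).le (h l (by simp)).2]
    simpa using Nat.add_le_add h2 h1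

lemma length_bitIndices (d : ℕ) : d.bitIndices.length ≤ d.size := by
  induction d using Nat.strong_induction_on with
  | _ d ih =>
    rcases Nat.even_or_odd' d with ⟨k, rfl | rfl⟩
    · rcases Nat.eq_zero_or_pos k with rfl | hk
      · simp
      · have h1 := ih k (by omega)
        have h2 : k.size ≤ (2 * k).size := Nat.size_le_size (by omega)
        rw [Nat.bitIndices_two_mul, length_map]; omega
    · have h1 := ih k (by omega)
      have h2 : (2 * k + 1).size = k.size + 1 := by
        have := Nat.size_bit (b := true) (n := k) (by simp)
        simpa using this
      rw [Nat.bitIndices_two_mul_add_one, length_cons, length_map]; omega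

lemma size_chainPat (w : List Symb) : (chainPat w).size = w.length := by
  induction w with
  | nil => simp [chainPat]
  | cons a w ih => simp [chainPat] at ih ⊢; omega

/-- The total size of right-hand sides. -/
def prodsSize (l : List (Symb × Pat Symb)) : ℕ := (l.map fun p => Pat.size p.2).sum

lemma prodsSize_append (l l' : List (Symb × Pat Symb)) :
    prodsSize (l ++ l') = prodsSize l + prodsSize l' := by simp [prodsSize]

lemma log_max_le (ds : List ℕ) : Nat.log 2 (ds.foldr max 0) ≤ (ds.map Nat.size).sum := by
  induction ds with
  | nil => simp
  | cons d ds ih =>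
    simp; rcases max_cases d (ds.foldr max 0) with ⟨h, -⟩ | ⟨h, -⟩
    · have : Nat.log 2 d ≤ d.size := by
        rcases Nat.eq_zero_or_pos d with rfl | hd
        · simp
        · exact (Nat.lt_size.2 (Nat.pow_log_le_self 2 hd.ne')).le
      rw [h]; omega
    · rw [h]; omega

/-- The factor 5 splits into 2 for the powers of two, 1 for the binary expansions and 2 for the
letters of the chains. -/
lemma prodsSize_chainRulesFor (ν : Key → Symb) (a : Symb) {ls : List ℕ}
    (hs : (0 :: ls).Pairwise (· < ·)) : prodsSize (chainRulesFor ν a ls) ≤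
      5 * ((zipWith (fun l l' => l - l') ls (0 :: ls)).map Nat.size).sum := by
  rw [chainRulesFor, prodsSize_append, prodsSize_append]
  have h3 : ∀ lo, (lo :: ls).Pairwise (· < ·) → prodsSize (zipWith (fun l l' => (ν (.chain a l),
      chainPat (ν (.diff a (l - l')) :: if l' = 0 then [] else [ν (.chain a l')]))) ls (lo :: ls)) ≤
      2 * ((zipWith (fun l l' => l - l') ls (lo :: ls)).map Nat.size).sum := by
    clear hs; intro lo hs
    induction ls generalizing lo with
    | nil => simp [prodsSize]
    | cons l ls ih =>
      rw [pairwise_cons] at hs; have ih := ih l hs.2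
      have h1 : 0 < (l - lo).size := Nat.size_pos.2 (by have := hs.1 l (by simp); omega)
      have h2 : (chainPat (ν (.diff a (l - lo)) :: if lo = 0 then [] else [ν (.chain a lo)])).size ≤ 2 := by
        rw [size_chainPat]; split_ifs <;> simp
      simp [prodsSize] at ih ⊢; omega
  replace h3 := h3 0 hs
  generalize zipWith (fun l l' => l - l') ls (0 :: ls) = ds at h3 ⊢
  have h1 : prodsSize ((range (Nat.log 2 (ds.foldr max 0))).map
      fun i => (ν (.pow a (i + 1)), chainPat [powSym ν a i, powSym ν a i])) ≤
      2 * (ds.map Nat.size).sum := by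
    have := log_max_le ds
    rw [prodsSize, map_map, map_congr_left (g := fun _ => 2) fun i _ => by
      simp [Function.comp, size_chainPat]]
    simp; omega
  have h2 : prodsSize (ds.dedup.map
      fun d => (ν (.diff a d), chainPat (d.bitIndices.map (powSym ν a)))) ≤ (ds.map Nat.size).sum := by
    have e : ∀ l : List ℕ, prodsSize (l.map
        fun d => (ν (.diff a d), chainPat (d.bitIndices.map (powSym ν a)))) ≤ (l.map Nat.size).sum := by
      intro l; rw [prodsSize, map_map]; refine sum_le_sum fun d _ => ?_
      simpa [size_chainPat] using length_bitIndices d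
    exact (e _).trans (((dedup_sublist ds).map _).sum_le_sum (by simp))
  omega

/-! ### Payments -/

section

def popLen (ps : List (Part α)) : ℕ := (ps.map fun p => if p.tag = .ex then 0 else p.word.length).sum

lemma popLen_add (ps : List (Part α)) : exLen ps + popLen ps = (flat ps).length := by
  induction ps with
  | nil => rfl
  | cons p ps ih =>
    simp [exLen, popLen, flat_cons] at ih ⊢
    split_ifs <;> omega

lemma numPop_eq_zero : numPop ps = 0 → popLen ps = 0 := by
  intro h; simp only [numPop, countP_eq_zero] at h; refine sum_eq_zero fun x hx => ?_
  grind

lemma exists_of_numPop_eq_one (h : numPop ps = 1) :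
    ∃ p ∈ ps, p.tag ≠ .ex ∧ popLen ps = p.word.length := by
  induction ps with
  | nil => simp [numPop] at h
  | cons p ps ih =>
    by_cases hp : p.tag = .ex
    · obtain ⟨q, h1, h2, h3⟩ := ih (by simpa [numPop, hp] using h)
      exact ⟨q, by simp [h1], h2, by simpa [popLen, hp] using h3⟩
    · have := numPop_eq_zero (ps := ps) (by simpa [numPop, hp] using h)
      exact ⟨p, by simp, hp, by simpa [popLen, hp] using this⟩

lemma numRem_le (ps : List (Part α)) : numRem ps ≤ numPop ps :=
  countP_mono_left fun p _ h => by simp at h ⊢; simp [h]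

/-- The length of a run popped from a nonterminal that the run is built from. -/
def predLen (ps : List (Part α)) : ℕ :=
  if numRem ps = 0 ∧ numPop ps = 1 ∧ 2 ≤ popLen ps then popLen ps else 0

/-- The price of extending the predecessor run to the full length. A run of one letter needs no
production. -/
def chainPay (ps : List (Part α)) : ℕ :=
  if (flat ps).length ≤ 1 then 0 else ((flat ps).length - predLen ps).size

def pairPay (ps : List (Part α)) : ℕ := if (flat ps).length ≤ 1 then 0 else 1

lemma exLen_pos (h : ps ≠ []) (hw : ∀ p ∈ ps, p.word ≠ [])
    (h0 : numPop ps = 0) : 0 < exLen ps := by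
  have h1 := popLen_add ps; rw [numPop_eq_zero h0] at h1
  have h2 : flat ps ≠ [] := by rw [Ne, flat_eq_nil hw]; exact h
  grind

lemma exWt_le (wt : α → ℕ) (ps : List (Part α)) : exWt wt ps ≤ wtSum wt (flat ps) := by
  induction ps with
  | nil => simp [exWt, flat]
  | cons p ps ih =>
    have : wtSum wt (flat (p :: ps)) = wtSum wt p.word + wtSum wt (flat ps) := by
      rw [flat_cons, wtSum_append]
    simp [exWt] at ih ⊢
    split_ifs <;> omega

lemma word_subset_flat {p : Part α} (h : p ∈ ps) : p.word ⊆ flat ps :=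
  fun _ hb => mem_flatMap.2 ⟨p, h, hb⟩

lemma payOk_pair (R : α → α → Bool) : PayOk R wt F n pairPay where
  nil := rfl
  le ps h _ hw _ hc := by
    have h1 : pairPay ps ≤ 1 := by rw [pairPay]; split_ifs <;> simp
    have h2 := numRem_le ps; have h5 : 0 ≤ F * numRem ps := Nat.zero_le _
    by_cases h0 : numPop ps = 0
    · have h3 := exLen_pos h hw h0; have h4 := popLen_add ps; rw [numPop_eq_zero h0] at h4
      rw [pairPay] at h1 ⊢
      split_ifs at h1 ⊢ <;> omega
    · omega
  le_two ps _ _ _ _ h2 := by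
    have h1 : pairPay ps ≤ 1 := by rw [pairPay]; split_ifs <;> simp
    have := Nat.size_le_size (exWt_le wt ps); omega

lemma length_le_wtSum (h1 : ∀ a, 1 ≤ wt a) (w : List α) : w.length ≤ wtSum wt w := by
  induction w with
  | nil => simp
  | cons a w ih => have := h1 a; simp; omega

/-- Bit length is at most the number itself, so explicit letters pay for what they contribute, and
`F` pays for any length up to `n`. With one popped piece only the difference to the predecessor is
charged; a predecessor of length one is no chain but adds only one to the length. -/
lemma payOk_chain [DecidableEq α] (h1 : ∀ a, 1 ≤ wt a) (hF : ∀ x ≤ n, x.size ≤ F) :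
    PayOk (fun a b : α => decide (a = b)) wt F n chainPay where
  nil := rfl
  le ps h hl hw hn hc := by
    have hlen := popLen_add ps; have hle := length_le_wtSum h1 (flat ps); have hR := numRem_le ps
    have hsz : chainPay ps ≤ (flat ps).length.size := by
      rw [chainPay]; split_ifs
      · simp
      · exact Nat.size_le_size (by omega)
    by_cases hr : numRem ps = 0
    · rw [hr] at hc ⊢
      by_cases h0 : numPop ps = 0
      · have h3 := exLen_pos h hw h0; rw [numPop_eq_zero h0] at hlen
        have := size_le_self (flat ps).length
        by_cases h4 : (flat ps).length ≤ 1
        · simp [chainPay, h4]; omega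
        · omega
      · have hp : numPop ps = 1 := by omega
        rw [chainPay, predLen]
        by_cases h4 : (flat ps).length ≤ 1
        · simp [h4, hp]
        · by_cases h5 : 2 ≤ popLen ps
          · have := size_le_self ((flat ps).length - popLen ps); simp [h4, hr, hp, h5]; omega
          · have := size_le_self (flat ps).length; simp [h4, hr, hp, h5]; omega
    · have h5 : F * 1 ≤ F * numRem ps := Nat.mul_le_mul_left _ (by omega)
      grind
  le_two ps hl hw hn hr h2 := by
    have hsz : chainPay ps ≤ (flat ps).length.size := by
      rw [chainPay]; split_ifs
      · simp
      · exact Nat.size_le_size (by omega)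
    rcases hf : flat ps with _ | ⟨a, w⟩
    · have : exWt wt ps = 0 := by
        refine sum_eq_zero fun x hx => ?_
        obtain ⟨p, hp, rfl⟩ := mem_map.1 hx
        have : p.word = [] := by
          have hs : p.word ⊆ flat ps := word_subset_flat hp; rw [hf] at hs
          exact eq_nil_of_subset_nil hs
        simp [this]
      rw [hf] at hsz; simp [this] at hsz ⊢; omega
    · have hrep := linked_eq_replicate (hf ▸ hl); have hall : ∀ b ∈ flat ps, b = a := by grind
      have hwt : ∀ v : List α, (∀ b ∈ v, b = a) → wtSum wt v = v.length * wt a := by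
        intro v hv; rw [wtSum, map_congr_left (g := fun _ => wt a) fun b hb => by rw [hv b hb]]
        simp
      have e1 : exWt wt ps = exLen ps * wt a := by
        rw [exWt, exLen, ← sum_map_mul_right]; congr 1; refine map_congr_left fun p hp => ?_
        split_ifs
        · exact hwt _ fun b hb => hall b (word_subset_flat hp hb)
        · simp
      -- For `ℓ` letters of weight `w`, `e` of them explicit, the bit length of `ℓ * w` is at least
      -- the sum of those of `ℓ` and `w` minus one, and that of `e * w` at most the sum of those of
      -- `e` and `w`. The weight of the letter cancels.
      rw [← hf, hwt _ hall, e1]; have k1 := size_mul_le (exLen ps) (wt a)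
      have k2 := size_add_size_le (x := (flat ps).length) (by rw [hf]; simp) (h1 a)
      have k3 := size_le_self (exLen ps); omega

/-- If a run consists of its popped piece only, then the same length already occurs in a smaller
nonterminal. Descending in this way leads to a run of this length that is strictly longer than its
predecessor or has none; its payment is the edge used in `sum_gaps_le`. -/
lemma Gram.Inv.chain_reach [DecidableEq α] (h : G.Inv D ord m wt n) {X : Name} (hX : D.Mem X)
    {ps : List (Part α)} (hps : ps ∈ G.allRuns (fun a b => decide (a = b)) (G.rule X)) {a : α}
    (ha : (flat ps).head? = some a) (hl : 2 ≤ (flat ps).length) :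
    ∃ p < (flat ps).length,
      (p = 0 ∨ 2 ≤ p ∧ ∃ Z, D.Mem Z ∧ ∃ qs ∈ G.allRuns (fun a b => decide (a = b)) (G.rule Z),
        (flat qs).head? = some a ∧ (flat qs).length = p) ∧
      ∃ Z, D.Mem Z ∧ ∃ qs ∈ G.allRuns (fun a b => decide (a = b)) (G.rule Z),
        (flat qs).head? = some a ∧ (flat qs).length = (flat ps).length ∧
        chainPay qs = ((flat ps).length - p).size := by
  induction hk : ord X using Nat.strong_induction_on generalizing X ps with
  | _ k ih =>
    subst hk
    by_cases hp : predLen ps = 0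
    · exact ⟨0, by omega, .inl rfl, X, hX, ps, hps, ha, rfl, by
        rw [chainPay, if_neg (by omega), hp]⟩
    · have hpred : numRem ps = 0 ∧ numPop ps = 1 ∧ 2 ≤ popLen ps := by
        by_contra hne; exact hp (if_neg hne)
      obtain ⟨hr, h1, h2⟩ := hpred; obtain ⟨p, hpm, htag, hlen⟩ := exists_of_numPop_eq_one h1
      have ht : p.tag = .rt ∨ p.tag = .lf := by
        rcases htg : p.tag with _ | _ | _ | _
        · exact absurd htg htag
        · simp
        · simp
        · have := countP_eq_zero.1 hr p hpm; simp [htg] at this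
      obtain ⟨Y, hY, ho, hne, qs, hqs, hq⟩ := h.popped_mem hX hps hpm ht
      have hqa : (flat qs).head? = some a := by
        rcases hf : flat ps with _ | ⟨b, w⟩
        · simp [hf] at ha
        · obtain rfl : b = a := by simpa [hf] using ha
          have hrep := linked_eq_replicate (hf ▸ Gram.linked_allRuns hps)
          obtain ⟨c, v, hv⟩ := exists_cons_of_ne_nil hne
          have hc : c ∈ flat ps := word_subset_flat hpm (by rw [hv]; simp)
          rw [hf, hrep] at hc; rw [hq, hv, head?_cons]; rcases mem_cons.1 hc with rfl | hc
          · rfl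
          · rw [(mem_replicate.1 hc).2]
      have hql : (flat qs).length = popLen ps := by rw [hq, hlen]
      have hadd := popLen_add ps
      by_cases heq : popLen ps = (flat ps).length
      · obtain ⟨p', h3, h4, Z, hZ, qs', h5, h6, h7, h8⟩ := ih _ ho hY hqs hqa (by omega) rfl
        grind
      · refine ⟨popLen ps, by omega, .inr ⟨h2, Y, hY, qs, hqs, hqa, hql⟩, X, hX, ps, hps, ha, rfl, ?_⟩
        rw [chainPay, if_neg (by omega), predLen, if_pos ⟨hr, h1, h2⟩]

end

variable {lab : α → Symb} {V w : List α} {ps : List (Part α)}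

/-! ### Labels of compressed trees -/

/-- Labels for runs stand for linked runs that start with a unary letter, the others for letters that
are not unary. -/
def Blk.Ok (lab : α → Symb) (R : α → α → Bool) (V : List α) : Blk α → Prop
  | .run a w => IsRunIn R V a w ∧ (lab a).rank = 1
  | .other a => a ∈ V ∧ (lab a).rank ≠ 1

lemma ok_comp (t : Pat α) (ht : WellRanked (t.relabel lab)) (hV : t.labels ⊆ V) :
    ∀ b ∈ (comp R t).labels, b.Ok lab R V := by
  have fin : ∀ (t : Pat α) s, t.labels ⊆ V → cut R t = s →
      ((∀ b ∈ s.2.labels, b.Ok lab R V) ∧ ∀ a ∈ s.1, (lab a).rank = 1) →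
      ∀ b ∈ (finish Blk.run s).labels, b.Ok lab R V := by
    rintro t ⟨_ | ⟨a, w⟩, u⟩ hV hs ⟨h1, h2⟩ b hb
    · exact h1 b hb
    · simp [finish] at hb; rcases hb with rfl | hb
      · exact ⟨isRunIn_of_splitRun hV hs, h2 a (by simp)⟩
      · exact h1 b hb
  suffices key : (∀ b ∈ (cut R t).2.labels, b.Ok lab R V) ∧ ∀ a ∈ (cut R t).1, (lab a).rank = 1 from
    fin t _ hV rfl key
  induction t using induct_unary with
  | hp i => simp
  | h1 a t ih =>
    rw [relabel_node] at ht
    cases ht with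
    | node _ _ hr hw =>
    have hV := labels_subset_of_mem hV (mem_singleton.2 rfl); have ih := ih (hw _ (by simp)) hV
    have fin := fin t _ hV rfl ih; have ha : (lab a).rank = 1 := by simpa using hr.symm
    rw [show cut R (node a [t]) = pushRun R Blk.run a (cut R t) from splitRun_unary _ _]
    generalize cut R t = s at ih fin; obtain ⟨_ | ⟨b, w⟩, u⟩ := s
    · exact ⟨ih.1, by simpa [pushRun] using ha⟩
    · by_cases hr : R a b
      · simp [pushRun, hr]; exact ⟨ih.1, by simpa [ha] using ih.2⟩
      · simp only [pushRun, hr]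
        exact ⟨fin, by simpa using ha⟩
  | hn a ts hl ih =>
    rw [relabel_node] at ht
    cases ht with
    | node _ _ hr hw =>
    rw [cut, splitRun_node _ _ hl]; refine ⟨fun b hb => ?_, by simp⟩
    simp at hb; rcases hb with rfl | ⟨t, ht, hb⟩
    · exact ⟨hV (by simp), fun e => hl (by simpa [e] using hr)⟩
    · have hV := labels_subset_of_mem hV ht
      exact fin t _ hV rfl (ih t ht (hw _ (mem_map_of_mem ht)) hV) b hb

lemma exists_run_of_pair {R : Symb → Symb → Bool} (t : Pat Symb) {p : Symb × Symb}
    (hp : p ∈ unaryPairs t) (hR : R p.1 p.2 = true) :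
    ∃ a w, .run a w ∈ (comp R t).labels ∧ [p.1, p.2] <:+: a :: w := by
  have fin : ∀ s : List Symb × Pat (Blk Symb), ([p.1, p.2] <:+: s.1 ∨
      ∃ a w, .run a w ∈ s.2.labels ∧ [p.1, p.2] <:+: a :: w) →
      ∃ a w, .run a w ∈ (finish Blk.run s).labels ∧ [p.1, p.2] <:+: a :: w := by
    rintro ⟨_ | ⟨b, w⟩, u⟩ (h | ⟨a, v, h1, h2⟩)
    · simp at h
    · exact ⟨a, v, h1, h2⟩
    · exact ⟨b, w, by simp [finish], h⟩
    · exact ⟨a, v, by simp [finish, h1], h2⟩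
  refine fin (cut R t) ?_
  induction t using induct_unary with
  | hp i => simp at hp
  | h1 a t ih =>
    rw [unaryPairs_unary, mem_append] at hp
    have hh : (cut R t).1.head? = topUnary t := head?_splitRun t
    rw [show cut R (node a [t]) = pushRun R Blk.run a (cut R t) from splitRun_unary _ _]
    generalize cut R t = s at ih hh; obtain ⟨_ | ⟨b, w⟩, u⟩ := s
    · rw [← hh] at hp; exact .inr ((ih (by simpa using hp)).resolve_left (by simp))
    · rw [← hh] at hp
      by_cases hr : R a b
      · simp [pushRun, hr]; rcases hp with hp | hp
        · simp at hp; exact .inl (by rw [hp]; exact ⟨[], w, rfl⟩)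
        · exact (ih hp).imp_left fun h => h.trans (suffix_cons _ _).isInfix
      · simp only [pushRun, hr]; rcases hp with hp | hp
        · simp at hp; rw [hp] at hR; exact absurd hR hr
        · exact .inr (fin (b :: w, u) (ih hp))
  | hn a ts hl ih =>
    rw [unaryPairs_node _ _ hl, mem_flatMap] at hp; obtain ⟨t, ht, hp⟩ := hp
    obtain ⟨b, w, h1, h2⟩ := fin _ (ih t ht hp); rw [cut, splitRun_node _ _ hl]
    refine .inr ⟨b, w, ?_, h2⟩; simp only [labels_node, flatMap_map, mem_cons, mem_flatMap]
    exact .inr ⟨t, ht, h1⟩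

/-! ### Internal grammars that represent trees -/

variable {T : Pat Symb}

/-- The internal grammar generates the tree, up to a renaming of the letters. -/
structure Rel (lab : α → Symb) (T : Pat Symb) (G : Gram α) (D : Dom) (ord m : Name → ℕ)
    (wt : α → ℕ) (n : ℕ) : Prop where
  inv : G.Inv D ord m wt n
  one_le : ∀ a, 1 ≤ wt a
  tree : T = (G.val D.S).relabel lab
  inj : ∀ a ∈ (G.val D.S).labels, ∀ b ∈ (G.val D.S).labels, lab a = lab b → a = b

lemma Rel.clean (h : Rel lab T G D ord m wt n) : Rel lab T G.clean D ord m wt n :=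
  ⟨h.inv.clean, h.one_le, h.tree, h.inj⟩

def blkLab (lab : α → Symb) (φ : Symb → List Symb → Symb) : Blk α → Symb
  | .run a w => φ (lab a) (w.map lab)
  | .other a => lab a

lemma runComp_relabel_eq {R₀ : Symb → Symb → Bool} {φ : Symb → List Symb → β}
    {g : Symb → β}
    (hR : ∀ a ∈ t.labels, ∀ b ∈ t.labels, R a b = R₀ (lab a) (lab b)) :
    runComp R₀ φ g (t.relabel lab) = (comp R t).relabel fun
      | .run a w => φ (lab a) (w.map lab)
      | .other a => g (lab a) := by
  rw [runComp_relabel_left, runComp_relabel_right]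
  exact runComp_congr t (fun a ha b hb => (hR a ha b hb).symm) (fun _ _ _ _ => rfl) fun _ _ => rfl

/-- Injectivity of the renaming survives because distinct linked runs in the tree get distinct
letters, and a run letter is unary while the remaining labels are not. -/
lemma Rel.runStep (h : Rel lab T G D ord m wt n) (hT : WellRanked T) {R₀ : Symb → Symb → Bool}
    {φ : Symb → List Symb → Symb}
    (hR : ∀ a ∈ (G.val D.S).labels, ∀ b ∈ (G.val D.S).labels, R a b = R₀ (lab a) (lab b))
    (hr : ∀ a w, a.rank = 1 → (φ a w).rank = 1)
    (hφ : ∀ a w b v, IsRunIn R₀ T.labels a w → IsRunIn R₀ T.labels b v → φ a w = φ b v →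
      a = b ∧ w = v) :
    Rel (blkLab lab φ) (runComp R₀ φ id T) (G.runStep R D.S) D ord m (blkWt wt) n := by
  have hv : (G.runStep R D.S).val D.S = comp R (G.val D.S) := if_pos rfl
  refine ⟨h.inv.runStep, ?_, ?_, ?_⟩
  · rintro (⟨a, w⟩ | a)
    · exact (h.one_le a).trans (by simp [blkWt])
    · exact h.one_le a
  · rw [hv, h.tree, runComp_relabel_eq hR]; congr 1
  · rw [hv]; have ht := h.tree ▸ hT
    have run : ∀ {a w}, IsRunIn R (G.val D.S).labels a w →
        IsRunIn R₀ T.labels (lab a) (w.map lab) := by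
      rintro a w ⟨h1, h2⟩
      rw [h.tree, labels_relabel]; refine ⟨by rw [← map_cons]; exact map_subset _ h1, ?_⟩
      rw [← map_cons, Linked, isChain_map]
      refine IsChain.imp_of_mem_imp (fun x y hx hy hxy => ?_) h2
      rw [← hR x (h1 hx) y (h1 hy)]; exact hxy
    have inj : ∀ w v : List α, w ⊆ (G.val D.S).labels → v ⊆ (G.val D.S).labels →
        w.map lab = v.map lab → w = v := by
      intro w v hw hv e; refine ext_getElem (by simpa using congrArg length e) fun i h1 h2 => ?_
      exact h.inj _ (hw (getElem_mem _)) _ (hv (getElem_mem _)) (by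
        simpa [h1, h2] using congrArg (·[i]?) e)
    intro b hb c hc e; have hb := ok_comp _ ht (fun _ h => h) b hb
    have hc := ok_comp _ ht (fun _ h => h) c hc
    rcases b with ⟨a, w⟩ | a <;> rcases c with ⟨a', w'⟩ | a' <;> simp only [blkLab] at e
    · obtain ⟨e1, e2⟩ := hφ _ _ _ _ (run hb.1) (run hc.1) e
      have := inj (a :: w) (a' :: w') hb.1.1 hc.1.1 (by simp [e1, e2])
      cases this; rfl
    · exact absurd (e ▸ hr _ _ hb.2) hc.2
    · exact absurd (e ▸ hr _ _ hc.2) hb.2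
    · rw [h.inj a hb.1 a' hc.1 e]

lemma Rel.run_mem (h : Rel lab T G D ord m wt n)
    (hb : .run a w ∈ (comp R (G.val D.S)).labels) :
    ∃ X, D.Mem X ∧ ∃ ps ∈ G.allRuns R (G.rule X), flat ps = a :: w := by
  obtain ⟨X, hX, hm⟩ := (h.inv.runStep (R := R)).label_mem (X := .zero D.S) h.inv.start_mem
    (a := .run a w) (by rwa [Gram.nameLabels, show (G.runStep R D.S).val D.S = _ from if_pos rfl])
  exact ⟨X, hX, G.run_mem hm⟩

/-- The runs in all right-hand sides. -/
noncomputable def Gram.domRuns (R : α → α → Bool) (G : Gram α) (D : Dom) : List (List (Part α)) :=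
  D.list.flatMap fun X => G.allRuns R (G.rule X)

lemma Gram.mem_domRuns : ps ∈ G.domRuns R D ↔ ∃ X, D.Mem X ∧ ps ∈ G.allRuns R (G.rule X) := by
  simp [domRuns, mem_flatMap, Dom.mem_list]

/-- The productions for powers of `a` are charged to the runs of internal letters named `a`, for
each `a` separately. -/
lemma Rel.prodsSize_chain [DecidableEq α] (h : Rel lab T G D ord m wt n) (hT : WellRanked T)
    (ν : Key → Symb) :
    prodsSize ((unaryLetters T).flatMap fun a => chainRulesFor ν a (chainLengths T a)) ≤
      5 * ((G.domRuns (fun a b => decide (a = b)) D).map chainPay).sum := by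
  have e1 : ∀ l : List Symb, prodsSize (l.flatMap fun a => chainRulesFor ν a (chainLengths T a)) =
      (l.map fun a => prodsSize (chainRulesFor ν a (chainLengths T a))).sum := by
    intro l
    induction l with
    | nil => rfl
    | cons a l ih => rw [flatMap_cons, prodsSize_append, ih]; rfl
  rw [e1, ← sum_map_mul_left]
  refine sum_filter_le _ (fun ps => (flat ps).head?.map lab) _ (nodup_dedup _) fun a _ => ?_
  have hs : (0 :: chainLengths T a).Pairwise (· < ·) := by
    rw [pairwise_cons]; constructor
    · intro l hl; simp [chainLengths, mem_insertionSort] at hl; omega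
    · have h1 := pairwise_insertionSort (· ≤ ·) (((group T).labels.filter
        (fun p => p.1 = a ∧ 1 < p.2)).map Prod.snd).dedup
      have h2 : (chainLengths T a).Nodup := (perm_insertionSort _ _).nodup_iff.2 (nodup_dedup _)
      exact (h1.and h2).imp fun h => lt_of_le_of_ne h.1 h.2
  refine (prodsSize_chainRulesFor ν a hs).trans ?_; rw [sum_map_mul_left]
  refine Nat.mul_le_mul_left _ ?_
  set l := (G.domRuns (fun a b => decide (a = b)) D).filter
    fun ps => decide ((flat ps).head?.map lab = some a) with hl
  -- Each run belonging to `a` is an edge that starts at its length and weighs its payment; `L`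
  -- describes the lengths, at least two, of such runs.
  let E := l.map fun ps => ((flat ps).length, chainPay ps)
  let L (k : ℕ) := 2 ≤ k ∧ ∃ b, lab b = a ∧
    ∃ X, D.Mem X ∧ ∃ ps ∈ G.allRuns (fun a b => decide (a = b)) (G.rule X),
      (flat ps).head? = some b ∧ (flat ps).length = k
  have hL : ∀ k, L k → ∃ p < k, (p = 0 ∨ L p) ∧ (k, (k - p).size) ∈ E := by
    rintro k ⟨hk, b, hb, X, hX, ps, hps, hh, rfl⟩
    obtain ⟨p, h1, h2, Z, hZ, qs, hqs, h3, h4, h5⟩ := h.inv.chain_reach hX hps hh hk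
    refine ⟨p, h1, h2.imp_right fun h => ⟨h.1, b, hb, h.2⟩, mem_map.2 ⟨qs,
      mem_filter.2 ⟨Gram.mem_domRuns.2 ⟨Z, hZ, hqs⟩, by rw [h3]; simp [hb]⟩, by rw [h4, h5]⟩⟩
  have hM : ∀ k ∈ chainLengths T a, L k ∧ k ≤ (chainLengths T a).sum := by
    intro k hk; refine ⟨?_, le_sum_of_mem hk⟩
    simp only [chainLengths, mem_insertionSort, mem_dedup, mem_map,
      mem_filter, decide_eq_true_eq] at hk
    obtain ⟨⟨_, k⟩, ⟨hm, rfl, h1⟩, rfl⟩ := hk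
    rw [group_eq T hT, h.tree, runComp_relabel_eq (R := fun a b => decide (a = b)) (fun a ha b hb =>
      decide_eq_decide.2 ⟨congrArg lab, h.inj a ha b hb⟩), labels_relabel, mem_map] at hm
    obtain ⟨⟨b, w⟩ | b, hb, e⟩ := hm
    · obtain ⟨X, hX, ps, hps, hf⟩ := h.run_mem hb; simp at e
      exact ⟨h1, b, e.1, X, hX, ps, hps, by simp [hf], by simp [hf, e.2]⟩
    grind
  refine (sum_gaps_le hL _ 0 hs hM).trans ((edgeSum_le E _ _).trans ?_); simp [E, Function.comp_def]

/-- By disjointness of `up` and `down` a linked run of length two is the pair itself, and it appears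
in some right-hand side with payment 1. The production has size 2. -/
lemma Rel.prodsSize_pair (h : Rel lab T G D ord m wt n) (ν : Key → Symb) {up down : Finset Symb}
    (hd : Disjoint up down) :
    prodsSize ((((unaryPairs T).filter fun p => p.1 ∈ up ∧ p.2 ∈ down).dedup).map
      fun p => (ν (.pair p.1 p.2), chainPat [p.1, p.2])) ≤
      2 * ((G.domRuns (fun a b => decide (lab a ∈ up ∧ lab b ∈ down)) D).map pairPay).sum := by
  rw [prodsSize, map_map, ← sum_map_mul_left]
  have e : ∀ l : List (Symb × Symb), l.map ((fun p : Symb × Pat Symb => p.2.size) ∘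
      fun p => (ν (.pair p.1 p.2), chainPat [p.1, p.2])) = (l.map fun p => [p.1, p.2]).map fun _ => 2 := by
    intro l; rw [map_map]; exact map_congr_left fun p _ => size_chainPat _
  rw [e]
  refine sum_filter_le _ (fun ps => some ((flat ps).map lab)) _
    ((nodup_dedup _).map fun p q e => by simpa [Prod.ext_iff] using e) fun k hk => ?_
  obtain ⟨p, hp, rfl⟩ := mem_map.1 hk; simp at hp
  obtain ⟨a, w, hw, hi⟩ := exists_run_of_pair (R := fun a b => decide (a ∈ up ∧ b ∈ down)) T hp.1
    (by simpa using hp.2)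
  rw [h.tree, comp, runComp_relabel_eq (R := fun a b => decide (lab a ∈ up ∧ lab b ∈ down))
    (fun _ _ _ _ => rfl), labels_relabel, mem_map] at hw
  obtain ⟨⟨b, v⟩ | b, hb, e⟩ := hw
  · obtain ⟨X, hX, ps, hps, hf⟩ := h.run_mem hb; cases e; have hl := G.linked_allRuns hps
    have hv : ((flat ps).map lab) = [p.1, p.2] := by
      rw [hf] at hl ⊢; rw [← map_cons] at hi; refine (hi.eq_of_length_le ?_).symm
      rcases v with _ | ⟨c, _ | ⟨d, v⟩⟩
      · simp
      · simp
      · simp [Linked] at hl; exact absurd hl.2.1.1 (Finset.disjoint_right.1 hd hl.1.2)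
    have hlen : (flat ps).length = 2 := by rw [← length_map lab, hv]; rfl
    refine le_trans ?_ (le_sum_of_mem (mem_map_of_mem (a := ps) (mem_filter.2
      ⟨Gram.mem_domRuns.2 ⟨X, hX, hps⟩, by simp [hv]⟩)))
    simp [pairPay, hlen]
  · cases e

end Sim

-- The records and productions of leaf compression

namespace TtoG

lemma leafRecords_node (f : Symb) (ts : List (Pat Symb)) : leafRecords (node f ts) =
    (if (ts.map constLabel).any Option.isSome then [(f, ts.map constLabel)] else []) ++
      ts.flatMap leafRecords := by
  have e : leafRecords = fun t : Pat Symb => t.subtrees.filterMap (fun s => match s with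
    | node f ts =>
        if (ts.map constLabel).any Option.isSome then some (f, ts.map constLabel) else none
    | param _ => none) := rfl
  rw [e]; simp only [subtrees_node, filterMap_cons]
  rw [flatMap_def, filterMap_flatten, flatMap_def, map_map]
  split <;> split_ifs at * <;> simp_all [Function.comp_def]

lemma mem_leafRecords (t : Pat Symb) {p : Symb × List (Option Symb)} (hp : p ∈ leafRecords t) :
    p ∈ (absorb Prod.mk t).labels ∧ p.2.any Option.isSome = true := by
  induction t using induct with
  | hp i => simp [leafRecords] at hp
  | hn f ts ih =>
    rw [leafRecords_node, mem_append, constLabel_eq] at hp; rw [absorb_node]; rcases hp with hp | hp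
    · split_ifs at hp with h
      · rw [mem_singleton.1 hp]; exact ⟨by simp, h⟩
      · simp at hp
    · obtain ⟨t, ht, hp⟩ := mem_flatMap.1 hp
      have hc : constOf t = none := by
        rcases hc : constOf t with _ | c
        · rfl
        · rw [constOf_eq_some.1 hc, leafRecords_node] at hp; simp at hp
      refine ⟨?_, (ih t ht hp).2⟩; simp only [labels_node, mem_cons, mem_flatMap]; grind

lemma size_fillPat (i : ℕ) (p : List (Option Symb)) :
    ((fillPat i p).map Pat.size).sum = p.countP Option.isSome := by
  induction p generalizing i with
  | nil => rfl
  | cons o p ih => rcases o with _ | c <;> simp [fillPat, ih]; omega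

end TtoG

namespace Sim

open RunState (push close pushWord push_bot)
open Frame (letter fill token_letter token)


variable {α : Type} {lab : α → Symb} {G : Gram α} {D : Dom} {ord m : Name → ℕ} {wt : α → ℕ}
  {n F : ℕ} {T : Pat Symb}

lemma labels_leafed (t : Pat α) (ht : WellRanked (t.relabel lab)) : ∀ b ∈ (leafed t).labels,
    b.1 ∈ t.labels ∧ (∀ c, some c ∈ b.2 → c ∈ t.labels) ∧ b.2.length = (lab b.1).rank := by
  induction t using induct with
  | hp i => simp
  | hn a ts ih =>
    rw [relabel_node] at ht
    cases ht with
    | node _ _ hr hw =>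
    intro b hb; simp [leafed, absorb_node] at hb ⊢; rcases hb with rfl | ⟨t, ⟨ht, -⟩, hb⟩
    · refine ⟨.inl rfl, fun c hc => ?_, by simpa using hr⟩
      obtain ⟨t, ht, h⟩ := mem_map.1 hc; exact .inr ⟨t, ht, by rw [constOf_eq_some.1 h]; simp⟩
    · obtain ⟨h1, h2, h3⟩ := ih t ht (hw _ (mem_map_of_mem ht)) b hb
      exact ⟨.inr ⟨t, ht, h1⟩, fun c hc => .inr ⟨t, ht, h2 c hc⟩, h3⟩

def leafLab (lab : α → Symb) (ν : Key → Symb) (b : Leafed α) : Symb :=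
  leafLetter ν (lab b.1) (b.2.map (Option.map lab))

lemma Rel.leaf (h : Rel lab T G D ord m wt n) (hT : WellRanked T) (hs : G.ZeroSolid D)
    (hE : ∀ X, D.Mem X → (G.rule X).EndsOk) {ν : Key → Symb} (hν : Function.Injective ν)
    (hf : ∀ k, ν k ∉ T.labels) :
    Rel (leafLab lab ν) (leafComp ν T) G.leaf D ord m (leafWt wt) n where
  inv := h.inv.leaf hs hE
  one_le b := (h.one_le b.1).trans (Nat.le_add_right _ _)
  tree := by
    rw [leafComp_eq, h.tree, absorb_relabel_left]
    exact (absorb_relabel_right (g := Prod.mk) (leafLab lab ν) (G.val D.S)).symm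
  inj := by
    have ht := h.tree ▸ hT
    have hl : ∀ {a}, a ∈ (G.val D.S).labels → lab a ∈ T.labels := fun ha => by
      rw [h.tree, labels_relabel]; exact mem_map_of_mem ha
    rintro ⟨a, p⟩ hb ⟨a', p'⟩ hb' e
    obtain ⟨h1, h2, h3⟩ := labels_leafed _ ht _ hb
    obtain ⟨h1', h2', h3'⟩ := labels_leafed _ ht _ hb'
    have key : lab a = lab a' → p.map (Option.map lab) = p'.map (Option.map lab) →
        (a, p) = (a', p') := by
      intro e1 e2; rw [h.inj a h1 a' h1' e1]; congr 1
      refine ext_getElem (by simpa using congrArg length e2) fun i k1 k2 => ?_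
      have e3 : (p[i]).map lab = (p'[i]).map lab := by simpa [k1, k2] using congrArg (·[i]?) e2
      have m1 := getElem_mem k1; have m2 := getElem_mem k2
      rcases hx : p[i] with _ | c <;> rcases hy : p'[i] with _ | c' <;> rw [hx, hy] at e3
      · simp at e3
      · simp at e3
      · rw [h.inj c (h2 c (hx ▸ m1)) c' (h2' c' (hy ▸ m2)) (by simpa using e3)]
    have none : ∀ {q : List (Option α)}, ¬ (q.map (Option.map lab)).any Option.isSome = true →
        q = replicate q.length none := by
      intro q hq; simp only [any_eq_true, mem_map, not_exists, not_and] at hq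
      refine eq_replicate_iff.2 ⟨rfl, fun o ho => ?_⟩
      have := hq _ ⟨o, ho, rfl⟩; simpa using this
    simp only [leafLab, leafLetter] at e; grind

/-- A production that absorbs `k ≥ 1` constants has size `k + 1 ≤ 2 * k` and is charged to one
explicit label with these constants. -/
lemma Rel.prodsSize_leaf (h : Rel lab T G D ord m wt n) (hs : G.ZeroSolid D)
    (hE : ∀ X, D.Mem X → (G.rule X).EndsOk) (ν : Key → Symb) :
    prodsSize ((leafRecords T).dedup.map fun p => (ν (.leaf p.1 p.2), node p.1 (fillPat 0 p.2))) ≤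
      2 * D.sum fun X => wtSum (fun b => b.2.countP Option.isSome) (G.leaf.rule X).labels := by
  simp only [wtSum]; rw [prodsSize, map_map, ← Dom.sum_flatMap, ← sum_map_mul_left]
  refine sum_filter_le _ (fun b => some (lab b.1, b.2.map (Option.map lab))) _
    (nodup_dedup _) fun p hp => ?_
  obtain ⟨h1, h2⟩ := mem_leafRecords T (mem_dedup.1 hp); rw [h.tree, absorb_relabel_left] at h1
  rw [← absorb_relabel_right (g := Prod.mk) (fun b : Leafed α => (lab b.1, b.2.map (Option.map lab)))
    (G.val D.S), labels_relabel, mem_map] at h1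
  obtain ⟨b, hb, rfl⟩ := h1
  obtain ⟨Y, hY, hm⟩ := (h.inv.leaf hs hE).label_mem (X := .zero D.S) h.inv.start_mem hb
  refine le_trans ?_ (le_sum_of_mem (mem_map_of_mem (a := b) (mem_filter.2
      ⟨mem_flatMap.2 ⟨Y, Dom.mem_list.2 hY, hm⟩, by simp⟩)))
  have : 0 < (b.2.map (Option.map lab)).countP Option.isSome := by grind
  have e : (b.2.map (Option.map lab)).countP Option.isSome = b.2.countP Option.isSome := by
    rw [countP_map]; congr 1; funext o; cases o <;> rfl
  simp only [Function.comp, size_node, size_fillPat]; omega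

/-! ### The cost of a phase -/

/-- The potential of a grammar. -/
def Gram.potential (G : Gram α) (D : Dom) (wt : α → ℕ) (F : ℕ) : ℕ :=
  D.sum fun X => 2 * (G.rule X).size + (G.rule X).pot wt F

lemma Gram.potential_eq : G.potential D wt F =
    2 * D.sum (fun X => (G.rule X).size) + D.sum fun X => (G.rule X).pot wt F := by
  rw [potential, Dom.sum_add, Dom.sum_mul]

lemma Gram.Inv.clean_potential (h : G.Inv D ord m wt n) (hF : ∀ x ≤ n, x.size ≤ F) :
    G.clean.potential D wt F ≤ G.potential D wt F + 2 * D.sum m := by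
  refine le_trans ?_ (Nat.add_le_add_left (Nat.mul_le_mul_left 2 h.sum_names) _)
  rw [potential, potential, ← Dom.sum_mul, ← Dom.sum_add]; refine D.sum_le fun X hX => ?_
  have := G.clean_size X; have := Gram.clean_pot hF (h.weight hX); omega

lemma Gram.Inv.runStep_potential (h : G.Inv D ord m wt n) (hc : G.IsClean D)
    {R : α → α → Bool} {pay : List (Part α) → ℕ} (hp : PayOk R wt F n pay)
    (hF : ∀ x ≤ n, x.size ≤ F) :
    ((G.domRuns R D).map pay).sum + (G.runStep R D.S).potential D (blkWt wt) F ≤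
      G.potential D wt F + 8 * D.sum m := by
  refine le_trans ?_ (Nat.add_le_add_left (Nat.mul_le_mul_left 8 h.sum_names) _)
  rw [potential, potential, domRuns, Dom.sum_flatMap, ← Dom.sum_mul, ← Dom.sum_add, ← Dom.sum_add]
  refine D.sum_le fun X hX => ?_
  have := G.runStep_cost hp hF (S := D.S) X (fun B hB => ?_) (h.weight hX)
  · omega
  · have := hc X hX (.one B) (mem_append_left _ (mem_flatMap.2 ⟨_, hB, by simp [Item.names]⟩))
    simpa [solid] using this

lemma Rel.pop (h : Rel lab T G D ord m wt n) (hc : G.IsClean D)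
    (hord : ∀ E j, ord (.zero (.child E j)) = ord (.one E) + 1)
    (hm : ∀ E j, m (.zero (.child E j)) = m (.one E)) : Rel lab T (G.pop D.r) D ord m wt n :=
  ⟨h.inv.pop hc hord hm, h.one_le, h.tree, h.inj⟩

/-- The increase of the potential in a phase. -/
def phaseCost (D : Dom) (m : Name → ℕ) : ℕ :=
  22 * D.sum m + 2 * (D.r * (∑ A ∈ D.one, m (.one A) + D.one.card))

/-- The grammar is cleaned before each of chain compression, pair compression and popping (2 for
each name and cleaning) and undergoes two run compressions (8 for each name), which explains the 22
in `phaseCost`; popping adds the rest. The potential is multiplied by 5 because this is the largest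
ratio between productions and payments, the one for chains. -/
lemma Rel.phase {s s' : State} (h : Rel lab s.tree G D ord m wt n) (hT : s.tree.IsTree)
    (hF : ∀ x ≤ n, x.size ≤ F) (hord : ∀ E j, ord (.zero (.child E j)) = ord (.one E) + 1)
    (hm : ∀ E j, m (.zero (.child E j)) = m (.one E)) (hp : Phase s s') :
    ∃ (β : Type) (lab' : β → Symb) (G' : Gram β) (wt' : β → ℕ), Rel lab' s'.tree G' D ord m wt' n ∧
      prodsSize s'.prods + 5 * G'.potential D wt' F ≤
        prodsSize s.prods + 5 * G.potential D wt F + 5 * phaseCost D m := by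
  classical
  obtain ⟨s₁, s₂, _, ν₁, ν₂, ν₃, order, up, down, f₁, rfl, ho, hg, f₂, rfl, f₃, rfl⟩ := hp
  obtain ⟨t₁, d₁⟩ := isTree_chainComp f₁ hT; have hq := isGoodPartition t₁.1 d₁ ho hg
  have t₂ := isTree_unaryComp f₂ t₁ hq
  -- chain compression
  have r₀ := h.clean; have p₀ := h.inv.clean_potential hF
  have r₁ := r₀.runStep hT.1 (R := fun a b => decide (a = b)) (R₀ := fun a b => decide (a = b))
    (φ := chainLetter ν₁) (fun a ha b hb => decide_eq_decide.2 ⟨congrArg lab, r₀.inj a ha b hb⟩)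
    (fun a w ha => by
      rw [chainLetter]; split_ifs
      · exact ha
      · exact f₁.rank_eq _)
    (fun a w b v ha hb e => by
      have ea := linked_eq_replicate ha.2; have eb := linked_eq_replicate hb.2
      have ma := ha.1 mem_cons_self; have mb := hb.1 mem_cons_self
      have key : a = b → w.length = v.length → a = b ∧ w = v := by
        rintro rfl e; exact ⟨rfl, by rw [ea, eb, e]⟩
      simp only [chainLetter] at e; split_ifs at e with c1 c2 c2
      · exact key e (by omega)
      · exact absurd (e ▸ ma) (f₁.not_mem_tree _)
      · exact absurd (e ▸ mb) (f₁.not_mem_tree _)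
      · have := f₁.injective e; simp at this; exact key this.1 this.2)
  rw [← chainComp_eq ν₁ _ hT.1] at r₁
  have p₁ := r₀.inv.runStep_potential (Gram.isClean_clean D) (payOk_chain h.one_le hF) hF
  have q₁ := r₀.prodsSize_chain hT.1 ν₁
  -- pair compression
  have r₂ := r₁.clean; have p₂ := r₁.inv.clean_potential hF
  have r₃ := r₂.runStep t₁.1 (R := fun a b => decide (blkLab lab (chainLetter ν₁) a ∈ up ∧
      blkLab lab (chainLetter ν₁) b ∈ down)) (R₀ := fun a b => decide (a ∈ up ∧ b ∈ down))
    (φ := pairLetter ν₂) (fun a ha b hb => rfl)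
    (fun a w ha => by
      cases w with
      | nil => exact ha
      | cons b w => exact f₂.rank_eq _)
    (fun a w b v ha hb e => by
      have two : ∀ {a x y} {w : List Symb}, ¬ Linked (fun a b => decide (a ∈ up ∧ b ∈ down))
          (a :: x :: y :: w) := by
        intro a x y w hl; simp [Linked] at hl
        exact absurd hl.2.1.1 (Finset.disjoint_right.1 hq.disjoint hl.1.2)
      have ma := ha.1 mem_cons_self; have mb := hb.1 mem_cons_self
      rcases w with _ | ⟨x, _ | ⟨y, w⟩⟩ <;> rcases v with _ | ⟨x', _ | ⟨y', v⟩⟩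
      · exact ⟨e, rfl⟩
      · exact absurd ((show a = ν₂ (.pair b x') from e) ▸ ma) (f₂.not_mem_tree _)
      · exact absurd hb.2 two
      · exact absurd ((show ν₂ (.pair a x) = b from e) ▸ mb) (f₂.not_mem_tree _)
      · have := f₂.injective e; simp at this; simp [this]
      · exact absurd hb.2 two
      · exact absurd ha.2 two
      · exact absurd ha.2 two
      · exact absurd ha.2 two)
  have e₂ := unaryComp_eq_of_fresh f₂ hq
  rw [show chainComp ν₁ s.tree = (chainStep ν₁ s).tree from rfl, ← e₂] at r₃
  have p₃ := r₂.inv.runStep_potential (Gram.isClean_clean D) (payOk_pair (wt := blkWt wt) (n := n)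
    (F := F) fun a b => decide (blkLab lab (chainLetter ν₁) a ∈ up ∧
      blkLab lab (chainLetter ν₁) b ∈ down)) hF
  have q₃ := r₂.prodsSize_pair ν₂ hq.disjoint
  -- leaf compression
  have r₄ := r₃.clean; have p₄ := r₃.inv.clean_potential hF
  set G₄ := Gram.clean (Gram.runStep _ _ _) with e₄
  have c₄ : G₄.IsClean D := Gram.isClean_clean D; have r₅ := r₄.pop c₄ hord hm
  have z₅ := r₄.inv.pop_zeroSolid c₄ hord; have k₅ := fun X hX => r₄.inv.pop_endsOk (X := X) c₄ hX
  have s₅ := r₄.inv.pop_size c₄; have p₅ := r₄.inv.pop_pot c₄ hF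
  have r₆ := r₅.leaf t₂.1 z₅ k₅ f₃.injective f₃.not_mem_tree; have q₆ := r₅.prodsSize_leaf z₅ k₅ ν₃
  have p₆ := D.sum_le fun X hX => r₅.inv.leaf_pot z₅ k₅ hF hX
  have s₆ := D.sum_le fun X hX => (size_leafRule (k₅ X hX)).le
  rw [Dom.sum_add] at s₆
  change D.sum (fun X => ((G₄.pop D.r).leaf.rule X).size) + D.sum (fun X => wtSum
    (fun b => b.2.countP Option.isSome) ((G₄.pop D.r).leaf.rule X).labels) ≤ _ at s₆
  refine ⟨_, _, _, _, r₆, ?_⟩; simp only [Gram.potential_eq] at p₀ p₁ p₂ p₃ p₄ ⊢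
  simp only [leafStep, unaryStep, chainStep, prodsSize_append, phaseCost] at *; omega

lemma Rel.loop {s s' : State} (hl : Loop s s') (hF : ∀ x ≤ n, x.size ≤ F)
    (hord : ∀ E j, ord (.zero (.child E j)) = ord (.one E) + 1)
    (hm : ∀ E j, m (.zero (.child E j)) = m (.one E)) (h : Rel lab s.tree G D ord m wt n) (hT : s.tree.IsTree) (k : ℕ)
    (hk : s.tree.size * 3 ^ k < 2 * 4 ^ k) :
    prodsSize s'.prods ≤ prodsSize s.prods + 5 * G.potential D wt F + k * (5 * phaseCost D m) := by
  induction hl generalizing α k with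
  | done s hs => omega
  | step s s' s'' hs hp _ ih =>
    rcases k with _ | k
    · simp at hk; omega
    · obtain ⟨hT', hsz⟩ := hp.isTree_and_size hT hs
      obtain ⟨β, lab', G', wt', h', hc⟩ := h.phase hT hF hord hm hp
      have := ih h' hT' k (by
        rw [pow_succ, pow_succ] at hk; have := Nat.mul_le_mul_right (3 ^ k) hsz; nlinarith)
      have e : (k + 1) * (5 * phaseCost D m) = k * (5 * phaseCost D m) + 5 * phaseCost D m := by ring
      omega

lemma Rel.produces {R : Grammar} (hR : Produces T R) (h : Rel lab T G D ord m wt n)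
    (hT : T.IsTree) (hn : T.size ≤ n) (hord : ∀ E j, ord (.zero (.child E j)) = ord (.one E) + 1)
    (hm : ∀ E j, m (.zero (.child E j)) = m (.one E)) :
    R.size ≤ 5 * G.potential D wt n.size + 15 * n.size * phaseCost D m := by
  obtain ⟨s, hl, -, hp⟩ := hR
  -- Three phases shrink the tree by the factor `27 / 64`, hence by more than one half, so three
  -- times the bit length of `n` phases suffice.
  have := Rel.loop hl (F := n.size) (fun x hx => Nat.size_le_size hx) hord hm h hT (3 * n.size) (by
    have h1 := Nat.lt_size_self n; have h2 : 0 < 4 ^ (3 * n.size) := by positivity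
    calc T.size * 3 ^ (3 * n.size) ≤ 2 ^ n.size * 27 ^ n.size := by
          rw [pow_mul]; exact Nat.mul_le_mul (by omega) (by norm_num)
      _ = 54 ^ n.size := by rw [← mul_pow]; norm_num
      _ ≤ 64 ^ n.size := Nat.pow_le_pow_left (by norm_num) _
      _ = 4 ^ (3 * n.size) := by rw [pow_mul]; norm_num
      _ < 2 * 4 ^ (3 * n.size) := by omega)
  have e : R.size = prodsSize s.prods := by rw [Grammar.size, hp]; rfl
  have e2 : prodsSize [] = 0 := rfl; rw [e]; simp at this; nlinarith

/-! ### Internal grammars for handle grammars -/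

def End.sym : End Symb → Symb
  | .con c => c
  | .nt (.orig C) => C
  | .nt (.child E _) => E

def Name.sym : Name → Symb
  | .one A => A
  | .zero (.orig C) => C
  | .zero (.child E _) => E

def Twig.toPat (t : Twig Symb) : Pat Symb := plug (t.chain.map letter) (node t.last.sym [])

def Item.toFrame : Item Symb → Frame Symb (Pat Symb)
  | .frame x => x.map Twig.toPat
  | .nt B => letter B

variable (H : Grammar)

def End.Ok : End Symb → Prop
  | .con c => c ∉ H.nonterminals
  | .nt (.orig C) => C ∈ H.nonterminals ∧ C.rank = 0
  | .nt (.child _ _) => False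

def Twig.Ok (t : Twig Symb) : Prop := (∀ a ∈ t.chain, a ∉ H.nonterminals) ∧ t.last.Ok H

def Item.Ok : Item Symb → Prop
  | .frame x => x.label ∉ H.nonterminals ∧ ∀ t ∈ x.pre ++ x.post, t.Ok H
  | .nt B => B ∈ H.nonterminals ∧ B.rank = 1

/-- The right-hand side `t` is represented by `ru`. -/
structure Rep (ru : Rule Symb) (t : Pat Symb) : Prop where
  items : ∀ i ∈ ru.items, i.Ok H
  last : ∀ e ∈ ru.last, e.Ok H
  eq : t = plug (ru.items.map Item.toFrame) (ru.last.elim (param 0) fun e => node e.sym [])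

variable {H}

lemma exists_end (c : Symb) (hc : c.rank = 0) : ∃ e : End Symb, e.Ok H ∧ e.sym = c := by
  by_cases h : c ∈ H.nonterminals
  · exact ⟨.nt (.orig c), ⟨h, hc⟩, rfl⟩
  · exact ⟨.con c, h, rfl⟩

lemma exists_twigs {l : List (Pat Symb)} (h : ∀ t ∈ l, H.IsTwig t) :
    ∃ l' : List (Twig Symb), (∀ t ∈ l', t.Ok H) ∧ l = l'.map Twig.toPat := by
  have one : ∀ t, H.IsTwig t → ∃ t' : Twig Symb, t'.Ok H ∧ t = t'.toPat := by
    intro t ht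
    induction ht with
    | last c hc =>
      obtain ⟨e, he, rfl⟩ := exists_end (H := H) c hc
      exact ⟨⟨[], e⟩, ⟨by simp, he⟩, rfl⟩
    | cons a t _ ha _ ih =>
      obtain ⟨t', ⟨h1, h2⟩, rfl⟩ := ih
      exact ⟨⟨a :: t'.chain, t'.last⟩, ⟨by simpa [ha] using h1, h2⟩, rfl⟩
  induction l with
  | nil => exact ⟨[], by simp, rfl⟩
  | cons t l ih =>
    obtain ⟨l', h1, rfl⟩ := ih fun t ht => h t (by simp [ht])
    obtain ⟨t', h2, rfl⟩ := one t (h t (by simp))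
    exact ⟨t' :: l', by simpa [h2] using h1, rfl⟩

lemma exists_items {P : Pat Symb → Prop} {t : Pat Symb} (h : H.HandlesThen P t) :
    ∃ l : List (Item Symb), (∀ i ∈ l, i.Ok H) ∧ ∃ s, P s ∧ t = plug (l.map Item.toFrame) s := by
  induction h with
  | nil s hs => exact ⟨[], by simp, s, hs, rfl⟩
  | cons f pre post s hf _ h1 h2 _ ih =>
    obtain ⟨l, hl, s, hs, rfl⟩ := ih; obtain ⟨pre, k1, rfl⟩ := exists_twigs h1
    obtain ⟨post, k2, rfl⟩ := exists_twigs h2; refine ⟨.frame ⟨f, pre, post⟩ :: l, ?_, s, hs, rfl⟩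
    simp; exact ⟨⟨hf, fun t ht => (mem_append.1 ht).elim (k1 t) (k2 t)⟩, hl⟩

lemma exists_items_nt {P : Pat Symb → Prop} {t : Pat Symb} (h : H.NtThen (H.HandlesThen P) t) :
    ∃ l : List (Item Symb), (∀ i ∈ l, i.Ok H) ∧ ∃ s, P s ∧ t = plug (l.map Item.toFrame) s := by
  obtain ⟨B, h1, h2, _, rfl, h⟩ := h; obtain ⟨l, hl, s, hs, rfl⟩ := exists_items h
  exact ⟨.nt B :: l, by simpa [Item.Ok, h1, h2] using hl, s, hs, rfl⟩

lemma exists_rep (hh : H.IsHandle) {p : Symb × Pat Symb} (hp : p ∈ H.prods) :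
    ∃ ru, Rep H ru p.2 ∧ (p.1.rank = 1 ∧ ru.last = none ∨ p.1.rank = 0 ∧ ru.last ≠ none) := by
  obtain ⟨A, t⟩ := p
  have app : ∀ {l l' : List (Item Symb)} {s t : Pat Symb}, (∀ i ∈ l, i.Ok H) → (∀ i ∈ l', i.Ok H) →
      s = plug (l'.map Item.toFrame) t → (∀ i ∈ l ++ l', i.Ok H) ∧
      plug (l.map Item.toFrame) s = plug ((l ++ l').map Item.toFrame) t := by
    rintro l l' s t h1 h2 rfl
    exact ⟨fun i hi => (mem_append.1 hi).elim (h1 i) (h2 i), by rw [map_append, plug_append]⟩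
  rcases hh _ hp with ⟨hr, h⟩ | ⟨hr, h⟩
  · obtain ⟨l, hl, s, hs, rfl⟩ := exists_items h
    have fin : ∀ l' : List (Item Symb), (∀ i ∈ l', i.Ok H) →
        (∃ c : Symb, c.rank = 0 ∧ s = plug (l'.map Item.toFrame) (node c [])) →
        ∃ ru, Rep H ru (plug (l.map Item.toFrame) s) ∧
          (A.rank = 1 ∧ ru.last = none ∨ A.rank = 0 ∧ ru.last ≠ none) := by
      rintro l' hl' ⟨c, hc, hs⟩
      obtain ⟨e, he, rfl⟩ := exists_end (H := H) c hc; obtain ⟨h1, h2⟩ := app hl hl' hs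
      exact ⟨⟨l ++ l', some e⟩, ⟨h1, by simpa using he, h2⟩, .inr ⟨hr, by simp⟩⟩
    rcases hs with ⟨c, hc, rfl⟩ | hs
    · exact fin [] (by simp) ⟨c, hc, rfl⟩
    · obtain ⟨l', hl', s', ⟨c, hc, rfl⟩, hs⟩ := exists_items_nt hs; exact fin l' hl' ⟨c, hc, hs⟩
  · obtain ⟨l, hl, s, hs, rfl⟩ := exists_items h
    have fin : ∀ l' : List (Item Symb), (∀ i ∈ l', i.Ok H) → s = plug (l'.map Item.toFrame) (param 0) →
        ∃ ru, Rep H ru (plug (l.map Item.toFrame) s) ∧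
          (A.rank = 1 ∧ ru.last = none ∨ A.rank = 0 ∧ ru.last ≠ none) := by
      intro l' hl' hs; obtain ⟨h1, h2⟩ := app hl hl' hs
      exact ⟨⟨l ++ l', none⟩, ⟨h1, by simp, h2⟩, .inl ⟨hr, rfl⟩⟩
    rcases hs with rfl | hs
    · exact fin [] (by simp) rfl
    · obtain ⟨l', hl', s', rfl | hs', rfl⟩ := exists_items_nt hs
      · exact fin l' hl' rfl
      · obtain ⟨l'', hl'', s'', rfl, hs''⟩ := exists_items_nt hs'
        obtain ⟨h1, h2⟩ := app hl' hl'' hs''; exact fin (l' ++ l'') h1 h2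

lemma Rep.perm {ru : Rule Symb} {t : Pat Symb} (h : Rep H ru t) :
    t.labels.Perm (ru.labels ++ ru.names.map Name.sym) := by
  rw [perm_iff_count]; intro B
  have he : ∀ e : End Symb, e.Ok H → [e.sym].count B = e.labels.count B + (e.names.map Name.sym).count B := by
    rintro (c | C | ⟨E, j⟩) h
    · simp [End.sym, End.labels, End.names]
    · simp [End.sym, End.labels, End.names, Name.sym]
    · exact h.elim
  have ht : ∀ t : Twig Symb, t.Ok H → t.toPat.labels.count B = t.labels.count B +
      (t.names.map Name.sym).count B := by
    rintro ⟨w, e⟩ ⟨-, h⟩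
    replace h := he e h
    have : (Twig.toPat ⟨w, e⟩).labels = w ++ [e.sym] := by
      clear h
      induction w with
      | nil => simp [Twig.toPat]
      | cons a w ih => simpa [Twig.toPat, fill, letter] using ih
    simp [this, Twig.labels, Twig.names]; omega
  have hts : ∀ l : List (Twig Symb), (∀ t ∈ l, t.Ok H) →
      ((l.map Twig.toPat).flatMap Pat.labels).count B =
        (l.flatMap Twig.labels).count B + ((l.flatMap Twig.names).map Name.sym).count B := by
    intro l hl
    induction l with
    | nil => rfl
    | cons t l ih =>
      have := ih fun t ht => hl t (by simp [ht])
      have := ht t (hl t (by simp))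
      simp at *; omega
  obtain ⟨items, last⟩ := ru; obtain ⟨h1, h2, rfl⟩ := h
  simp only [Rule.labels, Rule.names, Rule.lastNames] at h1 h2 ⊢
  induction items with
  | nil =>
    rcases last with _ | e
    · simp
    · simpa using he e (h2 e rfl)
  | cons i l ih =>
    have ih := ih fun i hi => h1 i (by simp [hi])
    have hi := h1 i (by simp)
    rcases i with x | A
    · have k1 := hts x.pre fun t ht => hi.2 t (by simp [ht])
      have k2 := hts x.post fun t ht => hi.2 t (by simp [ht])
      simp only [map_cons, plug_cons, Item.toFrame, fill, Frame.map, labels_node,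
        flatMap_cons, flatMap_append, count_cons, count_append, map_append,
        Item.labels, Item.names, cons_append] at *
      omega
    · simp only [map_cons, plug_cons, Item.toFrame, fill, letter, labels_node,
        flatMap_cons, count_cons, count_append, map_append, flatMap_nil,
        Item.labels, Item.names, cons_append, nil_append, Name.sym,
        append_nil] at *
      omega

lemma Rep.name_ok {ru : Rule Symb} {t : Pat Symb} (h : Rep H ru t) {Y : Name} (hY : Y ∈ ru.names) :
    Y.sym ∈ H.nonterminals ∧ (Y = .one Y.sym ∧ Y.sym.rank = 1 ∨ Y = .zero (.orig Y.sym) ∧ Y.sym.rank = 0) := by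
  have he : ∀ e : End Symb, e.Ok H → Y ∈ e.names → Y.sym ∈ H.nonterminals ∧
      (Y = .one Y.sym ∧ Y.sym.rank = 1 ∨ Y = .zero (.orig Y.sym) ∧ Y.sym.rank = 0) := by
    rintro (c | C | ⟨E, j⟩) h hY
    · simp [End.names] at hY
    · obtain rfl : Y = .zero (.orig C) := by simpa [End.names] using hY
      exact ⟨h.1, .inr ⟨rfl, h.2⟩⟩
    · exact h.elim
  rcases mem_append.1 hY with hY | hY
  · obtain ⟨x | B, hi, hY⟩ := mem_flatMap.1 hY
    · obtain ⟨t, ht, hY⟩ := mem_flatMap.1 hY; exact he _ ((h.items _ hi).2 t ht).2 hY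
    · obtain rfl : Y = .one B := by simpa [Item.names] using hY
      exact ⟨(h.items _ hi).1, .inl ⟨rfl, (h.items _ hi).2⟩⟩
  · rcases hl : ru.last with _ | e
    · simp [Rule.lastNames, hl] at hY
    · exact he e (h.last e hl) (by simpa [Rule.lastNames, hl] using hY)

lemma Rep.size_eq {ru : Rule Symb} {t : Pat Symb} (h : Rep H ru t) : ru.size ≤ t.size := by
  have := h.perm.length_eq; rw [length_append, Rule.length_labels, ← size_eq_length_labels] at this
  omega

lemma Rep.pot_le {ru : Rule Symb} {t : Pat Symb} (h : Rep H ru t) (wt : Symb → ℕ) (F : ℕ) :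
    ru.pot wt F ≤ 2 * F * t.labels.countP fun B => decide (B ∈ H.nonterminals ∧ B.rank = 1) := by
  refine (gapPot_le F _ _).trans (Nat.mul_le_mul_left _ ?_)
  have key : ∀ l : List (Item Symb), (∀ i ∈ l, i.Ok H) → (l.map (Item.mark wt)).countP Sum.isRight ≤
      ((l.flatMap Item.names).map Name.sym).countP fun B => decide (B ∈ H.nonterminals ∧ B.rank = 1) := by
    intro l hl
    induction l with
    | nil => simp
    | cons i l ih =>
      have ih := ih fun i hi => hl i (by simp [hi])
      have hi := hl i (by simp)
      rw [map_cons, flatMap_cons, map_append, countP_append, countP_cons]; rcases i with x | B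
      · simp only [Item.mark, Sum.isRight_inl, Bool.false_eq_true, if_false]; omega
      · rw [show (Item.nt B : Item Symb).names.map Name.sym = [B] from rfl,
          countP_singleton, if_pos (decide_eq_true (p := B ∈ H.nonterminals ∧ B.rank = 1) hi)]
        simp only [Item.mark, Sum.isRight_inr, if_true]; omega
  rw [h.perm.countP_eq, countP_append, Rule.names, map_append, countP_append]; have := key _ h.items
  omega

/-! ### The internal grammar of a handle grammar -/

/-- The children of the frames contain no parameters. -/
def Closed (L : List (Frame Symb (Pat Symb))) : Prop := ∀ x ∈ L, ∀ t ∈ x.pre ++ x.post, t.params = []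

lemma map_subst_closed {l : List (Pat Symb)} (h : ∀ t ∈ l, t.params = []) (us : List (Pat Symb)) :
    l.map (subst us) = l := by
  rw [map_congr_left fun t ht => subst_of_params_nil us t (h t ht), map_id']

lemma subst_plug {L : List (Frame Symb (Pat Symb))} (h : Closed L) (us : List (Pat Symb))
    (t : Pat Symb) : (plug L t).subst us = plug L (t.subst us) := by
  induction L with
  | nil => rfl
  | cons x L ih =>
    have hx := h x (by simp)
    simp only [mem_append] at hx
    rw [plug_cons, fill, subst_node, map_append, map_cons, ih fun y hy => h y (by simp [hy]),
      map_subst_closed fun t ht => hx t (.inl ht), map_subst_closed fun t ht => hx t (.inr ht)]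
    rfl

lemma frame_of_wellRanked_plug {L : List (Frame Symb (Pat Symb))} {t : Pat Symb} {x : Frame Symb (Pat Symb)}
    (hx : x ∈ L) (hw : WellRanked (plug L t)) :
    x.label ∈ (plug L t).labels ∧ x.pre.length + x.post.length < x.label.rank := by
  induction L with
  | nil => simp at hx
  | cons y L ih =>
    rw [plug_cons, fill, wellRanked_node] at hw; rw [plug_cons, fill, labels_node]
    rcases mem_cons.1 hx with rfl | hx
    · have := hw.1; simp at this; exact ⟨by simp, by omega⟩
    · have := ih hx (hw.2 _ (by simp))
      exact ⟨by simp [this.1], this.2⟩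

variable {v : Symb → Option (Pat Symb)} {d : Symb}

/-- The internal grammar for given right-hand sides and values. -/
def handleGram (d : Symb) (v : Symb → Option (Pat Symb)) (ru : Symb → Rule Symb)
    (ctx : Symb → List (Frame Symb (Pat Symb))) : Gram Symb where
  rule
    | .one A => ru A
    | .zero (.orig C) => ru C
    | .zero (.child _ _) => ⟨[], some (.con d)⟩
  ctx := ctx
  val
    | .orig C => (v C).getD (node d [])
    | .child _ _ => node d []

variable {ru : Symb → Rule Symb} {ctx : Symb → List (Frame Symb (Pat Symb))}

lemma expand_end (hv : H.IsVal v) {e : End Symb} (he : e.Ok H) :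
    expand v (node e.sym []) = (handleGram d v ru ctx).endVal e ∧
      ((handleGram d v ru ctx).endVal e).params = [] := by
  rcases e with c | C | ⟨E, j⟩
  · exact ⟨expand_node_none ((hv.none_iff c).2 he) [], by simp [Gram.endVal]⟩
  · obtain ⟨h1, h2⟩ : C ∈ H.nonterminals ∧ C.rank = 0 := he; rcases hC : v C with _ | p
    · exact absurd h1 ((hv.none_iff C).1 hC)
    · have hp : p.params = [] := by simpa [h2] using hv.perm C p hC
      simp [Gram.endVal, handleGram, End.sym, expand_node_some hC, hC, hp, subst_of_params_nil]
  · exact he.elim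

lemma expand_twig (hv : H.IsVal v) {t : Twig Symb} (ht : t.Ok H) :
    expand v t.toPat = (handleGram d v ru ctx).twigVal t ∧
      ((handleGram d v ru ctx).twigVal t).params = [] := by
  obtain ⟨w, e⟩ := t; obtain ⟨h1, h2⟩ := ht
  induction w with
  | nil => exact expand_end hv h2
  | cons a w ih =>
    obtain ⟨k1, k2⟩ := ih (fun b hb => h1 b (by simp [hb])) h2
    have ha := (hv.none_iff a).2 (h1 a (by simp))
    simp only [Twig.toPat, Gram.twigVal, map_cons, plug_cons, fill, letter,
      nil_append, expand_node_none ha, map_nil, params_node, flatMap_cons,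
      flatMap_nil, append_nil] at k1 k2 ⊢
    exact ⟨by rw [← k1], k2⟩

lemma expand_items (hv : H.IsVal v) {l : List (Item Symb)} (hl : ∀ i ∈ l, i.Ok H)
    (hB : ∀ B, .nt B ∈ l → v B = some (plug (ctx B) (param 0)) ∧ Closed (ctx B)) (s : Pat Symb) :
    expand v (plug (l.map Item.toFrame) s) =
      plug ((handleGram d v ru ctx).itemsVal l) (expand v s) ∧
        Closed ((handleGram d v ru ctx).itemsVal l) := by
  induction l with
  | nil => exact ⟨rfl, by simp [Closed]⟩
  | cons i l ih =>
    obtain ⟨k1, k2⟩ := ih (fun i hi => hl i (by simp [hi])) fun B h => hB B (by simp [h])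
    have hi := hl i (by simp)
    rw [map_cons, plug_cons, Gram.itemsVal_cons, plug_append, ← k1]
    suffices h : expand v (i.toFrame.fill (plug (l.map Item.toFrame) s)) =
        plug ((handleGram d v ru ctx).itemVal i) (expand v (plug (l.map Item.toFrame) s)) ∧
          Closed ((handleGram d v ru ctx).itemVal i) from
      ⟨h.1, fun x hx => (mem_append.1 hx).elim (h.2 x) (k2 x)⟩
    rcases i with x | B
    · have ht : ∀ l' : List (Twig Symb), (∀ t ∈ l', t.Ok H) → (l'.map Twig.toPat).map (expand v) =
          l'.map (handleGram d v ru ctx).twigVal := by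
        intro l' h; rw [map_map]; exact map_congr_left fun t ht => (expand_twig hv (h t ht)).1
      change expand v (node x.label (x.pre.map Twig.toPat ++ _ :: x.post.map Twig.toPat)) = _ ∧ _
      rw [expand_node_none ((hv.none_iff _).2 hi.1), map_append, map_cons]
      refine ⟨congrArg₂ (fun a b => node _ (a ++ _ :: b)) (ht x.pre fun t h => hi.2 t (by simp [h]))
        (ht x.post fun t h => hi.2 t (by simp [h])), ?_⟩
      simp only [Gram.itemVal, Closed, mem_singleton, forall_eq, Frame.map, ← map_append, mem_map]
      rintro _ ⟨t, ht, rfl⟩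
      exact (expand_twig hv (hi.2 t ht)).2
    · obtain ⟨h1, h2⟩ := hB B (by simp)
      refine ⟨?_, h2⟩; rw [fill, Item.toFrame, letter, expand_node_some h1, subst_plug h2]
      simp [Gram.itemVal, handleGram]

lemma Rep.expand_eq {t : Pat Symb} {r : Rule Symb} (h : Rep H r t) (hv : H.IsVal v)
    (hB : ∀ B, .nt B ∈ r.items → v B = some (plug (ctx B) (param 0)) ∧ Closed (ctx B)) :
    expand v t = plug ((handleGram d v ru ctx).itemsVal r.items)
      (r.last.elim (param 0) (handleGram d v ru ctx).endVal) ∧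
        Closed ((handleGram d v ru ctx).itemsVal r.items) := by
  obtain ⟨k1, k2⟩ := expand_items (d := d) (ru := ru) hv h.items hB
    (r.last.elim (param 0) fun e => node e.sym [])
  refine ⟨?_, k2⟩; rw [h.eq, k1]; rcases hl : r.last with _ | e
  · simp
  · simp [(expand_end (d := d) (ru := ru) (ctx := ctx) hv (h.last e hl)).1]

lemma sum_le_sum_prods (h : H.IsSLCF) {s : Finset Symb} (hs : ∀ A ∈ s, A ∈ H.nonterminals)
    {f : Symb → ℕ} {g : Symb × Pat Symb → ℕ} (hfg : ∀ p ∈ H.prods, f p.1 ≤ g p) :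
    ∑ A ∈ s, f A ≤ (H.prods.map g).sum := by
  have e : (H.nonterminals.map f).sum ≤ (H.prods.map g).sum := by
    rw [Grammar.nonterminals, map_map]; exact sum_le_sum hfg
  rw [← sum_toFinset f h.unique_prod] at e
  exact (Finset.sum_le_sum_of_subset fun A hA => mem_toFinset.2 (hs A hA)).trans e

lemma sum_count_le {s : Finset Symb} {p : Symb → Bool} (h : ∀ A ∈ s, p A = true) (W : List Symb) :
    ∑ A ∈ s, W.count A ≤ W.countP p := by
  induction W with
  | nil => simp
  | cons b W ih =>
    simp only [count_cons, countP_cons, Finset.sum_add_distrib, beq_iff_eq, Finset.sum_ite_eq]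
    grind

lemma rank_le_maxRank {T : Pat Symb} {a : Symb} (h : a ∈ T.labels) : a.rank ≤ T.maxRank := by
  rw [maxRank]; generalize T.labels = l at h
  induction l with
  | nil => simp at h
  | cons b l ih => grind

/-- The child names start as dummy constants: nothing is pending, and the first frame can be popped
at once. The start grammar has unit weights, so weights are sizes of values, and for reachable
nonterminals these are bounded by the size of the tree. -/
lemma exists_rel {T : Pat Symb} (h : H.IsSLCF) (hh : H.IsHandle) (hT : H.Generates T) :
    ∃ (G : Gram Symb) (D : Dom) (ord m : Name → ℕ), Rel id T G D ord m (fun _ => 1) T.size ∧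
      (∀ E j, ord (.zero (.child E j)) = ord (.one E) + 1) ∧
      (∀ E j, m (.zero (.child E j)) = m (.one E)) ∧
      (∀ F, G.potential D (fun _ => 1) F ≤
        2 * H.size + 2 * F * H.ntOcc 1 + 2 * (T.maxRank * H.ntOcc 1)) ∧
      phaseCost D m ≤ 22 * (H.ntOcc 0 + (T.maxRank + 1) * H.ntOcc 1) +
        4 * (T.maxRank * H.ntOcc 1) := by
  classical
  obtain ⟨v, hv⟩ := h.exists_val; have hs := hT.val_start h hv
  obtain ⟨o, -, ho, ho'⟩ := h.straight_line
  have hru : ∀ A, ∃ ru, ∀ t, (A, t) ∈ H.prods → Rep H ru t ∧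
      (A.rank = 1 ∧ ru.last = none ∨ A.rank = 0 ∧ ru.last ≠ none) := by
    intro A
    by_cases hA : ∃ t, (A, t) ∈ H.prods
    · obtain ⟨t, ht⟩ := hA; obtain ⟨ru, h1⟩ := exists_rep hh ht; refine ⟨ru, fun t' ht' => ?_⟩
      have e := h.unique ht ht' rfl; simp only [Prod.mk.injEq, true_and] at e; exact e ▸ h1
    · exact ⟨⟨[], none⟩, fun t ht => absurd ⟨t, ht⟩ hA⟩
  choose ru hru using hru
  have hlast : ∀ {A t}, (A, t) ∈ H.prods → A.rank = 1 → (ru A).last = none := fun ht h1 =>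
    ((hru _ _ ht).2.resolve_right (by omega)).2
  have hitem : ∀ {A B}, .nt B ∈ (ru A).items → .one B ∈ (ru A).names := fun hB =>
    mem_append_left _ (mem_flatMap.2 ⟨_, hB, by simp [Item.names]⟩)
  have hnt : ∀ {A t}, (A, t) ∈ H.prods → ∀ {Y}, Y ∈ (ru A).names → Y.sym ∈ t.labels ∧ o Y.sym < o A := by
    intro A t hA Y hY
    have h1 : Y.sym ∈ t.labels :=
      (hru A t hA).1.perm.mem_iff.2 (mem_append_right _ (mem_map_of_mem hY))
    exact ⟨h1, ho _ hA _ ((hru A t hA).1.name_ok hY).1 h1⟩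
  have hmem : ∀ {A}, A ∈ H.nonterminals → ∃ t, (A, t) ∈ H.prods := fun hA => by
    obtain ⟨⟨A, t⟩, hp, rfl⟩ := mem_map.1 hA; exact ⟨t, hp⟩
  -- the values of the nonterminals of rank `1`
  let tv : Twig Symb → Pat Symb := (handleGram H.start v ru fun _ => []).twigVal
  -- The context of a nonterminal of rank 1 as a list of frames, by recursion along the order. Twigs
  -- contain no nonterminals of rank 1, so their values do not depend on `ctx`.
  let ctx : Symb → List (Frame Symb (Pat Symb)) := (measure o).wf.fix fun A rec =>
    (ru A).items.flatMap fun i => match i with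
      | .frame x => [x.map tv]
      | .nt B => if hB : o B < o A then rec B hB else []
  obtain ⟨G, hG⟩ : ∃ G, G = handleGram H.start v ru ctx := ⟨_, rfl⟩
  have hctx : ∀ A ∈ H.nonterminals, ctx A = G.itemsVal (ru A).items := by
    intro A hA; obtain ⟨t, ht⟩ := hmem hA; rw [hG]
    refine ((measure o).wf.fix_eq _ A).trans (flatMap_congr fun i hi => ?_)
    rcases i with x | B
    · rfl
    · exact dif_pos (hnt ht (hitem hi)).2
  have hval : ∀ k A t, o A < k → (A, t) ∈ H.prods →
      (∀ B, .nt B ∈ (ru A).items → v B = some (plug (ctx B) (param 0)) ∧ Closed (ctx B)) := by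
    intro k
    induction k with intro A t hk ht B hB
    | zero => omega
    | succ k ih =>
      obtain ⟨h1, h2⟩ := hnt ht (hitem hB); obtain ⟨h3, h4⟩ := (hru A t ht).1.name_ok (hitem hB)
      obtain ⟨s, hs⟩ := hmem h3
      obtain ⟨k1, k2⟩ := (hru _ s hs).1.expand_eq (d := H.start) (ru := ru) hv
        (ih _ s (by omega) hs)
      rw [← hG, ← hctx _ h3] at k1 k2; refine ⟨?_, k2⟩
      rw [hlast hs (by simp at h4; exact h4.2)] at k1
      exact (hv.eq _ hs).trans (congrArg some k1)
  have hexp : ∀ A t, (A, t) ∈ H.prods → v A = some (plug (G.itemsVal (ru A).items)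
      ((ru A).last.elim (param 0) G.endVal)) := by
    intro A t ht
    rw [hv.eq _ ht, ((hru A t ht).1.expand_eq (d := H.start) (ru := ru) hv
      (hval _ A t (Nat.lt_succ_self _) ht)).1, hG]
  -- the nonterminals in use
  let W := H.prods.flatMap fun p => p.2.labels
  let use (i : ℕ) : Finset Symb := H.nonterminals.toFinset.filter fun A => H.Reach A ∧ A.rank = i
  have huse : ∀ {i A}, A ∈ use i ↔ A ∈ H.nonterminals ∧ H.Reach A ∧ A.rank = i := by simp [use]
  let D : Dom := ⟨use 1, use 0, T.maxRank, H.start⟩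
  -- Doubling the order makes room for the child names.
  let ord : Name → ℕ
    | .one A => 2 * o A
    | .zero (.orig C) => 2 * o C
    | .zero (.child E _) => 2 * o E + 1
  let m : Name → ℕ := fun Y => W.count Y.sym
  have hocc : ∀ i, ∑ A ∈ use i, W.count A ≤ H.ntOcc i := by
    intro i
    refine (sum_count_le (p := fun B => decide (B ∈ H.nonterminals ∧ B.rank = i)) ?_ W).trans ?_
    · intro A hA; have := huse.1 hA; simp [this]
    · rw [countP_flatMap]; exact le_rfl
  -- A reachable nonterminal of rank 1 is not the start, so it occurs in some right-hand side.
  have hcard : (use 1).card ≤ H.ntOcc 1 := by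
    refine le_trans ?_ (hocc 1); rw [Finset.card_eq_sum_ones]
    refine Finset.sum_le_sum fun A hA => count_pos_iff.2 ?_
    obtain ⟨-, h2, h3⟩ := huse.1 hA
    rcases Relation.ReflTransGen.cases_tail h2 with rfl | ⟨B, -, t, ht, hB⟩
    · rw [h.start_rank] at h3; omega
    · exact mem_flatMap.2 ⟨_, ht, hB⟩
  have hsum : ∀ (f : Name → ℕ) (g : Symb × Pat Symb → ℕ) (c : ℕ),
      (∀ A t, (A, t) ∈ H.prods → f (.one A) ≤ g (A, t) ∧ f (.zero (.orig A)) ≤ g (A, t)) →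
      (∀ E j, f (.zero (.child E j)) ≤ c) →
      D.sum f ≤ (H.prods.map g).sum + c * (T.maxRank * H.ntOcc 1) := by
    intro f g c h1 h2
    -- A symbol is used with one rank only, so each production is counted at most once.
    let f' : Symb → ℕ := fun A => max (f (.one A)) (f (.zero (.orig A)))
    have hd : Disjoint (use 1) (use 0) := Finset.disjoint_left.2 fun A h1 h0 => by
      have := (huse.1 h1).2.2.symm.trans (huse.1 h0).2.2; omega
    have k1 := sum_le_sum_prods (s := use 1 ∪ use 0) (f := f') (g := g) h
      (fun A hA => (Finset.mem_union.1 hA).elim (fun h => (huse.1 h).1) fun h => (huse.1 h).1)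
      fun p hp => max_le (h1 _ _ hp).1 (h1 _ _ hp).2
    rw [Finset.sum_union hd] at k1
    have k2 : ∑ E ∈ use 1, ∑ j ∈ Finset.range T.maxRank, f (.zero (.child E j)) ≤
        (use 1).card * (T.maxRank * c) := by
      refine Finset.sum_le_card_nsmul _ _ _ fun E _ => ?_
      exact (Finset.sum_le_card_nsmul _ _ _ fun j _ => h2 E j).trans (by simp)
    have k3 := Nat.mul_le_mul_right (T.maxRank * c) hcard
    have k4 := Finset.sum_le_sum (s := use 1) fun E _ => le_max_left (f (.one E)) (f (.zero (.orig E)))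
    have k5 := Finset.sum_le_sum (s := use 0) fun E _ => le_max_right (f (.one E)) (f (.zero (.orig E)))
    rw [Dom.sum, Finset.sum_add_distrib]
    have e : c * (T.maxRank * H.ntOcc 1) = H.ntOcc 1 * (T.maxRank * c) := by ring
    simp only [D, f'] at *; omega
  -- the grammar rules
  have hX : ∀ X, D.Mem X → (∃ E j, X = .zero (.child E j)) ∨ G.rule X = ru X.sym ∧
      X.sym ∈ H.nonterminals ∧ H.Reach X.sym ∧ ord X = 2 * o X.sym := by
    rintro (A | C | ⟨E, j⟩) h
    · exact .inr ⟨by rw [hG]; rfl, (huse.1 h).1, (huse.1 h).2.1, rfl⟩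
    · exact .inr ⟨by rw [hG]; rfl, (huse.1 h).1, (huse.1 h).2.1, rfl⟩
    · exact .inl ⟨E, j, rfl⟩
  have hchild : ∀ E j, (G.rule (.zero (.child E j))).names = [] := by intro E j; rw [hG]; rfl
  have hY : ∀ X, D.Mem X → ∀ Y ∈ (G.rule X).names, D.Mem Y ∧ ord Y + 1 < ord X ∧ Y ≠ .zero D.S := by
    intro X hXm Y hY; rcases hX X hXm with ⟨E, j, rfl⟩ | ⟨h1, h2, h3, h4⟩
    · rw [hchild] at hY; simp at hY
    · obtain ⟨t, ht⟩ := hmem h2; rw [h1] at hY; obtain ⟨k1, k2⟩ := hnt ht hY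
      obtain ⟨k3, k4⟩ := (hru _ t ht).1.name_ok hY; have k5 : H.Reach Y.sym := h3.tail ⟨t, ht, k1⟩
      rw [h4]
      rcases k4 with ⟨e, k4⟩ | ⟨e, k4⟩ <;> rw [e] at *
      · exact ⟨huse.2 ⟨k3, k5, k4⟩, by simp only [ord, Name.sym] at *; omega, by simp⟩
      · refine ⟨huse.2 ⟨k3, k5, k4⟩, by simp only [ord, Name.sym] at *; omega, ?_⟩
        intro e; have e : Y.sym = H.start := by injection e with e; injection e
        have k2 : o Y.sym < o X.sym := k2; rw [e] at k2; rcases eq_or_ne X.sym H.start with e' | e'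
        · exact absurd k2 (e' ▸ lt_irrefl _)
        · exact absurd k2 (ho' _ h2 e').not_gt
  have hsub : ∀ A, H.Reach A → ∀ p, v A = some p → p.labels.Sublist T.labels := by
    intro A hA p hp; simpa [symLabels, hp] using hA.symLabels_sublist h hv hs
  have hone : ∀ A ∈ use 1, v A = some (plug (ctx A) (param 0)) := by
    intro A hA; obtain ⟨h1, -, h3⟩ := huse.1 hA; obtain ⟨t, ht⟩ := hmem h1
    rw [hexp A t ht, ← hctx A h1, hlast ht h3]; rfl
  have hwt : ∀ t : Pat Symb, treeWt (fun _ => 1) t = t.size := by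
    intro t; rw [treeWt, size_eq_length_labels]; simp [wtSum]
  have hpos : 1 ≤ T.size := by
    cases T
    · simpa using hT.1.2
    · simp
  have hsize : ∀ A, H.Reach A → ∀ p, v A = some p → treeWt (fun _ => 1) p ≤ T.size := by
    intro A hA p hp; rw [hwt, size_eq_length_labels, size_eq_length_labels]
    exact (hsub A hA p hp).length_le
  have inv : G.Inv D ord m (fun _ => 1) T.size := by
    refine ⟨huse.2 ⟨h.start_mem, .refl, h.start_rank⟩, ?_, fun X hXm Y h => ?_, fun X hXm B h => ?_,
      fun Y => ?_, fun A hA => ?_, ?_, fun A hA x hx => ?_, fun X hXm E l₁ l₂ _ j _ hc => ?_⟩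
    · rintro (A | C | ⟨E, j⟩) hXm
      · obtain ⟨h1, -, h3⟩ := huse.1 hXm; obtain ⟨t, ht⟩ := hmem h1
        exact ⟨by rw [hG]; exact hlast ht h3, by rw [hG] at hctx ⊢; exact hctx A h1⟩
      · obtain ⟨h1, -, h3⟩ := huse.1 hXm; obtain ⟨t, ht⟩ := hmem h1
        rcases hl : (ru C).last with _ | e
        · rcases (hru _ t ht).2 with h | h
          · omega
          · exact absurd hl h.2
        · have := hexp C t ht; rw [hl, hG] at this; refine ⟨e, by rw [hG]; exact hl, ?_⟩
          rw [hG]; exact (congrArg (Option.getD · _) this).trans rfl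
      · rw [hG]; exact ⟨_, rfl, rfl⟩
    · obtain ⟨h1, h2, h3⟩ := hY X hXm Y h; exact ⟨h1, by omega, h3⟩
    · exact (hY X hXm _ h).2.1
    · refine (hsum _ (fun p => p.2.labels.count Y.sym) 0 ?_ fun E j => by rw [hchild]; simp).trans ?_
      · intro A t ht
        have : (ru A).names.count Y ≤ t.labels.count Y.sym := by
          rw [(hru A t ht).1.perm.count_eq, count_append]
          exact count_le_count_map.trans (Nat.le_add_left _ _)
        rw [hG]; exact ⟨this, this⟩
      · simp only [m, W, count_flatMap, zero_mul, add_zero]; exact le_rfl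
    · have := hsize A (huse.1 hA).2.1 _ (hone A hA); rw [treeWt_plug] at this; rw [hG]
      exact (Nat.le_add_right _ _).trans this
    · rintro (C | ⟨E, j⟩) hC
      · obtain ⟨t, ht⟩ := hmem (huse.1 hC).1; have := hsize C (huse.1 hC).2.1 _ (hexp C t ht)
        rw [← Option.getD_some (a := plug _ _) (b := node H.start []), ← hexp C t ht] at this
        rw [hG]; exact this
      · rw [hG, show (handleGram H.start v ru ctx).val (.child E j) = node H.start [] from rfl, hwt]
        simpa using hpos
    · have hw := hv.wellRanked _ _ (hone A hA); rw [hG] at hx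
      obtain ⟨h1, h2⟩ := frame_of_wellRanked_plug hx hw
      exact h2.trans_le (rank_le_maxRank ((hsub A (huse.1 hA).2.1 _ (hone A hA)).subset h1))
    · rw [hG] at hc; simp [handleGram, constOf] at hc
  have htree : G.val D.S = T := by rw [hG]; simp [handleGram, D, Dom.S, hs]
  refine ⟨G, D, ord, m, ⟨inv, fun _ => le_rfl, ?_, fun a _ b _ e => e⟩, fun _ _ => rfl,
    fun _ _ => rfl, fun F => ?_, ?_⟩
  · rw [htree]; clear * -
    induction T using induct with
    | hp i => simp
    | hn a ts ih => rw [relabel_node, ← map_congr_left ih, map_id']; rfl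
  · refine (hsum _ (fun p => 2 * p.2.size + 2 * F * p.2.labels.countP fun B =>
      decide (B ∈ H.nonterminals ∧ B.rank = 1)) 2 ?_ ?_).trans ?_
    · intro A t ht; have h1 := (hru A t ht).1.size_eq
      have h2 := (hru A t ht).1.pot_le (fun _ => 1) F
      rw [hG]; exact ⟨by simp only [handleGram]; omega, by simp only [handleGram]; omega⟩
    · intro E j; rw [hG]; rfl
    · rw [sum_map_add, sum_map_mul_left, sum_map_mul_left]; exact le_rfl
  · have k1 := hocc 1; have k0 := hocc 0
    have e : D.sum m = (T.maxRank + 1) * ∑ A ∈ use 1, W.count A + ∑ A ∈ use 0, W.count A := by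
      simp only [Dom.sum, D, m, Name.sym, Finset.sum_add_distrib, Finset.sum_const,
        Finset.card_range, smul_eq_mul, ← Finset.mul_sum]
      ring
    have e' : ∑ A ∈ D.one, m (.one A) = ∑ A ∈ use 1, W.count A := rfl
    have k2 := Nat.mul_le_mul_left (T.maxRank + 1) k1
    have k3 := Nat.mul_le_mul_left T.maxRank (Nat.add_le_add k1 hcard)
    rw [phaseCost, e, e', show D.r = T.maxRank from rfl, show D.one = use 1 from rfl]
    rw [← two_mul, mul_left_comm] at k3; omega

lemma size_le_of_handle {T : Pat Symb} {R : Grammar} (h : H.IsSLCF) (hh : H.IsHandle)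
    (hT : H.Generates T) (hR : Produces T R) :
    R.size ≤ 10 * H.size + 10 * (T.maxRank * H.ntOcc 1) + T.size.size * (10 * H.ntOcc 1 +
      15 * (22 * (H.ntOcc 0 + (T.maxRank + 1) * H.ntOcc 1) + 4 * (T.maxRank * H.ntOcc 1))) := by
  obtain ⟨G, D, ord, m, hr, h1, h2, h3, h4⟩ := exists_rel h hh hT
  have := hr.produces hR hT.1 le_rfl h1 h2; have k := Nat.mul_le_mul_left T.size.size h4
  have := h3 T.size.size; nlinarith

end Sim

/-! ### The logarithm -/

/-- The bit length is at most twice the bit length minus one, and `2 / log 2 < 3`. -/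
lemma size_le_log {n : ℕ} (hn : 2 ≤ n) : (n.size : ℝ) ≤ 3 * Real.log n := by
  have h0 : n ≠ 0 := by omega
  have hs : 2 ≤ n.size := Nat.lt_size.2 (by simpa using hn)
  have h1 : 2 ^ (n.size - 1) ≤ n := Nat.lt_size.1 (by omega)
  have h2 : ((n.size - 1 : ℕ) : ℝ) * Real.log 2 ≤ Real.log n := by
    rw [← Real.log_pow]; exact Real.log_le_log (by positivity) (by exact_mod_cast h1)
  have h3 : ((n.size - 1 : ℕ) : ℝ) = n.size - 1 := by rw [Nat.cast_sub (by omega)]; simp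
  have h4 : (2 : ℝ) ≤ n.size := by exact_mod_cast hs
  have := Real.log_two_gt_d9; rw [h3] at h2; nlinarith

lemma one_le_maxRank {T : Pat Symb} (hT : T.IsTree) (h : 2 ≤ T.size) : 1 ≤ T.maxRank := by
  rcases T with i | ⟨a, ts⟩
  · simp at h
  · have h1 := (wellRanked_node.1 hT.1).1
    have h2 : a.rank ≤ (node a ts).maxRank := by simp [maxRank]
    rcases ts with _ | ⟨t, ts⟩
    · simp at h
    · simp at h1; omega

lemma size_bounds (K : ℕ) {T : Pat Symb} {G H : Grammar} (hn : 2 ≤ T.size)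
    (hH : Grammar.IsHandleNormalForm K T G H) :
    (∀ R : Grammar, Produces T R → (R.size : ℝ) ≤ (10 * K + 2220) *
      (G.size * T.maxRank + (H.ntOcc 0 + H.ntOcc 1 * T.maxRank) * Real.log T.size)) ∧
    (G.size : ℝ) * T.maxRank + (H.ntOcc 0 + H.ntOcc 1 * T.maxRank) * Real.log T.size ≤
      (10 * K + 2220) * (G.size * T.maxRank + G.size * T.maxRank * Real.log T.size) := by
  have hr := one_le_maxRank hH.generates.1 hn; have hl := size_le_log hn
  have h0 : (H.ntOcc 0 : ℝ) ≤ K * (G.size * T.maxRank) := by exact_mod_cast hH.occ_zero_le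
  have h1 : (H.ntOcc 1 : ℝ) * T.maxRank ≤ K * (G.size * T.maxRank) := by
    have := Nat.mul_le_mul_right T.maxRank hH.occ_one_le; rw [mul_assoc] at this
    exact_mod_cast this
  have hs : (H.size : ℝ) ≤ K * (G.size * T.maxRank) := by exact_mod_cast hH.size_le
  have hl0 : 0 ≤ Real.log T.size := Real.log_natCast_nonneg _
  have hg : (0 : ℝ) ≤ G.size * T.maxRank := by positivity
  set L := Real.log T.size
  set x : ℝ := G.size * T.maxRank
  set y : ℝ := H.ntOcc 0 + H.ntOcc 1 * T.maxRank with hy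
  have hy0 : 0 ≤ y := by positivity
  have hK : (0 : ℝ) ≤ K := Nat.cast_nonneg K; have hyl : 0 ≤ y * L := mul_nonneg hy0 hl0
  refine ⟨fun R hR => ?_, ?_⟩
  · have h := Sim.size_le_of_handle hH.slcf hH.handle hH.generates hR
    -- Using `1 ≤ r` and a bit length of at least 1, the coefficient of `n₁ r` times the bit length
    -- is `10 + 10 + 2 * 330 + 60 = 740`. The final constant 2220 is three times this, by
    -- `size_le_log`.
    have h' : R.size ≤ 10 * H.size + 740 * ((H.ntOcc 0 + H.ntOcc 1 * T.maxRank) * T.size.size) := by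
      have hF : 1 ≤ T.size.size := Nat.size_pos.2 (by omega)
      have k1 := Nat.mul_le_mul_right (H.ntOcc 1) hr
      have k2 := Nat.mul_le_mul_left (T.maxRank * H.ntOcc 1) hF
      have k3 := Nat.mul_le_mul_left T.size.size k1
      have k4 : 0 ≤ H.ntOcc 0 * T.size.size := Nat.zero_le _; nlinarith
    have h'' : (R.size : ℝ) ≤ 10 * H.size + 740 * (y * T.size.size) := by rw [hy]; exact_mod_cast h'
    have k1 := mul_le_mul_of_nonneg_left hl hy0; nlinarith [mul_nonneg hK hyl]
  · have k1 : y * L ≤ 2 * K * x * L := mul_le_mul_of_nonneg_right (by linarith) hl0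
    nlinarith [mul_nonneg hK (mul_nonneg hg hl0), mul_nonneg hK hg, mul_nonneg hg hl0]

namespace HandleForm

/-! ### Decompositions of patterns -/

lemma params_fill {f : Symb} {pre post : List (Pat Symb)} {q : Pat Symb}
    (h : ∀ u ∈ pre ++ post, u.params = []) : (node f (pre ++ q :: post)).params = q.params := by
  have h1 : pre.flatMap params = [] := flatMap_eq_nil_iff.2 fun u hu => h u (by simp [hu])
  have h2 : post.flatMap params = [] := flatMap_eq_nil_iff.2 fun u hu => h u (by simp [hu])
  simp [h1, h2]

lemma params_subst_one {X q : Pat Symb} (h : X.params = [0]) : (X.subst [q]).params = q.params := by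
  simp [params_subst, h]

lemma size_subst (us : List (Pat Symb)) (t : Pat Symb) :
    (t.subst us).size = t.size + (t.params.map fun i => (us.getD i (param i)).size).sum := by
  induction t using induct with
  | hp i => simp
  | hn a ts ih =>
    simp only [subst_node, size_node, params_node, map_map, flatMap_def, map_flatten, sum_flatten]
    rw [map_congr_left (g := fun t => t.size + _) ih, sum_map_add, Nat.add_right_comm]
    rfl

lemma size_subst_one {X q : Pat Symb} (h : X.params = [0]) : (X.subst [q]).size = X.size + q.size := by
  simp [size_subst, h]

lemma subst_one_subst {X : Pat Symb} (h : X.params = [0]) (q : Pat Symb) (us : List (Pat Symb)) :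
    (X.subst [q]).subst us = X.subst [q.subst us] := subst_subst _ _ _ (by simp [h])

lemma size_lt_of_mem {f : Symb} {ts : List (Pat Symb)} {t : Pat Symb} (h : t ∈ ts) :
    t.size < (node f ts).size := by
  have := le_sum_of_mem (mem_map_of_mem (f := size) h); rw [size_node]; omega

/-- The number of patterns that contain parameters. -/
def opens (cs : List (Pat Symb)) : ℕ := cs.countP fun c => decide (c.params ≠ [])

variable (T : Pat Symb) (nm : Pat Symb → Symb)

/-- The lower part of a right-hand side, with its value: the parameter or one nonterminal. -/
inductive Arg (S : List (Pat Symb)) : Pat Symb → Pat Symb → Prop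
  | param : Arg S (param 0) (param 0)
  | zero (q : Pat Symb) : q ∈ S → q.params = [] → Arg S q (node (nm q) [])
  | one (q : Pat Symb) : q ∈ S → q.params = [0] → Arg S q (node (nm q) [param 0])

/-- Right-hand sides, with their values, where `nm p` is the nonterminal with the value `p`. -/
inductive Rhs (S : List (Pat Symb)) : Pat Symb → Pat Symb → Prop
  | con (f : Symb) : f ∈ T.labels → f.rank = 0 → Rhs S (node f []) (node f [])
  | frame (f : Symb) (pre post : List (Pat Symb)) (q s : Pat Symb) : f ∈ T.labels →
      f.rank = pre.length + 1 + post.length → (∀ u ∈ pre ++ post, u ∈ S ∧ u.params = []) →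
      Arg nm S q s → Rhs S (node f (pre ++ q :: post))
        (node f (pre.map (fun u => node (nm u) []) ++ s :: post.map fun u => node (nm u) []))
  | ctx (X q s : Pat Symb) : X ∈ S → X.params = [0] → Arg nm S q s → 0 < X.size → 0 < q.size →
      Rhs S (X.subst [q]) (node (nm X) [s])

/-- Every pattern in the list has a right-hand side. -/
def Closed (S : List (Pat Symb)) : Prop := ∀ p ∈ S, ∃ t, Rhs T nm S p t

/-- The pattern consists of values in `S` of nonterminals of rank `0` and `1` and of nodes with at
least two children that contain parameters. The flag says that no nonterminal is on top. -/
inductive Good (S : List (Pat Symb)) : Bool → Pat Symb → Prop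
  | zero (p : Pat Symb) : p ∈ S → p.params = [] → Good S false p
  | param (i : ℕ) : Good S true (param i)
  | branch (f : Symb) (cs : List (Pat Symb)) (b : Pat Symb → Bool) : f ∈ T.labels →
      f.rank = cs.length → (∀ c ∈ cs, Good S (b c) c) → 2 ≤ opens cs →
      Good S true (node f cs)
  | ctx (X c : Pat Symb) : X ∈ S → X.params = [0] → Good S true c → Good S false (X.subst [c])

variable {T nm} {S S' : List (Pat Symb)} {p t : Pat Symb}

lemma Arg.mono {q s : Pat Symb} (h : Arg nm S q s) (hS : ∀ u ∈ S, u.size ≤ q.size → u ∈ S') :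
    Arg nm S' q s := by
  cases h with
  | param => exact .param
  | zero _ h1 h2 => exact .zero _ (hS _ h1 le_rfl) h2
  | one _ h1 h2 => exact .one _ (hS _ h1 le_rfl) h2

/-- A right-hand side refers only to patterns strictly smaller than its value. This gives
straight-linearity for free, and allows larger patterns to be discarded. -/
lemma Rhs.mono (h : Rhs T nm S p t) (hS : ∀ q ∈ S, q.size < p.size → q ∈ S') : Rhs T nm S' p t := by
  cases h with
  | con f h1 h2 => exact .con f h1 h2
  | frame f pre post q s h1 h2 h3 h4 =>
    exact .frame f pre post q s h1 h2 (fun u hu => ⟨hS u (h3 u hu).1 (size_lt_of_mem (by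
      simp at hu ⊢; tauto)), (h3 u hu).2⟩)
      (h4.mono fun u hu h => hS u hu (h.trans_lt (size_lt_of_mem (by simp))))
  | ctx X q s h1 h2 h3 h4 h5 =>
    rw [size_subst_one h2] at hS
    exact .ctx X q s (hS X h1 (by omega)) h2 (h3.mono fun u hu h => hS u hu (by omega)) h4 h5

lemma Closed.cons (h : Closed T nm S) (hp : Rhs T nm S p t) : Closed T nm (p :: S) := by
  intro q hq; rcases mem_cons.1 hq with rfl | hq
  · exact ⟨t, hp.mono fun _ h _ => mem_cons_of_mem _ h⟩
  · obtain ⟨t', h'⟩ := h q hq; exact ⟨t', h'.mono fun _ h _ => mem_cons_of_mem _ h⟩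

lemma Closed.size_pos (h : Closed T nm S) (hp : p ∈ S) : 0 < p.size := by
  obtain ⟨t, h⟩ := h p hp
  cases h with
  | con => simp
  | frame => simp
  | ctx X q s _ h2 _ h4 => rw [size_subst_one h2]; omega

lemma Good.mono {b : Bool} (h : Good T S b p) (hS : S ⊆ S') : Good T S' b p := by
  induction h with
  | zero p h1 h2 => exact .zero p (hS h1) h2
  | param i => exact .param i
  | branch f cs b h1 h2 _ h4 ih => exact .branch f cs b h1 h2 ih h4
  | ctx X c h1 h2 _ ih => exact .ctx X c (hS h1) h2 ih

lemma Good.ne_nil (h : Good T S true p) : p.params ≠ [] := by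
  cases h with
  | param i => simp
  | branch f cs b _ _ _ h4 =>
    obtain ⟨c, hc, h⟩ := countP_pos_iff.1 (lt_of_lt_of_le two_pos h4); simp at h
    rw [params_node, Ne, flatMap_eq_nil_iff]; exact fun h' => h (h' c hc)

lemma Good.mem {b : Bool} (h : Good T S b p) (hp : p.params = []) : p ∈ S := by
  cases h with
  | zero _ h1 _ => exact h1
  | param i => simp at hp
  | branch f cs b h1 h2 h3 h4 => exact absurd hp (Good.ne_nil (.branch f cs b h1 h2 h3 h4))
  | ctx X c h1 h2 h3 => exact absurd (params_subst_one h2 ▸ hp) h3.ne_nil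

/-- A context on top of something without a nonterminal at its root simply stays there. Otherwise it
has to be merged with the piece below, which costs one new piece. -/
lemma Good.add_ctx {b : Bool} {X c : Pat Symb} (hS : Closed T nm S) (hX : X ∈ S)
    (h2 : X.params = [0]) (h : Good T S b c) : ∃ S', S ⊆ S' ∧ Closed T nm S' ∧
      Good T S' false (X.subst [c]) ∧ S'.length ≤ S.length + if b then 0 else 1 := by
  have hX0 := hS.size_pos hX
  cases h with
  | zero _ h3 h4 =>
    have hr : Rhs T nm S (X.subst [c]) _ := .ctx X c _ hX h2 (.zero c h3 h4) hX0 (hS.size_pos h3)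
    exact ⟨_ :: S, by simp, hS.cons hr, .zero _ (by simp) (by rw [params_subst_one h2, h4]), by simp⟩
  | ctx Y c h3 h4 h5 =>
    have hr : Rhs T nm S (X.subst [Y]) _ := .ctx X Y _ hX h2 (.one Y h3 h4) hX0 (hS.size_pos h3)
    refine ⟨_ :: S, by simp, hS.cons hr, ?_, by simp⟩
    rw [← subst_one_subst h2]
    exact .ctx _ c (by simp) (by rw [params_subst_one h2, h4]) (h5.mono (by simp))
  | param i => exact ⟨S, by simp, hS, .ctx X _ hX h2 (.param i), by simp⟩
  | branch f cs b k1 k2 k3 k4 =>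
    exact ⟨S, by simp, hS, .ctx X _ hX h2 (.branch f cs b k1 k2 k3 k4), by simp⟩

/-- A letter with at least two open children is a branching node and costs nothing. With fewer, it
is joined with its closed children and the context on top of its open child, if any, into one new
piece. -/
lemma Good.add_letter {f : Symb} {cs : List (Pat Symb)} (hS : Closed T nm S) (hf : f ∈ T.labels)
    (hr : f.rank = cs.length) (h : ∀ c ∈ cs, ∃ b, Good T S b c) : ∃ S' b, S ⊆ S' ∧ Closed T nm S' ∧
      Good T S' b (node f cs) ∧ S'.length ≤ S.length + (if b then 0 else 1) ∧
      (2 ≤ opens cs → b = true) := by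
  by_cases h2 : 2 ≤ opens cs
  · choose! b hb using h
    exact ⟨S, true, by simp, hS, .branch f cs b hf hr hb h2, by simp, fun _ => rfl⟩
  let P (p : Pat Symb) := ∃ S', S ⊆ S' ∧ Closed T nm S' ∧ Good T S' false p ∧ S'.length ≤ S.length + 1
  suffices hs : P (node f cs) by grind
  have hmem : ∀ c ∈ cs, c.params = [] → c ∈ S := fun c hc h' => by
    obtain ⟨b, hb⟩ := h c hc; exact hb.mem h'
  by_cases h1 : ∃ c ∈ cs, c.params ≠ []
  · obtain ⟨c, hc, h1⟩ := h1; obtain ⟨b, hb⟩ := h c hc; obtain ⟨pre, post, rfl⟩ := append_of_mem hc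
    rw [opens, countP_append, countP_cons_of_pos (by simpa using h1)] at h2
    have hcl : ∀ u ∈ pre ++ post, u.params = [] := by
      have e : opens (pre ++ post) = 0 := by rw [opens, countP_append]; omega
      simpa using countP_eq_zero.1 e
    have hm : ∀ u ∈ pre ++ post, u ∈ S ∧ u.params = [] := fun u hu =>
      ⟨hmem u (by simp at hu ⊢; tauto) (hcl u hu), hcl u hu⟩
    have hsub : ∀ q d, (node f (pre ++ q :: post)).subst [d] = node f (pre ++ q.subst [d] :: post) := by
      intro q d
      rw [subst_node, map_append, map_cons, Sim.map_subst_closed fun u hu => hcl u (by simp [hu]),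
        Sim.map_subst_closed fun u hu => hcl u (by simp [hu])]
    have key : ∀ q s d, Arg nm S q s → q.params = [0] → Good T S true d → P (node f (pre ++ q.subst [d] :: post)) := by
      intro q s d ha hq hd
      refine ⟨_ :: S, by simp, hS.cons (.frame f pre post q s hf (by simp at hr; omega) hm ha), ?_, by simp⟩
      rw [← hsub]; exact .ctx _ d (by simp) (by rw [params_fill hcl, hq]) (hd.mono (by simp))
    have base : Good T S true c → P (node f (pre ++ c :: post)) := fun hc => by
      simpa using key (Pat.param 0) (Pat.param 0) c .param (by simp) hc
    cases hb with
    | zero _ _ h' => exact absurd h' h1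
    | param i => exact base (.param i)
    | branch g ds b k1 k2 k3 k4 => exact base (.branch g ds b k1 k2 k3 k4)
    | ctx X d k1 k2 k3 => exact key X _ d (.one X k1 k2) k2 k3
  · push Not at h1
    have hp : (node f cs).params = [] := by rw [params_node]; exact flatMap_eq_nil_iff.2 h1
    rcases cs with _ | ⟨c, cs⟩
    · exact ⟨_ :: S, by simp, hS.cons (.con f hf hr), .zero _ (by simp) hp, by simp⟩
    · exact ⟨_ :: S, by simp, hS.cons (.frame f [] cs c _ hf (by simpa [add_comm] using hr)
        (fun u hu => ⟨hmem u (by simp at hu; simp [hu]) (h1 u (by simp at hu; simp [hu])),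
          h1 u (by simp at hu; simp [hu])⟩) (.zero c (hmem c (by simp) (h1 c (by simp))) (h1 c (by simp)))),
        .zero _ (by simp) hp, by simp⟩

/-- Whether the pattern is not just a parameter. -/
def isNode (t : Pat Symb) : Bool := decide (0 < t.size)

lemma Good.isNode (h : Good T S false p) (hS : Closed T nm S) : isNode p = true := by
  rw [HandleForm.isNode, decide_eq_true_eq]
  cases h with
  | zero _ h1 h => exact hS.size_pos h1
  | ctx X c h1 h2 => rw [size_subst_one h2]; exact Nat.add_pos_left (hS.size_pos h1) _

/-- The number of patterns, other than parameters, that are substituted. -/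
def cost (us : List (Pat Symb)) (t : Pat Symb) : ℕ :=
  t.params.countP fun i => HandleForm.isNode (us.getD i (param i))

/-- An argument that is not a parameter brings three credits: one if the place now has a nonterminal
on top, two if it becomes closed. A branching node that stops branching has lost at least one open
child; the two credits of that child pay for the new piece and for the change of the flag. If it
becomes closed altogether, at least two children were lost, and the two remaining credits are handed
upwards. -/
lemma Good.subst {us : List (Pat Symb)} {b : Bool} {V : Pat Symb} (h : Good T S b V) :
    ∀ S', S ⊆ S' → Closed T nm S' → (∀ u ∈ us, ∃ b, Good T S' b u) →
      ∃ S'' b', S' ⊆ S'' ∧ Closed T nm S'' ∧ Good T S'' b' (V.subst us) ∧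
        S''.length + (if b = true ∧ b' = false then 1 else 0) + 2 * opens [V] ≤
          S'.length + 3 * cost us V + 2 * opens [V.subst us] := by
  induction h with
  | zero p h1 h2 =>
    intro S' hS hc _
    exact ⟨S', false, by simp, hc, by rw [subst_of_params_nil _ _ h2]; exact .zero p (hS h1) h2,
      by simp [subst_of_params_nil _ _ h2]⟩
  | param i =>
    intro S' _ hc hu
    obtain ⟨b, hb⟩ : ∃ b, Good T S' b (us.getD i (.param i)) := by
      rcases hi : us[i]? with _ | u
      · exact ⟨true, by simpa [hi] using .param i⟩
      · simpa [hi] using hu u (mem_of_getElem? hi)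
    refine ⟨S', b, by simp, hc, by simpa using hb, ?_⟩
    have h2 : b = true → opens [us.getD i (.param i)] = 1 := by
      rintro rfl
      simpa [opens] using hb.ne_nil
    have h3 : opens [(Pat.param i : Pat Symb)] = 1 := rfl; rw [subst_param, h3]
    simp only [cost, params_param, countP_singleton]; generalize us.getD i (.param i) = u at *
    rcases b with _ | _
    · simp [hb.isNode hc]
    · rw [h2 rfl]; simp
  | ctx X c h1 h2 h3 ih =>
    intro S' hS hc hu; obtain ⟨S₁, b₁, k1, k2, k3, k4⟩ := ih S' hS hc hu
    obtain ⟨S₂, j1, j2, j3, j4⟩ := k3.add_ctx k2 (k1 (hS h1)) h2; have e := subst_one_subst h2 c us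
    have e1 : opens [X.subst [c.subst us]] = opens [c.subst us] := by simp [opens, params_subst_one h2]
    have e2 : opens [X.subst [c]] = opens [c] := by simp [opens, params_subst_one h2]
    refine ⟨S₂, false, Subset.trans k1 j1, j2, e ▸ j3, ?_⟩
    rw [e, e1, e2, cost, params_subst_one h2]; rw [cost] at k4
    cases b₁ <;> simp at k4 j4 ⊢ <;> omega
  | branch f cs b hf hr hcs h2 ih =>
    intro S' hS hc hu
    have key : ∀ l, (∀ c ∈ l, c ∈ cs) → ∃ S'', S' ⊆ S'' ∧ Closed T nm S'' ∧
        (∀ c ∈ l.map (Pat.subst us), ∃ b, Good T S'' b c) ∧ S''.length + 2 * opens l ≤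
          S'.length + 3 * (l.map (cost us)).sum + 2 * opens (l.map (Pat.subst us)) := by
      intro l hl
      induction l with
      | nil => exact ⟨S', by simp, hc, by simp, by simp⟩
      | cons c l ihl =>
        obtain ⟨S₁, k1, k2, k3, k4⟩ := ihl fun c h => hl c (by simp [h])
        obtain ⟨S₂, b₂, j1, j2, j3, j4⟩ := ih c (hl c (by simp)) S₁ (Subset.trans hS k1) k2
          fun u h => (hu u h).imp fun _ h => h.mono k1
        refine ⟨S₂, Subset.trans k1 j1, j2, ?_, ?_⟩
        · simp only [map_cons, mem_cons, forall_eq_or_imp]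
          exact ⟨⟨b₂, j3⟩, fun c hc => (k3 c hc).imp fun _ h => h.mono j1⟩
        · simp only [opens, map_cons, sum_cons, countP_cons, countP_nil] at *; omega
    obtain ⟨S₁, k1, k2, k3, k4⟩ := key cs fun _ h => h
    obtain ⟨S₂, b₂, j1, j2, j3, j4, j5⟩ := Good.add_letter k2 hf (by simpa using hr) k3
    have hle : opens (cs.map (Pat.subst us)) ≤ opens cs := by
      rw [opens, countP_map]; refine countP_mono_left fun c _ h => ?_
      simp at h ⊢; exact fun h' => h (by rw [params_subst, h']; rfl)
    have ho : opens (cs.map (Pat.subst us)) = 0 ∨ opens [node f (cs.map (Pat.subst us))] = 1 := by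
      by_cases h0 : 0 < opens (cs.map (Pat.subst us))
      · obtain ⟨c, hc, h⟩ := countP_pos_iff.1 h0; right
        simp only [opens, countP_singleton, params_node, decide_eq_true_eq] at h ⊢; rw [if_pos]
        exact fun h' => h (flatMap_eq_nil_iff.1 h' c hc)
      · left; omega
    have h1 : opens [node f cs] ≤ 1 := countP_le_length
    have hcost : cost us (node f cs) = (cs.map (cost us)).sum := by
      rw [cost, params_node, countP_flatMap]; rfl
    refine ⟨S₂, b₂, Subset.trans k1 j1, j2, by rw [subst_node]; exact j3, ?_⟩
    rw [subst_node, hcost]; grind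

/-! ### Decompositions of the values of a grammar -/

lemma cost_le {v : Symb → Option (Pat Symb)} {a : Symb} {V : Pat Symb} {ts : List (Pat Symb)}
    (hV : V.params.Perm (range a.rank)) (hl : ts.length = a.rank) :
    cost (ts.map (expand v)) V ≤ ts.countP isNode := by
  have e : (range ts.length).map (fun i => (ts.map (expand v)).getD i (param i)) =
      ts.map (expand v) := by
    apply ext_getElem
    · simp
    grind
  rw [cost, hV.countP_eq, ← hl]; have := congrArg (countP isNode) e
  rw [countP_map, countP_map] at this; refine this.le.trans (countP_mono_left fun t _ h => ?_)
  cases t <;> simp_all [isNode]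

/-- Each node receives four credits. At most one pays for its own letter, and three are kept for the
case that the node is an argument of a nonterminal, as demanded by `Good.subst`. -/
lemma exists_good_expand {v : Symb → Option (Pat Symb)}
    (hv : ∀ a p, v a = some p → p.params.Perm (range a.rank)) (t : Pat Symb) (ht : WellRanked t) :
    ∀ S, Closed T nm S → (∀ a ∈ t.labels, v a = none ∧ a ∈ T.labels ∨
      ∃ V b, v a = some V ∧ Good T S b V) → ∃ S' b, S ⊆ S' ∧ Closed T nm S' ∧
        Good T S' b (expand v t) ∧ S'.length + (if isNode t then 3 else 0) ≤ S.length + 4 * t.size := by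
  induction t using induct with
  | hp i => intro S hS _; exact ⟨S, true, by simp, hS, by simpa using .param i, by simp [isNode]⟩
  | hn a ts ih =>
    intro S hS hl; rw [wellRanked_node] at ht; simp only [labels_node, mem_cons, mem_flatMap] at hl
    have key : ∀ l : List (Pat Symb), (∀ t ∈ l, t ∈ ts) → ∃ S', S ⊆ S' ∧ Closed T nm S' ∧
        (∀ c ∈ l.map (expand v), ∃ b, Good T S' b c) ∧
        S'.length + 3 * l.countP isNode ≤ S.length + 4 * (l.map size).sum := by
      intro l hm
      induction l with
      | nil => exact ⟨S, by simp, hS, by simp, by simp⟩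
      | cons t l ihl =>
        obtain ⟨S₁, k1, k2, k3, k4⟩ := ihl fun c h => hm c (by simp [h])
        have htt := hm t (by simp)
        obtain ⟨S₂, b₂, j1, j2, j3, j4⟩ := ih t htt (ht.2 t htt) S₁ k2 fun a ha =>
          (hl a (.inr ⟨t, htt, ha⟩)).imp_right fun ⟨V, b, h1, h2⟩ => ⟨V, b, h1, h2.mono k1⟩
        refine ⟨S₂, Subset.trans k1 j1, j2, ?_, ?_⟩
        · simp only [map_cons, mem_cons, forall_eq_or_imp]
          exact ⟨⟨b₂, j3⟩, fun c hc => (k3 c hc).imp fun _ h => h.mono j1⟩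
        grind
    obtain ⟨S₁, k1, k2, k3, k4⟩ := key ts fun _ h => h
    have e3 : (if isNode (node a ts) = true then 3 else 0) = 3 := by simp [isNode]
    rw [e3, size_node]; rcases hl a (.inl rfl) with ⟨h1, h2⟩ | ⟨V, b, h1, h2⟩
    · obtain ⟨S₂, b₂, j1, j2, j3, j4, -⟩ := Good.add_letter k2 h2 (by simp [ht.1]) k3
      refine ⟨S₂, b₂, Subset.trans k1 j1, j2, expand_node_none h1 ts ▸ j3, ?_⟩
      split_ifs at j4 <;> omega
    · obtain ⟨S₂, b₂, j1, j2, j3, j4⟩ := h2.subst S₁ k1 k2 k3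
      have := cost_le (v := v) (hv a V h1) ht.1
      have ho : opens [V.subst (ts.map (expand v))] ≤ opens [V] := by
        simp only [opens, countP_singleton, decide_eq_true_eq]
        by_cases h : V.params = []
        · simp [params_subst, h]
        · rw [if_pos h]; split_ifs <;> simp
      exact ⟨S₂, b₂, Subset.trans k1 j1, j2, expand_node_some h1 ts ▸ j3, by omega⟩

/-- The reachable productions are processed in increasing order, reusing all earlier pieces. The
tree itself is a piece because it contains no parameters. -/
lemma exists_closed {G : Grammar} (h : G.IsSLCF) (hT : G.Generates T) :
    ∃ S, Closed T nm S ∧ T ∈ S ∧ S.length ≤ 4 * G.size := by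
  classical
  obtain ⟨v, hv⟩ := h.exists_val; have hs := hT.val_start h hv
  obtain ⟨o, -, ho, -⟩ := h.straight_line
  let all := G.prods.toFinset.filter fun p => G.Reach p.1
  have hall : ∀ p, p ∈ all ↔ p ∈ G.prods ∧ G.Reach p.1 := fun p => by simp [all]
  -- Restricting to downward closed sets ensures that all nonterminals in the next right-hand side
  -- already have a decomposition.
  have key : ∀ s : Finset (Symb × Pat Symb), s ⊆ all →
      (∀ p ∈ s, ∀ q ∈ all, o q.1 < o p.1 → q ∈ s) → ∃ S, Closed T nm S ∧
        (∀ p ∈ s, ∃ b V, v p.1 = some V ∧ Good T S b V) ∧ S.length ≤ 4 * ∑ p ∈ s, p.2.size := by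
    intro s
    induction s using Finset.induction_on_max_value (fun p : Symb × Pat Symb => o p.1) with
    | empty => intro _ _; exact ⟨[], by simp [Closed], by simp, by simp⟩
    | insert p s hp hmax ih =>
      intro hsub hdown
      obtain ⟨S, k1, k2, k3⟩ := ih (fun q hq => hsub (Finset.mem_insert_of_mem hq)) fun q hq q' hq' hlt => by
        grind
      obtain ⟨hp1, hp2⟩ := (hall p).1 (hsub (Finset.mem_insert_self _ _))
      obtain ⟨S', b, j1, j2, j3, j4⟩ := exists_good_expand hv.perm p.2 (h.wellRanked p hp1) S k1 (by
        intro a ha; have hr : G.Reach a := hp2.tail ⟨p.2, hp1, ha⟩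
        by_cases hn : a ∈ G.nonterminals
        · obtain ⟨q, hq, rfl⟩ := mem_map.1 hn; grind
        · have hn := (hv.none_iff a).2 hn; have := hr.symLabels_sublist h hv hs
          simp [symLabels, hn] at this; exact .inl ⟨hn, this⟩)
      refine ⟨S', j2, ?_, ?_⟩
      · simp only [Finset.mem_insert, forall_eq_or_imp]
        exact ⟨⟨b, _, hv.eq p hp1, j3⟩, fun q hq => by
          obtain ⟨b, V, h1, h2⟩ := k2 q hq; exact ⟨b, V, h1, h2.mono j1⟩⟩
      grind
  obtain ⟨S, k1, k2, k3⟩ := key all (fun _ h => h) fun _ _ q hq _ => hq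
  obtain ⟨q, hq, hq'⟩ := mem_map.1 h.start_mem
  obtain ⟨b, V, h1, h2⟩ := k2 q ((hall q).2 ⟨hq, hq' ▸ .refl⟩); rw [hq', hs] at h1
  obtain rfl := Option.some.inj h1
  refine ⟨S, k1, h2.mem hT.1.2, k3.trans (Nat.mul_le_mul_left _ ?_)⟩
  rw [Grammar.size, ← sum_toFinset _ (Nodup.of_map _ h.unique_prod)]
  exact Finset.sum_le_sum_of_subset (Finset.filter_subset _ _)

/-! ### The handle grammar -/

/-- Nonterminals are named by their values, so every pattern needs its own number. -/
lemma exists_injective : ∃ e : Pat Symb → ℕ, Function.Injective e := by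
  refine ⟨fold (fun i => 2 * i) fun a ns => 2 * Encodable.encode ((a.rank, a.id), ns) + 1, fun t => ?_⟩
  induction t using induct with
  | hp i =>
    rintro (j | ⟨b, ss⟩) h
    · rw [fold_param, fold_param] at h; rw [show i = j by omega]
    · rw [fold_param, fold_node] at h; omega
  | hn a ts ih =>
    rintro (j | ⟨b, ss⟩) h
    · rw [fold_param, fold_node] at h; omega
    · rw [fold_node, fold_node] at h
      replace h := Encodable.encode_injective (Nat.eq_of_mul_eq_mul_left two_pos (Nat.succ.inj h))
      simp at h; obtain ⟨⟨h1, h2⟩, h3⟩ := h; have e : a = b := by cases a; cases b; simp_all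
      rw [e, node.injEq]; refine ⟨rfl, ?_⟩; clear h1 h2 e
      induction ts generalizing ss with
      | nil =>
        cases ss
        · rfl
        · simp at h3
      | cons t ts iht =>
        rcases ss with _ | ⟨s, ss⟩
        · simp at h3
        · simp at h3; rw [ih t (by simp) h3.1, iht (fun t ht => ih t (by simp [ht])) ss h3.2]

variable {q s : Pat Symb}

lemma map_nm {v : Symb → Option (Pat Symb)} {l : List (Pat Symb)} (hl : ∀ u ∈ l, u.params = [])
    (h : ∀ u ∈ l, v (nm u) = some u) : (l.map fun u => node (nm u) []).map (expand v) = l := by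
  rw [map_map, map_congr_left (g := id), map_id]; intro u hu
  rw [Function.comp, expand_node_some (h u hu), subst_of_params_nil _ _ (hl u hu), id]

lemma Arg.expand_eq {v : Symb → Option (Pat Symb)} (h : Arg nm S q s)
    (hv : ∀ u ∈ S, u.size ≤ q.size → v (nm u) = some u) : expand v s = q := by
  cases h with
  | param => simp
  | zero _ h1 h2 => rw [expand_node_some (hv q h1 le_rfl), subst_of_params_nil _ _ h2]
  | one _ h1 h2 => rw [expand_node_some (hv q h1 le_rfl)]; simpa using subst_eq_self q (by simp [h2])

lemma Rhs.expand_eq {v : Symb → Option (Pat Symb)} (h : Rhs T nm S p t) (h0 : ∀ a ∈ T.labels, v a = none)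
    (hv : ∀ u ∈ S, u.size < p.size → v (nm u) = some u) : expand v t = p := by
  cases h with
  | con f h1 h2 => rw [expand_node_none (h0 f h1)]; rfl
  | frame f pre post q s h1 h2 h3 h4 =>
    have hm : ∀ u ∈ pre ++ post, u.params = [] ∧ v (nm u) = some u := fun u hu =>
      ⟨(h3 u hu).2, hv u (h3 u hu).1 (size_lt_of_mem (by simp at hu ⊢; tauto))⟩
    rw [expand_node_none (h0 f h1), map_append, map_cons,
      map_nm (fun u hu => (hm u (by simp [hu])).1) fun u hu => (hm u (by simp [hu])).2,
      map_nm (fun u hu => (hm u (by simp [hu])).1) fun u hu => (hm u (by simp [hu])).2,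
      h4.expand_eq fun u hu h => hv u hu (h.trans_lt (size_lt_of_mem (by simp)))]
  | ctx X q s h1 h2 h3 h4 h5 =>
    rw [size_subst_one h2] at hv
    rw [expand_node_some (hv X h1 (by omega)), map_cons, map_nil,
      h3.expand_eq fun u hu h => hv u hu (by omega)]

lemma Rhs.exists_of_mem (h : Rhs T nm S p t) {B : Symb} (hB : B ∈ t.labels) :
    B ∈ T.labels ∨ ∃ u ∈ S, B = nm u ∧ u.size < p.size := by
  have ha : ∀ {q s}, Arg nm S q s → B ∈ s.labels → ∃ u ∈ S, B = nm u ∧ u.size ≤ q.size := by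
    intro q s h hB
    cases h with
    | param => simp at hB
    | zero _ h1 h2 => exact ⟨q, h1, by simpa using hB, le_rfl⟩
    | one _ h1 h2 => exact ⟨q, h1, by simpa using hB, le_rfl⟩
  cases h with
  | con f h1 h2 => exact .inl (by simp at hB; exact hB ▸ h1)
  | frame f pre post q s h1 h2 h3 h4 =>
    simp only [labels_node, flatMap_append, flatMap_cons, flatMap_map, mem_cons,
      mem_append, flatMap_nil, mem_flatMap, not_mem_nil, or_false] at hB
    rcases hB with rfl | ⟨u, hu, rfl⟩ | hB | ⟨u, hu, rfl⟩
    · exact .inl h1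
    · exact .inr ⟨u, (h3 u (by simp [hu])).1, rfl, size_lt_of_mem (by simp [hu])⟩
    · obtain ⟨u, k1, k2, k3⟩ := ha h4 hB
      exact .inr ⟨u, k1, k2, k3.trans_lt (size_lt_of_mem (by simp))⟩
    · exact .inr ⟨u, (h3 u (by simp [hu])).1, rfl, size_lt_of_mem (by simp [hu])⟩
  | ctx X q s h1 h2 h3 h4 h5 =>
    rw [size_subst_one h2]
    simp only [labels_node, flatMap_cons, flatMap_nil, append_nil, mem_cons] at hB
    rcases hB with rfl | hB
    · exact .inr ⟨X, h1, rfl, by omega⟩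
    · obtain ⟨u, k1, k2, k3⟩ := ha h3 hB; exact .inr ⟨u, k1, k2, by omega⟩

lemma Rhs.wellRanked (h : Rhs T nm S p t) (hr : ∀ u, (nm u).rank = u.params.length) :
    WellRanked t ∧ t.params = p.params ∧ (p.params = [] ∨ p.params = [0]) := by
  have ha : ∀ {q s}, Arg nm S q s →
      WellRanked s ∧ s.params = q.params ∧ (q.params = [] ∨ q.params = [0]) := by
    intro q s h
    cases h with
    | param => exact ⟨.param 0, rfl, .inr rfl⟩
    | zero _ h1 h2 => exact ⟨.node _ _ (by simp [hr, h2]) (by simp), by simp [h2], .inl h2⟩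
    | one _ h1 h2 => exact ⟨.node _ _ (by simp [hr, h2]) (by simpa using .param 0), by simp [h2], .inr h2⟩
  cases h with
  | con f h1 h2 => exact ⟨.node _ _ (by simp [h2]) (by simp), rfl, .inl (by simp)⟩
  | frame f pre post q s h1 h2 h3 h4 =>
    obtain ⟨k1, k2, k3⟩ := ha h4; rw [params_fill fun u hu => (h3 u hu).2, params_fill, k2]
    · refine ⟨.node _ _ (by simp [h2]; omega) fun t ht => ?_, rfl, k3⟩
      have hw : ∀ u ∈ pre ++ post, WellRanked (node (nm u) []) := fun u hu =>
        .node _ _ (by simp [hr, (h3 u hu).2]) (by simp)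
      simp only [mem_append, mem_map, mem_cons] at ht hw
      rcases ht with ⟨u, hu, rfl⟩ | rfl | ⟨u, hu, rfl⟩
      · exact hw u (.inl hu)
      · exact k1
      · exact hw u (.inr hu)
    · intro u hu; rw [← map_append] at hu; obtain ⟨w, -, rfl⟩ := mem_map.1 hu
      simp
  | ctx X q s h1 h2 h3 h4 h5 =>
    obtain ⟨k1, k2, k3⟩ := ha h3; rw [params_subst_one h2]
    exact ⟨.node _ _ (by simp [hr, h2]) (by simpa using k1), by simp [k2], k3⟩

variable {H : Grammar}

lemma Rhs.isHandle (h : Rhs T nm S p t) (hr : ∀ u, (nm u).rank = u.params.length)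
    (hH : H.nonterminals = S.map nm) (hT : ∀ a ∈ T.labels, a ∉ H.nonterminals) :
    ((nm p).rank = 0 ∧ H.IsHandleRhs0 t) ∨ ((nm p).rank = 1 ∧ H.IsHandleRhs1 t) := by
  have hm : ∀ u ∈ S, nm u ∈ H.nonterminals := fun u hu => hH ▸ mem_map_of_mem hu
  cases h with
  | con f h1 h2 => exact .inl ⟨by simp [hr], .nil _ (.inl ⟨f, h2, rfl⟩)⟩
  | frame f pre post q s h1 h2 h3 h4 =>
    rw [hr, params_fill fun u hu => (h3 u hu).2]
    have htw : ∀ l : List (Pat Symb), (∀ u ∈ l, u ∈ pre ++ post) →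
        ∀ t ∈ l.map (fun u => node (nm u) []), H.IsTwig t := by
      intro l hl t ht; obtain ⟨u, hu, rfl⟩ := mem_map.1 ht
      exact .last _ (by simp [hr, (h3 u (hl u hu)).2])
    have cons : ∀ {P : Pat Symb → Prop}, P s → H.HandlesThen P (node f
        (pre.map (fun u => node (nm u) []) ++ s :: post.map fun u => node (nm u) [])) := fun hP =>
      .cons f _ _ s (hT f h1) (by simpa using h2) (htw pre (by simp +contextual))
        (htw post (by simp +contextual)) (.nil s hP)
    cases h4 with
    | param => exact .inr ⟨by simp, cons (.inl rfl)⟩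
    | zero _ k1 k2 => exact .inl ⟨by simp [k2], cons (.inl ⟨_, by simp [hr, k2], rfl⟩)⟩
    | one _ k1 k2 =>
      exact .inr ⟨by simp [k2], cons (.inr ⟨_, hm q k1, by simp [hr, k2], _, rfl, .nil _ (.inl rfl)⟩)⟩
  | ctx X q s h1 h2 h3 h4 h5 =>
    rw [hr, params_subst_one h2]; have hX : (nm X).rank = 1 := by simp [hr, h2]
    cases h3 with
    | param => exact .inr ⟨by simp, .nil _ (.inr ⟨_, hm X h1, hX, _, rfl, .nil _ (.inl rfl)⟩)⟩
    | zero _ k1 k2 => exact .inl ⟨by simp [k2],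
        .nil _ (.inr ⟨_, hm X h1, hX, _, rfl, .nil _ ⟨_, by simp [hr, k2], rfl⟩⟩)⟩
    | one _ k1 k2 => exact .inr ⟨by simp [k2], .nil _ (.inr ⟨_, hm X h1, hX, _, rfl,
        .nil _ (.inr ⟨_, hm q k1, by simp [hr, k2], _, rfl, .nil _ rfl⟩)⟩)⟩

/-- A handle has a letter of rank at most `r`, its other children are single nonterminals of rank 0,
and below the hole there is at most one more node. Rank 1 can occur only in that node or, for a
concatenation, in its two parts. -/
lemma Rhs.size_le (h : Rhs T nm S p t) (hr : ∀ u, (nm u).rank = u.params.length)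
    (hT1 : 1 ≤ T.maxRank) : t.size ≤ 2 * T.maxRank ∧
      ∀ N : Symb → Prop, [DecidablePred N] → (∀ a ∈ T.labels, ¬ N a) →
        t.labels.countP (fun B => decide (N B ∧ B.rank = 1)) ≤ 2 := by
  have ha : ∀ {q s}, Arg nm S q s → s.size ≤ 1 := by
    intro q s h
    cases h <;> simp
  have hle : ∀ {q s}, Arg nm S q s → ∀ P : Symb → Bool, s.labels.countP P ≤ 1 := fun h P =>
    countP_le_length.trans (by rw [← size_eq_length_labels]; exact ha h)
  cases h with
  | con f h1 h2 =>
    refine ⟨by simp; omega, fun N _ hN => ?_⟩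
    simp [hN f h1]
  | frame f pre post q s h1 h2 h3 h4 =>
    have := ha h4; have hf := Sim.rank_le_maxRank h1; refine ⟨?_, fun N _ hN => ?_⟩
    · simp [Function.comp_def]; omega
    · have hz : ∀ l : List (Pat Symb), (∀ u ∈ l, u ∈ pre ++ post) →
          ((l.map fun u => node (nm u) []).flatMap labels).countP
            (fun B => decide (N B ∧ B.rank = 1)) = 0 := by
        intro l hl; rw [countP_eq_zero]; intro B hB
        simp only [flatMap_map, labels_node, flatMap_nil, mem_flatMap, mem_singleton] at hB
        obtain ⟨u, hu, rfl⟩ := hB; simp [hr, (h3 u (hl u hu)).2]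
      rw [labels_node, flatMap_append, flatMap_cons, countP_cons, countP_append,
        countP_append, hz pre (by simp +contextual), hz post (by simp +contextual)]
      have := hle h4 fun B => decide (N B ∧ B.rank = 1)
      split_ifs <;> omega
  | ctx X q s h1 h2 h3 h4 h5 =>
    have := ha h3; refine ⟨by simp; omega, fun N _ hN => countP_le_length.trans ?_⟩
    rw [← size_eq_length_labels]; simp; omega

end HandleForm

-- Existence of handle normal forms

open HandleForm

/-- Every piece of the tree becomes a nonterminal that derives it. There are at most `4 g` of them,
with right-hand sides of size at most `2 r` and at most two nonterminals of rank 1, hence the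
constant 8. -/
lemma exists_handleNormalForm : ∃ K : ℕ, ∀ (T : Pat Symb) (G : Grammar), 2 ≤ T.size →
    G.IsSmallest T → ∃ H : Grammar, Grammar.IsHandleNormalForm K T G H := by
  classical
  refine ⟨8, fun T G hn ⟨hG, hGT, _⟩ => ?_⟩
  have hT := hGT.1; obtain ⟨e, he⟩ := exists_injective
  -- The offset keeps the ids of nonterminals above those of all letters of the tree.
  let nm : Pat Symb → Symb := fun p => ⟨p.params.length, (T.labels.map Symb.id).sum + 1 + e p⟩
  have hr : ∀ u, (nm u).rank = u.params.length := fun u => rfl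
  have hnm : nm.Injective := fun p q h => he (Nat.add_left_cancel (congrArg Symb.id h))
  have hT' : ∀ p, nm p ∉ T.labels := fun p h => by
    have := le_sum_of_mem (mem_map_of_mem (f := Symb.id) h); simp only [nm] at this; omega
  obtain ⟨S₀, c₀, t₀, l₀⟩ := exists_closed (nm := nm) hG hGT
  -- The start nonterminal has to be the largest one, so only pieces smaller than the tree are kept
  -- besides the tree itself.
  let S := (S₀.filter fun p => decide (p = T ∨ p.size < T.size)).dedup
  have hS : ∀ p, p ∈ S ↔ p ∈ S₀ ∧ (p = T ∨ p.size < T.size) := fun p => by simp [S]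
  have hSl : S.length ≤ 4 * G.size := ((dedup_sublist _).trans filter_sublist).length_le.trans l₀
  have hTS : T ∈ S := (hS T).2 ⟨t₀, .inl rfl⟩
  have hmax : ∀ p ∈ S, p.size ≤ T.size := fun p hp => by
    rcases ((hS p).1 hp).2 with rfl | h
    · exact le_rfl
    · exact h.le
  have hex : ∀ p, ∃ t, p ∈ S → Rhs T nm S p t := fun p => by
    by_cases hp : p ∈ S
    · obtain ⟨t, ht⟩ := c₀ p ((hS p).1 hp).1
      exact ⟨t, fun _ => ht.mono fun q hq h => (hS q).2 ⟨hq, .inr (h.trans_le (hmax p hp))⟩⟩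
    · exact ⟨p, fun h => absurd h hp⟩
  choose rhs hrhs using hex
  let H : Grammar := ⟨S.map fun p => (nm p, rhs p), nm T⟩
  have hN : H.nonterminals = S.map nm := by simp [H, Grammar.nonterminals]
  have hprod : ∀ {P : Symb × Pat Symb → Prop}, (∀ p ∈ S, P (nm p, rhs p)) → ∀ x ∈ H.prods, P x := by
    intro P h x hx; obtain ⟨p, hp, rfl⟩ := mem_map.1 hx; exact h p hp
  have hNT : ∀ a ∈ T.labels, a ∉ H.nonterminals := fun a ha h => by
    rw [hN] at h; obtain ⟨p, -, rfl⟩ := mem_map.1 h; exact hT' p ha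
  have hnt : ∀ {P : Symb → Prop}, (∀ p ∈ S, P (nm p)) → ∀ A ∈ H.nonterminals, P A := by
    intro P h A hA; rw [hN] at hA; obtain ⟨p, hp, rfl⟩ := mem_map.1 hA; exact h p hp
  -- the order of the nonterminals
  let M := (S.map fun p => (nm p).id).sum + 1
  have hM : ∀ p ∈ S, (nm p).id < M := fun p hp =>
    Nat.lt_succ_of_le (le_sum_of_mem (mem_map_of_mem (f := fun p => (nm p).id) hp))
  have : Nonempty (Pat Symb) := ⟨T⟩
  let sz : Symb → ℕ := fun A => (Function.invFun nm A).size
  have hsz : ∀ p, sz (nm p) = p.size := fun p => congrArg size (Function.leftInverse_invFun hnm p)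
  -- The order is by size of the value. Ids below `M` break ties, which makes it injective on the
  -- nonterminals.
  let ord : Symb → ℕ := fun A => sz A * M + A.id
  have hord : ∀ p q, p ∈ S → p.size < q.size → ord (nm p) < ord (nm q) := by
    intro p q hp h; have h1 := Nat.mul_le_mul_right M (show p.size + 1 ≤ q.size from h)
    have h2 := hM p hp; simp only [ord, hsz]; rw [Nat.add_mul, one_mul] at h1; omega
  have hinj : ∀ p q, p ∈ S → q ∈ S → ord (nm p) = ord (nm q) → p = q := by
    intro p q hp hq h; rcases lt_trichotomy p.size q.size with h1 | h1 | h1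
    · exact absurd h (hord p q hp h1).ne
    · simp only [ord, hsz, h1] at h; exact he (Nat.add_left_cancel (Nat.add_left_cancel h))
    · exact absurd h (hord q p hq h1).ne'
  have hH : H.IsSLCF := by
    refine ⟨?_, ?_, ?_, hprod fun p hp => ((hrhs p hp).wellRanked hr).1, hprod fun p hp => ?_,
      ord, ?_, hprod fun p hp B hB hBt => ?_, hnt fun p hp h => ?_⟩
    · rw [hN]; exact (nodup_dedup _).map hnm
    · rw [hN]; exact mem_map_of_mem hTS
    · simp [H, nm, hT.2]
    · obtain ⟨-, h1, h2⟩ := (hrhs p hp).wellRanked hr; rw [h1, hr]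
      rcases h2 with h2 | h2 <;> rw [h2] <;> simp
    · intro A hA B hB h; simp only [Set.mem_ofPred_eq, hN, mem_map] at hA hB
      obtain ⟨p, hp, rfl⟩ := hA; obtain ⟨q, hq, rfl⟩ := hB; rw [hinj p q hp hq h]
    · rcases (hrhs p hp).exists_of_mem hBt with h | ⟨u, hu, rfl, h⟩
      · exact absurd hB (hNT B h)
      · exact hord u p hu h
    · rcases ((hS p).1 hp).2 with rfl | h'
      · exact absurd rfl h
      · exact hord p T hp h'
  obtain ⟨v, hv⟩ := hH.exists_val
  have hval : ∀ k, ∀ p ∈ S, p.size < k → v (nm p) = some p := by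
    intro k
    induction k with intro p hp hk
    | zero => omega
    | succ k ih =>
      rw [hv.eq (nm p, rhs p) (mem_map_of_mem hp), (hrhs p hp).expand_eq
        (fun a ha => (hv.none_iff a).2 (hNT a ha)) fun u hu h => ih u hu (by omega)]
  have hsum : ∀ (f : Symb × Pat Symb → ℕ) (c : ℕ), (∀ p ∈ S, f (nm p, rhs p) ≤ c) →
      (H.prods.map f).sum ≤ 4 * G.size * c := by
    intro f c h
    refine (sum_le_card_nsmul _ c ?_).trans (by simpa [H] using Nat.mul_le_mul_right c hSl)
    simpa [H] using h
  have hmr := one_le_maxRank hT hn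
  have hcount : ∀ p ∈ S, (rhs p).size ≤ 2 * T.maxRank := fun p hp => ((hrhs p hp).size_le hr hmr).1
  refine ⟨H, hH, hprod fun p hp => (hrhs p hp).isHandle hr hN hNT,
    hH.generates_of_val hv hT hNT (hval _ T hTS (Nat.lt_succ_self _)), (hsum _ _ hcount).trans_eq (by ring),
    (hsum _ 2 fun p hp => ((hrhs p hp).size_le hr hmr).2 _ hNT).trans_eq (by ring),
    (hsum _ (2 * T.maxRank) fun p hp => countP_le_length.trans ?_).trans_eq (by ring)⟩
  rw [← size_eq_length_labels]; exact hcount p hp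

end TreeGrammar

theorem mainTheorem2 :
    -- a smallest grammar has a handle normal form, with a universal constant
    (∃ K : ℕ, ∀ (T : Pat Symb) (G : Grammar), 2 ≤ T.size → G.IsSmallest T →
      ∃ H : Grammar, Grammar.IsHandleNormalForm K T G H) ∧
    -- on every input tree the algorithm returns a grammar
    (∀ T : Pat Symb, T.IsTree → 2 ≤ T.size → ∃ R : Grammar, TtoG.Produces T R) ∧
    -- the bounds on its size, in terms of any handle normal form of any smallest grammar
    (∀ K : ℕ, ∃ C : ℝ, 0 < C ∧ ∀ (T : Pat Symb) (G H : Grammar), 2 ≤ T.size → G.IsSmallest T →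
      Grammar.IsHandleNormalForm K T G H →
      ∀ n r g n₀ n₁ : ℝ, n = T.size → r = T.maxRank → g = G.size →
        n₀ = H.ntOcc 0 → n₁ = H.ntOcc 1 →
        (∀ R : Grammar, TtoG.Produces T R →
          (R.size : ℝ) ≤ C * (g * r + (n₀ + n₁ * r) * Real.log n)) ∧
        g * r + (n₀ + n₁ * r) * Real.log n ≤ C * (g * r + g * r * Real.log n)) := by
  refine ⟨exists_handleNormalForm, fun T hT _ => TtoG.exists_produces T hT, fun K =>
    ⟨10 * K + 2220, by positivity, ?_⟩⟩
  rintro T G H hn - hH _ _ _ _ _ rfl rfl rfl rfl rfl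
  exact size_bounds K hn hH
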